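/- **Setting.** Fix a slope angle $\gamma\in(0,\pi/2)$, $\gamma\neq\pi/4$, a function $\chi\in C_c^\infty(\mathbb R)$, numbers $\nu_0,\kappa_0>0$, $c>0$, $\beta>0$, and one of the five regimes - Case 1: $\nu=\nu_0\varepsilon^6$, $\kappa=\kappa_0\varepsilon^\beta$, $0<\beta<6$; - Case 2: $\nu=\nu_0\varepsilon^6$, $\kappa=\kappa_0\varepsilon^\beta$, $\beta>6$; - Case 3: $\nu=\nu_0\varepsilon^\beta$, $\kappa=\kappa_0\varepsilon^6$, $0<\beta<6$; - Case 4: $\nu=\nu_0\varepsilon^\beta$, $\kappa=\kappa_0\varepsilon^6$, $\beta>6$; - Case 5: $\nu=\nu_0\varepsilon^\beta$, $\kappa=\kappa_0\varepsilon^\beta$, $\beta>6$. Consider, in $\mathbb R^2_+=\{y>0\}$, the system $$\partial_t u-b\sin\gamma+\partial_xp=\nu\Delta u,\quad \partial_t w-b\cos\gamma+\partial_yp=\nu\Delta w,\quad \partial_t b+u\sin\gamma+w\cos\gamma=\kappa\Delta b,\quad \partial_xu+\partial_yw=0\qquad (S)$$ with boundary conditions $u=w=\partial_yb=0$ at $y=0$.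 For $(k,m)\in\mathbb R^2$ let $\omega=\omega_{k,m}$ be the branch of $\pm\frac{k\cos\gamma-m\sin\gamma}{\sqrt{k^2+m^2}}$ whose derivative in $m$ is negative, let $\zeta=\omega_{k,m}^2-\sin^2\gamma$, and let $$\widehat A(k,m)=\varepsilon^{-2}\sum_\pm\chi(\varepsilon^{-2}(k\pm k_0))\,\chi(\varepsilon^{-2}(m\pm m_0)).$$ The incident packet is $$\mathcal W_{\rm inc}=\int_{\mathbb R^2}\widehat A\,X_{k,m}\,e^{-i\omega t+ikx+imy}\,dk\,dm,\qquad X_{k,m}=\Big(1,\,-\tfrac km,\,\tfrac{i(k\cos\gamma-m\sin\gamma)}{m\omega}\Big),$$ with pressure amplitude $\frac1k\big[\omega+\sin\gamma\,\frac{k\cos\gamma-m\sin\gamma}{m\omega}\big]$. It is assumed near-critical: $c\le|k_0|\le c^{-1}$, $|m_0|\le c^{-1}$, and $|\zeta|\le c^{-1}\varepsilon^2$ wherever $\widehat A\ne0$; in Case 5 also $|\zeta|\ge c\,\varepsilon^2$ there. For $\lambda\in\mathbb C$ put $$X_\lambda=\Big(1,\ \tfrac{ik}{\lambda},\ B_\lambda\Big),\qquad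 B_\lambda=\frac{\sin\gamma+ik\lambda^{-1}\cos\gamma}{i\omega-\kappa(k^2-\lambda^2)},\qquad P_\lambda=\tfrac1{ik}\big[i\omega+\nu(\lambda^2-k^2)+\sin\gamma\,B_\lambda\big],$$ $$\begin{aligned}\mathcal P(\lambda)={}&-\kappa\nu\lambda^6-(i\omega(\kappa+\nu)-3\nu\kappa k^2)\lambda^4+(\zeta+2i\omega(\kappa+\nu)k^2-3\nu\kappa k^4)\lambda^2\\&-2i\lambda k\sin\gamma\cos\gamma+k^2(\cos^2\gamma-\omega^2-i\omega(\kappa+\nu)k^2+\nu\kappa k^4).\end{aligned}$$ **Proposition.** There are $C,\varepsilon_0>0$, depending only on the data fixed above ($\gamma,\chi,\nu_0,\kappa_0,\beta,c$ and the regime), such that for all $0<\varepsilon<\varepsilon_0$ and all such $k_0,m_0$ there are $\lambda_j=\lambda_j(k,m)$, $a_j=a_j(k,m)$, $j=2,3,5$, for which the following holds. Wherever $\widehat A\neq0$, $\operatorname{Re}\lambda_j>0$, $\mathcal P(\lambda_j)=0$, and $(X_{\lambda_j},P_{\lambda_j})$ is in the kernel of the $4\times4$ matrix obtained by inserting $(U,W,B,P)e^{-i\omega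 t+ikx-\lambda_j y}$ in $(S)$. The integrals in $$\mathcal W_{\rm BL}=\sum_{j\in\{2,3,5\}}\int_{\mathbb R^2}\widehat A\,a_jX_{\lambda_j}e^{-i\omega t+ikx-\lambda_jy}\,dk\,dm$$ (and in the corresponding pressure) converge absolutely for $y\ge0$. Set $\mathcal W^{\rm app}=\mathcal W_{\rm inc}+\mathcal W_{\rm BL}$, with the pressures added. 1. *Decay rates and amplitudes.* Where $\widehat A\ne0$, $|a_j|\le C\varepsilon^{\alpha_j}$, and both $|\lambda_j|$ and $\operatorname{Re}\lambda_j$ lie between $C^{-1}$ and $C$ times the indicated power of $\varepsilon$ (the same power for both, except for $\lambda_2$ in Case 5): - Case 1: $\lambda_2,\lambda_3$: $\varepsilon^{-\beta/3}$; $\lambda_5$: $\varepsilon^{-3}$; $\alpha_2=\alpha_3=-\beta/3$; $\alpha_5=\beta/3-3$ if $\beta>9/2$, $\alpha_5=-\beta/3$ if $\beta\le9/2$. - Case 2: $\lambda_2,\lambda_3$: $\varepsilon^{-2}$; $\lambda_5$: $\varepsilon^{-\beta/2}$; $\alpha_2=\alpha_3=-2$; $\alpha_5=3\beta/2-10$.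 - Case 3: $\lambda_2,\lambda_3$: $\varepsilon^{-\beta/3}$; $\lambda_5$: $\varepsilon^{-3}$; $\alpha_2=\alpha_3=-\beta/3$; $\alpha_5=9-5\beta/3$. - Case 4: $\lambda_2,\lambda_3$: $\varepsilon^{-2}$; $\lambda_5$: $\varepsilon^{-\beta/2}$; $\alpha_2=\alpha_3=-2$; $\alpha_5=2-\beta/2$ if $\beta<8$, $\alpha_5=-2$ if $\beta\ge8$. - Case 5: $|\lambda_2|$: $\varepsilon^{-2}$ and $\operatorname{Re}\lambda_2$: $\varepsilon^{\beta-8}$; $\lambda_3$: $\varepsilon^{1-\beta/2}$; $\lambda_5$: $\varepsilon^{-\beta/2}$; $\alpha_2=\alpha_3=-2$; $\alpha_5=-1$. 2. *Amplitude system.* Where $\widehat A\ne0$, the $3\times3$ matrix $M$ with columns $(1,\,ik/\lambda_j,\,-\lambda_jB_{\lambda_j})^T$, $j=2,3,5$, is invertible, and $M(a_2,a_3,a_5)^T=-(1,\,-\tfrac km,\,im\,\widehat b_{\rm inc})^T$, where $\widehat b_{\rm inc}$ is the third component of $X_{k,m}$. 3. *(a)* $\mathcal W_{\rm BL}$ is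 an exact classical solution of $(S)$ in $\{y\ge0\}$, and at $y=0$: $u_{\rm BL}=-u_{\rm inc}$, $w_{\rm BL}=-w_{\rm inc}$, $\partial_yb_{\rm BL}=-\partial_yb_{\rm inc}$. Hence $\mathcal W^{\rm app}$ satisfies exactly $u=w=\partial_yb=0$ at $y=0$. 4. *(b)* $\mathcal W^{\rm app}$ is consistent: it solves $(S)$ with source terms $R_u,R_w,R_b$ added to the right-hand sides of the first three equations, where, for every time $t$, $\|R_u\|_{L^2(\mathbb R^2_+)}\le C\nu$, $\|R_w\|_{L^2(\mathbb R^2_+)}\le C\nu$, $\|R_b\|_{L^2(\mathbb R^2_+)}\le C\kappa$. Consequently $R=(R_u,R_w,R_b)$ satisfies $\|R\|_{L^2}\le\|R_u\|_{L^2}+\|R_w\|_{L^2}+\|R_b\|_{L^2}\le C(\nu+\kappa)$, and $\|R\|_{L^2}\le C\varepsilon^{\beta}$ in Cases 1, 3, 5 and $\|R\|_{L^2}\le C\varepsilon^{6}$ in Cases 2, 4. -/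

import Mathlib

open MeasureTheory Complex

noncomputable section

namespace Boussinesq

/-! Scalar functions of `(t, x, y)` and their partial derivatives. -/

/-- Partial derivative in time. -/
def dt (f : ℝ → ℝ → ℝ → ℂ) (t x y : ℝ) : ℂ := deriv (fun s => f s x y) t

/-- Partial derivative in `x` (along the slope). -/
def dx (f : ℝ → ℝ → ℝ → ℂ) (t x y : ℝ) : ℂ := deriv (fun s => f t s y) x

/-- Partial derivative in `y` (normal to the slope). -/
def dy (f : ℝ → ℝ → ℝ → ℂ) (t x y : ℝ) : ℂ := deriv (fun s => f t x s) y

/-- Laplacian in `(x, y)`. -/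
def lap (f : ℝ → ℝ → ℝ → ℂ) (t x y : ℝ) : ℂ := dx (dx f) t x y + dy (dy f) t x y

/-- Velocity `(u, w)`, buoyancy `b` and pressure `p` as functions of `(t, x, y)`. -/
structure Fields where
  u : ℝ → ℝ → ℝ → ℂ
  w : ℝ → ℝ → ℝ → ℂ
  b : ℝ → ℝ → ℝ → ℂ
  p : ℝ → ℝ → ℝ → ℂ

instance : Add Fields where
  add V W := ⟨V.u + W.u, V.w + W.w, V.b + W.b, V.p + W.p⟩

/-- `W` is a classical solution in the half plane `y ≥ 0`, up to the boundary, of the linear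
Boussinesq system (buoyancy frequency one) in coordinates rotated by `γ`, with viscosity `ν`,
diffusivity `κ` and source terms `Ru`, `Rw`, `Rb`. The wave packets below are given by formulas
that make sense for every real `y`; their regularity is required on the whole space. -/
structure SolvesWithSource (γ ν κ : ℝ) (W : Fields) (Ru Rw Rb : ℝ → ℝ → ℝ → ℂ) : Prop where
  smooth_u : ContDiff ℝ 2 (fun z : ℝ × ℝ × ℝ => W.u z.1 z.2.1 z.2.2)
  smooth_w : ContDiff ℝ 2 (fun z : ℝ × ℝ × ℝ => W.w z.1 z.2.1 z.2.2)
  smooth_b : ContDiff ℝ 2 (fun z : ℝ × ℝ × ℝ => W.b z.1 z.2.1 z.2.2)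
  smooth_p : ContDiff ℝ 1 (fun z : ℝ × ℝ × ℝ => W.p z.1 z.2.1 z.2.2)
  momentum_x : ∀ t x y : ℝ, 0 ≤ y →
    dt W.u t x y - W.b t x y * Real.sin γ + dx W.p t x y = ν * lap W.u t x y + Ru t x y
  momentum_y : ∀ t x y : ℝ, 0 ≤ y →
    dt W.w t x y - W.b t x y * Real.cos γ + dy W.p t x y = ν * lap W.w t x y + Rw t x y
  buoyancy : ∀ t x y : ℝ, 0 ≤ y →
    dt W.b t x y + W.u t x y * Real.sin γ + W.w t x y * Real.cos γ
      = κ * lap W.b t x y + Rb t x y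
  divergence_free : ∀ t x y : ℝ, 0 ≤ y → dx W.u t x y + dy W.w t x y = 0

/-- `W` solves the Boussinesq system exactly. -/
def Solves (γ ν κ : ℝ) (W : Fields) : Prop := SolvesWithSource γ ν κ W 0 0 0

/-! The incident wave packet. A point `q : ℝ × ℝ` of Fourier space stands for `(k, m)`. -/

/-- The branch `ω⁺ = (k cos γ - m sin γ) / |(k, m)|` of the dispersion relation. -/
def omegaPlus (γ k m : ℝ) : ℝ :=
  (k * Real.cos γ - m * Real.sin γ) / Real.sqrt (k ^ 2 + m ^ 2)

open Classical in
/-- The time frequency of an incident wave: the branch `± ω⁺` whose group velocity points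
towards the boundary, that is, whose derivative in `m` is negative. -/
def omega (γ : ℝ) (q : ℝ × ℝ) : ℝ :=
  if deriv (fun m => omegaPlus γ q.1 m) q.2 < 0 then omegaPlus γ q.1 q.2
  else -omegaPlus γ q.1 q.2

/-- The criticality parameter `ζ = ω² - sin² γ`. -/
def criticality (γ : ℝ) (q : ℝ × ℝ) : ℝ := omega γ q ^ 2 - Real.sin γ ^ 2

/-- The spectral density, concentrated at distance `O(ε²)` of `(k₀, m₀)` and `(-k₀, -m₀)`. -/
def density (χ : ℝ → ℂ) (ε k₀ m₀ : ℝ) (q : ℝ × ℝ) : ℂ :=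
  (1 / (ε : ℂ) ^ 2) *
    (χ ((q.1 + k₀) / ε ^ 2) * χ ((q.2 + m₀) / ε ^ 2)
      + χ ((q.1 - k₀) / ε ^ 2) * χ ((q.2 - m₀) / ε ^ 2))

/-- Superposition of the waves `A X exp (-i ω t + i k x - μ y)` over `(k, m)`. -/
def packet (γ : ℝ) (A X μ : ℝ × ℝ → ℂ) (t x y : ℝ) : ℂ :=
  ∫ q : ℝ × ℝ, A q * X q * exp (-I * omega γ q * t + I * q.1 * x - μ q * y)

/-- Buoyancy component of the incident eigenvector; the velocity components are `1`, `-k / m`. -/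
def incB (γ : ℝ) (q : ℝ × ℝ) : ℂ :=
  I * (q.1 * Real.cos γ - q.2 * Real.sin γ) / (q.2 * omega γ q)

/-- Pressure component of the incident wave. -/
def incP (γ : ℝ) (q : ℝ × ℝ) : ℂ :=
  1 / q.1 * (omega γ q
    + Real.sin γ * (q.1 * Real.cos γ - q.2 * Real.sin γ) / (q.2 * omega γ q))

/-- The incident wave packet: superposition of `exp (-i ω t + i k x + i m y)`. -/
def incident (γ : ℝ) (χ : ℝ → ℂ) (ε k₀ m₀ : ℝ) : Fields where
  u := packet γ (density χ ε k₀ m₀) (fun _ => 1) (fun q => -I * q.2)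
  w := packet γ (density χ ε k₀ m₀) (fun q => -(q.1 : ℂ) / q.2) (fun q => -I * q.2)
  b := packet γ (density χ ε k₀ m₀) (incB γ) (fun q => -I * q.2)
  p := packet γ (density χ ε k₀ m₀) (incP γ) (fun q => -I * q.2)

/-! Boundary layers: solutions of the form `(U, W, B, P) exp (-i ω t + i k x - l y)`. -/

/-- The matrix of the linear system obtained by inserting
`(U, W, B, P) exp (-i ω t + i k x - l y)` in the Boussinesq system. -/
def symbolMatrix (γ ν κ ω k : ℝ) (l : ℂ) : Matrix (Fin 4) (Fin 4) ℂ :=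
  !![-I * ω + ν * (k ^ 2 - l ^ 2), 0, -(Real.sin γ : ℂ), I * k;
     0, -I * ω + ν * (k ^ 2 - l ^ 2), -(Real.cos γ : ℂ), -l;
     (Real.sin γ : ℂ), (Real.cos γ : ℂ), -I * ω + κ * (k ^ 2 - l ^ 2), 0;
     I * k, -l, 0, 0]

/-- The sextic characteristic polynomial in `l`. -/
def charPoly (γ ν κ ω k : ℝ) (l : ℂ) : ℂ :=
  -(κ * ν) * l ^ 6 - (I * ω * (κ + ν) - 3 * ν * κ * k ^ 2) * l ^ 4
    + ((ω ^ 2 - Real.sin γ ^ 2) + 2 * I * ω * (κ + ν) * k ^ 2 - 3 * ν * κ * k ^ 4) * l ^ 2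
    - 2 * I * l * k * Real.sin γ * Real.cos γ
    + k ^ 2 * (Real.cos γ ^ 2 - ω ^ 2 - I * ω * (κ + ν) * k ^ 2 + ν * κ * k ^ 4)

/-- Second velocity component of the boundary layer eigenvector; the first one is `1`. -/
def layerW (k : ℝ) (l : ℂ) : ℂ := I * k / l

/-- Buoyancy component of the boundary layer eigenvector. -/
def layerB (γ κ ω k : ℝ) (l : ℂ) : ℂ :=
  (Real.sin γ + I * k / l * Real.cos γ) / (I * ω - κ * (k ^ 2 - l ^ 2))

/-- Pressure component of the boundary layer eigenvector. -/
def layerP (γ ν κ ω k : ℝ) (l : ℂ) : ℂ :=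
  1 / (I * k) * (I * ω + ν * (l ^ 2 - k ^ 2) + Real.sin γ * layerB γ κ ω k l)

/-- The eigenvector `(U, W, B, P)` of a boundary layer, normalized by `U = 1`. -/
def layerVec (γ ν κ ω k : ℝ) (l : ℂ) : Fin 4 → ℂ :=
  ![1, layerW k l, layerB γ κ ω k l, layerP γ ν κ ω k l]

/-- The boundary layer wave packet with roots `l (k, m)` and amplitudes `a (k, m)`. -/
def layer (γ ν κ : ℝ) (χ : ℝ → ℂ) (ε k₀ m₀ : ℝ) (l a : ℝ × ℝ → ℂ) : Fields where
  u := packet γ (fun q => density χ ε k₀ m₀ q * a q)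
    (fun q => layerVec γ ν κ (omega γ q) q.1 (l q) 0) l
  w := packet γ (fun q => density χ ε k₀ m₀ q * a q)
    (fun q => layerVec γ ν κ (omega γ q) q.1 (l q) 1) l
  b := packet γ (fun q => density χ ε k₀ m₀ q * a q)
    (fun q => layerVec γ ν κ (omega γ q) q.1 (l q) 2) l
  p := packet γ (fun q => density χ ε k₀ m₀ q * a q)
    (fun q => layerVec γ ν κ (omega γ q) q.1 (l q) 3) l

/-- `layer γ ν κ χ ε k₀ m₀ l a` is a genuine boundary layer wave packet: its defining integrals
converge in the half plane and, at each frequency that carries the density, `l` is a root of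
positive real part of the characteristic polynomial whose eigenvector lies in the kernel of the
matrix of the system, the decay rate `Re l` has exact order `ε ^ r`, the root `l` itself has
exact order `ε ^ s`, and the amplitude is `O(ε ^ α)`, with constant `C`. -/
structure IsLayer (γ ν κ : ℝ) (χ : ℝ → ℂ) (ε k₀ m₀ : ℝ) (l a : ℝ × ℝ → ℂ) (C r s α : ℝ) :
    Prop where
  integrable : ∀ (i : Fin 4) (t x y : ℝ), 0 ≤ y → Integrable (fun q : ℝ × ℝ =>
    density χ ε k₀ m₀ q * a q * layerVec γ ν κ (omega γ q) q.1 (l q) i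
      * exp (-I * omega γ q * t + I * q.1 * x - l q * y))
  re_pos : ∀ q, density χ ε k₀ m₀ q ≠ 0 → 0 < (l q).re
  root : ∀ q, density χ ε k₀ m₀ q ≠ 0 → charPoly γ ν κ (omega γ q) q.1 (l q) = 0
  kernel : ∀ q, density χ ε k₀ m₀ q ≠ 0 →
    (symbolMatrix γ ν κ (omega γ q) q.1 (l q)).mulVec
      (layerVec γ ν κ (omega γ q) q.1 (l q)) = 0
  decay : ∀ q, density χ ε k₀ m₀ q ≠ 0 → C⁻¹ * ε ^ r ≤ (l q).re ∧ (l q).re ≤ C * ε ^ r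
  size : ∀ q, density χ ε k₀ m₀ q ≠ 0 → C⁻¹ * ε ^ s ≤ ‖l q‖ ∧ ‖l q‖ ≤ C * ε ^ s
  amplitude : ∀ q, density χ ε k₀ m₀ q ≠ 0 → ‖a q‖ ≤ C * ε ^ α

/-- The matrix that expresses the boundary values of `u`, `w`, `∂_y b` through the three
amplitudes. -/
def amplitudeMatrix (γ κ ω k : ℝ) (l : Fin 3 → ℂ) : Matrix (Fin 3) (Fin 3) ℂ :=
  !![1, 1, 1;
     layerW k (l 0), layerW k (l 1), layerW k (l 2);
     -l 0 * layerB γ κ ω k (l 0), -l 1 * layerB γ κ ω k (l 1), -l 2 * layerB γ κ ω k (l 2)]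

/-! The five regimes. -/

/-- The five scaling regimes of viscosity and diffusivity. -/
inductive Regime where
  | case1 | case2 | case3 | case4 | case5

namespace Regime

/-- The range of the exponent `β`. -/
def Admissible (β : ℝ) : Regime → Prop
  | case1 | case3 => 0 < β ∧ β < 6
  | case2 | case4 | case5 => 6 < β

/-- The viscosity. -/
def visc (ν₀ ε β : ℝ) : Regime → ℝ
  | case1 | case2 => ν₀ * ε ^ 6
  | case3 | case4 | case5 => ν₀ * ε ^ β

/-- The diffusivity. -/
def diff (κ₀ ε β : ℝ) : Regime → ℝ
  | case3 | case4 => κ₀ * ε ^ 6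
  | case1 | case2 | case5 => κ₀ * ε ^ β

/-- The exponents of `ε` in the sizes of the three roots. -/
def sizeExp (β : ℝ) : Regime → Fin 3 → ℝ
  | case1 | case3 => ![-(β / 3), -(β / 3), -3]
  | case2 | case4 => ![-2, -2, -(β / 2)]
  | case5 => ![-2, 1 - β / 2, -(β / 2)]

/-- The exponents of `ε` in the real parts of the three roots (the decay rates in `y`). -/
def decayExp (β : ℝ) : Regime → Fin 3 → ℝ
  | case5 => ![β - 8, 1 - β / 2, -(β / 2)]
  | R => R.sizeExp β

open Classical in
/-- The exponents of `ε` in the amplitudes of the three boundary layers. -/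
def ampExp (β : ℝ) : Regime → Fin 3 → ℝ
  | case1 => ![-(β / 3), -(β / 3), if 9 / 2 < β then β / 3 - 3 else -(β / 3)]
  | case2 => ![-2, -2, 3 * β / 2 - 10]
  | case3 => ![-(β / 3), -(β / 3), 9 - 5 * β / 3]
  | case4 => ![-2, -2, if β < 8 then 2 - β / 2 else -2]
  | case5 => ![-2, -2, -1]

/-- The exponent of `ε` in the size of the remainder. -/
def remainderExp (β : ℝ) : Regime → ℝ
  | case2 | case4 => 6
  | case1 | case3 | case5 => β

/-- Near-criticality of the incident packet, with constant `c`: its central frequency is of order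
one and `ζ` is of order `ε²` at all frequencies of the packet (the lower bound on `|ζ|` is asked
for in the fifth regime only). -/
def NearCritical (R : Regime) (γ : ℝ) (χ : ℝ → ℂ) (c ε k₀ m₀ : ℝ) : Prop :=
  c ≤ |k₀| ∧ |k₀| ≤ c⁻¹ ∧ |m₀| ≤ c⁻¹ ∧
    ∀ q : ℝ × ℝ, density χ ε k₀ m₀ q ≠ 0 →
      |criticality γ q| ≤ c⁻¹ * ε ^ 2 ∧ (R = case5 → c * ε ^ 2 ≤ |criticality γ q|)

end Regime

/-- The open half plane `y > 0`. -/
def halfPlane : Set (ℝ × ℝ) := {z | 0 < z.2}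

/-- The `L²` norm over the half plane at time `t`. -/
def normL2 {E : Type*} [NormedAddCommGroup E] (f : ℝ → ℝ → ℝ → E) (t : ℝ) : ENNReal :=
  eLpNorm (fun z : ℝ × ℝ => f t z.1 z.2) 2 (volume.restrict halfPlane)

end Boussinesq

end

open MeasureTheory Complex

noncomputable section

namespace Boussinesq

/-! ### Roots near a given point -/

theorem exists_root_near (p : Polynomial ℂ) {n : ℕ} (hn : p.natDegree ≤ n) (z : ℂ)
    (hd : p.derivative.eval z ≠ 0) :
    ∃ w, p.eval w = 0 ∧ ‖w - z‖ * ‖p.derivative.eval z‖ ≤ n * ‖p.eval z‖ := by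
  by_cases hz : p.eval z = 0
  · exact ⟨z, hz, by simp [hz]⟩
  have hp0 : p ≠ 0 := by rintro rfl; simp at hz
  have hsum := (IsAlgClosed.splits p).eval_derivative_div_eval_of_ne_zero hz
  have hne : p.roots.toFinset.Nonempty := by
    rw [Finset.nonempty_iff_ne_empty]
    intro h
    rw [Multiset.toFinset_eq_empty] at h
    rw [h] at hsum
    simp only [Multiset.map_zero, Multiset.sum_zero, div_eq_zero_iff] at hsum
    tauto
  obtain ⟨w, hw, hmin⟩ := Finset.exists_min_image p.roots.toFinset (fun w => ‖w - z‖) hne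
  have hw' : p.eval w = 0 := by simpa [hp0] using hw
  have hwz : 0 < ‖w - z‖ := by
    rw [norm_pos_iff, sub_ne_zero]; rintro rfl; exact hz hw'
  refine ⟨w, hw', ?_⟩
  have hb : ‖(p.roots.map fun r => 1 / (z - r)).sum‖ ≤ n * (1 / ‖w - z‖) := by
    refine (norm_multiset_sum_le _).trans ?_
    rw [Multiset.map_map]
    refine (Multiset.sum_le_card_nsmul _ (1 / ‖w - z‖) ?_).trans ?_
    · intro x hx
      obtain ⟨r, hr, rfl⟩ := Multiset.mem_map.1 hx
      simp only [Function.comp, norm_div, norm_one]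
      rw [norm_sub_rev z r]
      exact one_div_le_one_div_of_le hwz (hmin r (by simpa using hr))
    · rw [Multiset.card_map, nsmul_eq_mul]
      gcongr
      exact_mod_cast (Polynomial.card_roots' p).trans hn
  rw [← hsum, norm_div, div_le_iff₀ (norm_pos_iff.2 hz)] at hb
  calc ‖w - z‖ * ‖p.derivative.eval z‖
      ≤ ‖w - z‖ * (n * (1 / ‖w - z‖) * ‖p.eval z‖) := by gcongr
    _ = n * ‖p.eval z‖ := by field_simp

/-- The derivative of the characteristic polynomial. -/
def charDeriv (γ ν κ ω k : ℝ) (l : ℂ) : ℂ :=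
  -(6 * κ * ν) * l ^ 5 - 4 * (I * ω * (κ + ν) - 3 * ν * κ * k ^ 2) * l ^ 3
    + 2 * ((ω ^ 2 - Real.sin γ ^ 2) + 2 * I * ω * (κ + ν) * k ^ 2 - 3 * ν * κ * k ^ 4) * l
    - 2 * I * k * Real.sin γ * Real.cos γ

theorem exists_charPoly_root_near (γ ν κ ω k : ℝ) {z : ℂ} {r : ℝ}
    (hd : charDeriv γ ν κ ω k z ≠ 0)
    (h : 6 * ‖charPoly γ ν κ ω k z‖ ≤ r * ‖charDeriv γ ν κ ω k z‖) :
    ∃ w, charPoly γ ν κ ω k w = 0 ∧ ‖w - z‖ ≤ r := by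
  open Polynomial in
  let p : ℂ[X] := C (-(κ * ν : ℂ)) * X ^ 6
    + C (-(I * ω * (κ + ν) - 3 * ν * κ * k ^ 2)) * X ^ 4
    + C ((ω ^ 2 - Real.sin γ ^ 2) + 2 * I * ω * (κ + ν) * k ^ 2 - 3 * ν * κ * k ^ 4) * X ^ 2
    + C (-(2 * I * k * Real.sin γ * Real.cos γ)) * X
    + C ((k : ℂ) ^ 2 * (Real.cos γ ^ 2 - ω ^ 2 - I * ω * (κ + ν) * k ^ 2 + ν * κ * k ^ 4))
  have hp : ∀ l, p.eval l = charPoly γ ν κ ω k l := by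
    intro l
    simp only [p, charPoly, Polynomial.eval_add, Polynomial.eval_mul, Polynomial.eval_C,
      Polynomial.eval_pow, Polynomial.eval_X]
    ring
  have hp' : p.derivative.eval z = charDeriv γ ν κ ω k z := by
    simp only [p, charDeriv, Polynomial.derivative_add, Polynomial.derivative_C_mul,
      Polynomial.derivative_X_pow, Polynomial.derivative_C, Polynomial.derivative_X,
      Polynomial.eval_add, Polynomial.eval_mul, Polynomial.eval_C,
      Polynomial.eval_pow, Polynomial.eval_X, Polynomial.eval_one, Polynomial.eval_zero]
    push_cast
    ring
  have hdeg : p.natDegree ≤ 6 := by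
    simp only [p]
    compute_degree
  obtain ⟨w, hw, hwz⟩ := exists_root_near p hdeg z (by rwa [hp'])
  rw [hp', hp z] at hwz
  refine ⟨w, by rw [← hp, hw], ?_⟩
  have := hwz.trans (by exact_mod_cast h)
  exact le_of_mul_le_mul_right this (norm_pos_iff.2 hd)

/-- The factored form of the characteristic polynomial. -/
theorem charPoly_eq (γ ν κ ω k : ℝ) (l : ℂ) :
    charPoly γ ν κ ω k l =
      -((I * ω + ν * (l ^ 2 - k ^ 2)) * (I * ω + κ * (l ^ 2 - k ^ 2)) * (l ^ 2 - k ^ 2)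
        + (l * Real.sin γ + I * k * Real.cos γ) ^ 2) := by
  unfold charPoly
  linear_combination
    (ω ^ 2 * (l ^ 2 - k ^ 2) + k ^ 2 * Real.cos γ ^ 2 : ℂ) * Complex.I_sq

/-! ### The model cubic -/

/-- `z ^ 3 + i a z + b` has a root in the open first quadrant, with uniform bounds. -/
theorem exists_cubic_root {A b₀ b₁ : ℝ} (hA : 0 < A) (hb₀ : 0 < b₀) (hb₁ : b₀ ≤ b₁) :
    ∃ δ > 0, ∀ a b : ℝ, |a| ≤ A → b₀ ≤ b → b ≤ b₁ →
      ∃ z : ℂ, z ^ 3 + I * a * z + b = 0 ∧ δ ≤ z.re ∧ δ ≤ z.im ∧ ‖z‖ ≤ δ⁻¹ ∧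
        δ ≤ ‖2 * z ^ 3 - b‖ := by
  set x₁ : ℝ := min 1 (min (b₀ / 36) (b₀ ^ 3 / (16 * A ^ 4))) with hx₁
  set X : ℝ := max 1 (max b₁ A) with hX
  have hx₁0 : 0 < x₁ := by positivity
  have hx₁1 : x₁ ≤ 1 := min_le_left _ _
  have hx₁b : x₁ ≤ b₀ / 36 := (min_le_right _ _).trans (min_le_left _ _)
  have hx₁A : x₁ ≤ b₀ ^ 3 / (16 * A ^ 4) := (min_le_right _ _).trans (min_le_right _ _)
  have hX1 : 1 ≤ X := le_max_left _ _
  have hXb : b₁ ≤ X := (le_max_left _ _).trans (le_max_right _ _)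
  have hXA : A ≤ X := (le_max_right _ _).trans (le_max_right _ _)
  clear_value x₁ X
  refine ⟨min x₁ (min (4 * x₁ ^ 3) (3 * X)⁻¹), by positivity, ?_⟩
  intro a b ha hb hb'
  have hb0 : 0 < b := hb₀.trans_le hb
  let Y : ℝ → ℝ := fun x => Real.sqrt (Real.sqrt (x ^ 4 + b * x))
  have hY4 : ∀ x, 0 < x → Y x ^ 4 = x ^ 4 + b * x := by
    intro x hx
    have h1 : (Y x) ^ 2 = Real.sqrt (x ^ 4 + b * x) := Real.sq_sqrt (Real.sqrt_nonneg _)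
    calc Y x ^ 4 = (Y x ^ 2) ^ 2 := by ring
      _ = _ := by rw [h1, Real.sq_sqrt (by positivity)]
  have hYx : ∀ x, 0 < x → x ≤ Y x := by
    intro x hx
    refine le_of_pow_le_pow_left₀ (n := 4) (by norm_num) (Real.sqrt_nonneg _) ?_
    rw [hY4 x hx]
    nlinarith [mul_pos hb0 hx]
  have hcont : ContinuousOn (fun x => Y x ^ 3 / x - 3 * x * Y x) (Set.Icc x₁ X) := by
    have hYc : Continuous Y := by fun_prop
    refine ContinuousOn.sub (ContinuousOn.div (by fun_prop) (by fun_prop) ?_) (by fun_prop)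
    intro x hx; exact (hx₁0.trans_le hx.1).ne'
  have hlow : A ≤ Y x₁ ^ 3 / x₁ - 3 * x₁ * Y x₁ := by
    have hy := hY4 x₁ hx₁0
    have hyx := hYx x₁ hx₁0
    have hy0 : 0 < Y x₁ := hx₁0.trans_le hyx
    generalize Y x₁ = y at hy hyx hy0
    have h36 : 36 * x₁ ^ 3 ≤ b := by
      have : x₁ ^ 3 ≤ x₁ := by
        calc x₁ ^ 3 = x₁ * x₁ ^ 2 := by ring
          _ ≤ x₁ * 1 := by gcongr; exact pow_le_one₀ hx₁0.le hx₁1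
          _ = x₁ := mul_one _
      linarith
    have h6 : 6 * x₁ ^ 2 ≤ y ^ 2 := by
      refine le_of_pow_le_pow_left₀ (n := 2) (by norm_num) (by positivity) ?_
      calc (6 * x₁ ^ 2) ^ 2 = (36 * x₁ ^ 3) * x₁ := by ring
        _ ≤ b * x₁ := by gcongr
        _ ≤ y ^ 4 := by rw [hy]; have := pow_pos hx₁0 4; linarith
        _ = (y ^ 2) ^ 2 := by ring
    have h2 : 2 * A * x₁ ≤ y ^ 3 := by
      refine le_of_pow_le_pow_left₀ (n := 4) (by norm_num) (by positivity) ?_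
      rw [le_div_iff₀ (by positivity)] at hx₁A
      calc (2 * A * x₁) ^ 4 = (x₁ * (16 * A ^ 4)) * x₁ ^ 3 := by ring
        _ ≤ b₀ ^ 3 * x₁ ^ 3 := by gcongr
        _ ≤ b ^ 3 * x₁ ^ 3 := by gcongr
        _ = (b * x₁) ^ 3 := by ring
        _ ≤ (y ^ 4) ^ 3 := by gcongr; rw [hy]; have := pow_pos hx₁0 4; linarith
        _ = (y ^ 3) ^ 4 := by ring
    have e : y ^ 3 / x₁ - 3 * x₁ * y = (y ^ 3 - 3 * x₁ ^ 2 * y) / x₁ := by field_simp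
    rw [e, le_div_iff₀ hx₁0]
    nlinarith [mul_le_mul_of_nonneg_right h6 hy0.le]
  have hX0 : 0 < X := by linarith
  have hhigh : Y X ^ 3 / X - 3 * X * Y X ≤ -A := by
    have hy := hY4 X hX0
    have hyx := hYx X hX0
    have hy0 : 0 < Y X := hX0.trans_le hyx
    generalize Y X = y at hy hyx hy0
    have hb3 : b * X ≤ X ^ 4 := by
      have h2 : 1 ≤ X ^ 2 := one_le_pow₀ hX1
      calc b * X ≤ X * X := by gcongr; linarith
        _ = X ^ 2 * 1 := by ring
        _ ≤ X ^ 2 * X ^ 2 := by gcongr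
        _ = X ^ 4 := by ring
    have h2 : y ^ 2 ≤ 2 * X ^ 2 := by
      refine le_of_pow_le_pow_left₀ (n := 2) (by norm_num) (by positivity) ?_
      have := pow_pos hX0 4
      calc (y ^ 2) ^ 2 = y ^ 4 := by ring
        _ ≤ 2 * X ^ 4 := by rw [hy]; linarith
        _ ≤ (2 * X ^ 2) ^ 2 := by nlinarith
    have e : y ^ 3 / X - 3 * X * y = (y ^ 3 - 3 * X ^ 2 * y) / X := by field_simp
    rw [e, div_le_iff₀ hX0]
    have h3 : X * X ≤ X * y := by gcongr
    nlinarith [mul_le_mul_of_nonneg_right h2 hy0.le, mul_le_mul_of_nonneg_left hXA hX0.le,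
      mul_le_mul_of_nonneg_right hX1 (mul_nonneg hX0.le hy0.le)]
  have hx₁X : x₁ ≤ X := by linarith
  obtain ⟨ha1, ha2⟩ := abs_le.1 ha
  obtain ⟨x, ⟨hx1, hx2⟩, hxa⟩ := intermediate_value_Icc' hx₁X hcont
    (show a ∈ Set.Icc _ _ from ⟨by linarith, by linarith⟩)
  have hx0 : 0 < x := hx₁0.trans_le hx1
  have hy := hY4 x hx0
  have hyx := hYx x hx0
  simp only at hxa
  generalize Y x = y at hy hyx hxa
  have hy0 : 0 < y := hx0.trans_le hyx
  have hax : a * x = y ^ 3 - 3 * x ^ 2 * y := by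
    rw [← hxa]; field_simp
  have hyX : y ≤ 2 * X := by
    refine le_of_pow_le_pow_left₀ (n := 4) (by norm_num) (by positivity) ?_
    have h4 : x ^ 4 ≤ X ^ 4 := by gcongr
    have hbX : b * x ≤ X ^ 4 := by
      have h2 : 1 ≤ X ^ 2 := one_le_pow₀ hX1
      calc b * x ≤ X * X := by gcongr; linarith
        _ = X ^ 2 * 1 := by ring
        _ ≤ X ^ 2 * X ^ 2 := by gcongr
        _ = X ^ 4 := by ring
    rw [hy]; nlinarith [pow_pos hX0 4]
  have e3 : ((x : ℂ) + y * I) ^ 3 =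
      ((x ^ 3 - 3 * x * y ^ 2 : ℝ) : ℂ) + ((3 * x ^ 2 * y - y ^ 3 : ℝ) : ℂ) * I := by
    push_cast
    linear_combination (3 * x * y ^ 2 + y ^ 3 * I : ℂ) * Complex.I_sq
  refine ⟨x + y * I, ?_, ?_, ?_, ?_, ?_⟩
  · have hre : x ^ 3 - 3 * x * y ^ 2 - a * y + b = 0 := by
      have : x * (x ^ 3 - 3 * x * y ^ 2 - a * y + b) = 0 := by
        linear_combination (-1 : ℝ) * hy - y * hax
      exact (mul_eq_zero.1 this).resolve_left hx0.ne'
    have him : 3 * x ^ 2 * y - y ^ 3 + a * x = 0 := by linarith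
    have hre' : (x ^ 3 - 3 * x * y ^ 2 - a * y + b : ℂ) = 0 := by exact_mod_cast hre
    have him' : (3 * x ^ 2 * y - y ^ 3 + a * x : ℂ) = 0 := by exact_mod_cast him
    rw [e3]; push_cast
    linear_combination hre' + I * him' + (a * y : ℂ) * Complex.I_sq
  · simpa using Or.inl hx1
  · simpa using Or.inl (hx1.trans hyx)
  · have h1 : ‖(x + y * I : ℂ)‖ ≤ 3 * X := by
      refine (norm_add_le _ _).trans ?_
      simp only [norm_mul, Complex.norm_real, Complex.norm_I, mul_one, Real.norm_eq_abs,
        abs_of_pos hx0, abs_of_pos hy0]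
      linarith
    refine h1.trans ?_
    rw [le_inv_comm₀ (by positivity) (by positivity)]
    exact (min_le_right _ _).trans (min_le_right _ _)
  · refine ((min_le_right _ _).trans (min_le_left _ _)).trans ?_
    have hre : (2 * (x + y * I : ℂ) ^ 3 - b).re = 2 * (x ^ 3 - 3 * x * y ^ 2) - b := by
      rw [e3]
      generalize x ^ 3 - 3 * x * y ^ 2 = p
      generalize 3 * x ^ 2 * y - y ^ 3 = q
      simp
    have hle : 2 * (x ^ 3 - 3 * x * y ^ 2) - b ≤ -(4 * x ^ 3) := by
      have : x * (2 * (x ^ 3 - 3 * x * y ^ 2) - b) ≤ x * -(4 * x ^ 3) := by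
        have h2 : x ^ 2 ≤ y ^ 2 := by gcongr
        nlinarith [pow_pos hx0 2, mul_le_mul h2 h2 (by positivity) (by positivity),
          mul_le_mul_of_nonneg_left h2 (by positivity : (0:ℝ) ≤ x ^ 2)]
      exact le_of_mul_le_mul_left this hx0
    calc 4 * x₁ ^ 3 ≤ 4 * x ^ 3 := by gcongr
      _ ≤ |(2 * (x + y * I : ℂ) ^ 3 - b).re| := by
        rw [hre, le_abs]; right; linarith
      _ ≤ _ := Complex.abs_re_le_norm _

theorem charDeriv_eq (γ ν κ ω k : ℝ) (l : ℂ) :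
    charDeriv γ ν κ ω k l =
      -(6 * ν * κ * l * (l ^ 2 - k ^ 2) ^ 2 + 4 * I * ω * (ν + κ) * l * (l ^ 2 - k ^ 2)
        - 2 * (ω ^ 2 - Real.sin γ ^ 2) * l + 2 * I * k * Real.sin γ * Real.cos γ) := by
  unfold charDeriv
  ring

theorem norm_ofReal_add_ofReal {a b : ℝ} (h : 0 ≤ a + b) : ‖(a + b : ℂ)‖ = a + b := by
  rw [← Complex.ofReal_add, Complex.norm_real, Real.norm_eq_abs, abs_of_nonneg h]

theorem norm_ofReal_mul_ofReal {a b : ℝ} (h : 0 ≤ a * b) : ‖(a * b : ℂ)‖ = a * b := by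
  rw [← Complex.ofReal_mul, Complex.norm_real, Real.norm_eq_abs, abs_of_nonneg h]

theorem norm_cos_sq_sub_sq_le {γ ω : ℝ} (hω : |ω| ≤ 1) :
    ‖(Real.cos γ ^ 2 - ω ^ 2 : ℂ)‖ ≤ 1 := by
  have h : (Real.cos γ ^ 2 - ω ^ 2 : ℂ) = ((Real.cos γ ^ 2 - ω ^ 2 : ℝ) : ℂ) := by push_cast; rfl
  rw [h, Complex.norm_real, Real.norm_eq_abs, abs_le]
  have h1 : ω ^ 2 ≤ 1 := by rw [← sq_abs]; exact pow_le_one₀ (abs_nonneg _) hω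
  have h2 := Real.cos_sq_le_one γ
  constructor <;> nlinarith [sq_nonneg ω, sq_nonneg (Real.cos γ)]

theorem charPoly_eq' (γ ν κ ω k : ℝ) (l : ℂ) :
    charPoly γ ν κ ω k l =
      -(ν * κ * (l ^ 2 - k ^ 2) ^ 3 + I * ω * (ν + κ) * (l ^ 2 - k ^ 2) ^ 2
        - (ω ^ 2 - Real.sin γ ^ 2) * l ^ 2 + 2 * I * k * Real.sin γ * Real.cos γ * l
        + k ^ 2 * (ω ^ 2 - Real.cos γ ^ 2)) := by
  unfold charPoly
  ring

/-- A root of the model cubic, rescaled by `T`, is close to a root of the characteristic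
polynomial. -/
theorem exists_root_near_cubic {K δ : ℝ} (hK : 1 ≤ K) (hδ : 0 < δ) :
    ∃ T₀ ≥ 1, ∀ (γ ν κ ω k T a b : ℝ) (z : ℂ), 0 < ν → 0 < κ → T₀ ≤ T → |k| ≤ K → |ω| ≤ 1 →
      K⁻¹ ≤ |ω| → K⁻¹ ≤ (ν + κ) * T ^ 3 → (ν + κ) * T ^ 3 ≤ K →
      a * (ω * ((ν + κ) * T ^ 3)) = (ω ^ 2 - Real.sin γ ^ 2) * T →
      b * (ω * ((ν + κ) * T ^ 3)) = 2 * k * Real.sin γ * Real.cos γ →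
      z ^ 3 + I * a * z + b = 0 → ‖z‖ ≤ δ⁻¹ → δ ≤ ‖2 * z ^ 3 - b‖ →
      ∃ w, charPoly γ ν κ ω k w = 0 ∧ ‖w - T * z‖ ≤ T * δ / 2 := by
  set d : ℝ := δ⁻¹ ^ 2 + K ^ 2 with hd
  set E₀ : ℝ := K ^ 2 * d ^ 3 + K * (2 * K ^ 2 * δ⁻¹ ^ 2 + K ^ 4) + K ^ 2 with hE₀
  set E₁ : ℝ := 6 * K ^ 2 * δ⁻¹ * d ^ 2 + 4 * K ^ 3 * δ⁻¹ with hE₁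
  have hK0 : 0 < K := by linarith
  have hd0 : 0 < d := by positivity
  have hE₀0 : 0 < E₀ := by positivity
  have hE₁0 : 0 < E₁ := by positivity
  refine ⟨max 1 (max (2 * E₁ * K ^ 2 / δ) (24 * E₀ * K ^ 2 / δ ^ 2)), le_max_left _ _, ?_⟩
  intro γ ν κ ω k T a b z hν hκ hT hk hω1 hω hσ hσ' ha hb hz hzn hz'
  have hT1 : 1 ≤ T := (le_max_left _ _).trans hT
  have hTE₁ : 2 * E₁ * K ^ 2 / δ ≤ T := ((le_max_left _ _).trans (le_max_right _ _)).trans hT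
  have hTE₀ : 24 * E₀ * K ^ 2 / δ ^ 2 ≤ T :=
    ((le_max_right _ _).trans (le_max_right _ _)).trans hT
  have hT0 : 0 < T := by linarith
  have hσ0 : 0 < ν + κ := by linarith
  have hνκ : ν * κ ≤ (ν + κ) ^ 2 := by nlinarith
  have hk2 : k ^ 2 ≤ K ^ 2 := by rw [← sq_abs]; gcongr
  have haC : (a * (ω * ((ν + κ) * T ^ 3)) : ℂ) = (ω ^ 2 - Real.sin γ ^ 2) * T := by
    exact_mod_cast ha
  have hbC : (b * (ω * ((ν + κ) * T ^ 3)) : ℂ) = 2 * k * Real.sin γ * Real.cos γ := by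
    exact_mod_cast hb
  have hz2 : ‖z‖ ^ 2 ≤ δ⁻¹ ^ 2 := by gcongr
  have hD : ‖((T * z) ^ 2 - k ^ 2 : ℂ)‖ ≤ T ^ 2 * d := by
    refine (norm_sub_le _ _).trans ?_
    simp only [norm_pow, norm_mul, Complex.norm_real, Real.norm_eq_abs, sq_abs, mul_pow, hd,
      mul_add]
    gcongr
    calc k ^ 2 ≤ 1 * K ^ 2 := by linarith
      _ ≤ T ^ 2 * K ^ 2 := by gcongr; exact one_le_pow₀ hT1
  have hval : charPoly γ ν κ ω k (T * z) =
      -(ν * κ * ((T * z) ^ 2 - k ^ 2) ^ 3) + I * ω * (ν + κ) * (2 * k ^ 2 * (T * z) ^ 2 - k ^ 4)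
        + k ^ 2 * (Real.cos γ ^ 2 - ω ^ 2) := by
    rw [charPoly_eq']
    linear_combination (-(I * ω * (ν + κ) * T ^ 4 * z)) * hz + (-T * z ^ 2 : ℂ) * haC
      + I * T * z * hbC + (ω * (ν + κ) * T ^ 4 * z ^ 2 * a : ℂ) * Complex.I_sq
  have hder : charDeriv γ ν κ ω k (T * z) =
      -(I * (ω * ((ν + κ) * T ^ 3)) * (2 * z ^ 3 - b)) -
        (6 * (ν * κ) * (T * z) * ((T * z) ^ 2 - k ^ 2) ^ 2
          - 4 * (I * ω) * (ν + κ) * k ^ 2 * (T * z)) := by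
    rw [charDeriv_eq]
    linear_combination (-(2 * I * ω * (ν + κ) * T ^ 3)) * hz + (-2 * z : ℂ) * haC
      + I * hbC + (2 * ω * (ν + κ) * T ^ 3 * z * a : ℂ) * Complex.I_sq
  have hσn : ‖(ν + κ : ℂ)‖ = ν + κ := norm_ofReal_add_ofReal hσ0.le
  have hνκn : ‖(ν * κ : ℂ)‖ = ν * κ := norm_ofReal_mul_ofReal (by positivity)
  have hTn : ‖(T : ℂ)‖ = T := by rw [Complex.norm_real, Real.norm_eq_abs, abs_of_pos hT0]
  have hσT2 : (ν + κ) * T ^ 2 ≤ K := by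
    refine le_trans ?_ hσ'
    gcongr (ν + κ) * ?_
    exact pow_le_pow_right₀ hT1 (by norm_num)
  have hσT2' : (ν + κ) * T ^ 2 * T ≤ K := by linarith [hσ']
  have hE : ‖charPoly γ ν κ ω k (T * z)‖ ≤ E₀ := by
    rw [hval]
    refine (norm_add₃_le).trans ?_
    have h1 : ‖-(ν * κ * ((T * z) ^ 2 - k ^ 2) ^ 3 : ℂ)‖ ≤ K ^ 2 * d ^ 3 := by
      rw [norm_neg, norm_mul, hνκn, norm_pow]
      calc ν * κ * ‖((T * z) ^ 2 - k ^ 2 : ℂ)‖ ^ 3 ≤ (ν + κ) ^ 2 * (T ^ 2 * d) ^ 3 := by gcongr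
        _ = ((ν + κ) * T ^ 3) ^ 2 * d ^ 3 := by ring
        _ ≤ K ^ 2 * d ^ 3 := by gcongr
    have h2 : ‖(I * ω * (ν + κ) * (2 * k ^ 2 * (T * z) ^ 2 - k ^ 4) : ℂ)‖ ≤
        K * (2 * K ^ 2 * δ⁻¹ ^ 2 + K ^ 4) := by
      have h3 : ‖(2 * k ^ 2 * (T * z) ^ 2 - k ^ 4 : ℂ)‖ ≤
          T ^ 2 * (2 * K ^ 2 * δ⁻¹ ^ 2 + K ^ 4) := by
        refine (norm_sub_le _ _).trans ?_
        simp only [norm_mul, norm_pow, Complex.norm_real, Real.norm_eq_abs, hTn, Complex.norm_two]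
        calc 2 * |k| ^ 2 * (T * ‖z‖) ^ 2 + |k| ^ 4
            ≤ 2 * K ^ 2 * (T * δ⁻¹) ^ 2 + K ^ 4 * 1 := by rw [mul_one]; gcongr
          _ ≤ 2 * K ^ 2 * (T * δ⁻¹) ^ 2 + K ^ 4 * T ^ 2 := by gcongr; exact one_le_pow₀ hT1
          _ = _ := by ring
      rw [norm_mul, norm_mul, norm_mul, Complex.norm_I, one_mul, Complex.norm_real, hσn,
        Real.norm_eq_abs]
      calc |ω| * (ν + κ) * ‖(2 * k ^ 2 * (T * z) ^ 2 - k ^ 4 : ℂ)‖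
          ≤ 1 * (ν + κ) * (T ^ 2 * (2 * K ^ 2 * δ⁻¹ ^ 2 + K ^ 4)) := by gcongr
        _ = ((ν + κ) * T ^ 2) * (2 * K ^ 2 * δ⁻¹ ^ 2 + K ^ 4) := by ring
        _ ≤ _ := by gcongr
    have h4 : ‖(k ^ 2 * (Real.cos γ ^ 2 - ω ^ 2) : ℂ)‖ ≤ K ^ 2 := by
      rw [norm_mul, norm_pow, Complex.norm_real, Real.norm_eq_abs, sq_abs]
      calc k ^ 2 * ‖(Real.cos γ ^ 2 - ω ^ 2 : ℂ)‖ ≤ K ^ 2 * 1 := by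
            gcongr; exact norm_cos_sq_sub_sq_le hω1
        _ = K ^ 2 := mul_one _
    linarith
  have hE' : K⁻¹ ^ 2 * δ / 2 ≤ ‖charDeriv γ ν κ ω k (T * z)‖ := by
    rw [hder]
    refine le_trans ?_ (norm_sub_norm_le _ _)
    have h1 : K⁻¹ ^ 2 * δ ≤ ‖-(I * (ω * ((ν + κ) * T ^ 3)) * (2 * z ^ 3 - b) : ℂ)‖ := by
      simp only [norm_neg, norm_mul, norm_pow, Complex.norm_I, one_mul, hσn, hTn,
        Complex.norm_real, Real.norm_eq_abs]
      calc K⁻¹ ^ 2 * δ = K⁻¹ * K⁻¹ * δ := by ring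
        _ ≤ _ := by gcongr
    have h2 : ‖(6 * (ν * κ) * (T * z) * ((T * z) ^ 2 - k ^ 2) ^ 2
          - 4 * (I * ω) * (ν + κ) * k ^ 2 * (T * z) : ℂ)‖ ≤ E₁ / T := by
      refine (norm_sub_le _ _).trans ?_
      have e6 : ‖(6 : ℂ)‖ = 6 := by norm_num
      have e4 : ‖(4 : ℂ)‖ = 4 := by norm_num
      simp only [norm_mul, norm_pow, hTn, hσn, Complex.norm_I, one_mul, Complex.norm_real,
        Real.norm_eq_abs, sq_abs, e6, e4, abs_of_pos hν, abs_of_pos hκ]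
      rw [le_div_iff₀ hT0]
      calc (6 * (ν * κ) * (T * ‖z‖) * ‖((T * z) ^ 2 - k ^ 2 : ℂ)‖ ^ 2
            + 4 * |ω| * (ν + κ) * k ^ 2 * (T * ‖z‖)) * T
          ≤ (6 * (ν + κ) ^ 2 * (T * δ⁻¹) * (T ^ 2 * d) ^ 2
            + 4 * 1 * (ν + κ) * K ^ 2 * (T * δ⁻¹)) * T := by gcongr
        _ = 6 * ((ν + κ) * T ^ 3) ^ 2 * δ⁻¹ * d ^ 2
            + 4 * ((ν + κ) * T ^ 2) * K ^ 2 * δ⁻¹ := by ring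
        _ ≤ 6 * K ^ 2 * δ⁻¹ * d ^ 2 + 4 * K * K ^ 2 * δ⁻¹ := by gcongr
        _ = E₁ := by rw [hE₁]; ring
    have h3 : E₁ / T ≤ K⁻¹ ^ 2 * δ / 2 := by
      rw [div_le_iff₀ hT0]
      rw [div_le_iff₀ hδ] at hTE₁
      have : K⁻¹ ^ 2 * (2 * E₁ * K ^ 2) ≤ K⁻¹ ^ 2 * (T * δ) := by gcongr
      have e : K⁻¹ ^ 2 * (2 * E₁ * K ^ 2) = 2 * E₁ := by field_simp
      linarith
    linarith
  refine exists_charPoly_root_near γ ν κ ω k (norm_pos_iff.1 (lt_of_lt_of_le ?_ hE')) ?_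
  · positivity
  calc 6 * ‖charPoly γ ν κ ω k (T * z)‖ ≤ 6 * E₀ := by gcongr
    _ ≤ T * δ / 2 * (K⁻¹ ^ 2 * δ / 2) := by
      rw [div_le_iff₀ (by positivity)] at hTE₀
      have : K⁻¹ ^ 2 * (24 * E₀ * K ^ 2) ≤ K⁻¹ ^ 2 * (T * δ ^ 2) := by gcongr
      have e : K⁻¹ ^ 2 * (24 * E₀ * K ^ 2) = 24 * E₀ := by field_simp
      linarith
    _ ≤ _ := by gcongr

theorem exists_slow_roots {γ K : ℝ} (hs : 0 < Real.sin γ) (hc : 0 < Real.cos γ) (hK : 1 ≤ K) :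
    ∃ δ > 0, ∃ T₀ ≥ 1, ∀ ν κ ω k T : ℝ, 0 < ν → 0 < κ → T₀ ≤ T → |k| ≤ K → |ω| ≤ 1 →
      K⁻¹ ≤ |ω| → K⁻¹ ≤ k * ω → K⁻¹ ≤ (ν + κ) * T ^ 3 → (ν + κ) * T ^ 3 ≤ K →
      |ω ^ 2 - Real.sin γ ^ 2| * T ≤ K →
      (∃ w, charPoly γ ν κ ω k w = 0 ∧ δ * T ≤ w.re ∧ δ * T ≤ w.im ∧ ‖w‖ ≤ δ⁻¹ * T) ∧
      (∃ w, charPoly γ ν κ ω k w = 0 ∧ δ * T ≤ w.re ∧ δ * T ≤ -w.im ∧ ‖w‖ ≤ δ⁻¹ * T) := by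
  have hK0 : 0 < K := by linarith
  set sc := Real.sin γ * Real.cos γ with hsc
  have hsc0 : 0 < sc := by positivity
  have hb : 2 * K⁻¹ * sc * K⁻¹ ≤ 2 * K ^ 3 * sc * K := by
    have h1 : K⁻¹ ≤ K := (inv_le_one_of_one_le₀ hK).trans hK
    have h2 : K⁻¹ ≤ K ^ 3 := h1.trans (le_self_pow₀ hK (by norm_num))
    gcongr
  obtain ⟨δ, hδ, hcub⟩ := exists_cubic_root (A := K ^ 3) (b₀ := 2 * K⁻¹ * sc * K⁻¹)
    (b₁ := 2 * K ^ 3 * sc * K) (by positivity) (by positivity) hb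
  obtain ⟨T₀, hT₀, hnear⟩ := exists_root_near_cubic hK hδ
  refine ⟨min (δ / 2) (δ⁻¹ + δ / 2)⁻¹, by positivity, T₀, hT₀, ?_⟩
  intro ν κ ω k T hν hκ hT hk hω1 hω hkω hσ hσ' hζ
  have hT0 : 0 < T := by linarith
  have hω0 : ω ≠ 0 := by
    rintro rfl; simp at hω; linarith
  have hσ0 : 0 < (ν + κ) * T ^ 3 := by positivity
  set S := (ν + κ) * T ^ 3 with hS
  have hS' : S⁻¹ ≤ K := by rw [inv_le_comm₀ hσ0 hK0]; exact hσ
  have hS'' : K⁻¹ ≤ S⁻¹ := by gcongr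
  set a := (ω ^ 2 - Real.sin γ ^ 2) * T / (ω * S) with ha
  set b := 2 * k * Real.sin γ * Real.cos γ / (ω * S) with hb
  have haA : |a| ≤ K ^ 3 := by
    rw [ha, abs_div, abs_mul, abs_mul, abs_of_pos hT0, abs_of_pos hσ0, div_eq_mul_inv, mul_inv]
    calc |ω ^ 2 - Real.sin γ ^ 2| * T * (|ω|⁻¹ * S⁻¹) ≤ K * (K * K) := by
          gcongr
          rw [inv_le_comm₀ (abs_pos.2 hω0) hK0]; exact hω
      _ = K ^ 3 := by ring
  have hω2 : ω ^ 2 ≤ 1 := by rw [← sq_abs]; exact pow_le_one₀ (abs_nonneg _) hω1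
  have hω2' : (ω ^ 2)⁻¹ ≤ K ^ 2 := by
    rw [inv_le_comm₀ (by positivity) (by positivity), ← inv_pow, ← sq_abs ω]
    gcongr
  have hbe : b = 2 * (k * ω * (ω ^ 2)⁻¹) * sc * S⁻¹ := by
    rw [hb, hsc]; field_simp
  have hkω' : k * ω ≤ K := by
    calc k * ω ≤ |k * ω| := le_abs_self _
      _ = |k| * |ω| := abs_mul _ _
      _ ≤ K * 1 := by gcongr
      _ = K := mul_one _
  have hkω0 : 0 < k * ω := lt_of_lt_of_le (by positivity) hkω
  have hb₀ : 2 * K⁻¹ * sc * K⁻¹ ≤ b := by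
    rw [hbe]
    have : K⁻¹ ≤ k * ω * (ω ^ 2)⁻¹ := by
      calc K⁻¹ = K⁻¹ * 1 := by ring
        _ ≤ k * ω * (ω ^ 2)⁻¹ := by
          gcongr
          exact (one_le_inv₀ (by positivity)).2 hω2
    gcongr
  have hb₁ : b ≤ 2 * K ^ 3 * sc * K := by
    rw [hbe]
    have : k * ω * (ω ^ 2)⁻¹ ≤ K ^ 3 := by
      calc k * ω * (ω ^ 2)⁻¹ ≤ K * K ^ 2 := by gcongr
        _ = K ^ 3 := by ring
    gcongr
  have haS : a * (ω * S) = (ω ^ 2 - Real.sin γ ^ 2) * T := by rw [ha]; field_simp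
  have hbS : b * (ω * S) = 2 * k * Real.sin γ * Real.cos γ := by rw [hb]; field_simp
  have key : ∀ (z w : ℂ), δ ≤ z.re → ‖z‖ ≤ δ⁻¹ → ‖w - T * z‖ ≤ T * δ / 2 →
      min (δ / 2) (δ⁻¹ + δ / 2)⁻¹ * T ≤ w.re ∧
      |w.im - T * z.im| ≤ T * δ / 2 ∧ ‖w‖ ≤ (min (δ / 2) (δ⁻¹ + δ / 2)⁻¹)⁻¹ * T := by
    intro z w hzr hzn hwz
    have hre := (Complex.abs_re_le_norm _).trans hwz
    have him := (Complex.abs_im_le_norm _).trans hwz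
    simp only [Complex.sub_re, Complex.sub_im, Complex.re_ofReal_mul, Complex.im_ofReal_mul]
      at hre him
    refine ⟨?_, him, ?_⟩
    · have h1 := (abs_le.1 hre).1
      have h2 : min (δ / 2) (δ⁻¹ + δ / 2)⁻¹ * T ≤ δ / 2 * T := by gcongr; exact min_le_left _ _
      have h3 : T * δ ≤ T * z.re := by gcongr
      linarith
    · have h4 : δ⁻¹ + δ / 2 ≤ (min (δ / 2) (δ⁻¹ + δ / 2)⁻¹)⁻¹ := by
        rw [le_inv_comm₀ (by positivity) (by positivity)]; exact min_le_right _ _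
      calc ‖w‖ = ‖(w - T * z) + T * z‖ := by ring_nf
        _ ≤ T * δ / 2 + T * δ⁻¹ := by
          refine (norm_add_le _ _).trans ?_
          rw [norm_mul, Complex.norm_real, Real.norm_eq_abs, abs_of_pos hT0]
          gcongr
        _ = (δ⁻¹ + δ / 2) * T := by ring
        _ ≤ _ := by gcongr
  have hmin : min (δ / 2) (δ⁻¹ + δ / 2)⁻¹ * T ≤ δ / 2 * T := by gcongr; exact min_le_left _ _
  constructor
  · obtain ⟨z, hz, hzr, hzi, hzn, hz'⟩ := hcub a b haA hb₀ hb₁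
    obtain ⟨w, hw, hwz⟩ := hnear γ ν κ ω k T a b z hν hκ hT hk hω1 hω hσ hσ' haS hbS hz hzn hz'
    obtain ⟨h1, h2, h3⟩ := key z w hzr hzn hwz
    refine ⟨w, hw, h1, ?_, h3⟩
    have h4 : T * δ ≤ T * z.im := by gcongr
    linarith [(abs_le.1 h2).1]
  · obtain ⟨z, hz, hzr, hzi, hzn, hz'⟩ := hcub (-a) b (by rwa [abs_neg]) hb₀ hb₁
    have hz2 : (starRingEnd ℂ z) ^ 3 + I * a * starRingEnd ℂ z + b = 0 := by
      have := congrArg (starRingEnd ℂ) hz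
      simp only [map_add, map_mul, map_pow, Complex.conj_ofReal, Complex.conj_I, map_zero] at this
      push_cast at this
      linear_combination this
    have hz'2 : δ ≤ ‖2 * (starRingEnd ℂ z) ^ 3 - b‖ := by
      have : 2 * (starRingEnd ℂ z) ^ 3 - b = starRingEnd ℂ (2 * z ^ 3 - b) := by
        rw [map_sub, map_mul, map_pow, Complex.conj_ofReal, map_ofNat]
      rwa [this, Complex.norm_conj]
    obtain ⟨w, hw, hwz⟩ := hnear γ ν κ ω k T a b _ hν hκ hT hk hω1 hω hσ hσ' haS hbS hz2
      (by rwa [Complex.norm_conj]) hz'2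
    obtain ⟨h1, h2, h3⟩ := key _ w (by simpa using hzr) (by rwa [Complex.norm_conj]) hwz
    refine ⟨w, hw, h1, ?_, h3⟩
    have h4 : T * δ ≤ T * z.im := by gcongr
    simp only [Complex.conj_im] at h2
    linarith [(abs_le.1 h2).2]

theorem exists_sqrt_re {z : ℂ} (hz : 0 ≤ z.re) :
    ∃ w : ℂ, w ^ 2 = z ∧ 0 ≤ w.re ∧ ‖z‖ ≤ 2 * w.re ^ 2 := by
  obtain ⟨w, hw⟩ : ∃ w : ℂ, w ^ 2 = z := IsAlgClosed.exists_pow_nat_eq z (by norm_num)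
  have h2 : ‖z‖ ≤ 2 * w.re ^ 2 := by
    have h1 : ‖z‖ = w.re ^ 2 + w.im ^ 2 := by
      rw [← hw, norm_pow, ← Complex.normSq_eq_norm_sq, Complex.normSq_apply]; ring
    have h3 : z.re = w.re ^ 2 - w.im ^ 2 := by
      rw [← hw, sq, Complex.mul_re]; ring
    linarith
  rcases le_total 0 w.re with h | h
  · exact ⟨w, hw, h, h2⟩
  · exact ⟨-w, by rw [neg_sq, hw], by simpa using h, by simpa using h2⟩

theorem four_le_add_mul_inv_add_inv {ν κ : ℝ} (hν : 0 < ν) (hκ : 0 < κ) :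
    4 ≤ (ν + κ) * (1 / ν + 1 / κ) := by
  have e : (ν + κ) * (1 / ν + 1 / κ) = (ν + κ) ^ 2 / (ν * κ) := by field_simp; ring
  rw [e, le_div_iff₀ (by positivity)]
  nlinarith [sq_nonneg (ν - κ)]

/-- The fast root, given by the balance between diffusion and viscosity. -/
theorem exists_fast_root {K η : ℝ} (hK : 1 ≤ K) (hη : 0 < η) :
    ∃ θ > 0, ∀ γ ν κ ω k L : ℝ, 0 < ν → 0 < κ → θ⁻¹ ≤ L → |k| ≤ K → |ω| ≤ 1 →
      K⁻¹ ≤ |ω| → K⁻¹ * L ^ 2 ≤ 1 / ν + 1 / κ → 1 / ν + 1 / κ ≤ K * L ^ 2 →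
      |ω ^ 2 - Real.sin γ ^ 2| ≤ θ →
      ∃ w, charPoly γ ν κ ω k w = 0 ∧
        ‖w ^ 2 - k ^ 2 + I * ω * ((1 / ν + 1 / κ : ℝ) : ℂ)‖ ≤ η * L ^ 2 ∧
        (4 * K)⁻¹ * L ≤ w.re ∧ ‖w‖ ≤ 3 * K * L := by
  have hK0 : 0 < K := by linarith
  set η' : ℝ := min (η / (5 * K)) (1 / (4 * K)) with hη'
  have hη'0 : 0 < η' := by positivity
  have hη'1 : η' * (5 * K) ≤ η := by
    rw [← le_div_iff₀ (by positivity)]; exact min_le_left _ _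
  have hη'2 : η' ≤ 1 / (4 * K) := min_le_right _ _
  clear_value η'
  have hη'3 : η' ≤ 1 := hη'2.trans (by rw [div_le_one (by positivity)]; linarith)
  refine ⟨η' / (54 * K ^ 5), by positivity, ?_⟩
  set θ : ℝ := η' / (54 * K ^ 5) with hθ
  have hθ0 : 0 < θ := by positivity
  have hθ5 : 54 * (K ^ 5 * θ) = η' := by rw [hθ]; field_simp
  intro γ ν κ ω k L hν hκ hL hk hω1 hω hρ hρ' hζ
  have hL0 : 0 < L := lt_of_lt_of_le (by positivity) hL
  have hθL : 1 ≤ θ * L := by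
    rw [inv_le_iff_one_le_mul₀ hθ0] at hL; linarith
  have hK5 : 1 ≤ K ^ 5 := one_le_pow₀ hK
  have hθ1 : θ ≤ 1 := by
    rw [hθ, div_le_one (by positivity)]; linarith
  have hL1 : 1 ≤ L := by
    calc 1 ≤ θ * L := hθL
      _ ≤ 1 * L := by gcongr
      _ = L := one_mul L
  set ρ := 1 / ν + 1 / κ with hρd
  have hρ0 : 0 < ρ := by positivity
  have hρνκ : ν * κ * ρ = ν + κ := by rw [hρd]; field_simp; ring
  have hσρ : 4 ≤ (ν + κ) * ρ := four_le_add_mul_inv_add_inv hν hκ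
  clear_value ρ
  obtain ⟨z, hz, hzr, hzn⟩ := exists_sqrt_re (z := k ^ 2 - I * ω * ρ) (by
    have : (k ^ 2 - I * ω * ρ : ℂ).re = k ^ 2 := by
      simp only [Complex.sub_re, Complex.mul_re, Complex.I_re, Complex.I_im, Complex.ofReal_re,
        Complex.ofReal_im, ← Complex.ofReal_pow]
      ring
    rw [this]; positivity)
  have hk2 : k ^ 2 ≤ K ^ 2 := by rw [← sq_abs]; gcongr
  have hz2 : ‖z‖ ^ 2 ≤ (2 * K * L) ^ 2 := by
    rw [← norm_pow, hz]
    refine (norm_sub_le _ _).trans ?_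
    simp only [norm_mul, norm_pow, Complex.norm_I, Complex.norm_real, Real.norm_eq_abs, sq_abs,
      one_mul, abs_of_pos hρ0]
    calc k ^ 2 + |ω| * ρ ≤ K ^ 2 * 1 + 1 * (K * L ^ 2) := by rw [mul_one]; gcongr
      _ ≤ K ^ 2 * L ^ 2 + K ^ 2 * L ^ 2 := by
        have h1 : 1 ≤ L ^ 2 := one_le_pow₀ hL1
        have h2 : K ≤ K ^ 2 := le_self_pow₀ hK (by norm_num)
        rw [one_mul]; gcongr
      _ ≤ (2 * K * L) ^ 2 := by linarith [sq_nonneg (K * L)]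
  have hzle : ‖z‖ ≤ 2 * K * L := le_of_pow_le_pow_left₀ (by norm_num) (by positivity) hz2
  have hzre : K⁻¹ * L / 2 ≤ z.re := by
    refine le_of_pow_le_pow_left₀ (n := 2) (by norm_num) hzr ?_
    have h1 : K⁻¹ * (K⁻¹ * L ^ 2) ≤ ‖(k ^ 2 - I * ω * ρ : ℂ)‖ := by
      calc K⁻¹ * (K⁻¹ * L ^ 2) ≤ |ω| * ρ := by gcongr
        _ = |(k ^ 2 - I * ω * ρ : ℂ).im| := by
          have : (k ^ 2 - I * ω * ρ : ℂ).im = -(ω * ρ) := by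
            simp only [Complex.sub_im, Complex.mul_re, Complex.mul_im, Complex.I_re, Complex.I_im,
              Complex.ofReal_re, Complex.ofReal_im, ← Complex.ofReal_pow]
            ring
          rw [this, abs_neg, abs_mul, abs_of_pos hρ0]
        _ ≤ _ := Complex.abs_im_le_norm _
    linarith [sq_nonneg (K⁻¹ * L)]
  have hzlow : K⁻¹ * L / 2 ≤ ‖z‖ := hzre.trans (Complex.re_le_norm z)
  have hD : z ^ 2 - (k : ℂ) ^ 2 = -(I * ω * ρ) := by rw [hz]; ring
  have hρC : (ν * κ * ρ : ℂ) = ν + κ := by exact_mod_cast hρνκ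
  have hζn : ‖(ω ^ 2 - Real.sin γ ^ 2 : ℂ)‖ ≤ θ := by
    have : (ω ^ 2 - Real.sin γ ^ 2 : ℂ) = ((ω ^ 2 - Real.sin γ ^ 2 : ℝ) : ℂ) := by push_cast; rfl
    rwa [this, Complex.norm_real, Real.norm_eq_abs]
  have hsc : ‖(2 * I * k * Real.sin γ * Real.cos γ : ℂ)‖ ≤ 2 * K := by
    simp only [norm_mul, Complex.norm_two, Complex.norm_I, Complex.norm_real, Real.norm_eq_abs]
    calc 2 * 1 * |k| * |Real.sin γ| * |Real.cos γ| ≤ 2 * 1 * K * 1 * 1 := by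
          gcongr
          · exact Real.abs_sin_le_one _
          · exact Real.abs_cos_le_one _
      _ = 2 * K := by ring
  have hval : charPoly γ ν κ ω k z = (ω ^ 2 - Real.sin γ ^ 2) * z ^ 2
      - 2 * I * k * Real.sin γ * Real.cos γ * z + k ^ 2 * (Real.cos γ ^ 2 - ω ^ 2) := by
    rw [charPoly_eq', hD]
    linear_combination (I ^ 3 * ω ^ 3 * ρ ^ 2) * hρC
  have hder : charDeriv γ ν κ ω k z = 2 * ω ^ 2 * ((ν + κ) * ρ) * z
      + (2 * (ω ^ 2 - Real.sin γ ^ 2) * z - 2 * I * k * Real.sin γ * Real.cos γ) := by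
    rw [charDeriv_eq, hD]
    linear_combination (-6 * I ^ 2 * ω ^ 2 * ρ * z) * hρC
      + (-2 * ω ^ 2 * ρ * (ν + κ) * z) * Complex.I_sq
  have hval' : ‖charPoly γ ν κ ω k z‖ ≤ 9 * K ^ 2 * θ * L ^ 2 := by
    rw [hval]
    refine (norm_add_le _ _).trans ((add_le_add_left (norm_sub_le _ _) _).trans ?_)
    rw [norm_mul _ (z ^ 2), norm_mul _ z, norm_mul _ (Real.cos γ ^ 2 - ω ^ 2 : ℂ), norm_pow,
      norm_pow, Complex.norm_real, Real.norm_eq_abs, sq_abs]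
    have hc := norm_cos_sq_sub_sq_le (γ := γ) hω1
    calc _ ≤ θ * (2 * K * L) ^ 2 + 2 * K * (2 * K * L) + K ^ 2 * 1 := by gcongr
      _ ≤ 4 * K ^ 2 * θ * L ^ 2 + 4 * K ^ 2 * L * (θ * L) + K ^ 2 * ((θ * L) * L) := by
        have h1 : 1 ≤ (θ * L) * L := one_le_mul_of_one_le_of_one_le hθL hL1
        have h2 : 4 * K ^ 2 * L * 1 ≤ 4 * K ^ 2 * L * (θ * L) := by gcongr
        have h3 : K ^ 2 * 1 ≤ K ^ 2 * ((θ * L) * L) := by gcongr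
        linarith
      _ = _ := by ring
  have hder' : K⁻¹ ^ 3 * L ≤ ‖charDeriv γ ν κ ω k z‖ := by
    rw [hder]
    refine le_trans ?_ (norm_sub_le_norm_add _ _)
    have h1 : 8 * K⁻¹ ^ 2 * ‖z‖ ≤ ‖2 * ω ^ 2 * ((ν + κ) * ρ) * z‖ := by
      rw [norm_mul, norm_mul, norm_mul, norm_mul, norm_pow, Complex.norm_two, Complex.norm_real,
        Complex.norm_real, Real.norm_eq_abs, Real.norm_eq_abs, abs_of_pos hρ0,
        norm_ofReal_add_ofReal (by positivity)]
      calc 8 * K⁻¹ ^ 2 * ‖z‖ = 2 * K⁻¹ ^ 2 * 4 * ‖z‖ := by ring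
        _ ≤ _ := by gcongr
    have h2 : ‖2 * (ω ^ 2 - Real.sin γ ^ 2) * z - 2 * I * k * Real.sin γ * Real.cos γ‖
        ≤ 2 * θ * ‖z‖ + 2 * K := by
      refine (norm_sub_le _ _).trans (add_le_add ?_ hsc)
      rw [norm_mul, norm_mul, Complex.norm_two]
      gcongr
    have hKinv : K⁻¹ * K = 1 := by field_simp
    have hKinv1 : K⁻¹ ≤ 1 := inv_le_one_of_one_le₀ hK
    have hKinv0 : 0 < K⁻¹ := by positivity
    have h3 : θ ≤ K⁻¹ ^ 5 / 54 := by
      calc θ = η' * K⁻¹ ^ 5 / 54 := by rw [hθ]; field_simp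
        _ ≤ 1 * K⁻¹ ^ 5 / 54 := by gcongr
        _ = _ := by ring
    have h4 : 2 * K ≤ K⁻¹ ^ 3 * L := by
      calc 2 * K = 2 * K * 1 := by ring
        _ ≤ 2 * K * (θ * L) := by gcongr
        _ ≤ 2 * K * (K⁻¹ ^ 5 / 54 * L) := by gcongr
        _ = K⁻¹ ^ 4 * L / 27 * (K⁻¹ * K) := by ring
        _ = K⁻¹ ^ 3 * L * (K⁻¹ / 27) := by rw [hKinv]; ring
        _ ≤ K⁻¹ ^ 3 * L * 1 := by gcongr; linarith
        _ = _ := mul_one _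
    have h5 : 2 * θ ≤ K⁻¹ ^ 2 := by
      have : K⁻¹ ^ 5 ≤ K⁻¹ ^ 2 := pow_le_pow_of_le_one hKinv0.le hKinv1 (by norm_num)
      linarith [pow_pos hKinv0 5]
    have h6 : 2 * θ * ‖z‖ ≤ K⁻¹ ^ 2 * ‖z‖ := by gcongr
    have h7 : K⁻¹ ^ 2 * (K⁻¹ * L / 2) ≤ K⁻¹ ^ 2 * ‖z‖ := by gcongr
    have h8 : 0 < K⁻¹ ^ 3 * L := by positivity
    linarith
  obtain ⟨w, hw, hwz⟩ := exists_charPoly_root_near γ ν κ ω k (r := η' * L)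
    (norm_pos_iff.1 (lt_of_lt_of_le (by positivity) hder')) (by
      calc 6 * ‖charPoly γ ν κ ω k z‖ ≤ 6 * (9 * K ^ 2 * θ * L ^ 2) := by gcongr
        _ = K⁻¹ ^ 3 * (54 * (K ^ 5 * θ)) * L ^ 2 := by field_simp; ring
        _ = η' * L * (K⁻¹ ^ 3 * L) := by rw [hθ5]; ring
        _ ≤ _ := by gcongr)
  have hηL : η' * L ≤ L := mul_le_of_le_one_left hL0.le hη'3
  have hLK : L ≤ K * L := le_mul_of_one_le_left hL0.le hK
  refine ⟨w, hw, ?_, ?_, ?_⟩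
  · have e : w ^ 2 - k ^ 2 + I * ω * ρ = (w - z) * ((w - z) + 2 * z) := by
      linear_combination hz
    rw [e, norm_mul]
    calc ‖w - z‖ * ‖(w - z) + 2 * z‖ ≤ (η' * L) * (L + 2 * (2 * K * L)) := by
          gcongr
          refine (norm_add_le _ _).trans ?_
          rw [norm_mul, Complex.norm_two]
          gcongr
          exact hwz.trans hηL
      _ ≤ (η' * L) * (5 * K * L) := by
        gcongr
        linarith
      _ = η' * (5 * K) * L ^ 2 := by ring
      _ ≤ η * L ^ 2 := by gcongr
  · have h1 := (abs_le.1 ((Complex.abs_re_le_norm _).trans hwz)).1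
    rw [Complex.sub_re] at h1
    have h2 : η' * L ≤ 1 / (4 * K) * L := by gcongr
    have e : (4 * K)⁻¹ * L = K⁻¹ * L / 4 := by field_simp
    have e' : 1 / (4 * K) * L = K⁻¹ * L / 4 := by field_simp
    linarith
  · calc ‖w‖ = ‖(w - z) + z‖ := by ring_nf
      _ ≤ L + 2 * K * L := (norm_add_le _ _).trans (add_le_add (hwz.trans hηL) hzle)
      _ ≤ 3 * K * L := by linarith

theorem norm_two_I_mul_le {γ k K : ℝ} (hk : |k| ≤ K) :
    ‖(2 * I * k * Real.sin γ * Real.cos γ : ℂ)‖ ≤ 2 * K := by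
  have hK : 0 ≤ K := (abs_nonneg _).trans hk
  simp only [norm_mul, Complex.norm_two, Complex.norm_I, Complex.norm_real, Real.norm_eq_abs]
  calc 2 * 1 * |k| * |Real.sin γ| * |Real.cos γ| ≤ 2 * 1 * K * 1 * 1 := by
        gcongr
        · exact Real.abs_sin_le_one _
        · exact Real.abs_cos_le_one _
    _ = 2 * K := by ring

theorem norm_sq_sub_sin_sq (γ ω : ℝ) :
    ‖(ω ^ 2 - Real.sin γ ^ 2 : ℂ)‖ = |ω ^ 2 - Real.sin γ ^ 2| := by
  have : (ω ^ 2 - Real.sin γ ^ 2 : ℂ) = ((ω ^ 2 - Real.sin γ ^ 2 : ℝ) : ℂ) := by push_cast; rfl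
  rw [this, Complex.norm_real, Real.norm_eq_abs]

/-- The root given by the balance between dissipation and detuning from criticality. -/
theorem exists_moderate_root {K : ℝ} (hK : 1 ≤ K) :
    ∃ θ > 0, ∀ γ ν κ ω k Z T : ℝ, 0 < ν → 0 < κ → |k| ≤ K → |ω| ≤ 1 → K⁻¹ ≤ |ω| →
      |ω ^ 2 - Real.sin γ ^ 2| = Z → 0 < Z → Z ≤ θ → ν + κ ≤ θ ^ 2 * Z ^ 3 → 0 < T →
      (ν + κ) * T ^ 2 = Z →
      ∃ w, charPoly γ ν κ ω k w = 0 ∧ T / 4 ≤ w.re ∧ ‖w‖ ≤ 2 * K * T := by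
  have hK0 : 0 < K := by linarith
  refine ⟨(336 * K ^ 6)⁻¹, by positivity, ?_⟩
  set θ : ℝ := (336 * K ^ 6)⁻¹ with hθ
  have hθ0 : 0 < θ := by positivity
  have hθK : 336 * K ^ 6 * θ = 1 := by rw [hθ]; field_simp
  have hK46 : K ^ 4 ≤ K ^ 6 := pow_le_pow_right₀ hK (by norm_num)
  have hK26 : K ^ 2 ≤ K ^ 6 := pow_le_pow_right₀ hK (by norm_num)
  have hK24 : K ^ 2 ≤ K ^ 4 := pow_le_pow_right₀ hK (by norm_num)
  have hK14 : K ≤ K ^ 4 := le_self_pow₀ hK (by norm_num)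
  have hK12 : K ≤ K ^ 2 := le_self_pow₀ hK (by norm_num)
  have hK6 : 1 ≤ K ^ 6 := one_le_pow₀ hK
  have hθ1 : θ ≤ 1 := inv_le_one_of_one_le₀ (by linarith)
  clear_value θ
  intro γ ν κ ω k Z T hν hκ hk hω1 hω hζ hZ hZθ hσ hT hσT
  have hσ0 : 0 < ν + κ := by positivity
  have hω0 : 0 < |ω| := lt_of_lt_of_le (by positivity) hω
  have hω0' : ω ≠ 0 := abs_pos.1 hω0
  have hZ1 : Z ≤ 1 := hZθ.trans hθ1
  have hZT : 1 ≤ θ * Z * T := by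
    refine le_of_pow_le_pow_left₀ (n := 2) (by norm_num) (by positivity) ?_
    have : (ν + κ) * T ^ 2 ≤ θ ^ 2 * Z ^ 3 * T ^ 2 := by gcongr
    rw [hσT] at this
    have h2 : Z * 1 ≤ Z * (θ * Z * T) ^ 2 := by linarith
    rw [one_pow]
    exact le_of_mul_le_mul_left h2 hZ
  have hθZ : θ * Z ≤ 1 := mul_le_one₀ hθ1 hZ.le hZ1
  have hT1 : 1 ≤ T := hZT.trans (mul_le_of_le_one_left hT.le hθZ)
  have hσθ : ν + κ ≤ θ * Z := by
    calc ν + κ ≤ θ ^ 2 * Z ^ 3 := hσ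
      _ = (θ * Z) * (θ * Z) * Z := by ring
      _ ≤ (θ * Z) * 1 * 1 := by gcongr
      _ = θ * Z := by ring
  set q : ℝ := (ω ^ 2 - Real.sin γ ^ 2) / (ω * (ν + κ)) with hq
  have hqe : ω * (ν + κ) * q = ω ^ 2 - Real.sin γ ^ 2 := by rw [hq]; field_simp
  have hqa : |q| * |ω| = T ^ 2 := by
    have h1 : |ω| * (ν + κ) * |q| = Z := by
      rw [← hζ, ← hqe, abs_mul, abs_mul, abs_of_pos hσ0]
    have h2 : (ν + κ) * (|q| * |ω|) = (ν + κ) * T ^ 2 := by rw [hσT, ← h1]; ring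
    exact mul_left_cancel₀ hσ0.ne' h2
  have hq1 : T ^ 2 ≤ |q| := by
    rw [← hqa]; exact mul_le_of_le_one_right (abs_nonneg _) hω1
  have hq2 : |q| ≤ K * T ^ 2 := by
    rw [← hqa]
    calc |q| = K * (|q| * K⁻¹) := by field_simp
      _ ≤ _ := by gcongr
  clear_value q
  obtain ⟨z, hz, hzr, hzn⟩ := exists_sqrt_re (z := -(I * q)) (by simp)
  have hqn : ‖-(I * q : ℂ)‖ = |q| := by simp
  rw [hqn] at hzn
  have hk2 : k ^ 2 ≤ K ^ 2 := by rw [← sq_abs]; gcongr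
  have hz2 : ‖z‖ ^ 2 = |q| := by rw [← norm_pow, hz, hqn]
  have hz2' : ‖z‖ ^ 2 ≤ K * T ^ 2 := by rw [hz2]; exact hq2
  have hzle : ‖z‖ ≤ K * T := by
    refine le_of_pow_le_pow_left₀ (n := 2) (by norm_num) (by positivity) ?_
    refine hz2'.trans ?_
    rw [mul_pow]
    gcongr
  have hTz : T ≤ ‖z‖ := by
    refine le_of_pow_le_pow_left₀ (n := 2) (by norm_num) (by positivity) ?_
    rw [hz2]; exact hq1
  have hzre : T / 2 ≤ z.re := by
    refine le_of_pow_le_pow_left₀ (n := 2) (by norm_num) hzr ?_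
    have : 0 < T ^ 2 := by positivity
    calc (T / 2) ^ 2 = T ^ 2 / 4 := by ring
      _ ≤ z.re ^ 2 := by linarith
  have hD : ‖z ^ 2 - (k : ℂ) ^ 2‖ ≤ 2 * K ^ 2 * T ^ 2 := by
    refine (norm_sub_le _ _).trans ?_
    rw [norm_pow, norm_pow, Complex.norm_real, Real.norm_eq_abs, sq_abs]
    calc ‖z‖ ^ 2 + k ^ 2 ≤ K ^ 2 * T ^ 2 + K ^ 2 * 1 := by
          rw [mul_one]
          gcongr
          exact hz2'.trans (by gcongr)
      _ ≤ K ^ 2 * T ^ 2 + K ^ 2 * T ^ 2 := by gcongr; exact one_le_pow₀ hT1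
      _ = _ := by ring
  have hqC : (ω * (ν + κ) * q : ℂ) = ω ^ 2 - Real.sin γ ^ 2 := by exact_mod_cast hqe
  have hσn : ‖(ν + κ : ℂ)‖ = ν + κ := norm_ofReal_add_ofReal hσ0.le
  have hνκn : ‖(ν * κ : ℂ)‖ = ν * κ := norm_ofReal_mul_ofReal (by positivity)
  have hνκ : ν * κ ≤ (ν + κ) ^ 2 := by
    calc ν * κ ≤ (ν + κ) * (ν + κ) := by gcongr <;> linarith
      _ = _ := by ring
  have hsc := norm_two_I_mul_le (γ := γ) hk
  have hval : charPoly γ ν κ ω k z = (-(ν * κ * (z ^ 2 - k ^ 2) ^ 3)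
      + I * ω * (ν + κ) * (2 * k ^ 2 * z ^ 2 - k ^ 4))
      + (-(2 * I * k * Real.sin γ * Real.cos γ * z) + k ^ 2 * (Real.cos γ ^ 2 - ω ^ 2)) := by
    rw [charPoly_eq']
    linear_combination (-I * ω * (ν + κ) * z ^ 2) * hz - z ^ 2 * hqC
      + (ω * (ν + κ) * q * z ^ 2) * Complex.I_sq
  have hder : charDeriv γ ν κ ω k z = -(2 * (ω ^ 2 - Real.sin γ ^ 2) * z)
      - ((6 * (ν * κ) * z * (z ^ 2 - k ^ 2) ^ 2 - 4 * I * ω * (ν + κ) * k ^ 2 * z)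
        + 2 * I * k * Real.sin γ * Real.cos γ) := by
    rw [charDeriv_eq]
    linear_combination (-4 * I * ω * (ν + κ) * z) * hz - 4 * z * hqC
      + (4 * ω * (ν + κ) * q * z) * Complex.I_sq
  have hZ2 : (ν + κ) ^ 2 * T ^ 4 ≤ θ * Z := by
    calc (ν + κ) ^ 2 * T ^ 4 = ((ν + κ) * T ^ 2) ^ 2 := by ring
      _ = Z * Z := by rw [hσT]; ring
      _ ≤ θ * Z := by gcongr
  have hval' : ‖charPoly γ ν κ ω k z‖ ≤ 14 * K ^ 6 * θ * Z * T ^ 2 := by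
    rw [hval]
    refine (norm_add_le _ _).trans ((add_le_add (norm_add_le _ _) (norm_add_le _ _)).trans ?_)
    have h1 : ‖-(ν * κ * (z ^ 2 - k ^ 2) ^ 3 : ℂ)‖ ≤ 8 * K ^ 6 * (θ * Z * T ^ 2) := by
      rw [norm_neg, norm_mul, hνκn, norm_pow]
      calc ν * κ * ‖(z ^ 2 - k ^ 2 : ℂ)‖ ^ 3 ≤ (ν + κ) ^ 2 * (2 * K ^ 2 * T ^ 2) ^ 3 := by gcongr
        _ = 8 * K ^ 6 * ((ν + κ) ^ 2 * T ^ 4) * T ^ 2 := by ring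
        _ ≤ 8 * K ^ 6 * (θ * Z) * T ^ 2 := by gcongr
        _ = _ := by ring
    have h2 : ‖(I * ω * (ν + κ) * (2 * k ^ 2 * z ^ 2 - k ^ 4) : ℂ)‖ ≤
        3 * K ^ 6 * (θ * Z * T ^ 2) := by
      have h3 : ‖(2 * k ^ 2 * z ^ 2 - k ^ 4 : ℂ)‖ ≤ 3 * K ^ 4 * T ^ 2 := by
        refine (norm_sub_le _ _).trans ?_
        simp only [norm_mul, norm_pow, Complex.norm_real, Real.norm_eq_abs, Complex.norm_two]
        calc 2 * |k| ^ 2 * ‖z‖ ^ 2 + |k| ^ 4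
            ≤ 2 * K ^ 2 * (K * T) ^ 2 + K ^ 4 * 1 := by rw [mul_one]; gcongr
          _ ≤ 2 * K ^ 2 * (K * T) ^ 2 + K ^ 4 * T ^ 2 := by gcongr; exact one_le_pow₀ hT1
          _ = _ := by ring
      rw [norm_mul, norm_mul, norm_mul, Complex.norm_I, one_mul, Complex.norm_real, hσn,
        Real.norm_eq_abs]
      calc |ω| * (ν + κ) * ‖(2 * k ^ 2 * z ^ 2 - k ^ 4 : ℂ)‖
          ≤ 1 * (θ * Z) * (3 * K ^ 4 * T ^ 2) := by gcongr
        _ ≤ 1 * (θ * Z) * (3 * K ^ 6 * T ^ 2) := by gcongr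
        _ = _ := by ring
    have h4 : ‖-(2 * I * k * Real.sin γ * Real.cos γ * z : ℂ)‖ ≤ 2 * K ^ 6 * (θ * Z * T ^ 2) := by
      rw [norm_neg, norm_mul]
      calc _ ≤ 2 * K * (K * T) := by gcongr
        _ = 2 * K ^ 2 * T * 1 := by ring
        _ ≤ 2 * K ^ 6 * T * (θ * Z * T) := by gcongr
        _ = _ := by ring
    have h5 : ‖(k ^ 2 * (Real.cos γ ^ 2 - ω ^ 2) : ℂ)‖ ≤ K ^ 6 * (θ * Z * T ^ 2) := by
      rw [norm_mul, norm_pow, Complex.norm_real, Real.norm_eq_abs, sq_abs]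
      calc k ^ 2 * ‖(Real.cos γ ^ 2 - ω ^ 2 : ℂ)‖ ≤ K ^ 2 * 1 := by
            gcongr; exact norm_cos_sq_sub_sq_le hω1
        _ ≤ K ^ 6 * ((θ * Z * T) * T) := by
          gcongr; exact one_le_mul_of_one_le_of_one_le hZT hT1
        _ = _ := by ring
    linarith
  have hder' : Z * T ≤ ‖charDeriv γ ν κ ω k z‖ := by
    rw [hder]
    refine le_trans ?_ (norm_sub_norm_le _ _)
    have h0 : ‖-(2 * (ω ^ 2 - Real.sin γ ^ 2) * z : ℂ)‖ = 2 * Z * ‖z‖ := by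
      rw [norm_neg, norm_mul, norm_mul, norm_sq_sub_sin_sq, hζ, Complex.norm_two]
    have h1 : ‖(6 * (ν * κ) * z * (z ^ 2 - k ^ 2) ^ 2 : ℂ)‖ ≤ 24 * K ^ 6 * θ * (Z * ‖z‖) := by
      have e6 : ‖(6 : ℂ)‖ = 6 := by norm_num
      rw [norm_mul, norm_mul, norm_mul, norm_pow, hνκn, e6]
      calc 6 * (ν * κ) * ‖z‖ * ‖z ^ 2 - (k : ℂ) ^ 2‖ ^ 2
          ≤ 6 * (ν + κ) ^ 2 * ‖z‖ * (2 * K ^ 2 * T ^ 2) ^ 2 := by gcongr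
        _ = 24 * K ^ 4 * ((ν + κ) ^ 2 * T ^ 4) * ‖z‖ := by ring
        _ ≤ 24 * K ^ 6 * (θ * Z) * ‖z‖ := by gcongr
        _ = _ := by ring
    have h2 : ‖(4 * I * ω * (ν + κ) * k ^ 2 * z : ℂ)‖ ≤ 4 * K ^ 6 * θ * (Z * ‖z‖) := by
      have e4 : ‖(4 : ℂ)‖ = 4 := by norm_num
      rw [norm_mul, norm_mul, norm_mul, norm_mul, norm_mul, norm_pow, hσn, e4, Complex.norm_I,
        Complex.norm_real, Complex.norm_real, Real.norm_eq_abs, Real.norm_eq_abs, sq_abs]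
      calc 4 * 1 * |ω| * (ν + κ) * k ^ 2 * ‖z‖
          ≤ 4 * 1 * 1 * (θ * Z) * K ^ 6 * ‖z‖ := by
            gcongr; exact hk2.trans hK26
        _ = _ := by ring
    have h3 : ‖(2 * I * k * Real.sin γ * Real.cos γ : ℂ)‖ ≤ 2 * K ^ 6 * θ * (Z * ‖z‖) := by
      calc _ ≤ 2 * K * 1 := by rw [mul_one]; exact hsc
        _ ≤ 2 * K ^ 6 * (θ * Z * T) := by gcongr; exact hK12.trans hK26
        _ ≤ 2 * K ^ 6 * (θ * Z * ‖z‖) := by gcongr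
        _ = _ := by ring
    have h4 := norm_add_le (6 * (ν * κ) * z * (z ^ 2 - k ^ 2) ^ 2
      - 4 * I * ω * (ν + κ) * k ^ 2 * z : ℂ) (2 * I * k * Real.sin γ * Real.cos γ)
    have h5 := norm_sub_le (6 * (ν * κ) * z * (z ^ 2 - k ^ 2) ^ 2 : ℂ)
      (4 * I * ω * (ν + κ) * k ^ 2 * z)
    have h6 : 30 * K ^ 6 * θ * (Z * ‖z‖) ≤ 1 * (Z * ‖z‖) := by
      gcongr
      linarith
    have h7 : Z * T ≤ Z * ‖z‖ := by gcongr
    linarith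
  obtain ⟨w, hw, hwz⟩ := exists_charPoly_root_near γ ν κ ω k (r := T / 4)
    (norm_pos_iff.1 (lt_of_lt_of_le (by positivity) hder')) (by
      calc 6 * ‖charPoly γ ν κ ω k z‖ ≤ 6 * (14 * K ^ 6 * θ * Z * T ^ 2) := by gcongr
        _ = T / 4 * (336 * K ^ 6 * θ * (Z * T)) := by ring
        _ = T / 4 * (Z * T) := by rw [hθK, one_mul]
        _ ≤ _ := by gcongr)
  refine ⟨w, hw, ?_, ?_⟩
  · have h1 := (abs_le.1 ((Complex.abs_re_le_norm _).trans hwz)).1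
    rw [Complex.sub_re] at h1
    linarith
  · have hKT : T ≤ K * T := le_mul_of_one_le_left hT.le hK
    calc ‖w‖ = ‖(w - z) + z‖ := by ring_nf
      _ ≤ T / 4 + K * T := (norm_add_le _ _).trans (add_le_add hwz hzle)
      _ ≤ 2 * K * T := by linarith

theorem exists_root_near_imaginary {K p η : ℝ} (hK : 1 ≤ K) (hp : 0 < p) (hη : 0 < η) :
    ∃ θ > 0, ∀ γ ν κ ω k Z ζ : ℝ, Real.sin γ * Real.cos γ = p → 0 < ν → 0 < κ → |k| ≤ K →
      |ω| ≤ 1 → K⁻¹ ≤ |k| → ω ^ 2 - Real.sin γ ^ 2 = ζ → |ζ| = Z → 0 < Z → Z ≤ θ →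
      ν + κ ≤ θ * Z ^ 3 →
      ∃ w, charPoly γ ν κ ω k w = 0 ∧ ‖w - 2 * I * k * p / ζ‖ ≤ η / Z := by
  have hK0 : 0 < K := by linarith
  refine ⟨min 1 (min (K⁻¹ * p / (340 * K ^ 6)) (η * (K⁻¹ * p) / (906 * K ^ 6))), by positivity, ?_⟩
  set θ : ℝ := min 1 (min (K⁻¹ * p / (340 * K ^ 6)) (η * (K⁻¹ * p) / (906 * K ^ 6))) with hθ
  have hθ0 : 0 < θ := by positivity
  have hθ1 : θ ≤ 1 := min_le_left _ _
  have hθ2 : θ * (340 * K ^ 6) ≤ K⁻¹ * p := by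
    rw [← le_div_iff₀ (by positivity)]; exact (min_le_right _ _).trans (min_le_left _ _)
  have hθ3 : θ * (906 * K ^ 6) ≤ η * (K⁻¹ * p) := by
    rw [← le_div_iff₀ (by positivity)]; exact (min_le_right _ _).trans (min_le_right _ _)
  clear_value θ
  have hK46 : K ^ 4 ≤ K ^ 6 := pow_le_pow_right₀ hK (by norm_num)
  have hK26 : K ^ 2 ≤ K ^ 6 := pow_le_pow_right₀ hK (by norm_num)
  have hK56 : K ^ 5 ≤ K ^ 6 := pow_le_pow_right₀ hK (by norm_num)
  have hK36 : K ^ 3 ≤ K ^ 6 := pow_le_pow_right₀ hK (by norm_num)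
  intro γ ν κ ω k Z ζ hpγ hν hκ hk hω1 hk' hζe hζZ hZ hZθ hσ
  have hp1 : p ≤ 1 := by
    rw [← hpγ]
    calc Real.sin γ * Real.cos γ ≤ |Real.sin γ * Real.cos γ| := le_abs_self _
      _ = |Real.sin γ| * |Real.cos γ| := abs_mul _ _
      _ ≤ 1 * 1 := by
        gcongr
        · exact Real.abs_sin_le_one _
        · exact Real.abs_cos_le_one _
      _ = 1 := one_mul 1
  have hσ0 : 0 < ν + κ := by positivity
  have hZ1 : Z ≤ 1 := hZθ.trans hθ1
  have hζ0 : ζ ≠ 0 := by rintro rfl; simp at hζZ; linarith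
  have hζC : (ω ^ 2 - Real.sin γ ^ 2 : ℂ) = ζ := by exact_mod_cast hζe
  have hpC : (Real.sin γ * Real.cos γ : ℂ) = p := by exact_mod_cast hpγ
  have hζC0 : (ζ : ℂ) ≠ 0 := by exact_mod_cast hζ0
  have hk2 : k ^ 2 ≤ K ^ 2 := by rw [← sq_abs]; gcongr
  set z : ℂ := 2 * I * k * p / ζ with hz
  have hzζ : ζ * z = 2 * I * k * p := by rw [hz]; field_simp
  have hzn : ‖z‖ = 2 * |k| * p / Z := by
    rw [hz]
    simp only [norm_div, norm_mul, Complex.norm_two, Complex.norm_I, Complex.norm_real,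
      Real.norm_eq_abs, hζZ, abs_of_pos hp, mul_one]
  have hzle : ‖z‖ ≤ 2 * K / Z := by
    rw [hzn]
    calc 2 * |k| * p / Z ≤ 2 * K * 1 / Z := by gcongr
      _ = _ := by ring
  clear_value z
  have hinv : 1 ≤ θ * Z⁻¹ := by rw [← div_eq_mul_inv, le_div_iff₀ hZ]; linarith
  have hinv1 : 1 ≤ Z⁻¹ := (one_le_inv₀ hZ).2 hZ1
  have hD : ‖z ^ 2 - (k : ℂ) ^ 2‖ ≤ 5 * K ^ 2 * Z⁻¹ ^ 2 := by
    refine (norm_sub_le _ _).trans ?_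
    rw [norm_pow, norm_pow, Complex.norm_real, Real.norm_eq_abs, sq_abs]
    calc ‖z‖ ^ 2 + k ^ 2 ≤ (2 * K / Z) ^ 2 + K ^ 2 * 1 := by rw [mul_one]; gcongr
      _ ≤ (2 * K / Z) ^ 2 + K ^ 2 * Z⁻¹ ^ 2 := by gcongr; exact one_le_pow₀ hinv1
      _ = _ := by ring
  have hσn : ‖(ν + κ : ℂ)‖ = ν + κ := norm_ofReal_add_ofReal hσ0.le
  have hνκn : ‖(ν * κ : ℂ)‖ = ν * κ := norm_ofReal_mul_ofReal (by positivity)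
  have hνκ : ν * κ ≤ (ν + κ) ^ 2 := by
    calc ν * κ ≤ (ν + κ) * (ν + κ) := by gcongr <;> linarith
      _ = _ := by ring
  have hval : charPoly γ ν κ ω k z = -(ν * κ * (z ^ 2 - k ^ 2) ^ 3)
      + -(I * ω * (ν + κ) * (z ^ 2 - k ^ 2) ^ 2) + k ^ 2 * (Real.cos γ ^ 2 - ω ^ 2) := by
    rw [charPoly_eq']
    linear_combination z ^ 2 * hζC + z * hzζ - 2 * I * k * z * hpC
  have hder : charDeriv γ ν κ ω k z = 2 * I * k * p
      - (6 * (ν * κ) * z * (z ^ 2 - k ^ 2) ^ 2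
        + 4 * I * ω * (ν + κ) * z * (z ^ 2 - k ^ 2)) := by
    rw [charDeriv_eq]
    linear_combination 2 * z * hζC + 2 * hzζ - 2 * I * k * hpC
  have hs2 : (ν + κ) ^ 2 ≤ θ ^ 2 * Z ^ 6 := by
    calc (ν + κ) ^ 2 ≤ (θ * Z ^ 3) ^ 2 := by gcongr
      _ = _ := by ring
  have hval' : ‖charPoly γ ν κ ω k z‖ ≤ 151 * K ^ 6 * θ * Z⁻¹ := by
    rw [hval]
    refine (norm_add₃_le).trans ?_
    have h1 : ‖-(ν * κ * (z ^ 2 - k ^ 2) ^ 3 : ℂ)‖ ≤ 125 * K ^ 6 * (θ * Z⁻¹) := by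
      rw [norm_neg, norm_mul, hνκn, norm_pow]
      calc ν * κ * ‖(z ^ 2 - k ^ 2 : ℂ)‖ ^ 3
          ≤ (ν + κ) ^ 2 * (5 * K ^ 2 * Z⁻¹ ^ 2) ^ 3 := by gcongr
        _ ≤ (θ ^ 2 * Z ^ 6) * (5 * K ^ 2 * Z⁻¹ ^ 2) ^ 3 := by gcongr
        _ = 125 * K ^ 6 * (θ * θ) := by field_simp; ring
        _ ≤ 125 * K ^ 6 * (θ * Z⁻¹) := by gcongr; linarith
    have h2 : ‖-(I * ω * (ν + κ) * (z ^ 2 - k ^ 2) ^ 2 : ℂ)‖ ≤ 25 * K ^ 6 * (θ * Z⁻¹) := by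
      rw [norm_neg, norm_mul, norm_mul, norm_mul, norm_pow, Complex.norm_I, one_mul,
        Complex.norm_real, hσn, Real.norm_eq_abs]
      calc |ω| * (ν + κ) * ‖(z ^ 2 - k ^ 2 : ℂ)‖ ^ 2
          ≤ 1 * (θ * Z ^ 3) * (5 * K ^ 2 * Z⁻¹ ^ 2) ^ 2 := by gcongr
        _ = 25 * K ^ 4 * (θ * Z⁻¹) := by field_simp; ring
        _ ≤ _ := by gcongr
    have h5 : ‖(k ^ 2 * (Real.cos γ ^ 2 - ω ^ 2) : ℂ)‖ ≤ K ^ 6 * (θ * Z⁻¹) := by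
      rw [norm_mul, norm_pow, Complex.norm_real, Real.norm_eq_abs, sq_abs]
      calc k ^ 2 * ‖(Real.cos γ ^ 2 - ω ^ 2 : ℂ)‖ ≤ K ^ 2 * 1 := by
            gcongr; exact norm_cos_sq_sub_sq_le hω1
        _ ≤ K ^ 6 * (θ * Z⁻¹) := by gcongr
    linarith
  have hder' : K⁻¹ * p ≤ ‖charDeriv γ ν κ ω k z‖ := by
    rw [hder]
    refine le_trans ?_ (norm_sub_norm_le _ _)
    have h0 : 2 * (K⁻¹ * p) ≤ ‖(2 * I * k * p : ℂ)‖ := by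
      simp only [norm_mul, Complex.norm_two, Complex.norm_I, Complex.norm_real,
        Real.norm_eq_abs, abs_of_pos hp, mul_one]
      calc 2 * (K⁻¹ * p) = 2 * K⁻¹ * p := by ring
        _ ≤ _ := by gcongr
    have h1 : ‖(6 * (ν * κ) * z * (z ^ 2 - k ^ 2) ^ 2 : ℂ)‖ ≤ 300 * K ^ 6 * θ := by
      have e6 : ‖(6 : ℂ)‖ = 6 := by norm_num
      rw [norm_mul, norm_mul, norm_mul, norm_pow, hνκn, e6]
      calc 6 * (ν * κ) * ‖z‖ * ‖z ^ 2 - (k : ℂ) ^ 2‖ ^ 2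
          ≤ 6 * (ν + κ) ^ 2 * (2 * K / Z) * (5 * K ^ 2 * Z⁻¹ ^ 2) ^ 2 := by gcongr
        _ ≤ 6 * (θ ^ 2 * Z ^ 6) * (2 * K / Z) * (5 * K ^ 2 * Z⁻¹ ^ 2) ^ 2 := by gcongr
        _ = 300 * K ^ 5 * (θ * θ * Z) := by field_simp; ring
        _ ≤ 300 * K ^ 6 * (θ * 1 * 1) := by gcongr
        _ = _ := by ring
    have h2 : ‖(4 * I * ω * (ν + κ) * z * (z ^ 2 - k ^ 2) : ℂ)‖ ≤ 40 * K ^ 6 * θ := by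
      have e4 : ‖(4 : ℂ)‖ = 4 := by norm_num
      rw [norm_mul, norm_mul, norm_mul, norm_mul, norm_mul, hσn, e4, Complex.norm_I,
        Complex.norm_real, Real.norm_eq_abs]
      calc 4 * 1 * |ω| * (ν + κ) * ‖z‖ * ‖(z ^ 2 - k ^ 2 : ℂ)‖
          ≤ 4 * 1 * 1 * (θ * Z ^ 3) * (2 * K / Z) * (5 * K ^ 2 * Z⁻¹ ^ 2) := by gcongr
        _ = 40 * K ^ 3 * θ := by field_simp; ring
        _ ≤ _ := by gcongr
    have h3 := norm_add_le (6 * (ν * κ) * z * (z ^ 2 - k ^ 2) ^ 2 : ℂ)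
      (4 * I * ω * (ν + κ) * z * (z ^ 2 - k ^ 2))
    linarith
  exact exists_charPoly_root_near γ ν κ ω k (r := η / Z)
    (norm_pos_iff.1 (lt_of_lt_of_le (by positivity) hder')) (by
      calc 6 * ‖charPoly γ ν κ ω k z‖ ≤ 6 * (151 * K ^ 6 * θ * Z⁻¹) := by gcongr
        _ = θ * (906 * K ^ 6) * Z⁻¹ := by ring
        _ ≤ η * (K⁻¹ * p) * Z⁻¹ := by gcongr
        _ = η / Z * (K⁻¹ * p) := by ring
        _ ≤ _ := by gcongr)

/-- The imaginary part of the characteristic equation. -/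
theorem re_mul_of_charPoly_eq_zero {γ ν κ ω k p ζ : ℝ} {w : ℂ}
    (hp : Real.sin γ * Real.cos γ = p) (hζ : ω ^ 2 - Real.sin γ ^ 2 = ζ)
    (h : charPoly γ ν κ ω k w = 0) :
    2 * w.re * (ζ * w.im - k * p) =
      ω * (ν + κ) * ((w ^ 2 - k ^ 2) ^ 2).re + ν * κ * ((w ^ 2 - k ^ 2) ^ 3).im := by
  have hζC : (ω ^ 2 - Real.sin γ ^ 2 : ℂ) = ζ := by exact_mod_cast hζ
  have hpC : (Real.sin γ * Real.cos γ : ℂ) = p := by exact_mod_cast hp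
  rw [charPoly_eq'] at h
  have h' : ((ν * κ : ℝ) : ℂ) * (w ^ 2 - k ^ 2) ^ 3
      + ((ω * (ν + κ) : ℝ) : ℂ) * (I * (w ^ 2 - k ^ 2) ^ 2)
      - (ζ : ℂ) * w ^ 2 + ((2 * k * p : ℝ) : ℂ) * (I * w)
        + ((k ^ 2 * (ω ^ 2 - Real.cos γ ^ 2) : ℝ) : ℂ) = 0 := by
    simp only [Complex.ofReal_mul, Complex.ofReal_add, Complex.ofReal_sub, Complex.ofReal_pow,
      Complex.ofReal_ofNat]
    linear_combination -h + w ^ 2 * hζC - 2 * k * I * w * hpC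
  generalize (w ^ 2 - (k : ℂ) ^ 2) ^ 3 = D3 at *
  generalize (w ^ 2 - (k : ℂ) ^ 2) ^ 2 = D2 at *
  have := congrArg Complex.im h'
  simp only [Complex.add_im, Complex.sub_im, Complex.mul_im, Complex.I_re,
    Complex.I_im, Complex.ofReal_im, Complex.ofReal_re, Complex.zero_im, sq w] at this
  linarith

set_option maxHeartbeats 1000000 in
/-- The root given by the balance of the inviscid terms; it is imaginary at leading order. -/
theorem exists_oscillating_root {K p : ℝ} (hK : 1 ≤ K) (hp : 0 < p) :
    ∃ δ > 0, ∃ θ > 0, ∀ γ ν κ ω k Z : ℝ, Real.sin γ * Real.cos γ = p → 0 < ν → 0 < κ →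
      |k| ≤ K → |ω| ≤ 1 → K⁻¹ ≤ |ω| → K⁻¹ ≤ k * ω → |ω ^ 2 - Real.sin γ ^ 2| = Z → 0 < Z →
      Z ≤ θ → ν + κ ≤ θ * Z ^ 3 →
      ∃ w, charPoly γ ν κ ω k w = 0 ∧ δ * ((ν + κ) / Z ^ 4) ≤ w.re ∧
        w.re ≤ δ⁻¹ * ((ν + κ) / Z ^ 4) ∧ δ / Z ≤ ‖w‖ ∧ ‖w‖ ≤ δ⁻¹ / Z := by
  have hK0 : 0 < K := by linarith
  have hKinv0 : 0 < K⁻¹ := by positivity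
  have hKinv1 : K⁻¹ ≤ 1 := inv_le_one_of_one_le₀ hK
  set η : ℝ := min 1 (min (K⁻¹ * p / 2) (K⁻¹ ^ 2 * p ^ 2 / (20 * K))) with hη
  have hη0 : 0 < η := by positivity
  have hη1 : η ≤ 1 := min_le_left _ _
  have hη2 : η ≤ K⁻¹ * p / 2 := (min_le_right _ _).trans (min_le_left _ _)
  have hη3 : η * (20 * K) ≤ K⁻¹ ^ 2 * p ^ 2 := by
    rw [← le_div_iff₀ (by positivity)]; exact (min_le_right _ _).trans (min_le_right _ _)
  clear_value η
  obtain ⟨θ₁, hθ₁, hnear⟩ := exists_root_near_imaginary hK hp hη0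
  set θ : ℝ := min θ₁ (min 1 (min (K⁻¹ ^ 2 * p ^ 2 / (4 * K ^ 2)) (K⁻¹ ^ 2 / (32 * K ^ 2))))
    with hθ
  have hθ0 : 0 < θ := by positivity
  have hθθ₁ : θ ≤ θ₁ := min_le_left _ _
  have hθ1 : θ ≤ 1 := (min_le_right _ _).trans (min_le_left _ _)
  have hθ2 : θ * (4 * K ^ 2) ≤ K⁻¹ ^ 2 * p ^ 2 := by
    rw [← le_div_iff₀ (by positivity)]
    exact (min_le_right _ _).trans ((min_le_right _ _).trans (min_le_left _ _))
  have hθ3 : θ * (32 * K ^ 2) ≤ K⁻¹ ^ 2 := by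
    rw [← le_div_iff₀ (by positivity)]
    exact (min_le_right _ _).trans ((min_le_right _ _).trans (min_le_right _ _))
  clear_value θ
  set c₁ : ℝ := K⁻¹ ^ 2 * (4 * K⁻¹ ^ 2 * p ^ 2) ^ 2 / (12 * K) with hc₁
  set c₂ : ℝ := 2 * (4 * K ^ 2) ^ 2 / (K⁻¹ * p) with hc₂
  have hc₁0 : 0 < c₁ := by positivity
  have hc₂0 : 0 < c₂ := by positivity
  refine ⟨min (min c₁ c₂⁻¹) (min (K⁻¹ * p) (3 * K)⁻¹), by positivity, θ, hθ0, ?_⟩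
  set δ : ℝ := min (min c₁ c₂⁻¹) (min (K⁻¹ * p) (3 * K)⁻¹) with hδ
  have hδ0 : 0 < δ := by positivity
  have hδ1 : δ ≤ c₁ := (min_le_left _ _).trans (min_le_left _ _)
  have hδ2 : c₂ ≤ δ⁻¹ := by
    rw [le_inv_comm₀ hc₂0 hδ0]; exact (min_le_left _ _).trans (min_le_right _ _)
  have hδ3 : δ ≤ K⁻¹ * p := (min_le_right _ _).trans (min_le_left _ _)
  have hδ4 : 3 * K ≤ δ⁻¹ := by
    rw [le_inv_comm₀ (by positivity) hδ0]; exact (min_le_right _ _).trans (min_le_right _ _)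
  clear_value δ
  intro γ ν κ ω k Z hpγ hν hκ hk hω1 hω hkω hζZ hZ hZθ hσ
  have hp1 : p ≤ 1 := by
    rw [← hpγ]
    calc Real.sin γ * Real.cos γ ≤ |Real.sin γ * Real.cos γ| := le_abs_self _
      _ = |Real.sin γ| * |Real.cos γ| := abs_mul _ _
      _ ≤ 1 * 1 := by
        gcongr
        · exact Real.abs_sin_le_one _
        · exact Real.abs_cos_le_one _
      _ = 1 := one_mul 1
  have hσ0 : 0 < ν + κ := by positivity
  have hZ1 : Z ≤ 1 := hZθ.trans hθ1
  have hkK : K⁻¹ ≤ |k| := by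
    calc K⁻¹ ≤ |k * ω| := hkω.trans (le_abs_self _)
      _ = |k| * |ω| := abs_mul _ _
      _ ≤ |k| * 1 := by gcongr
      _ = |k| := mul_one _
  have hkω' : k * ω ≤ K := by
    calc k * ω ≤ |k * ω| := le_abs_self _
      _ = |k| * |ω| := abs_mul _ _
      _ ≤ K * 1 := by gcongr
      _ = K := mul_one _
  obtain ⟨ζ, hζe⟩ : ∃ ζ, ω ^ 2 - Real.sin γ ^ 2 = ζ := ⟨_, rfl⟩
  rw [hζe] at hζZ
  have hζ0 : ζ ≠ 0 := by rintro rfl; simp at hζZ; linarith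
  have hζC0 : (ζ : ℂ) ≠ 0 := by exact_mod_cast hζ0
  obtain ⟨w, hw, hwz⟩ := hnear γ ν κ ω k Z ζ hpγ hν hκ hk hω1 hkK hζe hζZ hZ (hZθ.trans hθθ₁)
    (hσ.trans (by gcongr))
  have hre := re_mul_of_charPoly_eq_zero hpγ hζe hw
  set τ : ℝ := 2 * k * p / ζ with hτ
  have hzτ : 2 * I * k * p / ζ = I * τ := by rw [hτ]; push_cast; ring
  rw [hzτ] at hwz
  have hτa : |τ| = 2 * |k| * p / Z := by
    rw [hτ, abs_div, abs_mul, abs_mul, abs_of_pos hp, hζZ, abs_two]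
  have hτζ : ζ * τ = 2 * k * p := by rw [hτ]; field_simp
  obtain ⟨t, ht⟩ : ∃ t, t = 4 * k ^ 2 * p ^ 2 := ⟨_, rfl⟩
  have htτ : τ ^ 2 = t / Z ^ 2 := by
    rw [← sq_abs, hτa, div_pow, mul_pow, mul_pow, sq_abs, ht]; ring
  have ht1 : 4 * K⁻¹ ^ 2 * p ^ 2 ≤ t := by
    rw [ht, ← sq_abs k]; gcongr
  have ht2 : t ≤ 4 * K ^ 2 := by
    rw [ht, ← sq_abs k]
    calc 4 * |k| ^ 2 * p ^ 2 ≤ 4 * K ^ 2 * 1 ^ 2 := by gcongr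
      _ = _ := by ring
  have ht0 : 0 < t := lt_of_lt_of_le (by positivity) ht1
  have hτle : |τ| ≤ 2 * K / Z := by
    rw [hτa]
    calc 2 * |k| * p / Z ≤ 2 * K * 1 / Z := by gcongr
      _ = _ := by ring
  have hτge : 2 * (K⁻¹ * p) / Z ≤ |τ| := by
    rw [hτa, ← mul_assoc]
    gcongr
  have hIτ : ‖(I * τ : ℂ)‖ = |τ| := by simp
  clear_value τ
  have hDt : ‖w ^ 2 - (k : ℂ) ^ 2 + ((t / Z ^ 2 : ℝ) : ℂ)‖ ≤ t / 8 / Z ^ 2 := by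
    have e : w ^ 2 - (k : ℂ) ^ 2 + ((t / Z ^ 2 : ℝ) : ℂ) =
        (w - I * τ) * ((w - I * τ) + 2 * (I * τ)) - k ^ 2 := by
      rw [← htτ]; push_cast
      linear_combination (τ ^ 2 : ℂ) * Complex.I_sq
    rw [e]
    refine (norm_sub_le _ _).trans ?_
    rw [norm_mul, norm_pow, Complex.norm_real, Real.norm_eq_abs]
    have h1 : ‖(w - I * τ) + 2 * (I * τ)‖ ≤ η / Z + 2 * (2 * K / Z) := by
      refine (norm_add_le _ _).trans ?_
      rw [norm_mul _ (I * τ : ℂ), hIτ, Complex.norm_two]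
      gcongr
    calc ‖w - I * τ‖ * ‖(w - I * τ) + 2 * (I * τ)‖ + |k| ^ 2
        ≤ η / Z * (η / Z + 2 * (2 * K / Z)) + K ^ 2 := by gcongr
      _ = (η * (η + 4 * K) + K ^ 2 * Z * Z) / Z ^ 2 := by field_simp; ring
      _ ≤ (η * (1 + 4 * K) + K ^ 2 * θ * 1) / Z ^ 2 := by gcongr
      _ ≤ (t / 8) / Z ^ 2 := by
        gcongr
        have : η * 1 ≤ η * K := by gcongr
        linarith
  set D : ℂ := w ^ 2 - (k : ℂ) ^ 2 with hD
  clear_value D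
  have hDn : ‖D‖ ≤ 9 / 8 * t / Z ^ 2 := by
    calc ‖D‖ = ‖(D + ((t / Z ^ 2 : ℝ) : ℂ)) - ((t / Z ^ 2 : ℝ) : ℂ)‖ := by ring_nf
      _ ≤ t / 8 / Z ^ 2 + t / Z ^ 2 := by
        refine (norm_sub_le _ _).trans (add_le_add hDt ?_)
        rw [Complex.norm_real, Real.norm_eq_abs, abs_of_pos (by positivity)]
      _ = _ := by ring
  have hD2 : ‖D ^ 2 - (((t / Z ^ 2) ^ 2 : ℝ) : ℂ)‖ ≤ t ^ 2 / 2 / Z ^ 4 := by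
    have e : D ^ 2 - (((t / Z ^ 2) ^ 2 : ℝ) : ℂ) =
        (D + ((t / Z ^ 2 : ℝ) : ℂ)) * (D - ((t / Z ^ 2 : ℝ) : ℂ)) := by push_cast; ring
    rw [e, norm_mul]
    calc _ ≤ t / 8 / Z ^ 2 * (9 / 8 * t / Z ^ 2 + t / Z ^ 2) := by
          gcongr
          refine (norm_sub_le _ _).trans (add_le_add hDn ?_)
          rw [Complex.norm_real, Real.norm_eq_abs, abs_of_pos (by positivity)]
      _ = 17 / 64 * (t ^ 2 / Z ^ 4) := by field_simp; ring
      _ ≤ 1 / 2 * (t ^ 2 / Z ^ 4) 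
          := mul_le_mul_of_nonneg_right (by norm_num) (by positivity)
      _ = _ := by ring
  have hD2re := abs_le.1 ((Complex.abs_re_le_norm _).trans hD2)
  rw [Complex.sub_re, Complex.ofReal_re] at hD2re
  have et : (t / Z ^ 2) ^ 2 = t ^ 2 / Z ^ 4 := by field_simp
  have et2 : t ^ 2 / 2 / Z ^ 4 = t ^ 2 / Z ^ 4 / 2 := by ring
  rw [et, et2] at hD2re
  have hω2 : K⁻¹ ^ 2 ≤ ω ^ 2 := by rw [← sq_abs ω]; gcongr
  have hω2' : ω ^ 2 ≤ 1 := by rw [← sq_abs]; exact pow_le_one₀ (abs_nonneg _) hω1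
  set Y := t ^ 2 / Z ^ 4 with hY
  have hY0 : 0 < Y := by positivity
  have hνκ : ν * κ ≤ (ν + κ) ^ 2 := by
    calc ν * κ ≤ (ν + κ) * (ν + κ) := by gcongr <;> linarith
      _ = _ := by ring
  have hD3 : |ω * (ν * κ * (D ^ 3).im)| ≤ K⁻¹ ^ 2 / 4 * ((ν + κ) * Y) := by
    rw [abs_mul, abs_mul, abs_of_pos (by positivity : 0 < ν * κ)]
    have h1 : |(D ^ 3).im| ≤ (9 / 8 * t / Z ^ 2) ^ 3 := by
      refine (Complex.abs_im_le_norm _).trans ?_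
      rw [norm_pow]; gcongr
    calc |ω| * (ν * κ * |(D ^ 3).im|)
        ≤ 1 * (((ν + κ) * (ν + κ)) * (9 / 8 * t / Z ^ 2) ^ 3) := by
          gcongr <;> linarith
      _ ≤ 1 * (((ν + κ) * (θ * Z ^ 3)) * (9 / 8 * t / Z ^ 2) ^ 3) := by gcongr
      _ = 729 / 512 * (θ * t) * Z * ((ν + κ) * Y) := by rw [hY]; field_simp; ring
      _ ≤ 2 * (θ * (4 * K ^ 2)) * 1 * ((ν + κ) * Y) := by gcongr; norm_num
      _ = θ * (32 * K ^ 2) / 4 * ((ν + κ) * Y) := by ring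
      _ ≤ _ := by gcongr
  have hdev : |ζ * w.im - 2 * k * p| ≤ η := by
    have h1 := (Complex.abs_im_le_norm _).trans hwz
    rw [Complex.sub_im, Complex.mul_im, Complex.I_re, Complex.I_im, Complex.ofReal_re, zero_mul,
      one_mul, zero_add] at h1
    calc |ζ * w.im - 2 * k * p| = |ζ| * |w.im - τ| := by rw [← hτζ, ← abs_mul]; ring_nf
      _ ≤ Z * (η / Z) := by rw [hζZ]; gcongr
      _ = η := by field_simp
  have hP : |ω * (ζ * w.im - k * p) - k * ω * p| ≤ K⁻¹ * p / 2 := by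
    calc |ω * (ζ * w.im - k * p) - k * ω * p| = |ω| * |ζ * w.im - 2 * k * p| := by
          rw [← abs_mul]; ring_nf
      _ ≤ 1 * η := by gcongr
      _ ≤ _ := by linarith
  set P := ω * (ζ * w.im - k * p) with hPd
  have hkωp : K⁻¹ * p ≤ k * ω * p := by gcongr
  have hkωp' : k * ω * p ≤ K := by
    calc k * ω * p ≤ K * 1 := by gcongr
      _ = K := mul_one K
  have hP1 : K⁻¹ * p ≤ 2 * P := by linarith [(abs_le.1 hP).1]
  have hP2 : 2 * P ≤ 3 * K := by linarith [(abs_le.1 hP).2]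
  have hP0 : 0 < 2 * P := lt_of_lt_of_le (by positivity) hP1
  have hmain : w.re * (2 * P) =
      ω ^ 2 * (ν + κ) * (D ^ 2).re + ω * (ν * κ * (D ^ 3).im) := by
    rw [hPd]; linear_combination ω * hre
  have hσY : 0 < (ν + κ) * Y := by positivity
  have hN1 : K⁻¹ ^ 2 / 4 * ((ν + κ) * Y) ≤ w.re * (2 * P) := by
    have h1 : K⁻¹ ^ 2 * (ν + κ) * (Y / 2) ≤ ω ^ 2 * (ν + κ) * (D ^ 2).re := by
      gcongr; linarith [hD2re.1]
    rw [hmain]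
    linarith [(abs_le.1 hD3).1]
  have hN2 : w.re * (2 * P) ≤ 2 * ((ν + κ) * Y) := by
    have h1 : ω ^ 2 * (ν + κ) * (D ^ 2).re ≤ 1 * (ν + κ) * (3 / 2 * Y) := by
      have : 0 ≤ (D ^ 2).re := by linarith [hD2re.1]
      gcongr; linarith [hD2re.2]
    have h2 : K⁻¹ ^ 2 / 4 * ((ν + κ) * Y) ≤ 1 / 4 * ((ν + κ) * Y) := by
      gcongr; exact pow_le_one₀ hKinv0.le hKinv1
    rw [hmain]
    linarith [(abs_le.1 hD3).2]
  have hx0 : 0 < w.re := by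
    have : 0 < w.re * (2 * P) := lt_of_lt_of_le (by positivity) hN1
    exact (mul_pos_iff_of_pos_right hP0).1 this
  refine ⟨w, hw, ?_, ?_, ?_, ?_⟩
  · have h1 : K⁻¹ ^ 2 / 4 * ((ν + κ) * Y) ≤ w.re * (3 * K) := hN1.trans (by gcongr)
    calc δ * ((ν + κ) / Z ^ 4) ≤ c₁ * ((ν + κ) / Z ^ 4) := by gcongr
      _ = K⁻¹ ^ 2 / 4 * ((ν + κ) * ((4 * K⁻¹ ^ 2 * p ^ 2) ^ 2 / Z ^ 4)) / (3 * K) := by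
        rw [hc₁]; field_simp; ring
      _ ≤ K⁻¹ ^ 2 / 4 * ((ν + κ) * Y) / (3 * K) := by rw [hY]; gcongr
      _ ≤ w.re := by rwa [div_le_iff₀ (by positivity)]
  · have h1 : w.re * (K⁻¹ * p) ≤ 2 * ((ν + κ) * Y) := le_trans (by gcongr) hN2
    calc w.re ≤ 2 * ((ν + κ) * Y) / (K⁻¹ * p) := by rwa [le_div_iff₀ (by positivity)]
      _ ≤ 2 * ((ν + κ) * ((4 * K ^ 2) ^ 2 / Z ^ 4)) / (K⁻¹ * p) := by rw [hY]; gcongr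
      _ = c₂ * ((ν + κ) / Z ^ 4) := by rw [hc₂]; ring
      _ ≤ _ := by gcongr
  · have h1 : |τ| - η / Z ≤ ‖w‖ := by
      have := norm_sub_norm_le (I * τ : ℂ) (I * τ - w)
      rw [hIτ, norm_sub_rev (I * τ : ℂ) w, sub_sub_cancel] at this
      linarith
    have h2 : δ / Z ≤ K⁻¹ * p / Z := by gcongr
    have h3 : η / Z ≤ K⁻¹ * p / 2 / Z := by gcongr
    have h4 : 0 < K⁻¹ * p / Z := by positivity
    have e1 : K⁻¹ * p / 2 / Z = K⁻¹ * p / Z / 2 := by ring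
    have e2 : 2 * (K⁻¹ * p) / Z = 2 * (K⁻¹ * p / Z) := by ring
    linarith
  · calc ‖w‖ = ‖(w - I * τ) + I * τ‖ := by ring_nf
      _ ≤ η / Z + 2 * K / Z := (norm_add_le _ _).trans (add_le_add hwz (hIτ.le.trans hτle))
      _ = (η + 2 * K) / Z := by ring
      _ ≤ (3 * K) / Z := by gcongr; linarith
      _ ≤ _ := by gcongr

/-! ### Amplitudes -/

/-- The determinant of the matrix with rows `1`, `v`, `G`. -/
def det₃ (v G : Fin 3 → ℂ) : ℂ :=
  (v 1 * G 2 - v 2 * G 1) - (v 0 * G 2 - v 2 * G 0) + (v 0 * G 1 - v 1 * G 0)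

theorem norm_cramer_le {R : ℝ} {b c d e r g : ℂ} (hr : ‖r‖ ≤ R) (hg : ‖g‖ ≤ R) :
    ‖-(b * c - d * e) - (r * c - d * g) + (r * e - b * g)‖ ≤
      ‖b‖ * ‖c‖ + ‖d‖ * ‖e‖ + R * (‖b‖ + ‖c‖ + ‖d‖ + ‖e‖) := by
  have h1 := norm_add_le (-(b * c - d * e) - (r * c - d * g)) (r * e - b * g)
  have h2 := norm_sub_le (-(b * c - d * e)) (r * c - d * g)
  have h3 := norm_sub_le (b * c) (d * e)
  have h4 := norm_sub_le (r * c) (d * g)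
  have h5 := norm_sub_le (r * e) (b * g)
  rw [norm_neg] at h2
  simp only [norm_mul] at *
  have h6 : ‖r‖ * ‖c‖ ≤ R * ‖c‖ := by gcongr
  have h7 : ‖r‖ * ‖e‖ ≤ R * ‖e‖ := by gcongr
  have h8 : ‖d‖ * ‖g‖ ≤ ‖d‖ * R := by gcongr
  have h9 : ‖b‖ * ‖g‖ ≤ ‖b‖ * R := by gcongr
  linarith

theorem norm_mul_det₃_le {R : ℝ} {v G a : Fin 3 → ℂ} {r g : ℂ} (hr : ‖r‖ ≤ R) (hg : ‖g‖ ≤ R)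
    (h₁ : a 0 + a 1 + a 2 = -1) (h₂ : v 0 * a 0 + v 1 * a 1 + v 2 * a 2 = r)
    (h₃ : G 0 * a 0 + G 1 * a 1 + G 2 * a 2 = g) :
    ‖det₃ v G‖ * ‖a 0‖ ≤ ‖v 1‖ * ‖G 2‖ + ‖v 2‖ * ‖G 1‖
        + R * (‖v 1‖ + ‖G 2‖ + ‖v 2‖ + ‖G 1‖) ∧
      ‖det₃ v G‖ * ‖a 1‖ ≤ ‖v 0‖ * ‖G 2‖ + ‖v 2‖ * ‖G 0‖
        + R * (‖v 0‖ + ‖G 2‖ + ‖v 2‖ + ‖G 0‖) ∧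
      ‖det₃ v G‖ * ‖a 2‖ ≤ ‖v 0‖ * ‖G 1‖ + ‖v 1‖ * ‖G 0‖
        + R * (‖v 0‖ + ‖G 1‖ + ‖v 1‖ + ‖G 0‖) := by
  unfold det₃
  refine ⟨?_, ?_, ?_⟩
  · rw [← norm_mul]
    refine le_trans (le_of_eq ?_) (norm_cramer_le hr hg)
    congr 1
    linear_combination (v 1 * G 2 - v 2 * G 1) * h₁ - (G 2 - G 1) * h₂ + (v 2 - v 1) * h₃
  · rw [← norm_mul]
    refine le_trans (le_of_eq ?_) (norm_cramer_le hr hg)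
    rw [← norm_neg]
    congr 1
    linear_combination (v 0 * G 2 - v 2 * G 0) * h₁ - (G 2 - G 0) * h₂ + (v 2 - v 0) * h₃
  · rw [← norm_mul]
    refine le_trans (le_of_eq ?_) (norm_cramer_le hr hg)
    congr 1
    linear_combination (v 0 * G 1 - v 1 * G 0) * h₁ - (G 1 - G 0) * h₂ + (v 1 - v 0) * h₃

theorem cramer_bound {R D X Y b c d e : ℝ} (hR : 1 ≤ R) (hD : 1 ≤ D)
    (hXY : 1 ≤ X + Y) (hc0 : 0 ≤ c) (he0 : 0 ≤ e) (hb : b ≤ D)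
    (hc : c ≤ 2 * D * X) (hd : d ≤ D) (he : e ≤ 2 * D * Y) :
    b * c + d * e + R * (b + c + d + e) ≤ 6 * (R * D ^ 2) * (X + Y) := by
  have hD2 : D ≤ D ^ 2 := le_self_pow₀ hD (by norm_num)
  have hRD : D ^ 2 ≤ R * D ^ 2 := le_mul_of_one_le_left (by positivity) hR
  have h1 : b * c ≤ D * (2 * D * X) := by gcongr
  have h2 : d * e ≤ D * (2 * D * Y) := by gcongr
  have h3 : R * (b + c + d + e) ≤ R * (4 * D * (X + Y)) := by
    gcongr
    have : D * 1 ≤ D * (X + Y) := by gcongr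
    linarith
  have h4 : R * (4 * D * (X + Y)) ≤ R * (4 * D ^ 2 * (X + Y)) := by gcongr
  have h5 : D ^ 2 * (X + Y) ≤ R * D ^ 2 * (X + Y) := by gcongr
  linarith

/-- Amplitudes when the two slow roots have the same size. -/
theorem amplitude_bounds_of_same_size {δ R : ℝ} (hδ : 0 < δ) (hδ1 : δ ≤ 1) (hR : 1 ≤ R) :
    ∃ η > 0, ∃ C > 0, ∀ (T L μ : ℝ) (l G : Fin 3 → ℂ), 1 ≤ T → 0 < L → 0 < μ → T ≤ η * L →
      δ * T ≤ (l 0).re → ‖l 0‖ ≤ δ⁻¹ * T → δ * T ≤ (l 1).re → ‖l 1‖ ≤ δ⁻¹ * T →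
      δ * T ≤ ‖l 0 - l 1‖ → δ * L ≤ (l 2).re → ‖l 2‖ ≤ δ⁻¹ * L →
      ‖G 0 - l 0‖ ≤ η * T → ‖G 1 - l 1‖ ≤ η * T → ‖G 2 + μ * l 2‖ ≤ η * (μ * L) →
      det₃ (fun j => (l j)⁻¹) G ≠ 0 ∧
      ∀ (a : Fin 3 → ℂ) (r g : ℂ), ‖r‖ ≤ R → ‖g‖ ≤ R → a 0 + a 1 + a 2 = -1 →
        (l 0)⁻¹ * a 0 + (l 1)⁻¹ * a 1 + (l 2)⁻¹ * a 2 = r →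
        G 0 * a 0 + G 1 * a 1 + G 2 * a 2 = g →
        ‖a 0‖ ≤ C * T ∧ ‖a 1‖ ≤ C * T ∧ ‖a 2‖ ≤ C * (T ^ 2 / (μ * L + T)) := by
  refine ⟨δ ^ 6 / 16, by positivity, 24 * R * δ⁻¹ ^ 6, by positivity, ?_⟩
  set η := δ ^ 6 / 16 with hη
  have hη0 : 0 < η := by positivity
  have hη1 : η ≤ 1 := by
    have : δ ^ 6 ≤ 1 := pow_le_one₀ hδ.le hδ1
    rw [hη]; linarith
  have hηδ : η * (8 * δ⁻¹ ^ 4) = δ ^ 2 / 2 := by rw [hη]; field_simp; norm_num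
  clear_value η
  have hδi : 1 ≤ δ⁻¹ := (one_le_inv₀ hδ).2 hδ1
  intro T L μ l G hT hL hμ hTL h0 h0' h1 h1' h01 h2 h2' hG0 hG1 hG2
  have hT0 : 0 < T := by linarith
  have n0 : δ * T ≤ ‖l 0‖ := h0.trans (Complex.re_le_norm _)
  have n1 : δ * T ≤ ‖l 1‖ := h1.trans (Complex.re_le_norm _)
  have n2 : δ * L ≤ ‖l 2‖ := h2.trans (Complex.re_le_norm _)
  have p0 : 0 < ‖l 0‖ := lt_of_lt_of_le (by positivity) n0
  have p1 : 0 < ‖l 1‖ := lt_of_lt_of_le (by positivity) n1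
  have p2 : 0 < ‖l 2‖ := lt_of_lt_of_le (by positivity) n2
  have z0 := norm_pos_iff.1 p0
  have z1 := norm_pos_iff.1 p1
  have z2 := norm_pos_iff.1 p2
  have hLT : T ≤ L := hTL.trans (mul_le_of_le_one_left hL.le hη1)
  have v0 : ‖(l 0)⁻¹‖ ≤ δ⁻¹ * T⁻¹ := by rw [norm_inv, ← mul_inv]; gcongr
  have v1 : ‖(l 1)⁻¹‖ ≤ δ⁻¹ * T⁻¹ := by rw [norm_inv, ← mul_inv]; gcongr
  have v2 : ‖(l 2)⁻¹‖ ≤ δ⁻¹ * L⁻¹ := by rw [norm_inv, ← mul_inv]; gcongr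
  have hTinv : T⁻¹ ≤ 1 := inv_le_one_of_one_le₀ hT
  have hLinv : L⁻¹ ≤ 1 := inv_le_one_of_one_le₀ (hT.trans hLT)
  have v0' : ‖(l 0)⁻¹‖ ≤ δ⁻¹ := v0.trans (mul_le_of_le_one_right (by positivity) hTinv)
  have v1' : ‖(l 1)⁻¹‖ ≤ δ⁻¹ := v1.trans (mul_le_of_le_one_right (by positivity) hTinv)
  have v2' : ‖(l 2)⁻¹‖ ≤ δ⁻¹ := v2.trans (mul_le_of_le_one_right (by positivity) hLinv)
  have gT : η * T ≤ δ⁻¹ * T := by gcongr; exact hη1.trans hδi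
  have g0 : ‖G 0‖ ≤ 2 * δ⁻¹ * T := by
    calc ‖G 0‖ = ‖(G 0 - l 0) + l 0‖ := by ring_nf
      _ ≤ η * T + δ⁻¹ * T := (norm_add_le _ _).trans (add_le_add hG0 h0')
      _ ≤ _ := by linarith
  have g1 : ‖G 1‖ ≤ 2 * δ⁻¹ * T := by
    calc ‖G 1‖ = ‖(G 1 - l 1) + l 1‖ := by ring_nf
      _ ≤ η * T + δ⁻¹ * T := (norm_add_le _ _).trans (add_le_add hG1 h1')
      _ ≤ _ := by linarith
  have g2 : ‖G 2‖ ≤ 2 * δ⁻¹ * (μ * L) := by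
    have : η * (μ * L) ≤ δ⁻¹ * (μ * L) := by gcongr; exact hη1.trans hδi
    calc ‖G 2‖ = ‖(G 2 + μ * l 2) - μ * l 2‖ := by ring_nf
      _ ≤ η * (μ * L) + μ * (δ⁻¹ * L) := by
        refine (norm_sub_le _ _).trans (add_le_add hG2 ?_)
        rw [norm_mul, Complex.norm_real, Real.norm_eq_abs, abs_of_pos hμ]
        gcongr
      _ ≤ _ := by linarith
  have hdet : δ ^ 4 / 2 * (μ * L + T) ≤ ‖det₃ (fun j => (l j)⁻¹) G‖ * T := by
    have e : det₃ (fun j => (l j)⁻¹) G * (l 0 * l 1) =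
        -((l 0 - l 1) * (μ * l 2 + l 0 + l 1)) + ((G 2 + μ * l 2) * (l 0 - l 1)
          + (G 0 - G 1) * (l 0 * l 1 * (l 2)⁻¹)
          + ((G 1 - l 1) * l 1 - (G 0 - l 0) * l 0)) := by
      unfold det₃; field_simp; ring
    have hmain : δ ^ 2 * (T * (μ * L + T)) ≤ ‖-((l 0 - l 1) * (μ * l 2 + l 0 + l 1))‖ := by
      rw [norm_neg, norm_mul]
      have hre : δ * (μ * L + T) ≤ ‖μ * l 2 + l 0 + l 1‖ := by
        refine le_trans ?_ (Complex.re_le_norm _)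
        simp only [Complex.add_re, Complex.re_ofReal_mul]
        have : μ * (δ * L) ≤ μ * (l 2).re := by gcongr
        have : 0 < δ * T := by positivity
        linarith
      calc δ ^ 2 * (T * (μ * L + T)) = δ * T * (δ * (μ * L + T)) := by ring
        _ ≤ _ := by gcongr
    have hl01 : ‖l 0 - l 1‖ ≤ 2 * δ⁻¹ * T := (norm_sub_le _ _).trans (by linarith)
    have hG01 : ‖G 0 - G 1‖ ≤ 4 * δ⁻¹ * T := (norm_sub_le _ _).trans (by linarith)
    have e1 : ‖(G 2 + μ * l 2) * (l 0 - l 1)‖ ≤ η * (2 * δ⁻¹ ^ 4) * (T * (μ * L)) := by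
      rw [norm_mul]
      calc _ ≤ η * (μ * L) * (2 * δ⁻¹ * T) := by gcongr
        _ = η * (2 * δ⁻¹) * (T * (μ * L)) := by ring
        _ ≤ _ := by gcongr; exact le_self_pow₀ hδi (by norm_num)
    have e2 : ‖(G 0 - G 1) * (l 0 * l 1 * (l 2)⁻¹)‖ ≤ η * (4 * δ⁻¹ ^ 4) * (T * T) := by
      rw [norm_mul, norm_mul, norm_mul]
      calc _ ≤ 4 * δ⁻¹ * T * (δ⁻¹ * T * (δ⁻¹ * T) * (δ⁻¹ * L⁻¹)) := by gcongr
        _ = 4 * δ⁻¹ ^ 4 * (T * T) * (T * L⁻¹) := by ring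
        _ ≤ 4 * δ⁻¹ ^ 4 * (T * T) * η := by
          gcongr
          rw [← div_eq_mul_inv, div_le_iff₀ hL]; exact hTL
        _ = _ := by ring
    have e3 : ‖(G 1 - l 1) * l 1 - (G 0 - l 0) * l 0‖ ≤ η * (2 * δ⁻¹ ^ 4) * (T * T) := by
      refine (norm_sub_le _ _).trans ?_
      rw [norm_mul, norm_mul]
      calc _ ≤ η * T * (δ⁻¹ * T) + η * T * (δ⁻¹ * T) := by gcongr
        _ = η * (2 * δ⁻¹) * (T * T) := by ring
        _ ≤ _ := by gcongr; exact le_self_pow₀ hδi (by norm_num)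
    have hsum := norm_add₃_le (a := (G 2 + μ * l 2) * (l 0 - l 1))
      (b := (G 0 - G 1) * (l 0 * l 1 * (l 2)⁻¹))
      (c := (G 1 - l 1) * l 1 - (G 0 - l 0) * l 0)
    have htot : δ ^ 2 / 2 * (T * (μ * L + T)) ≤
        ‖det₃ (fun j => (l j)⁻¹) G * (l 0 * l 1)‖ := by
      rw [e]
      refine le_trans ?_ (norm_sub_le_norm_add _ _)
      have h3 : 0 ≤ T * (μ * L) := by positivity
      have h4 : 0 ≤ η * δ⁻¹ ^ 4 := by positivity
      have h5 : 0 ≤ η * δ⁻¹ ^ 4 * (T * (μ * L)) := by positivity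
      have h6 : 0 ≤ η * δ⁻¹ ^ 4 * (T * T) := by positivity
      have h7 : η * (8 * δ⁻¹ ^ 4) * (T * (μ * L + T)) = δ ^ 2 / 2 * (T * (μ * L + T)) := by
        rw [hηδ]
      linarith
    rw [norm_mul, norm_mul] at htot
    have h3 : ‖det₃ (fun j => (l j)⁻¹) G‖ * (‖l 0‖ * ‖l 1‖) ≤
        ‖det₃ (fun j => (l j)⁻¹) G‖ * (δ⁻¹ * T * (δ⁻¹ * T)) := by gcongr
    have h4 := htot.trans h3
    have h5 : δ ^ 2 * T * (δ ^ 2 / 2 * (T * (μ * L + T))) ≤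
      δ ^ 2 * T * (‖det₃ (fun j => (l j)⁻¹) G‖ * (δ⁻¹ * T * (δ⁻¹ * T))) := by gcongr
    have e5 : δ ^ 2 * T * (δ ^ 2 / 2 * (T * (μ * L + T))) =
      T ^ 2 * (δ ^ 4 / 2 * (μ * L + T)) := by ring
    have e6 : δ ^ 2 * T * (‖det₃ (fun j => (l j)⁻¹) G‖ * (δ⁻¹ * T * (δ⁻¹ * T))) =
      T ^ 2 * (‖det₃ (fun j => (l j)⁻¹) G‖ * T) := by field_simp
    rw [e5, e6] at h5
    exact le_of_mul_le_mul_left h5 (by positivity)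
  have hS0 : 0 < μ * L + T := by positivity
  refine ⟨fun h => ?_, ?_⟩
  · rw [h, norm_zero, zero_mul] at hdet
    have : 0 < δ ^ 4 / 2 * (μ * L + T) := by positivity
    linarith
  intro a r g hr hg ha1 ha2 ha3
  obtain ⟨k0, k1, k2⟩ := norm_mul_det₃_le (v := fun j => (l j)⁻¹) hr hg ha1 ha2 ha3
  have hμL : 0 < μ * L := by positivity
  have b0 := k0.trans (cramer_bound hR hδi (by linarith) (norm_nonneg _)
    (norm_nonneg _) v1' g2 v2' g1)
  have b1 := k1.trans (cramer_bound hR hδi (by linarith) (norm_nonneg _)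
    (norm_nonneg _) v0' g2 v2' g0)
  have b2 := k2.trans (cramer_bound hR hδi (by linarith) (norm_nonneg _)
    (norm_nonneg _) v0' g1 v1' g0)
  have slow : ∀ x : ℂ, ‖det₃ (fun j => (l j)⁻¹) G‖ * ‖x‖ ≤
      6 * (R * δ⁻¹ ^ 2) * (μ * L + T) → ‖x‖ ≤ 24 * R * δ⁻¹ ^ 6 * T := by
    intro x hx
    have h1 : δ ^ 4 / 2 * (μ * L + T) * ‖x‖ ≤ T * (6 * (R * δ⁻¹ ^ 2) * (μ * L + T)) := by
      calc _ ≤ ‖det₃ (fun j => (l j)⁻¹) G‖ * T * ‖x‖ := by gcongr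
        _ = T * (‖det₃ (fun j => (l j)⁻¹) G‖ * ‖x‖) := by ring
        _ ≤ _ := by gcongr
    have h2 : (μ * L + T) * ‖x‖ ≤ (μ * L + T) * (12 * R * δ⁻¹ ^ 6 * T) := by
      calc (μ * L + T) * ‖x‖ = 2 * δ⁻¹ ^ 4 * (δ ^ 4 / 2 * (μ * L + T) * ‖x‖) := by field_simp
        _ ≤ 2 * δ⁻¹ ^ 4 * (T * (6 * (R * δ⁻¹ ^ 2) * (μ * L + T))) := by gcongr
        _ = _ := by ring
    refine (le_of_mul_le_mul_left h2 hS0).trans ?_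
    gcongr; norm_num
  refine ⟨slow _ b0, slow _ b1, ?_⟩
  have h1 : δ ^ 4 / 2 * (μ * L + T) * ‖a 2‖ ≤ T * (6 * (R * δ⁻¹ ^ 2) * (T + T)) := by
    calc _ ≤ ‖det₃ (fun j => (l j)⁻¹) G‖ * T * ‖a 2‖ := by gcongr
      _ = T * (‖det₃ (fun j => (l j)⁻¹) G‖ * ‖a 2‖) := by ring
      _ ≤ _ := by gcongr
  have h2 : (μ * L + T) * ‖a 2‖ ≤ 24 * R * δ⁻¹ ^ 6 * T ^ 2 := by
    calc (μ * L + T) * ‖a 2‖ = 2 * δ⁻¹ ^ 4 * (δ ^ 4 / 2 * (μ * L + T) * ‖a 2‖) := by field_simp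
      _ ≤ 2 * δ⁻¹ ^ 4 * (T * (6 * (R * δ⁻¹ ^ 2) * (T + T))) := by gcongr
      _ = _ := by ring
  rw [← mul_div_assoc, le_div_iff₀ hS0]
  linarith

/-- Amplitudes when the three roots have well separated sizes. -/
theorem amplitude_bounds_of_separated {δ R : ℝ} (hδ : 0 < δ) (hδ1 : δ ≤ 1) (hR : 1 ≤ R) :
    ∃ η > 0, ∃ C > 0, ∀ (T S L : ℝ) (l G : Fin 3 → ℂ), 1 ≤ T → T ≤ η * S → S ≤ η * L →
      δ * T ≤ ‖l 0‖ → ‖l 0‖ ≤ δ⁻¹ * T → δ * S ≤ ‖l 1‖ → δ * L ≤ ‖l 2‖ →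
      ‖G 0‖ ≤ 2 * δ⁻¹ * T → ‖G 1‖ ≤ 2 * δ⁻¹ * S → δ * L ≤ ‖G 2‖ → ‖G 2‖ ≤ 2 * δ⁻¹ * L →
      det₃ (fun j => (l j)⁻¹) G ≠ 0 ∧
      ∀ (a : Fin 3 → ℂ) (r g : ℂ), ‖r‖ ≤ R → ‖g‖ ≤ R → a 0 + a 1 + a 2 = -1 →
        (l 0)⁻¹ * a 0 + (l 1)⁻¹ * a 1 + (l 2)⁻¹ * a 2 = r →
        G 0 * a 0 + G 1 * a 1 + G 2 * a 2 = g →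
        ‖a 0‖ ≤ C * T ∧ ‖a 1‖ ≤ C * T ∧ ‖a 2‖ ≤ C * (T * S / L) := by
  refine ⟨δ ^ 4 / 32, by positivity, 48 * R * δ⁻¹ ^ 4, by positivity, ?_⟩
  set η := δ ^ 4 / 32 with hη
  have hη0 : 0 < η := by positivity
  have hη1 : η ≤ 1 := by
    have : δ ^ 4 ≤ 1 := pow_le_one₀ hδ.le hδ1
    rw [hη]; linarith
  have hηδ : η * (16 * δ⁻¹ ^ 3) = δ / 2 := by rw [hη]; field_simp; norm_num
  clear_value η
  have hδi : 1 ≤ δ⁻¹ := (one_le_inv₀ hδ).2 hδ1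
  intro T S L l G hT hTS hSL n0 n0' n1 n2 g0 g1 g2 g2'
  have hT0 : 0 < T := by linarith
  have hS0 : 0 < S := by
    by_contra h
    have : η * S ≤ 0 := mul_nonpos_of_nonneg_of_nonpos hη0.le (not_lt.1 h)
    linarith
  have hL0 : 0 < L := by
    by_contra h
    have : η * L ≤ 0 := mul_nonpos_of_nonneg_of_nonpos hη0.le (not_lt.1 h)
    linarith
  have hTS' : T ≤ S := hTS.trans (mul_le_of_le_one_left hS0.le hη1)
  have hSL' : S ≤ L := hSL.trans (mul_le_of_le_one_left hL0.le hη1)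
  have p0 : 0 < ‖l 0‖ := lt_of_lt_of_le (by positivity) n0
  have p1 : 0 < ‖l 1‖ := lt_of_lt_of_le (by positivity) n1
  have p2 : 0 < ‖l 2‖ := lt_of_lt_of_le (by positivity) n2
  have z0 := norm_pos_iff.1 p0
  have z1 := norm_pos_iff.1 p1
  have z2 := norm_pos_iff.1 p2
  have v0 : ‖(l 0)⁻¹‖ ≤ δ⁻¹ * T⁻¹ := by rw [norm_inv, ← mul_inv]; gcongr
  have v1 : ‖(l 1)⁻¹‖ ≤ δ⁻¹ * S⁻¹ := by rw [norm_inv, ← mul_inv]; gcongr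
  have v2 : ‖(l 2)⁻¹‖ ≤ δ⁻¹ * L⁻¹ := by rw [norm_inv, ← mul_inv]; gcongr
  have hTinv : T⁻¹ ≤ 1 := inv_le_one_of_one_le₀ hT
  have hSinv : S⁻¹ ≤ 1 := inv_le_one_of_one_le₀ (hT.trans hTS')
  have hLinv : L⁻¹ ≤ 1 := inv_le_one_of_one_le₀ (hT.trans (hTS'.trans hSL'))
  have v0' : ‖(l 0)⁻¹‖ ≤ δ⁻¹ := v0.trans (mul_le_of_le_one_right (by positivity) hTinv)
  have v1' : ‖(l 1)⁻¹‖ ≤ δ⁻¹ := v1.trans (mul_le_of_le_one_right (by positivity) hSinv)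
  have v2' : ‖(l 2)⁻¹‖ ≤ δ⁻¹ := v2.trans (mul_le_of_le_one_right (by positivity) hLinv)
  have hTSi : T * S⁻¹ ≤ η := by rw [← div_eq_mul_inv, div_le_iff₀ hS0]; exact hTS
  have hSLi : S * L⁻¹ ≤ η := by rw [← div_eq_mul_inv, div_le_iff₀ hL0]; exact hSL
  have hdet : δ ^ 2 / 4 * L ≤ ‖det₃ (fun j => (l j)⁻¹) G‖ * T := by
    have e : det₃ (fun j => (l j)⁻¹) G * l 0 =
        -G 2 + (G 2 * (l 0 * (l 1)⁻¹) + (G 0 - G 1) * (l 0 * (l 2)⁻¹)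
          + (G 1 - G 0 * (l 0 * (l 1)⁻¹))) := by
      unfold det₃; field_simp; ring
    have hq : ‖l 0 * (l 1)⁻¹‖ ≤ δ⁻¹ ^ 2 * η := by
      rw [norm_mul]
      calc _ ≤ δ⁻¹ * T * (δ⁻¹ * S⁻¹) := by gcongr
        _ = δ⁻¹ ^ 2 * (T * S⁻¹) := by ring
        _ ≤ _ := by gcongr
    have e1 : ‖G 2 * (l 0 * (l 1)⁻¹)‖ ≤ η * (2 * δ⁻¹ ^ 3) * L := by
      rw [norm_mul]
      calc _ ≤ 2 * δ⁻¹ * L * (δ⁻¹ ^ 2 * η) := by gcongr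
        _ = _ := by ring
    have e2 : ‖(G 0 - G 1) * (l 0 * (l 2)⁻¹)‖ ≤ η * (4 * δ⁻¹ ^ 3) * L := by
      rw [norm_mul, norm_mul]
      have h1 : ‖G 0 - G 1‖ ≤ 4 * δ⁻¹ * S := by
        have : δ⁻¹ * T ≤ δ⁻¹ * S := by gcongr
        exact (norm_sub_le _ _).trans (by linarith)
      calc _ ≤ 4 * δ⁻¹ * S * (δ⁻¹ * T * (δ⁻¹ * L⁻¹)) := by gcongr
        _ = 4 * δ⁻¹ ^ 3 * (S * L⁻¹) * T := by ring
        _ ≤ 4 * δ⁻¹ ^ 3 * η * L := by gcongr; exact hTS'.trans hSL'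
        _ = _ := by ring
    have e3 : ‖G 1 - G 0 * (l 0 * (l 1)⁻¹)‖ ≤ η * (4 * δ⁻¹ ^ 3) * L := by
      refine (norm_sub_le _ _).trans ?_
      rw [norm_mul]
      calc _ ≤ 2 * δ⁻¹ * (η * L) + 2 * δ⁻¹ * L * (δ⁻¹ ^ 2 * η) := by
            gcongr
            · exact g1.trans (by gcongr)
            · exact g0.trans (by gcongr; exact hTS'.trans hSL')
        _ ≤ 2 * δ⁻¹ ^ 3 * (η * L) + 2 * δ⁻¹ * L * (δ⁻¹ ^ 2 * η) := by
            gcongr; exact le_self_pow₀ hδi (by norm_num)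
        _ = _ := by ring
    have hsum := norm_add₃_le (a := G 2 * (l 0 * (l 1)⁻¹))
      (b := (G 0 - G 1) * (l 0 * (l 2)⁻¹)) (c := G 1 - G 0 * (l 0 * (l 1)⁻¹))
    have htot : δ / 4 * L ≤ ‖det₃ (fun j => (l j)⁻¹) G * l 0‖ := by
      rw [e]
      refine le_trans ?_ (norm_sub_le_norm_add _ _)
      rw [norm_neg]
      have h7 : η * (16 * δ⁻¹ ^ 3) * L = δ / 2 * L := by rw [hηδ]
      have h8 : 0 ≤ η * δ⁻¹ ^ 3 * L := by positivity
      have h9 : 0 ≤ δ * L := by positivity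
      linarith
    rw [norm_mul] at htot
    calc δ ^ 2 / 4 * L = δ * (δ / 4 * L) := by ring
      _ ≤ δ * (‖det₃ (fun j => (l j)⁻¹) G‖ * (δ⁻¹ * T)) :=
        mul_le_mul_of_nonneg_left
          (htot.trans (mul_le_mul_of_nonneg_left n0' (norm_nonneg _))) hδ.le
      _ = _ := by field_simp
  refine ⟨fun h => ?_, ?_⟩
  · rw [h, norm_zero, zero_mul] at hdet
    have : 0 < δ ^ 2 / 4 * L := by positivity
    linarith
  intro a r g hr hg ha1 ha2 ha3
  obtain ⟨k0, k1, k2⟩ := norm_mul_det₃_le (v := fun j => (l j)⁻¹) hr hg ha1 ha2 ha3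
  have h1L : 1 ≤ L + L := by linarith
  have h1S : 1 ≤ S + S := by linarith
  have gL : ∀ x : ℂ, ‖x‖ ≤ 2 * δ⁻¹ * S → ‖x‖ ≤ 2 * δ⁻¹ * L := fun x hx => hx.trans (by gcongr)
  have g0S : ‖G 0‖ ≤ 2 * δ⁻¹ * S := g0.trans (by gcongr)
  have b0 := k0.trans (cramer_bound hR hδi h1L (norm_nonneg _)
    (norm_nonneg _) v1' g2' v2' (gL _ g1))
  have b1 := k1.trans (cramer_bound hR hδi h1L (norm_nonneg _)
    (norm_nonneg _) v0' g2' v2' (gL _ g0S))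
  have b2 := k2.trans (cramer_bound hR hδi h1S (norm_nonneg _)
    (norm_nonneg _) v0' g1 v1' g0S)
  have key : ∀ (x : ℂ) (Y : ℝ), ‖det₃ (fun j => (l j)⁻¹) G‖ * ‖x‖ ≤
      6 * (R * δ⁻¹ ^ 2) * (Y + Y) → ‖x‖ ≤ 48 * R * δ⁻¹ ^ 4 * (T * Y / L) := by
    intro x Y hx
    have h1 : δ ^ 2 / 4 * L * ‖x‖ ≤ T * (6 * (R * δ⁻¹ ^ 2) * (Y + Y)) := by
      calc _ ≤ ‖det₃ (fun j => (l j)⁻¹) G‖ * T * ‖x‖ := by gcongr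
        _ = T * (‖det₃ (fun j => (l j)⁻¹) G‖ * ‖x‖) := by ring
        _ ≤ _ := by gcongr
    rw [← mul_div_assoc, le_div_iff₀ hL0]
    calc ‖x‖ * L = 4 * δ⁻¹ ^ 2 * (δ ^ 2 / 4 * L * ‖x‖) := by field_simp
      _ ≤ 4 * δ⁻¹ ^ 2 * (T * (6 * (R * δ⁻¹ ^ 2) * (Y + Y))) := by gcongr
      _ = _ := by ring
  have eT : T * L / L = T := by field_simp
  exact ⟨by simpa [eT] using key _ _ b0, by simpa [eT] using key _ _ b1, key _ _ b2⟩

/-- The boundary value of the buoyancy flux of a layer, normalized so that it is close to the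
root when diffusion is weak. -/
def layerG (γ κ ω k : ℝ) (l : ℂ) : ℂ := l * layerB γ κ ω k l * (I * ω / Real.sin γ)

theorem amplitudeMatrix_det {γ κ ω k : ℝ} {l : Fin 3 → ℂ} (hs : Real.sin γ ≠ 0) (hω : ω ≠ 0) :
    (amplitudeMatrix γ κ ω k l).det =
      I * k * (I * Real.sin γ / ω) * det₃ (fun j => (l j)⁻¹) (fun j => layerG γ κ ω k (l j)) := by
  have hsC : (Real.sin γ : ℂ) ≠ 0 := by exact_mod_cast hs
  have hωC : (ω : ℂ) ≠ 0 := by exact_mod_cast hω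
  rw [Matrix.det_fin_three]
  simp only [amplitudeMatrix, det₃, layerG, layerW, Matrix.of_apply, Matrix.cons_val]
  generalize layerB γ κ ω k (l 0) = B0
  generalize layerB γ κ ω k (l 1) = B1
  generalize layerB γ κ ω k (l 2) = B2
  simp only [div_eq_mul_inv (I * k : ℂ)]
  generalize (l 0)⁻¹ = v0
  generalize (l 1)⁻¹ = v1
  generalize (l 2)⁻¹ = v2
  field_simp
  linear_combination (-k * ((v1 * l 2 * B2 - v2 * l 1 * B1) - (v0 * l 2 * B2 - v2 * l 0 * B0)
    + (v0 * l 1 * B1 - v1 * l 0 * B0))) * Complex.I_sq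

theorem amplitude_equations {γ κ ω k m : ℝ} {l : Fin 3 → ℂ} {a : Fin 3 → ℂ}
    (hs : Real.sin γ ≠ 0) (hω : ω ≠ 0) (hk : k ≠ 0) {b : ℂ}
    (h : (amplitudeMatrix γ κ ω k l).mulVec a = ![-1, -(-(k : ℂ) / m), -(I * m * b)]) :
    a 0 + a 1 + a 2 = -1 ∧
      (l 0)⁻¹ * a 0 + (l 1)⁻¹ * a 1 + (l 2)⁻¹ * a 2 = -I / m ∧
      layerG γ κ ω k (l 0) * a 0 + layerG γ κ ω k (l 1) * a 1 + layerG γ κ ω k (l 2) * a 2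
        = -(ω * m * b / Real.sin γ) := by
  have hsC : (Real.sin γ : ℂ) ≠ 0 := by exact_mod_cast hs
  have hωC : (ω : ℂ) ≠ 0 := by exact_mod_cast hω
  have hkC : (k : ℂ) ≠ 0 := by exact_mod_cast hk
  have h0 := congrFun h 0
  have h1 := congrFun h 1
  have h2 := congrFun h 2
  simp only [amplitudeMatrix, layerW, Matrix.mulVec, dotProduct, Fin.sum_univ_three,
    Matrix.of_apply, Matrix.cons_val] at h0 h1 h2
  refine ⟨by linear_combination h0, ?_, ?_⟩
  · have e : I * k * ((l 0)⁻¹ * a 0 + (l 1)⁻¹ * a 1 + (l 2)⁻¹ * a 2) = I * k * (-I / m) := by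
      linear_combination h1 + (k / m) * Complex.I_sq
    exact mul_left_cancel₀ (mul_ne_zero Complex.I_ne_zero hkC) e
  · simp only [layerG]
    linear_combination (-I * ω / Real.sin γ) * h2 + (m * b * ω / Real.sin γ) * Complex.I_sq

theorem norm_layerG_sub_le {γ κ ω k K e : ℝ} {l : ℂ} (hs : 0 < Real.sin γ) (hκ : 0 < κ)
    (hK : 1 ≤ K) (hk : |k| ≤ K) (hω1 : |ω| ≤ 1) (hω : K⁻¹ ≤ |ω|) (hl : l ≠ 0)
    (he : κ * ‖l ^ 2 - k ^ 2‖ ≤ e) (heK : e ≤ K⁻¹ / 2) :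
    ‖layerG γ κ ω k l - l‖ ≤ 2 * K * (K / Real.sin γ + e * ‖l‖) := by
  have hK0 : 0 < K := by linarith
  have hsC : (Real.sin γ : ℂ) ≠ 0 := by exact_mod_cast hs.ne'
  have hn : ‖(κ * (l ^ 2 - k ^ 2) : ℂ)‖ ≤ e := by
    rwa [norm_mul, Complex.norm_real, Real.norm_eq_abs, abs_of_pos hκ]
  have hb : K⁻¹ / 2 ≤ ‖I * ω + κ * (l ^ 2 - k ^ 2)‖ := by
    have h1 := norm_sub_le_norm_add (I * ω : ℂ) (κ * (l ^ 2 - k ^ 2))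
    rw [norm_mul, Complex.norm_I, one_mul, Complex.norm_real, Real.norm_eq_abs] at h1
    linarith
  have hb0 : I * ω + κ * (l ^ 2 - k ^ 2) ≠ 0 :=
    norm_pos_iff.1 (lt_of_lt_of_le (by positivity) hb)
  have e1 : layerG γ κ ω k l - l =
      (I * ω * (I * k * Real.cos γ / Real.sin γ) - κ * (l ^ 2 - k ^ 2) * l)
        / (I * ω + κ * (l ^ 2 - k ^ 2)) := by
    have hden : (I * ω - κ * (k ^ 2 - l ^ 2) : ℂ) = I * ω + κ * (l ^ 2 - k ^ 2) := by ring
    unfold layerG layerB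
    rw [hden, eq_div_iff hb0]
    generalize hX : (I * ω + κ * (l ^ 2 - k ^ 2) : ℂ) = X at *
    have hX' : κ * (l ^ 2 - k ^ 2) = X - I * ω := by rw [← hX]; ring
    rw [hX']
    field_simp
    ring
  rw [e1, norm_div, div_le_iff₀ (lt_of_lt_of_le (by positivity) hb)]
  have h2 : ‖I * ω * (I * k * Real.cos γ / Real.sin γ) - κ * (l ^ 2 - k ^ 2) * l‖ ≤
      K / Real.sin γ + e * ‖l‖ := by
    refine (norm_sub_le _ _).trans (add_le_add ?_ ?_)
    · simp only [norm_mul, norm_div, Complex.norm_I, Complex.norm_real, Real.norm_eq_abs, one_mul,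
        abs_of_pos hs]
      calc |ω| * (|k| * |Real.cos γ| / Real.sin γ) ≤ 1 * (K * 1 / Real.sin γ) := by
            gcongr; exact Real.abs_cos_le_one _
        _ = _ := by ring
    · rw [norm_mul]; gcongr
  have he0 : 0 ≤ e := le_trans (by positivity) he
  calc _ ≤ K / Real.sin γ + e * ‖l‖ := h2
    _ = 2 * K * (K / Real.sin γ + e * ‖l‖) * (K⁻¹ / 2) := by field_simp
    _ ≤ _ := by gcongr

/-- The product form of the buoyancy of a root. -/
theorem layerB_mul_eq {γ ν κ ω k : ℝ} {l : ℂ} (hl : l ≠ 0)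
    (hb : I * ω - κ * (k ^ 2 - l ^ 2) ≠ (0 : ℂ)) (h : charPoly γ ν κ ω k l = 0) :
    l * layerB γ κ ω k l * (l * Real.sin γ + I * k * Real.cos γ) =
      -((I * ω + ν * (l ^ 2 - k ^ 2)) * (l ^ 2 - k ^ 2)) := by
  rw [charPoly_eq] at h
  unfold layerB
  field_simp
  linear_combination -h

theorem norm_layerG_add_le {γ ν κ ω k K L η z : ℝ} {l : ℂ} (hs : 0 < Real.sin γ) (hν : 0 < ν)
    (hκ : 0 < κ) (hK : 1 ≤ K) (hk : |k| ≤ K) (hω1 : |ω| ≤ 1) (hω : K⁻¹ ≤ |ω|) (hL : 1 ≤ L)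
    (hρ : K⁻¹ * L ^ 2 ≤ 1 / ν + 1 / κ) (hroot : charPoly γ ν κ ω k l = 0)
    (hl : ‖l ^ 2 - k ^ 2 + I * ω * ((1 / ν + 1 / κ : ℝ) : ℂ)‖ ≤ η * L ^ 2)
    (hre : (4 * K)⁻¹ * L ≤ l.re) (hln : ‖l‖ ≤ 3 * K * L) (hη : 2 * K * η ≤ K⁻¹ / 2)
    (hζ : |ω ^ 2 - Real.sin γ ^ 2| ≤ z) :
    ‖layerG γ κ ω k l + ((ν / κ : ℝ) : ℂ) * l‖ ≤
      80 * K ^ 4 / Real.sin γ ^ 2 * (η + z + L⁻¹) * (ν / κ * L) := by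
  have hK0 : 0 < K := by linarith
  have hL0 : 0 < L := by linarith
  have hη0 : 0 ≤ η := by
    have h1 : 0 ≤ η * L ^ 2 := (norm_nonneg _).trans hl
    exact nonneg_of_mul_nonneg_left h1 (by positivity)
  have hz0 : 0 ≤ z := (abs_nonneg _).trans hζ
  have hsC : (Real.sin γ : ℂ) ≠ 0 := by exact_mod_cast hs.ne'
  have hs1 : Real.sin γ ≤ 1 := Real.sin_le_one γ
  have hνC : (ν : ℂ) ≠ 0 := by exact_mod_cast hν.ne'
  have hκC : (κ : ℂ) ≠ 0 := by exact_mod_cast hκ.ne'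
  have hre0 : 0 < l.re := lt_of_lt_of_le (by positivity) hre
  have hl0 : l ≠ 0 := by rintro rfl; simp at hre0
  set s := Real.sin γ with hsd
  have hs2 : s ^ 2 ≤ s := by
    calc s ^ 2 = s * s := sq s
      _ ≤ s * 1 := by gcongr
      _ = s := mul_one s
  obtain ⟨e, he⟩ : ∃ e : ℂ, l ^ 2 - k ^ 2 + I * ω * ((1 / ν + 1 / κ : ℝ) : ℂ) = e := ⟨_, rfl⟩
  rw [he] at hl
  have hD : (l ^ 2 - k ^ 2 : ℂ) = e - I * ω * (1 / ν + 1 / κ) := by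
    rw [← he]; push_cast; ring
  have hsum : Real.cos γ * Real.cos γ ≤ 1 := by nlinarith [Real.cos_sq_le_one γ]
  have hlsn : (4 * K)⁻¹ * L * s ≤ ‖l * s + I * k * Real.cos γ‖ := by
    have h1 : (l * s + I * k * Real.cos γ : ℂ).re = l.re * s := by
      have h2 : (I * k * Real.cos γ : ℂ) = I * ((k * Real.cos γ : ℝ) : ℂ) := by push_cast; ring
      rw [Complex.add_re, Complex.re_mul_ofReal, h2, Complex.mul_re, Complex.I_re,
        Complex.ofReal_im]
      ring
    calc (4 * K)⁻¹ * L * s ≤ l.re * s := by gcongr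
      _ = (l * s + I * k * Real.cos γ : ℂ).re := h1.symm
      _ ≤ _ := Complex.re_le_norm _
  have hls : l * s + I * k * Real.cos γ ≠ 0 :=
    norm_pos_iff.1 (lt_of_lt_of_le (by positivity) hlsn)
  rcases le_total ν κ with hle | hle
  · have hνL : ν * L ^ 2 ≤ 2 * K := by
      have h1 : 1 / κ ≤ 1 / ν := one_div_le_one_div_of_le hν hle
      have h2 : K⁻¹ * L ^ 2 ≤ 2 / ν := by
        have : 2 / ν = 1 / ν + 1 / ν := by ring
        linarith
      rw [le_div_iff₀ hν] at h2
      calc ν * L ^ 2 = K * (K⁻¹ * L ^ 2 * ν) := by field_simp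
        _ ≤ K * 2 := by gcongr
        _ = _ := by ring
    have hνe : ‖(ν * e : ℂ)‖ ≤ 2 * K * η := by
      rw [norm_mul, Complex.norm_real, Real.norm_eq_abs, abs_of_pos hν]
      calc ν * ‖e‖ ≤ ν * (η * L ^ 2) := by gcongr
        _ = ν * L ^ 2 * η := by ring
        _ ≤ _ := by gcongr
    have hb : K⁻¹ / 2 ≤ ‖I * ω - ν * e‖ := by
      have h1 := norm_sub_norm_le (I * ω : ℂ) (ν * e)
      rw [norm_mul, Complex.norm_I, one_mul, Complex.norm_real, Real.norm_eq_abs] at h1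
      linarith
    have hb0 : I * ω - ν * e ≠ 0 := norm_pos_iff.1 (lt_of_lt_of_le (by positivity) hb)
    have hden : (I * ω - κ * (k ^ 2 - l ^ 2) : ℂ) = -(κ / ν) * (I * ω - ν * e) := by
      have : (k ^ 2 - l ^ 2 : ℂ) = -(l ^ 2 - k ^ 2) := by ring
      rw [this, hD]; field_simp; ring
    have e1 : layerG γ κ ω k l + ((ν / κ : ℝ) : ℂ) * l =
        ((ν / κ : ℝ) : ℂ) * ((-(ν * e * l) + ω * k * Real.cos γ / s) / (I * ω - ν * e)) := by
      unfold layerG layerB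
      rw [hden, ← hsd]
      push_cast
      generalize hX : (I * ω - ν * e : ℂ) = X at *
      have hX' : (ν * e : ℂ) = I * ω - X := by rw [← hX]; ring
      rw [hX']
      field_simp
      linear_combination (-ω * k * Complex.cos γ) * Complex.I_sq
    rw [e1, norm_mul, Complex.norm_real, Real.norm_eq_abs, abs_of_pos (by positivity)]
    have h3 : ‖(-(ν * e * l) + ω * k * Real.cos γ / s) / (I * ω - ν * e)‖ ≤
        2 * K * (2 * K * η * (3 * K * L) + K / s) := by
      rw [norm_div, div_le_iff₀ (lt_of_lt_of_le (by positivity) hb)]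
      have h4 : ‖-(ν * e * l) + ω * k * Real.cos γ / s‖ ≤ 2 * K * η * (3 * K * L) + K / s := by
        refine (norm_add_le _ _).trans (add_le_add ?_ ?_)
        · rw [norm_neg, norm_mul]; gcongr
        · simp only [norm_mul, norm_div, Complex.norm_real, Real.norm_eq_abs, abs_of_pos hs]
          calc |ω| * |k| * |Real.cos γ| / s ≤ 1 * K * 1 / s := by
                gcongr; exact Real.abs_cos_le_one _
            _ = _ := by ring
      calc _ ≤ 2 * K * η * (3 * K * L) + K / s := h4
        _ = 2 * K * (2 * K * η * (3 * K * L) + K / s) * (K⁻¹ / 2) := by field_simp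
        _ ≤ _ := by gcongr
    calc ν / κ * ‖(-(ν * e * l) + ω * k * Real.cos γ / s) / (I * ω - ν * e)‖
        ≤ ν / κ * (2 * K * (2 * K * η * (3 * K * L) + K / s)) := by gcongr
      _ = (12 * K ^ 3 * η + 2 * K ^ 2 / s * L⁻¹) * (ν / κ * L) := by field_simp; ring
      _ ≤ (80 * K ^ 4 / s ^ 2 * (η + z) + 80 * K ^ 4 / s ^ 2 * L⁻¹) * (ν / κ * L) := by
        have h5 : 12 * K ^ 3 ≤ 80 * K ^ 4 / s ^ 2 := by
          rw [le_div_iff₀ (by positivity)]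
          calc 12 * K ^ 3 * s ^ 2 ≤ 80 * K ^ 4 * 1 := by
                gcongr
                · norm_num
                · norm_num
                · exact hs2.trans hs1
            _ = _ := mul_one _
        have h6 : 2 * K ^ 2 / s ≤ 80 * K ^ 4 / s ^ 2 := by
          have h7 : K ^ 2 ≤ K ^ 4 := pow_le_pow_right₀ hK (by norm_num)
          gcongr
          norm_num
        gcongr
        linarith
      _ = _ := by ring
  · have hκL : κ * L ^ 2 ≤ 2 * K := by
      have h1 : 1 / ν ≤ 1 / κ := one_div_le_one_div_of_le hκ hle
      have h2 : K⁻¹ * L ^ 2 ≤ 2 / κ := by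
        have : 2 / κ = 1 / κ + 1 / κ := by ring
        linarith
      rw [le_div_iff₀ hκ] at h2
      calc κ * L ^ 2 = K * (K⁻¹ * L ^ 2 * κ) := by field_simp
        _ ≤ K * 2 := by gcongr
        _ = _ := by ring
    have hκe : ‖(κ * e : ℂ)‖ ≤ 2 * K * η := by
      rw [norm_mul, Complex.norm_real, Real.norm_eq_abs, abs_of_pos hκ]
      calc κ * ‖e‖ ≤ κ * (η * L ^ 2) := by gcongr
        _ = κ * L ^ 2 * η := by ring
        _ ≤ _ := by gcongr
    have hb : I * ω - κ * (k ^ 2 - l ^ 2) ≠ (0 : ℂ) := by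
      intro h0
      rw [charPoly_eq] at hroot
      have h2 : I * ω + κ * (l ^ 2 - k ^ 2) = (0 : ℂ) := by rw [← h0]; ring
      rw [h2] at hroot
      apply hls
      have h3 : (l * s + I * k * Real.cos γ) ^ 2 = 0 := by linear_combination -hroot
      exact pow_eq_zero_iff (two_ne_zero) |>.1 h3
    have hprod := layerB_mul_eq hl0 hb hroot
    have hvisc : (I * ω + ν * (l ^ 2 - k ^ 2) : ℂ) = -(ν / κ) * (I * ω - κ * e) := by
      rw [hD]; field_simp; ring
    rw [hvisc, ← hsd] at hprod
    have e1 : (layerG γ κ ω k l + ((ν / κ : ℝ) : ℂ) * l) * (l * s + I * k * Real.cos γ) =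
        ((ν / κ : ℝ) : ℂ) * ((-(ω ^ 2 - s ^ 2) * l ^ 2 + (ω ^ 2 * k ^ 2
          - I * ω * (κ * e) * (l ^ 2 - k ^ 2)) + I * s * k * Real.cos γ * l) / s) := by
      have e2 : layerG γ κ ω k l * (l * s + I * k * Real.cos γ) =
          (ν / κ) * (I * ω - κ * e) * (l ^ 2 - k ^ 2) * (I * ω / s) := by
        unfold layerG
        rw [← hsd]
        linear_combination (I * ω / s) * hprod
      rw [add_mul, e2]
      push_cast
      field_simp
      linear_combination (ω ^ 2 * (l ^ 2 - k ^ 2)) * Complex.I_sq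
    have hD' : ‖(l ^ 2 - k ^ 2 : ℂ)‖ ≤ 10 * K ^ 2 * L ^ 2 := by
      refine (norm_sub_le _ _).trans ?_
      rw [norm_pow, norm_pow, Complex.norm_real, Real.norm_eq_abs]
      calc ‖l‖ ^ 2 + |k| ^ 2 ≤ (3 * K * L) ^ 2 + K ^ 2 * 1 := by rw [mul_one]; gcongr
        _ ≤ (3 * K * L) ^ 2 + K ^ 2 * L ^ 2 := by gcongr; exact one_le_pow₀ hL
        _ = _ := by ring
    have h3 : ‖(-(ω ^ 2 - s ^ 2) * l ^ 2 + (ω ^ 2 * k ^ 2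
          - I * ω * (κ * e) * (l ^ 2 - k ^ 2)) + I * s * k * Real.cos γ * l : ℂ)‖ ≤
        20 * K ^ 3 * (η + z + L⁻¹) * L ^ 2 := by
      refine (norm_add₃_le).trans ?_
      have t1 : ‖(-(ω ^ 2 - s ^ 2) * l ^ 2 : ℂ)‖ ≤ z * (3 * K * L) ^ 2 := by
        rw [norm_mul, norm_neg, norm_pow, norm_sq_sub_sin_sq]; gcongr
      have t2 : ‖(ω ^ 2 * k ^ 2 - I * ω * (κ * e) * (l ^ 2 - k ^ 2) : ℂ)‖ ≤
          1 ^ 2 * K ^ 2 + 1 * (2 * K * η) * (10 * K ^ 2 * L ^ 2) := by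
        refine (norm_sub_le _ _).trans ?_
        rw [norm_mul, norm_mul (I * ω * (κ * e) : ℂ), norm_mul (I * ω : ℂ), norm_mul I,
          Complex.norm_I, one_mul, norm_pow, norm_pow, Complex.norm_real, Complex.norm_real,
          Real.norm_eq_abs, Real.norm_eq_abs]
        gcongr
      have t3 : ‖(I * s * k * Real.cos γ * l : ℂ)‖ ≤ 1 * 1 * K * 1 * (3 * K * L) := by
        simp only [norm_mul, Complex.norm_I, Complex.norm_real, Real.norm_eq_abs, abs_of_pos hs]
        gcongr
        exact Real.abs_cos_le_one _
      have hK23 : K ^ 2 ≤ K ^ 3 := pow_le_pow_right₀ hK (by norm_num)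
      have hLi : L⁻¹ * L ^ 2 = L := by field_simp
      calc _ ≤ z * (3 * K * L) ^ 2 + (1 ^ 2 * K ^ 2 + 1 * (2 * K * η) * (10 * K ^ 2 * L ^ 2))
            + 1 * 1 * K * 1 * (3 * K * L) := add_le_add (add_le_add t1 t2) t3
        _ = 9 * K ^ 2 * (z * L ^ 2) + K ^ 2 * 1 + 20 * K ^ 3 * (η * L ^ 2)
            + 3 * K ^ 2 * L := by ring
        _ ≤ 9 * K ^ 3 * (z * L ^ 2) + K ^ 3 * L + 20 * K ^ 3 * (η * L ^ 2) + 3 * K ^ 3 * L := by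
          gcongr
        _ ≤ 20 * K ^ 3 * (η * L ^ 2) + 20 * K ^ 3 * (z * L ^ 2) + 20 * K ^ 3 * L := by
          have : 0 ≤ K ^ 3 * (z * L ^ 2) := by positivity
          have : 0 ≤ K ^ 3 * L := by positivity
          linarith
        _ = 20 * K ^ 3 * (η * L ^ 2) + 20 * K ^ 3 * (z * L ^ 2) + 20 * K ^ 3 * (L⁻¹ * L ^ 2) := by
          rw [hLi]
        _ = _ := by ring
    have h4 := congrArg norm e1
    rw [norm_mul, norm_mul, norm_div, Complex.norm_real, Complex.norm_real, Real.norm_eq_abs,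
      Real.norm_eq_abs, abs_of_pos hs, abs_of_pos (by positivity : 0 < ν / κ)] at h4
    have h5 : ‖layerG γ κ ω k l + ((ν / κ : ℝ) : ℂ) * l‖ * ((4 * K)⁻¹ * L * s) ≤
        ν / κ * (20 * K ^ 3 * (η + z + L⁻¹) * L ^ 2 / s) := by
      calc _ ≤ ‖layerG γ κ ω k l + ((ν / κ : ℝ) : ℂ) * l‖ * ‖l * s + I * k * Real.cos γ‖ := by
            gcongr
        _ = _ := h4
        _ ≤ _ := by gcongr
    calc ‖layerG γ κ ω k l + ((ν / κ : ℝ) : ℂ) * l‖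
        = ‖layerG γ κ ω k l + ((ν / κ : ℝ) : ℂ) * l‖ * ((4 * K)⁻¹ * L * s) * (4 * K / (L * s)) := by
          field_simp
      _ ≤ ν / κ * (20 * K ^ 3 * (η + z + L⁻¹) * L ^ 2 / s) * (4 * K / (L * s)) := by gcongr
      _ = _ := by field_simp; ring

/-- Wave numbers and frequencies of a near-critical packet. -/
structure NearData (γ K z : ℝ) (ω k m : ℝ) : Prop where
  k_le : |k| ≤ K
  ω_le : |ω| ≤ 1
  le_ω : K⁻¹ ≤ |ω|
  kω : K⁻¹ ≤ k * ω
  le_m : K⁻¹ ≤ |m|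
  m_le : |m| ≤ K
  ζ_le : |ω ^ 2 - Real.sin γ ^ 2| ≤ z

theorem norm_inhomogeneity_le {γ K z ω k m : ℝ} (hs : 0 < Real.sin γ) (hK : 1 ≤ K)
    (h : NearData γ K z ω k m) :
    ‖-I / (m : ℂ)‖ ≤ 2 * K / Real.sin γ ∧
      ‖-(ω * m * (I * (k * Real.cos γ - m * Real.sin γ) / (m * ω)) / Real.sin γ : ℂ)‖ ≤
        2 * K / Real.sin γ := by
  have hK0 : 0 < K := by linarith
  have hm0 : 0 < |m| := lt_of_lt_of_le (by positivity) h.le_m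
  have hω0 : 0 < |ω| := lt_of_lt_of_le (by positivity) h.le_ω
  have hmC : (m : ℂ) ≠ 0 := by exact_mod_cast abs_pos.1 hm0
  have hωC : (ω : ℂ) ≠ 0 := by exact_mod_cast abs_pos.1 hω0
  have hs1 : Real.sin γ ≤ 1 := Real.sin_le_one γ
  constructor
  · rw [norm_div, norm_neg, Complex.norm_I, Complex.norm_real, Real.norm_eq_abs]
    have h1 : 1 / |m| ≤ K := by
      rw [div_le_iff₀ hm0]
      calc 1 = K * K⁻¹ := by field_simp
        _ ≤ _ := by gcongr; exact h.le_m
    refine h1.trans ?_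
    rw [le_div_iff₀ hs]
    nlinarith
  · have e : -(ω * m * (I * (k * Real.cos γ - m * Real.sin γ) / (m * ω)) / Real.sin γ : ℂ) =
        -(I * (((k * Real.cos γ - m * Real.sin γ) / Real.sin γ : ℝ) : ℂ)) := by
      push_cast; field_simp
    rw [e, norm_neg, norm_mul, Complex.norm_I, one_mul, Complex.norm_real, Real.norm_eq_abs,
      abs_div, abs_of_pos hs]
    gcongr
    calc |k * Real.cos γ - m * Real.sin γ| ≤ |k * Real.cos γ| + |m * Real.sin γ| := abs_sub _ _
      _ = |k| * |Real.cos γ| + |m| * |Real.sin γ| := by rw [abs_mul, abs_mul]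
      _ ≤ K * 1 + K * 1 := by
        gcongr
        · exact h.k_le
        · exact Real.abs_cos_le_one _
        · exact h.m_le
        · exact Real.abs_sin_le_one _
      _ = 2 * K := by ring

theorem continuous_charPoly (γ ν κ : ℝ) :
    Continuous fun p : ℝ × ℝ × ℂ => charPoly γ ν κ p.1 p.2.1 p.2.2 := by
  unfold charPoly
  fun_prop

set_option maxHeartbeats 1000000 in
/-- Roots and amplitudes when two of the roots have the same size `T` and the third one has the
larger size `L`. -/
theorem exists_roots_of_same_size {γ K : ℝ} (hs : 0 < Real.sin γ) (hc : 0 < Real.cos γ)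
    (hK : 1 ≤ K) :
    ∃ C > 0, ∃ τ > 0, ∀ ν κ T L z : ℝ, 0 < ν → 0 < κ → τ ≤ T → 0 < L →
      K⁻¹ ≤ (ν + κ) * T ^ 3 → (ν + κ) * T ^ 3 ≤ K → K⁻¹ * L ^ 2 ≤ 1 / ν + 1 / κ →
      1 / ν + 1 / κ ≤ K * L ^ 2 → z ≤ τ⁻¹ → z * T ≤ K →
      ∃ F : Fin 3 → ℝ × ℝ × ℂ → ℝ, (∀ j, Continuous (F j)) ∧ ∃ N : ℝ,
        ∀ ω k m : ℝ, NearData γ K z ω k m →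
          (∀ j, ∃ w, ‖w‖ ≤ N ∧ F j (ω, k, w) ≤ 0) ∧
          ∀ l : Fin 3 → ℂ, (∀ j, F j (ω, k, l j) ≤ 0) →
            (∀ j, charPoly γ ν κ ω k (l j) = 0) ∧
            (C⁻¹ * T ≤ (l 0).re ∧ ‖l 0‖ ≤ C * T) ∧ (C⁻¹ * T ≤ (l 1).re ∧ ‖l 1‖ ≤ C * T) ∧
            (C⁻¹ * L ≤ (l 2).re ∧ ‖l 2‖ ≤ C * L) ∧
            (amplitudeMatrix γ κ ω k l).det ≠ 0 ∧
            ∀ a : Fin 3 → ℂ, (amplitudeMatrix γ κ ω k l).mulVec a =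
                ![-1, -(-(k : ℂ) / m), -(I * m *
                  (I * (k * Real.cos γ - m * Real.sin γ) / (m * ω)))] →
              ‖a 0‖ ≤ C * T ∧ ‖a 1‖ ≤ C * T ∧ ‖a 2‖ ≤ C * (T ^ 2 / (ν / κ * L + T)) := by
  have hK0 : 0 < K := by linarith
  have hs1 : Real.sin γ ≤ 1 := Real.sin_le_one γ
  obtain ⟨δ₀, hδ₀, T₀, hT₀, hslow⟩ := exists_slow_roots hs hc hK
  set δ := min δ₀ (4 * K)⁻¹ with hδd
  have hδ : 0 < δ := by positivity
  have hδ1 : δ ≤ 1 := (min_le_right _ _).trans (inv_le_one_of_one_le₀ (by linarith))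
  have hδ₀' : δ ≤ δ₀ := min_le_left _ _
  have hδK : δ ≤ (4 * K)⁻¹ := min_le_right _ _
  have hδK' : 3 * K ≤ δ⁻¹ := by
    rw [le_inv_comm₀ (by positivity) hδ]
    refine hδK.trans ?_
    gcongr; norm_num
  have hδi : 1 ≤ δ⁻¹ := (one_le_inv₀ hδ).2 hδ1
  clear_value δ
  have hR : 1 ≤ 2 * K / Real.sin γ := by rw [le_div_iff₀ hs]; nlinarith
  obtain ⟨ηA, hηA, CA, hCA, hamp⟩ := amplitude_bounds_of_same_size hδ hδ1 hR
  set η := min (ηA * Real.sin γ ^ 2 / (240 * K ^ 4)) (1 / (4 * K ^ 2)) with hηd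
  have hη : 0 < η := by positivity
  have hηA1 : 80 * K ^ 4 / Real.sin γ ^ 2 * (η + η + η) ≤ ηA := by
    have h1 : η ≤ ηA * Real.sin γ ^ 2 / (240 * K ^ 4) := min_le_left _ _
    calc 80 * K ^ 4 / Real.sin γ ^ 2 * (η + η + η)
        = 240 * K ^ 4 / Real.sin γ ^ 2 * η := by ring
      _ ≤ 240 * K ^ 4 / Real.sin γ ^ 2 * (ηA * Real.sin γ ^ 2 / (240 * K ^ 4)) := by gcongr
      _ = ηA := by field_simp
  have hηK : 2 * K * η ≤ K⁻¹ / 2 := by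
    have h1 : η ≤ 1 / (4 * K ^ 2) := min_le_right _ _
    calc 2 * K * η ≤ 2 * K * (1 / (4 * K ^ 2)) := by gcongr
      _ = K⁻¹ / 2 := by field_simp; norm_num
  clear_value η
  obtain ⟨θ, hθ, hfast⟩ := exists_fast_root hK hη
  set M := max 1 (max θ⁻¹ η⁻¹) with hM
  have hM0 : 0 < M := by positivity
  set B := δ⁻¹ ^ 2 + K ^ 2 with hB
  have hB0 : 0 < B := by positivity
  set E := 2 * K * (K / Real.sin γ + K * B * δ⁻¹) with hE
  have hE0 : 0 < E := by positivity
  set τ := max (max T₀ (2 * K ^ 2 * B)) (max (E / ηA)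
    (max (max (K ^ 2 / (4 * ηA ^ 2)) (M * ηA)) (max η⁻¹ θ⁻¹))) with hτ
  have t1 : T₀ ≤ τ := (le_max_left _ _).trans (le_max_left _ _)
  have t2 : 2 * K ^ 2 * B ≤ τ := (le_max_right _ _).trans (le_max_left _ _)
  have t3 : E / ηA ≤ τ := (le_max_left _ _).trans (le_max_right _ _)
  have t4 : K ^ 2 / (4 * ηA ^ 2) ≤ τ := ((le_max_left _ _).trans (le_max_left _ _)).trans
    ((le_max_right _ _).trans (le_max_right _ _))
  have t5 : M * ηA ≤ τ := ((le_max_right _ _).trans (le_max_left _ _)).trans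
    ((le_max_right _ _).trans (le_max_right _ _))
  have t6 : η⁻¹ ≤ τ := ((le_max_left _ _).trans (le_max_right _ _)).trans
    ((le_max_right _ _).trans (le_max_right _ _))
  have t7 : θ⁻¹ ≤ τ := ((le_max_right _ _).trans (le_max_right _ _)).trans
    ((le_max_right _ _).trans (le_max_right _ _))
  clear_value τ
  have hτ0 : 0 < τ := by linarith
  refine ⟨max δ⁻¹ CA, by positivity, τ, hτ0, ?_⟩
  intro ν κ T L z hν hκ hT hL hσ hσ' hρ hρ' hz hzT
  have hT1 : 1 ≤ T := hT₀.le.trans (t1.trans hT)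
  have hT0 : 0 < T := by linarith
  have hσ0 : 0 < ν + κ := by positivity
  have hzη : z ≤ η := hz.trans (by rw [inv_le_comm₀ hτ0 hη]; exact t6)
  have hzθ : z ≤ θ := hz.trans (by rw [inv_le_comm₀ hτ0 hθ]; exact t7)
  have hTL : T ≤ ηA * L := by
    refine le_of_pow_le_pow_left₀ (n := 2) (by norm_num) (by positivity) ?_
    have h1 := four_le_add_mul_inv_add_inv hν hκ
    have h2 : 4 * T ^ 3 ≤ K ^ 2 * L ^ 2 := by
      calc 4 * T ^ 3 ≤ (ν + κ) * (1 / ν + 1 / κ) * T ^ 3 := by gcongr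
        _ = (ν + κ) * T ^ 3 * (1 / ν + 1 / κ) := by ring
        _ ≤ K * (K * L ^ 2) := by gcongr
        _ = _ := by ring
    have h3 : K ^ 2 ≤ T * (4 * ηA ^ 2) := by
      rw [← div_le_iff₀ (by positivity)]; exact t4.trans hT
    have h4 : K ^ 2 * T ^ 2 ≤ K ^ 2 * (ηA * L) ^ 2 := by
      calc K ^ 2 * T ^ 2 ≤ T * (4 * ηA ^ 2) * T ^ 2 := by gcongr
        _ = ηA ^ 2 * (4 * T ^ 3) := by ring
        _ ≤ ηA ^ 2 * (K ^ 2 * L ^ 2) := by gcongr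
        _ = _ := by ring
    exact le_of_mul_le_mul_left h4 (by positivity)
  have hML : M ≤ L := by
    have : M * ηA ≤ L * ηA := by linarith [t5.trans hT]
    exact le_of_mul_le_mul_right this hηA
  have hL1 : 1 ≤ L := (le_max_left _ _).trans hML
  have hLθ : θ⁻¹ ≤ L := ((le_max_left _ _).trans (le_max_right _ _)).trans hML
  have hLη : L⁻¹ ≤ η := by
    rw [inv_le_comm₀ hL hη]
    exact ((le_max_right _ _).trans (le_max_right _ _)).trans hML
  refine ⟨![fun p => max ‖charPoly γ ν κ p.1 p.2.1 p.2.2‖ (max (δ * T - p.2.2.re)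
        (max (δ * T - p.2.2.im) (‖p.2.2‖ - δ⁻¹ * T))),
      fun p => max ‖charPoly γ ν κ p.1 p.2.1 p.2.2‖ (max (δ * T - p.2.2.re)
        (max (δ * T + p.2.2.im) (‖p.2.2‖ - δ⁻¹ * T))),
      fun p => max ‖charPoly γ ν κ p.1 p.2.1 p.2.2‖
        (max (‖p.2.2 ^ 2 - p.2.1 ^ 2 + I * p.1 * ((1 / ν + 1 / κ : ℝ) : ℂ)‖ - η * L ^ 2)
          (max ((4 * K)⁻¹ * L - p.2.2.re) (‖p.2.2‖ - 3 * K * L)))], ?_, δ⁻¹ * T + 3 * K * L, ?_⟩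
  · have h1 := continuous_charPoly γ ν κ
    intro j
    fin_cases j
    · show Continuous _
      simp only [Fin.zero_eta, Matrix.cons_val_zero]
      exact h1.norm.max (by fun_prop)
    · show Continuous _
      simp only [Fin.mk_one, Matrix.cons_val_one, Matrix.cons_val_zero]
      exact h1.norm.max (by fun_prop)
    · show Continuous _
      simp only [Fin.reduceFinMk, Matrix.cons_val]
      exact h1.norm.max (by fun_prop)
  intro ω k m h
  have hζT : |ω ^ 2 - Real.sin γ ^ 2| * T ≤ K := le_trans (by gcongr; exact h.ζ_le) hzT
  obtain ⟨⟨w0, hw0, hr0, hi0, hn0⟩, ⟨w1, hw1, hr1, hi1, hn1⟩⟩ := hslow ν κ ω k T hν hκ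
    (t1.trans hT) h.k_le h.ω_le h.le_ω h.kω hσ hσ' hζT
  obtain ⟨w2, hw2, he2, hr2, hn2⟩ := hfast γ ν κ ω k L hν hκ hLθ h.k_le h.ω_le h.le_ω hρ hρ'
    (h.ζ_le.trans hzθ)
  have hδT : δ * T ≤ δ₀ * T := by gcongr
  have hδiT : δ₀⁻¹ * T ≤ δ⁻¹ * T := by gcongr
  have hN0 : 0 ≤ δ⁻¹ * T := by positivity
  have hN1 : 0 ≤ 3 * K * L := by positivity
  constructor
  · intro j
    fin_cases j
    · refine ⟨w0, by linarith, ?_⟩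
      simp only [Fin.zero_eta, Matrix.cons_val_zero, max_le_iff, hw0, norm_zero]
      exact ⟨le_rfl, by linarith, by linarith, by linarith⟩
    · refine ⟨w1, by linarith, ?_⟩
      simp only [Fin.mk_one, Matrix.cons_val_one, Matrix.cons_val_zero, max_le_iff, hw1, norm_zero]
      exact ⟨le_rfl, by linarith, by linarith, by linarith⟩
    · refine ⟨w2, by linarith, ?_⟩
      simp only [Fin.reduceFinMk, Matrix.cons_val, max_le_iff, hw2, norm_zero]
      exact ⟨le_rfl, by linarith, by linarith, by linarith⟩
  intro l hl
  have l0 := hl 0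
  have l1 := hl 1
  have l2 := hl 2
  simp only [Matrix.cons_val, max_le_iff, norm_le_zero_iff] at l0 l1 l2
  obtain ⟨c0, r0, i0, n0⟩ := l0
  obtain ⟨c1, r1, i1, n1⟩ := l1
  obtain ⟨c2, e2, r2, n2⟩ := l2
  rw [sub_nonpos] at r0 i0 n0 r1 n1 e2 r2 n2
  have hC1 : δ⁻¹ ≤ max δ⁻¹ CA := le_max_left _ _
  have hC2 : CA ≤ max δ⁻¹ CA := le_max_right _ _
  have hC0 : (max δ⁻¹ CA)⁻¹ ≤ δ := by rw [inv_le_comm₀ (by positivity) hδ]; exact hC1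
  set C := max δ⁻¹ CA with hC
  have hω0 : ω ≠ 0 := abs_pos.1 (lt_of_lt_of_le (by positivity) h.le_ω)
  have hk0 : k ≠ 0 := by
    rintro rfl
    have := h.kω
    rw [zero_mul] at this
    have : 0 < K⁻¹ := by positivity
    linarith
  have hl0 : ∀ w : ℂ, δ * T ≤ w.re → w ≠ 0 := by
    rintro w hw rfl
    have : 0 < δ * T := by positivity
    simp at hw; linarith
  have hk2 : k ^ 2 ≤ K ^ 2 := by rw [← sq_abs]; gcongr; exact h.k_le
  have hG : ∀ w : ℂ, δ * T ≤ w.re → ‖w‖ ≤ δ⁻¹ * T → ‖layerG γ κ ω k w - w‖ ≤ ηA * T := by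
    intro w hw hw'
    have h1 : κ * ‖w ^ 2 - k ^ 2‖ ≤ K * B / T := by
      rw [le_div_iff₀ hT0]
      have h2 : ‖(w ^ 2 - k ^ 2 : ℂ)‖ ≤ B * T ^ 2 := by
        refine (norm_sub_le _ _).trans ?_
        rw [norm_pow, norm_pow, Complex.norm_real, Real.norm_eq_abs, sq_abs]
        calc ‖w‖ ^ 2 + k ^ 2 ≤ (δ⁻¹ * T) ^ 2 + K ^ 2 * 1 := by rw [mul_one]; gcongr
          _ ≤ (δ⁻¹ * T) ^ 2 + K ^ 2 * T ^ 2 := by gcongr; exact one_le_pow₀ hT1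
          _ = _ := by rw [hB]; ring
      calc κ * ‖(w ^ 2 - k ^ 2 : ℂ)‖ * T ≤ (ν + κ) * (B * T ^ 2) * T := by
            gcongr; linarith
        _ = (ν + κ) * T ^ 3 * B := by ring
        _ ≤ _ := by gcongr
    have h2 : K * B / T ≤ K⁻¹ / 2 := by
      rw [div_le_iff₀ hT0]
      calc K * B = K⁻¹ / 2 * (2 * K ^ 2 * B) := by field_simp
        _ ≤ _ := by gcongr; exact t2.trans hT
    refine (norm_layerG_sub_le hs hκ hK h.k_le h.ω_le h.le_ω (hl0 w hw) h1 h2).trans ?_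
    calc 2 * K * (K / Real.sin γ + K * B / T * ‖w‖)
        ≤ 2 * K * (K / Real.sin γ + K * B / T * (δ⁻¹ * T)) := by gcongr
      _ = E := by rw [hE]; field_simp
      _ ≤ ηA * T := by
        have := t3.trans hT
        rw [div_le_iff₀ hηA] at this
        linarith
  have hG2 : ‖layerG γ κ ω k (l 2) + ((ν / κ : ℝ) : ℂ) * l 2‖ ≤ ηA * (ν / κ * L) := by
    refine (norm_layerG_add_le hs hν hκ hK h.k_le h.ω_le h.le_ω hL1 hρ c2 e2 r2 n2 hηK
      (h.ζ_le.trans hzη)).trans ?_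
    calc _ ≤ 80 * K ^ 4 / Real.sin γ ^ 2 * (η + η + η) * (ν / κ * L) := by gcongr
      _ ≤ _ := by gcongr
  have h01 : δ * T ≤ ‖l 0 - l 1‖ := by
    refine le_trans ?_ ((le_abs_self _).trans (Complex.abs_im_le_norm _))
    rw [Complex.sub_im]
    have : 0 < δ * T := by positivity
    linarith
  obtain ⟨hdet, hbd⟩ := hamp T L (ν / κ) l (fun j => layerG γ κ ω k (l j)) hT1 hL (by positivity)
    hTL r0 n0 r1 n1 h01 (le_trans (by gcongr) r2) (n2.trans (by gcongr)) (hG _ r0 n0) (hG _ r1 n1)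
    hG2
  refine ⟨?_, ⟨le_trans (by gcongr) r0, n0.trans (by gcongr)⟩,
    ⟨le_trans (by gcongr) r1, n1.trans (by gcongr)⟩,
    ⟨(mul_le_mul_of_nonneg_right (hC0.trans hδK) hL.le).trans r2, n2.trans (by gcongr; exact hδK'.trans hC1)⟩,
    ?_, ?_⟩
  · intro j
    fin_cases j
    exacts [c0, c1, c2]
  · rw [amplitudeMatrix_det hs.ne' hω0]
    have hkC : (k : ℂ) ≠ 0 := by exact_mod_cast hk0
    have hsC : (Real.sin γ : ℂ) ≠ 0 := by exact_mod_cast hs.ne'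
    have hωC : (ω : ℂ) ≠ 0 := by exact_mod_cast hω0
    exact mul_ne_zero (mul_ne_zero (mul_ne_zero Complex.I_ne_zero hkC)
      (div_ne_zero (mul_ne_zero Complex.I_ne_zero hsC) hωC)) hdet
  · intro a ha
    obtain ⟨a1, a2, a3⟩ := amplitude_equations hs.ne' hω0 hk0 ha
    obtain ⟨hr, hg⟩ := norm_inhomogeneity_le hs hK h
    obtain ⟨b0, b1, b2⟩ := hbd a _ _ hr hg a1 a2 a3
    exact ⟨b0.trans (by gcongr), b1.trans (by gcongr), b2.trans (by gcongr)⟩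

theorem exists_pos_forall_le (s : List ℝ) (h : ∀ x ∈ s, 0 < x) : ∃ τ > 0, ∀ x ∈ s, τ ≤ x := by
  induction s with
  | nil => exact ⟨1, one_pos, by simp⟩
  | cons a s ih =>
    obtain ⟨τ, hτ, hle⟩ := ih fun x hx => h x (List.mem_cons_of_mem _ hx)
    refine ⟨min a τ, lt_min (h a List.mem_cons_self) hτ, ?_⟩
    intro x hx
    rcases List.mem_cons.1 hx with rfl | hx
    · exact min_le_left _ _
    · exact (min_le_right _ _).trans (hle x hx)

set_option maxHeartbeats 2000000 in
/-- Roots and amplitudes when the three roots have different sizes. -/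
theorem exists_roots_of_separated {γ K : ℝ} (hs : 0 < Real.sin γ) (hc : 0 < Real.cos γ)
    (hK : 1 ≤ K) :
    ∃ C > 0, ∃ τ > 0, ∀ ν κ ε S L : ℝ, 0 < ν → 0 < κ → 0 < ε → ε ≤ τ → 0 < S → 0 < L →
      (ν + κ) * S ^ 2 = ε ^ 2 → (ν + κ) * L ^ 2 = 1 → ν + κ ≤ τ ^ 2 * ε ^ 6 →
      K⁻¹ * L ^ 2 ≤ 1 / ν + 1 / κ → 1 / ν + 1 / κ ≤ K * L ^ 2 → K⁻¹ ≤ ν / κ → ν / κ ≤ K →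
      ∃ F : Fin 3 → ℝ × ℝ × ℂ → ℝ, (∀ j, Continuous (F j)) ∧ ∃ N : ℝ,
        ∀ ω k m : ℝ, NearData γ K (K * ε ^ 2) ω k m →
          K⁻¹ * ε ^ 2 ≤ |ω ^ 2 - Real.sin γ ^ 2| →
          (∀ j, ∃ w, ‖w‖ ≤ N ∧ F j (ω, k, w) ≤ 0) ∧
          ∀ l : Fin 3 → ℂ, (∀ j, F j (ω, k, l j) ≤ 0) →
            (∀ j, charPoly γ ν κ ω k (l j) = 0) ∧
            (C⁻¹ * ((ν + κ) / ε ^ 8) ≤ (l 0).re ∧ (l 0).re ≤ C * ((ν + κ) / ε ^ 8)) ∧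
            (C⁻¹ * (ε ^ 2)⁻¹ ≤ ‖l 0‖ ∧ ‖l 0‖ ≤ C * (ε ^ 2)⁻¹) ∧
            (C⁻¹ * S ≤ (l 1).re ∧ ‖l 1‖ ≤ C * S) ∧
            (C⁻¹ * L ≤ (l 2).re ∧ ‖l 2‖ ≤ C * L) ∧
            (amplitudeMatrix γ κ ω k l).det ≠ 0 ∧
            ∀ a : Fin 3 → ℂ, (amplitudeMatrix γ κ ω k l).mulVec a =
                ![-1, -(-(k : ℂ) / m), -(I * m *
                  (I * (k * Real.cos γ - m * Real.sin γ) / (m * ω)))] →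
              ‖a 0‖ ≤ C * (ε ^ 2)⁻¹ ∧ ‖a 1‖ ≤ C * (ε ^ 2)⁻¹ ∧ ‖a 2‖ ≤ C * ε⁻¹ := by
  have hK0 : 0 < K := by linarith
  have hs1 : Real.sin γ ≤ 1 := Real.sin_le_one γ
  obtain ⟨δ, hδ, θo, hθo, hosc⟩ := exists_oscillating_root hK (mul_pos hs hc)
  obtain ⟨θm, hθm, hmod⟩ := exists_moderate_root hK
  have hR : 1 ≤ 2 * K / Real.sin γ := by rw [le_div_iff₀ hs]; nlinarith
  set D0 := 2 * K * (K / Real.sin γ + δ⁻¹ * K) with hD0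
  set D1 := 2 * K * (K / Real.sin γ + 2 * K ^ 2) with hD1
  have hD0' : 0 < D0 := by positivity
  have hD1' : 0 < D1 := by positivity
  set W := 8 * K ^ 2 + D0 + D1 + K * δ⁻¹ + K ^ 4 * δ⁻¹ with hW
  have hδi0 : 0 < δ⁻¹ := by positivity
  have hKK : 1 ≤ K ^ 2 := one_le_pow₀ hK
  have hKK' : K ≤ K ^ 2 := le_self_pow₀ hK (by norm_num)
  have hKδ : 0 < K * δ⁻¹ := by positivity
  have hK4δ : 0 < K ^ 4 * δ⁻¹ := by positivity
  have hW8 : 8 * K ^ 2 ≤ W := by linarith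
  have hWD0 : D0 ≤ W := by linarith
  have hWD1 : D1 ≤ W := by linarith
  have hWδ : K * δ⁻¹ ≤ W := by linarith
  have hWδ4 : K ^ 4 * δ⁻¹ ≤ W := by linarith
  have hW1 : 1 ≤ W := by linarith
  have hW0 : 0 < W := by linarith
  clear_value W
  obtain ⟨ηA, hηA, CA, hCA, hamp⟩ := amplitude_bounds_of_separated (δ := W⁻¹) (by positivity)
    (inv_le_one_of_one_le₀ hW1) hR
  rw [inv_inv] at hamp
  obtain ⟨η, hη, hηl⟩ := exists_pos_forall_le
    [Real.sin γ ^ 2 / (1920 * K ^ 7), 1 / (4 * K ^ 2)] (by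
      intro x hx
      simp only [List.mem_cons, List.not_mem_nil, or_false] at hx
      rcases hx with rfl | rfl <;> positivity)
  have hη1 : 80 * K ^ 4 / Real.sin γ ^ 2 * (η + η + η) * K ≤ (8 * K ^ 2)⁻¹ := by
    have h1 : η ≤ Real.sin γ ^ 2 / (1920 * K ^ 7) := hηl _ (by simp)
    calc 80 * K ^ 4 / Real.sin γ ^ 2 * (η + η + η) * K
        = 240 * K ^ 5 / Real.sin γ ^ 2 * η := by ring
      _ ≤ 240 * K ^ 5 / Real.sin γ ^ 2 * (Real.sin γ ^ 2 / (1920 * K ^ 7)) := by gcongr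
      _ = (8 * K ^ 2)⁻¹ := by field_simp; norm_num
  have hηK : 2 * K * η ≤ K⁻¹ / 2 := by
    have h1 : η ≤ 1 / (4 * K ^ 2) := hηl _ (by simp)
    calc 2 * K * η ≤ 2 * K * (1 / (4 * K ^ 2)) := by gcongr
      _ = K⁻¹ / 2 := by field_simp; norm_num
  obtain ⟨θf, hθf, hfast⟩ := exists_fast_root hK hη
  obtain ⟨τ, hτ, hτl⟩ := exists_pos_forall_le [1, θm / K, θo / K, θf / K, θf, η / K, η,
    θm ^ 2 / K ^ 3, θo / K ^ 3, ηA, K⁻¹ / 2 / (δ⁻¹ ^ 2 * K ^ 2 + K ^ 2), K⁻¹ / 2 / (5 * K ^ 4)] (by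
      intro x hx
      simp only [List.mem_cons, List.not_mem_nil, or_false] at hx
      rcases hx with rfl | rfl | rfl | rfl | rfl | rfl | rfl | rfl | rfl | rfl | rfl | rfl <;>
        positivity)
  have t1 : τ ≤ 1 := hτl _ (by simp)
  have t2 : K * τ ≤ θm := by
    have : τ ≤ θm / K := hτl _ (by simp)
    rw [le_div_iff₀ hK0] at this; linarith
  have t3 : K * τ ≤ θo := by
    have : τ ≤ θo / K := hτl _ (by simp)
    rw [le_div_iff₀ hK0] at this; linarith
  have t4 : K * τ ≤ θf := by
    have : τ ≤ θf / K := hτl _ (by simp)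
    rw [le_div_iff₀ hK0] at this; linarith
  have t5 : τ ≤ θf := hτl _ (by simp)
  have t6 : K * τ ≤ η := by
    have : τ ≤ η / K := hτl _ (by simp)
    rw [le_div_iff₀ hK0] at this; linarith
  have t7 : τ ≤ η := hτl _ (by simp)
  have t8 : τ ≤ θm ^ 2 / K ^ 3 := hτl _ (by simp)
  have t9 : τ ≤ θo / K ^ 3 := hτl _ (by simp)
  have t10 : τ ≤ ηA := hτl _ (by simp)
  have t11 : τ * (δ⁻¹ ^ 2 * K ^ 2 + K ^ 2) ≤ K⁻¹ / 2 := by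
    rw [← le_div_iff₀ (by positivity)]; exact hτl _ (by simp)
  have t12 : τ * (5 * K ^ 4) ≤ K⁻¹ / 2 := by
    rw [← le_div_iff₀ (by positivity)]; exact hτl _ (by simp)
  clear hτl hηl
  refine ⟨max W CA, by positivity, τ, hτ, ?_⟩
  intro ν κ ε S L hν hκ hε hετ hS hL hσS hσL hσ hρ hρ' hμ hμ'
  have hσ0 : 0 < ν + κ := by positivity
  have hε1 : ε ≤ 1 := hετ.trans t1
  have hεε : ε ^ 2 ≤ ε := by
    calc ε ^ 2 = ε * ε := sq ε
      _ ≤ ε * 1 := by gcongr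
      _ = ε := mul_one ε
  have hε2τ : ε ^ 2 ≤ τ := hεε.trans hετ
  have hτ2 : τ ^ 2 ≤ τ := by
    calc τ ^ 2 = τ * τ := sq τ
      _ ≤ τ * 1 := by gcongr
      _ = τ := mul_one τ
  have hστ : ν + κ ≤ τ ^ 2 := hσ.trans (mul_le_of_le_one_right (by positivity) (pow_le_one₀ hε.le hε1))
  have hLτ : τ⁻¹ ≤ L := by
    rw [inv_le_iff_one_le_mul₀ hτ]
    refine le_of_pow_le_pow_left₀ (n := 2) (by norm_num) (by positivity) ?_
    calc 1 ^ 2 = (ν + κ) * L ^ 2 := by rw [hσL]; norm_num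
      _ ≤ τ ^ 2 * L ^ 2 := by gcongr
      _ = _ := by ring
  have hL1 : 1 ≤ L := ((one_le_inv₀ hτ).2 t1).trans hLτ
  have hLη : L⁻¹ ≤ η := by
    refine le_trans ?_ t7
    rw [inv_le_comm₀ hL hτ]; exact hLτ
  set T := (ε ^ 2)⁻¹ with hT
  have hT0 : 0 < T := by positivity
  have hTε : ε ^ 2 * T = 1 := by rw [hT]; field_simp
  have hT1 : 1 ≤ T := (one_le_inv₀ (by positivity)).2 (pow_le_one₀ hε.le hε1)
  have hTS : T ≤ τ * S := by
    refine le_of_pow_le_pow_left₀ (n := 2) (by norm_num) (by positivity) ?_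
    have h1 : (ν + κ) * T ^ 2 ≤ (ν + κ) * (τ * S) ^ 2 := by
      calc (ν + κ) * T ^ 2 ≤ τ ^ 2 * ε ^ 6 * T ^ 2 := by gcongr
        _ = τ ^ 2 * ε ^ 2 * (ε ^ 2 * T) ^ 2 := by ring
        _ = τ ^ 2 * ((ν + κ) * S ^ 2) := by rw [hTε, hσS]; ring
        _ = _ := by ring
    exact le_of_mul_le_mul_left h1 hσ0
  have hS1 : 1 ≤ S := hT1.trans (hTS.trans (mul_le_of_le_one_left hS.le t1))
  have hSL : S = ε * L := by
    have h1 : S ^ 2 = (ε * L) ^ 2 := by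
      have : (ν + κ) * S ^ 2 = (ν + κ) * (ε * L) ^ 2 := by
        rw [hσS, mul_pow]; linear_combination (-ε ^ 2) * hσL
      exact mul_left_cancel₀ hσ0.ne' this
    exact (pow_left_inj₀ hS.le (by positivity) two_ne_zero).1 h1
  refine ⟨![fun p => max ‖charPoly γ ν κ p.1 p.2.1 p.2.2‖
        (max (δ * (ν + κ) - |p.1 ^ 2 - Real.sin γ ^ 2| ^ 4 * p.2.2.re)
        (max (|p.1 ^ 2 - Real.sin γ ^ 2| ^ 4 * p.2.2.re - δ⁻¹ * (ν + κ))
        (max (δ - |p.1 ^ 2 - Real.sin γ ^ 2| * ‖p.2.2‖)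
        (|p.1 ^ 2 - Real.sin γ ^ 2| * ‖p.2.2‖ - δ⁻¹)))),
      fun p => max ‖charPoly γ ν κ p.1 p.2.1 p.2.2‖
        (max (Real.sqrt (|p.1 ^ 2 - Real.sin γ ^ 2| / (ν + κ)) / 4 - p.2.2.re)
        (‖p.2.2‖ - 2 * K * Real.sqrt (|p.1 ^ 2 - Real.sin γ ^ 2| / (ν + κ)))),
      fun p => max ‖charPoly γ ν κ p.1 p.2.1 p.2.2‖
        (max (‖p.2.2 ^ 2 - p.2.1 ^ 2 + I * p.1 * ((1 / ν + 1 / κ : ℝ) : ℂ)‖ - η * L ^ 2)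
          (max ((4 * K)⁻¹ * L - p.2.2.re) (‖p.2.2‖ - 3 * K * L)))], ?_,
    W * T + W * S + W * L, ?_⟩
  · have h1 := continuous_charPoly γ ν κ
    intro j
    fin_cases j
    · show Continuous _
      simp only [Fin.zero_eta, Matrix.cons_val_zero]
      exact h1.norm.max (by fun_prop)
    · show Continuous _
      simp only [Fin.mk_one, Matrix.cons_val_one, Matrix.cons_val_zero]
      refine h1.norm.max ?_
      have h2 : Continuous fun p : ℝ × ℝ × ℂ =>
          Real.sqrt (|p.1 ^ 2 - Real.sin γ ^ 2| / (ν + κ)) :=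
        Real.continuous_sqrt.comp (by fun_prop)
      exact ((h2.div_const 4).sub (by fun_prop)).max
        (Continuous.sub (by fun_prop) (continuous_const.mul h2))
    · show Continuous _
      simp only [Fin.reduceFinMk, Matrix.cons_val]
      exact h1.norm.max (by fun_prop)
  intro ω k m h hζlow
  obtain ⟨Z, hZ⟩ : ∃ Z, |ω ^ 2 - Real.sin γ ^ 2| = Z := ⟨_, rfl⟩
  rw [hZ] at hζlow
  have hZup : Z ≤ K * ε ^ 2 := hZ ▸ h.ζ_le
  have hZ0 : 0 < Z := lt_of_lt_of_le (by positivity) hζlow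
  have hZτ : Z ≤ K * τ := hZup.trans (by gcongr)
  have hεZ : ε ^ 6 ≤ K ^ 3 * Z ^ 3 := by
    calc ε ^ 6 = K ^ 3 * (K⁻¹ * ε ^ 2) ^ 3 := by field_simp
      _ ≤ _ := by gcongr
  have hσm : ν + κ ≤ θm ^ 2 * Z ^ 3 := by
    calc ν + κ ≤ τ ^ 2 * ε ^ 6 := hσ
      _ ≤ τ * (K ^ 3 * Z ^ 3) := by gcongr
      _ ≤ θm ^ 2 / K ^ 3 * (K ^ 3 * Z ^ 3) := by gcongr
      _ = _ := by field_simp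
  have hσo : ν + κ ≤ θo * Z ^ 3 := by
    calc ν + κ ≤ τ ^ 2 * ε ^ 6 := hσ
      _ ≤ τ * (K ^ 3 * Z ^ 3) := by gcongr
      _ ≤ θo / K ^ 3 * (K ^ 3 * Z ^ 3) := by gcongr
      _ = _ := by field_simp
  set T1 := Real.sqrt (Z / (ν + κ)) with hT1d
  have hT1sq : (ν + κ) * T1 ^ 2 = Z := by
    rw [hT1d, Real.sq_sqrt (by positivity)]; field_simp
  have hT10 : 0 < T1 := Real.sqrt_pos.2 (by positivity)
  have hT1S : T1 ≤ K * S := by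
    refine le_of_pow_le_pow_left₀ (n := 2) (by norm_num) (by positivity) ?_
    refine le_of_mul_le_mul_left (a := ν + κ) ?_ hσ0
    calc (ν + κ) * T1 ^ 2 ≤ K * ((ν + κ) * S ^ 2) := by rw [hT1sq, hσS]; exact hZup
      _ ≤ K ^ 2 * ((ν + κ) * S ^ 2) := by gcongr
      _ = _ := by ring
  have hST1 : K⁻¹ * S ≤ T1 := by
    refine le_of_pow_le_pow_left₀ (n := 2) (by norm_num) hT10.le ?_
    refine le_of_mul_le_mul_left (a := ν + κ) ?_ hσ0
    have hKi : K⁻¹ ≤ 1 := inv_le_one_of_one_le₀ hK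
    calc (ν + κ) * (K⁻¹ * S) ^ 2 = K⁻¹ * (K⁻¹ * ((ν + κ) * S ^ 2)) := by ring
      _ ≤ 1 * (K⁻¹ * ((ν + κ) * S ^ 2)) := by gcongr
      _ ≤ (ν + κ) * T1 ^ 2 := by rw [hT1sq, hσS, one_mul]; exact hζlow
  clear_value T1
  obtain ⟨w0, hw0, ha0, hb0, hc0, hd0⟩ := hosc γ ν κ ω k Z rfl hν hκ h.k_le h.ω_le h.le_ω h.kω hZ
    hZ0 (hZτ.trans t3) hσo
  obtain ⟨w1, hw1, ha1, hb1⟩ := hmod γ ν κ ω k Z T1 hν hκ h.k_le h.ω_le h.le_ω hZ hZ0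
    (hZτ.trans t2) hσm hT10 hT1sq
  obtain ⟨w2, hw2, he2, hr2, hn2⟩ := hfast γ ν κ ω k L hν hκ
    (le_trans (by gcongr) hLτ) h.k_le h.ω_le h.le_ω hρ hρ' (hZ ▸ hZτ.trans t4)
  have hWT : 0 < W * T := by positivity
  have hWS : 0 < W * S := by positivity
  have hWL : 0 < W * L := by positivity
  have hZT : Z⁻¹ ≤ K * T := by
    rw [inv_le_comm₀ hZ0 (by positivity), mul_inv, hT, inv_inv]; exact hζlow
  have hTZ : K⁻¹ * T ≤ Z⁻¹ := by
    rw [le_inv_comm₀ (by positivity) hZ0, mul_inv, inv_inv, hT, inv_inv]; exact hZup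
  have hsize0 : ∀ w : ℂ, Z * ‖w‖ ≤ δ⁻¹ → ‖w‖ ≤ K * δ⁻¹ * T := by
    intro w hw
    calc ‖w‖ = Z⁻¹ * (Z * ‖w‖) := by field_simp
      _ ≤ K * T * δ⁻¹ := by gcongr
      _ = _ := by ring
  have hZ4 : Z ^ 4 ≤ K ^ 4 * ε ^ 8 := by
    calc Z ^ 4 ≤ (K * ε ^ 2) ^ 4 := by gcongr
      _ = _ := by ring
  have hZ4' : K⁻¹ ^ 4 * ε ^ 8 ≤ Z ^ 4 := by
    calc K⁻¹ ^ 4 * ε ^ 8 = (K⁻¹ * ε ^ 2) ^ 4 := by ring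
      _ ≤ _ := by gcongr
  constructor
  · intro j
    fin_cases j
    · have e3 : Z * ‖w0‖ ≤ δ⁻¹ := by rw [le_div_iff₀ hZ0] at hd0; linarith
      refine ⟨w0, ?_, ?_⟩
      · have := hsize0 w0 e3
        have h2 : K * δ⁻¹ * T ≤ W * T := by gcongr
        linarith
      simp only [Fin.zero_eta, Matrix.cons_val_zero, max_le_iff, hw0, norm_zero, hZ]
      have e1 : δ * (ν + κ) ≤ Z ^ 4 * w0.re := by
        rw [← mul_div_assoc, div_le_iff₀ (by positivity)] at ha0; linarith
      have e2 : Z ^ 4 * w0.re ≤ δ⁻¹ * (ν + κ) := by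
        rw [← mul_div_assoc, le_div_iff₀ (by positivity)] at hb0; linarith
      have e4 : δ ≤ Z * ‖w0‖ := by rw [div_le_iff₀ hZ0] at hc0; linarith
      exact ⟨le_rfl, by linarith, by linarith, by linarith, by linarith⟩
    · refine ⟨w1, ?_, ?_⟩
      · have h1 : 2 * K * T1 ≤ 2 * K * (K * S) := by gcongr
        have h2 : 8 * K ^ 2 * S ≤ W * S := by gcongr
        have h3 : 0 < K ^ 2 * S := by positivity
        linarith
      simp only [Fin.mk_one, Matrix.cons_val_one, Matrix.cons_val_zero, max_le_iff, hw1, norm_zero,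
        hZ, ← hT1d]
      exact ⟨le_rfl, by linarith, by linarith⟩
    · refine ⟨w2, ?_, ?_⟩
      · have h1 : 3 * K * L ≤ W * L := by gcongr; linarith
        linarith
      simp only [Fin.reduceFinMk, Matrix.cons_val, max_le_iff, hw2, norm_zero]
      exact ⟨le_rfl, by linarith, by linarith, by linarith⟩
  intro l hl
  have l0 := hl 0
  have l1 := hl 1
  have l2 := hl 2
  simp only [Matrix.cons_val, max_le_iff, norm_le_zero_iff, hZ] at l0 l1 l2
  rw [← hT1d] at l1
  obtain ⟨c0, r0, r0', n0, n0'⟩ := l0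
  obtain ⟨c1, r1, n1⟩ := l1
  obtain ⟨c2, e2, r2, n2⟩ := l2
  rw [sub_nonpos] at r0 r0' n0 n0' r1 n1 e2 r2 n2
  have hC1 : W ≤ max W CA := le_max_left _ _
  have hC2 : CA ≤ max W CA := le_max_right _ _
  have hC0 : (max W CA)⁻¹ ≤ W⁻¹ := by gcongr
  set C := max W CA with hC
  have hC00 : 0 < C := by positivity
  have hω0 : ω ≠ 0 := abs_pos.1 (lt_of_lt_of_le (by positivity) h.le_ω)
  have hk0 : k ≠ 0 := by
    rintro rfl
    have := h.kω
    rw [zero_mul] at this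
    have : 0 < K⁻¹ := by positivity
    linarith
  have hk2 : k ^ 2 ≤ K ^ 2 := by rw [← sq_abs]; gcongr; exact h.k_le
  have m0 : ‖l 0‖ ≤ K * δ⁻¹ * T := hsize0 _ n0'
  have m0' : W⁻¹ * T ≤ ‖l 0‖ := by
    calc W⁻¹ * T ≤ (K * δ⁻¹)⁻¹ * T := by gcongr
      _ = δ * (K⁻¹ * T) := by rw [mul_inv, inv_inv]; ring
      _ ≤ δ * Z⁻¹ := by gcongr
      _ ≤ Z * ‖l 0‖ * Z⁻¹ := by gcongr
      _ = ‖l 0‖ := by field_simp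
  have m1 : ‖l 1‖ ≤ 2 * K ^ 2 * S := by
    calc ‖l 1‖ ≤ 2 * K * T1 := n1
      _ ≤ 2 * K * (K * S) := by gcongr
      _ = _ := by ring
  have m1' : W⁻¹ * S ≤ (l 1).re := by
    calc W⁻¹ * S ≤ (8 * K ^ 2)⁻¹ * S := by gcongr
      _ ≤ (4 * K)⁻¹ * S := by gcongr; linarith
      _ = K⁻¹ * S / 4 := by field_simp
      _ ≤ T1 / 4 := by gcongr
      _ ≤ _ := r1
  have m2' : W⁻¹ * L ≤ (l 2).re := by
    calc W⁻¹ * L ≤ (8 * K ^ 2)⁻¹ * L := by gcongr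
      _ ≤ (4 * K)⁻¹ * L := by gcongr; linarith
      _ ≤ _ := r2
  have m2 : ‖l 2‖ ≤ W * L := n2.trans (by gcongr; linarith)
  have hG : ∀ (w : ℂ) (A X : ℝ), w ≠ 0 → ‖w‖ ≤ A * X → 1 ≤ X → 0 < A →
      (ν + κ) * (A ^ 2 * X ^ 2 + K ^ 2) ≤ K⁻¹ / 2 →
      ‖layerG γ κ ω k w - w‖ ≤ 2 * K * (K / Real.sin γ + A) * X := by
    intro w A X hw hwA hX hA he
    have h1 : κ * ‖w ^ 2 - k ^ 2‖ ≤ K⁻¹ / 2 := by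
      refine le_trans ?_ he
      have h2 : ‖(w ^ 2 - k ^ 2 : ℂ)‖ ≤ A ^ 2 * X ^ 2 + K ^ 2 := by
        refine (norm_sub_le _ _).trans ?_
        rw [norm_pow, norm_pow, Complex.norm_real, Real.norm_eq_abs, sq_abs]
        calc ‖w‖ ^ 2 + k ^ 2 ≤ (A * X) ^ 2 + K ^ 2 := by gcongr
          _ = _ := by ring
      gcongr
      linarith
    refine (norm_layerG_sub_le hs hκ hK h.k_le h.ω_le h.le_ω hw h1 le_rfl).trans ?_
    have hKi : K⁻¹ / 2 ≤ 1 := by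
      have : K⁻¹ ≤ 1 := inv_le_one_of_one_le₀ hK
      linarith
    calc 2 * K * (K / Real.sin γ + K⁻¹ / 2 * ‖w‖)
        ≤ 2 * K * (K / Real.sin γ * X + 1 * (A * X)) := by
          gcongr
          exact le_mul_of_one_le_right (by positivity) hX
      _ = _ := by ring
  have hl0 : l 0 ≠ 0 := norm_pos_iff.1 (lt_of_lt_of_le (by positivity) m0')
  have hl1 : l 1 ≠ 0 :=
    norm_pos_iff.1 (lt_of_lt_of_le (by positivity) (m1'.trans (Complex.re_le_norm _)))
  have hστ' : ν + κ ≤ τ := hστ.trans hτ2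
  have hG0 : ‖layerG γ κ ω k (l 0)‖ ≤ 2 * W * T := by
    have h1 := hG (l 0) (δ⁻¹ * K) T hl0 (by linarith [m0]) hT1 (by positivity) (by
      have h2 : (ν + κ) * T ^ 2 ≤ τ := by
        calc (ν + κ) * T ^ 2 ≤ τ ^ 2 * ε ^ 6 * T ^ 2 := by gcongr
          _ = τ ^ 2 * (ε ^ 2 * (ε ^ 2 * T) ^ 2) := by ring
          _ ≤ τ * (1 * 1 ^ 2) := by
            rw [hTε]; gcongr; exact hε2τ.trans t1
          _ = τ := by ring
      calc (ν + κ) * ((δ⁻¹ * K) ^ 2 * T ^ 2 + K ^ 2)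
          = (δ⁻¹ * K) ^ 2 * ((ν + κ) * T ^ 2) + (ν + κ) * K ^ 2 := by ring
        _ ≤ (δ⁻¹ * K) ^ 2 * τ + τ * K ^ 2 := by gcongr
        _ = τ * (δ⁻¹ ^ 2 * K ^ 2 + K ^ 2) := by ring
        _ ≤ _ := t11)
    have h2 : 2 * K * (K / Real.sin γ + δ⁻¹ * K) * T ≤ W * T := by gcongr
    have h3 : K * δ⁻¹ * T ≤ W * T := by gcongr
    calc _ = ‖(layerG γ κ ω k (l 0) - l 0) + l 0‖ := by ring_nf
      _ ≤ W * T + W * T := (norm_add_le _ _).trans (add_le_add (h1.trans h2) (m0.trans h3))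
      _ = _ := by ring
  have hG1 : ‖layerG γ κ ω k (l 1)‖ ≤ 2 * W * S := by
    have h1 := hG (l 1) (2 * K ^ 2) S hl1 m1 hS1 (by positivity) (by
      have hK24 : K ^ 2 ≤ K ^ 4 := pow_le_pow_right₀ hK (by norm_num)
      calc (ν + κ) * ((2 * K ^ 2) ^ 2 * S ^ 2 + K ^ 2)
          = 4 * K ^ 4 * ((ν + κ) * S ^ 2) + (ν + κ) * K ^ 2 := by ring
        _ ≤ 4 * K ^ 4 * τ + τ * K ^ 4 := by rw [hσS]; gcongr
        _ = τ * (5 * K ^ 4) := by ring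
        _ ≤ _ := t12)
    have h2 : 2 * K * (K / Real.sin γ + 2 * K ^ 2) * S ≤ W * S := by gcongr
    have h3 : 2 * K ^ 2 * S ≤ W * S := by gcongr; linarith
    calc _ = ‖(layerG γ κ ω k (l 1) - l 1) + l 1‖ := by ring_nf
      _ ≤ W * S + W * S := (norm_add_le _ _).trans (add_le_add (h1.trans h2) (m1.trans h3))
      _ = _ := by ring
  have hG2 : ‖layerG γ κ ω k (l 2) + ((ν / κ : ℝ) : ℂ) * l 2‖ ≤ (8 * K ^ 2)⁻¹ * L := by
    refine (norm_layerG_add_le hs hν hκ hK h.k_le h.ω_le h.le_ω hL1 hρ c2 e2 r2 n2 hηK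
      (hZ.le.trans (hZτ.trans t6))).trans ?_
    calc _ ≤ 80 * K ^ 4 / Real.sin γ ^ 2 * (η + η + η) * (K * L) := by gcongr
      _ = 80 * K ^ 4 / Real.sin γ ^ 2 * (η + η + η) * K * L := by ring
      _ ≤ _ := by gcongr
  have hμ0 : 0 < ν / κ := by positivity
  have hμl : ‖((ν / κ : ℝ) : ℂ) * l 2‖ = ν / κ * ‖l 2‖ := by
    rw [norm_mul, Complex.norm_real, Real.norm_eq_abs, abs_of_pos hμ0]
  have hG2low : W⁻¹ * L ≤ ‖layerG γ κ ω k (l 2)‖ := by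
    have h1 : (4 * K ^ 2)⁻¹ * L ≤ ν / κ * ‖l 2‖ := by
      calc (4 * K ^ 2)⁻¹ * L = K⁻¹ * ((4 * K)⁻¹ * L) := by field_simp
        _ ≤ _ := by gcongr; exact r2.trans (Complex.re_le_norm _)
    have h2 := norm_sub_le (layerG γ κ ω k (l 2) + ((ν / κ : ℝ) : ℂ) * l 2) (layerG γ κ ω k (l 2))
    rw [add_sub_cancel_left, hμl] at h2
    have h3 : W⁻¹ * L ≤ (8 * K ^ 2)⁻¹ * L := by gcongr
    have h4 : (4 * K ^ 2)⁻¹ * L = 2 * ((8 * K ^ 2)⁻¹ * L) := by field_simp; norm_num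
    linarith
  have hG2up : ‖layerG γ κ ω k (l 2)‖ ≤ 2 * W * L := by
    have h2 := norm_sub_le (layerG γ κ ω k (l 2) + ((ν / κ : ℝ) : ℂ) * l 2)
      (((ν / κ : ℝ) : ℂ) * l 2)
    rw [add_sub_cancel_right, hμl] at h2
    have h3 : ν / κ * ‖l 2‖ ≤ K * (3 * K * L) := by gcongr
    have h4 : (8 * K ^ 2)⁻¹ * L ≤ 1 * L := by
      gcongr; exact inv_le_one_of_one_le₀ (by linarith)
    have h5 : 8 * K ^ 2 * L ≤ W * L := by gcongr
    have h6 : L ≤ K ^ 2 * L := le_mul_of_one_le_left hL.le hKK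
    linarith
  obtain ⟨hdet, hbd⟩ := hamp T S L l (fun j => layerG γ κ ω k (l j)) hT1
    (hTS.trans (by gcongr)) (by rw [hSL]; gcongr; exact hετ.trans t10) m0'
    (m0.trans (by gcongr)) (m1'.trans (Complex.re_le_norm _)) (m2'.trans (Complex.re_le_norm _))
    hG0 hG1 hG2low hG2up
  have hW4 : W⁻¹ ≤ K⁻¹ ^ 4 * δ := by
    calc W⁻¹ ≤ (K ^ 4 * δ⁻¹)⁻¹ := by gcongr
      _ = _ := by rw [mul_inv, inv_inv, inv_pow]
  refine ⟨?_, ⟨?_, ?_⟩, ⟨le_trans (by gcongr) m0', m0.trans (by gcongr; exact hWδ.trans hC1)⟩,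
    ⟨le_trans (by gcongr) m1', m1.trans (by gcongr; linarith)⟩,
    ⟨le_trans (by gcongr) m2', m2.trans (by gcongr)⟩, ?_, ?_⟩
  · intro j
    fin_cases j
    exacts [c0, c1, c2]
  · rw [← mul_div_assoc, div_le_iff₀ (by positivity)]
    have hre : 0 < (l 0).re := by
      have : 0 < Z ^ 4 * (l 0).re := lt_of_lt_of_le (by positivity) r0
      exact (mul_pos_iff_of_pos_left (by positivity)).1 this
    calc C⁻¹ * (ν + κ) ≤ K⁻¹ ^ 4 * δ * (ν + κ) := by gcongr; exact hC0.trans hW4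
      _ = K⁻¹ ^ 4 * (δ * (ν + κ)) := by ring
      _ ≤ K⁻¹ ^ 4 * (K ^ 4 * ε ^ 8 * (l 0).re) :=
          mul_le_mul_of_nonneg_left (r0.trans (by gcongr)) (by positivity)
      _ = (l 0).re * ε ^ 8 := by field_simp
  · rw [← mul_div_assoc, le_div_iff₀ (by positivity)]
    have hre : 0 < (l 0).re := by
      have : 0 < Z ^ 4 * (l 0).re := lt_of_lt_of_le (by positivity) r0
      exact (mul_pos_iff_of_pos_left (by positivity)).1 this
    calc (l 0).re * ε ^ 8 = K ^ 4 * (K⁻¹ ^ 4 * ε ^ 8 * (l 0).re) := by field_simp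
      _ ≤ K ^ 4 * (Z ^ 4 * (l 0).re) := by gcongr
      _ ≤ K ^ 4 * (δ⁻¹ * (ν + κ)) := by gcongr
      _ = K ^ 4 * δ⁻¹ * (ν + κ) := by ring
      _ ≤ _ := by gcongr; exact hWδ4.trans hC1
  · rw [amplitudeMatrix_det hs.ne' hω0]
    have hkC : (k : ℂ) ≠ 0 := by exact_mod_cast hk0
    have hsC : (Real.sin γ : ℂ) ≠ 0 := by exact_mod_cast hs.ne'
    have hωC : (ω : ℂ) ≠ 0 := by exact_mod_cast hω0
    exact mul_ne_zero (mul_ne_zero (mul_ne_zero Complex.I_ne_zero hkC)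
      (div_ne_zero (mul_ne_zero Complex.I_ne_zero hsC) hωC)) hdet
  · intro a ha
    obtain ⟨a1, a2, a3⟩ := amplitude_equations hs.ne' hω0 hk0 ha
    obtain ⟨hr, hg⟩ := norm_inhomogeneity_le hs hK h
    obtain ⟨b0, b1, b2⟩ := hbd a _ _ hr hg a1 a2 a3
    have hTSL : T * S / L = ε⁻¹ := by
      rw [hSL, hT]; field_simp
    rw [hTSL] at b2
    exact ⟨b0.trans (by gcongr), b1.trans (by gcongr), b2.trans (by gcongr)⟩

theorem NearData.mono {γ K K' z z' ω k m : ℝ} (h : NearData γ K z ω k m) (hK : 0 < K)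
    (hKK : K ≤ K') (hz : z ≤ z') : NearData γ K' z' ω k m := by
  have hi : K'⁻¹ ≤ K⁻¹ := by gcongr
  exact ⟨h.k_le.trans hKK, h.ω_le, hi.trans h.le_ω, hi.trans h.kω, hi.trans h.le_m,
    h.m_le.trans hKK, h.ζ_le.trans hz⟩

/-- Three boundary layer roots with decay rates of order `r`, sizes of order `s` and amplitudes
bounded by `α`, all up to the factor `C`. -/
structure LayerBounds (γ ν κ C : ℝ) (r s α : Fin 3 → ℝ) (ω k m : ℝ) (l : Fin 3 → ℂ) : Prop where
  root : ∀ j, charPoly γ ν κ ω k (l j) = 0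
  decay : ∀ j, C⁻¹ * r j ≤ (l j).re ∧ (l j).re ≤ C * r j
  size : ∀ j, C⁻¹ * s j ≤ ‖l j‖ ∧ ‖l j‖ ≤ C * s j
  det_ne : (amplitudeMatrix γ κ ω k l).det ≠ 0
  amplitude : ∀ a : Fin 3 → ℂ, (amplitudeMatrix γ κ ω k l).mulVec a =
    ![-1, -(-(k : ℂ) / m), -(I * m * (I * (k * Real.cos γ - m * Real.sin γ) / (m * ω)))] →
    ∀ j, ‖a j‖ ≤ C * α j

theorem LayerBounds.mono {γ ν κ C C' : ℝ} {r s α : Fin 3 → ℝ} {ω k m : ℝ} {l : Fin 3 → ℂ}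
    (h : LayerBounds γ ν κ C r s α ω k m l) (hC : 0 < C) (hCC : C ≤ C') (hr : ∀ j, 0 ≤ r j)
    (hs : ∀ j, 0 ≤ s j) (hα : ∀ j, 0 ≤ α j) : LayerBounds γ ν κ C' r s α ω k m l := by
  have hi : C'⁻¹ ≤ C⁻¹ := by gcongr
  exact ⟨h.root,
    fun j => ⟨(mul_le_mul_of_nonneg_right hi (hr j)).trans (h.decay j).1,
      (h.decay j).2.trans (mul_le_mul_of_nonneg_right hCC (hr j))⟩,
    fun j => ⟨(mul_le_mul_of_nonneg_right hi (hs j)).trans (h.size j).1,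
      (h.size j).2.trans (mul_le_mul_of_nonneg_right hCC (hs j))⟩,
    h.det_ne, fun a ha j => (h.amplitude a ha j).trans (mul_le_mul_of_nonneg_right hCC (hα j))⟩

/-- The zero sets `F j ≤ 0` of three continuous functions consist of boundary layer roots with the
bounds `LayerBounds`, and meet a fixed ball, over the part `P` of the near-critical set. -/
def RootsSelectable (γ ν κ C K z : ℝ) (P : ℝ → Prop) (r s α : Fin 3 → ℝ) : Prop :=
  ∃ F : Fin 3 → ℝ × ℝ × ℂ → ℝ, (∀ j, Continuous (F j)) ∧ ∃ N : ℝ,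
    ∀ ω k m : ℝ, NearData γ K z ω k m → P ω →
      (∀ j, ∃ w, ‖w‖ ≤ N ∧ F j (ω, k, w) ≤ 0) ∧
      ∀ l : Fin 3 → ℂ, (∀ j, F j (ω, k, l j) ≤ 0) → LayerBounds γ ν κ C r s α ω k m l

theorem exists_roots_of_power_law {γ K ν₀ κ₀ a b t s α : ℝ} (hs : 0 < Real.sin γ)
    (hc : 0 < Real.cos γ) (hK : 1 ≤ K) (hν₀ : 0 < ν₀) (hκ₀ : 0 < κ₀) (ht : 0 < t) (ht2 : t ≤ 2)
    (hmin : min a b = 3 * t) (hmax : max a b = 2 * s)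
    (hα : α ≤ -t ∨ α ≤ s + b - a - 2 * t) :
    ∃ C > 0, ∃ ε₁ > 0, ∀ ε : ℝ, 0 < ε → ε < ε₁ →
      RootsSelectable γ (ν₀ * ε ^ a) (κ₀ * ε ^ b) C K (K * ε ^ 2) (fun _ => True)
        (fun j => ε ^ (![-t, -t, -s] : Fin 3 → ℝ) j) (fun j => ε ^ (![-t, -t, -s] : Fin 3 → ℝ) j)
        (fun j => ε ^ (![-t, -t, α] : Fin 3 → ℝ) j) := by
  obtain ⟨K', hKK', k1, k2, k3, k4⟩ : ∃ K', K ≤ K' ∧ (min ν₀ κ₀)⁻¹ ≤ K' ∧ ν₀ + κ₀ ≤ K' ∧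
      (min (1 / ν₀) (1 / κ₀))⁻¹ ≤ K' ∧ 1 / ν₀ + 1 / κ₀ ≤ K' := by
    have h1 : 0 < min ν₀ κ₀ := lt_min hν₀ hκ₀
    have h2 : 0 < min (1 / ν₀) (1 / κ₀) := lt_min (by positivity) (by positivity)
    have p1 : 0 < (min ν₀ κ₀)⁻¹ := by positivity
    have p2 : 0 < (min (1 / ν₀) (1 / κ₀))⁻¹ := by positivity
    have p3 : 0 < 1 / ν₀ := by positivity
    have p4 : 0 < 1 / κ₀ := by positivity
    refine ⟨K + (min ν₀ κ₀)⁻¹ + (ν₀ + κ₀) + (min (1 / ν₀) (1 / κ₀))⁻¹ + (1 / ν₀ + 1 / κ₀),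
      ?_, ?_, ?_, ?_, ?_⟩ <;> linarith
  have hK' : 1 ≤ K' := hK.trans hKK'
  have hK0 : 0 < K := by linarith
  have hK'0 : 0 < K' := by linarith
  obtain ⟨C, hC, τ, hτ, H⟩ := exists_roots_of_same_size hs hc hK'
  have hD : 1 ≤ 1 + κ₀ / ν₀ := by
    have : 0 < κ₀ / ν₀ := by positivity
    linarith
  have hD0 : 0 < 1 + κ₀ / ν₀ := by linarith
  refine ⟨C * (1 + κ₀ / ν₀), by positivity,
    min 1 (min (τ ^ (-(1 / t))) (Real.sqrt (K * τ)⁻¹)), by positivity, fun ε hε hεε => ?_⟩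
  have hε1 : ε ≤ 1 := (hεε.le.trans (min_le_left _ _))
  have hετ : τ ≤ ε ^ (-t) := by
    have h1 : ε ≤ τ ^ (-(1 / t)) :=
      hεε.le.trans ((min_le_right _ _).trans (min_le_left _ _))
    calc τ = (τ ^ (-(1 / t))) ^ (-t) := by
          rw [← Real.rpow_mul hτ.le]; field_simp; simp
      _ ≤ ε ^ (-t) := Real.rpow_le_rpow_of_nonpos hε h1 (by linarith)
  have hεz : K * ε ^ 2 ≤ τ⁻¹ := by
    have h1 : ε ≤ Real.sqrt (K * τ)⁻¹ :=
      hεε.le.trans ((min_le_right _ _).trans (min_le_right _ _))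
    have h2 : ε ^ 2 ≤ (K * τ)⁻¹ := by
      rw [← Real.sq_sqrt (show 0 ≤ (K * τ)⁻¹ by positivity)]; gcongr
    calc K * ε ^ 2 ≤ K * (K * τ)⁻¹ := by gcongr
      _ = τ⁻¹ := by field_simp
  have hpos : ∀ x : ℝ, 0 < ε ^ x := fun x => Real.rpow_pos_of_pos hε x
  have hle : ∀ {x y : ℝ}, x ≤ y → ε ^ y ≤ ε ^ x := fun h =>
    Real.rpow_le_rpow_of_exponent_ge hε hε1 h
  have hT3 : (ε ^ (-t)) ^ 3 = ε ^ (-(3 * t)) := by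
    rw [← Real.rpow_natCast, ← Real.rpow_mul hε.le]; congr 1; push_cast; ring
  have hL2 : (ε ^ (-s)) ^ 2 = ε ^ (-(2 * s)) := by
    rw [← Real.rpow_natCast, ← Real.rpow_mul hε.le]; congr 1; push_cast; ring
  have ha : 3 * t ≤ a := hmin ▸ min_le_left a b
  have hb : 3 * t ≤ b := hmin ▸ min_le_right a b
  have ha' : a ≤ 2 * s := hmax ▸ le_max_left a b
  have hb' : b ≤ 2 * s := hmax ▸ le_max_right a b
  have e1 : (ν₀ * ε ^ a + κ₀ * ε ^ b) * (ε ^ (-t)) ^ 3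
      = ν₀ * ε ^ (a - 3 * t) + κ₀ * ε ^ (b - 3 * t) := by
    rw [hT3, sub_eq_add_neg, sub_eq_add_neg, Real.rpow_add hε, Real.rpow_add hε]; ring
  have e2 : 1 / (ν₀ * ε ^ a) + 1 / (κ₀ * ε ^ b) = 1 / ν₀ * ε ^ (-a) + 1 / κ₀ * ε ^ (-b) := by
    rw [Real.rpow_neg hε.le, Real.rpow_neg hε.le]; field_simp
  have hone : ∀ x : ℝ, 0 ≤ x → ε ^ x ≤ 1 := fun x hx => Real.rpow_le_one hε.le hε1 hx
  obtain ⟨F, hF, N, hN⟩ := H (ν₀ * ε ^ a) (κ₀ * ε ^ b) (ε ^ (-t)) (ε ^ (-s)) (K * ε ^ 2)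
    (by have := hpos a; positivity) (by have := hpos b; positivity) hετ (hpos _)
    (by
      rw [e1]
      refine (inv_le_comm₀ (lt_min hν₀ hκ₀) hK'0).1 k1 |>.trans ?_
      rcases min_choice a b with h | h
      · have : a - 3 * t = 0 := by rw [← hmin, h]; ring
        rw [this, Real.rpow_zero]
        have := hpos (b - 3 * t)
        have h2 : 0 < κ₀ * ε ^ (b - 3 * t) := by positivity
        linarith [min_le_left ν₀ κ₀]
      · have : b - 3 * t = 0 := by rw [← hmin, h]; ring
        rw [this, Real.rpow_zero]
        have := hpos (a - 3 * t)
        have h2 : 0 < ν₀ * ε ^ (a - 3 * t) := by positivity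
        linarith [min_le_right ν₀ κ₀])
    (by
      rw [e1]
      refine le_trans ?_ k2
      have h1 := mul_le_mul_of_nonneg_left (hone (a - 3 * t) (by linarith)) hν₀.le
      have h2 := mul_le_mul_of_nonneg_left (hone (b - 3 * t) (by linarith)) hκ₀.le
      linarith)
    (by
      rw [e2, hL2]
      have h0 : 0 < min (1 / ν₀) (1 / κ₀) := lt_min (by positivity) (by positivity)
      have h1 := mul_le_mul_of_nonneg_right ((inv_le_comm₀ h0 hK'0).1 k3)
        (hpos (-(2 * s))).le
      refine h1.trans ?_
      have q1 : 0 < 1 / ν₀ * ε ^ (-a) := by have := hpos (-a); positivity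
      have q2 : 0 < 1 / κ₀ * ε ^ (-b) := by have := hpos (-b); positivity
      rcases max_choice a b with h | h
      · have : a = 2 * s := by rw [← hmax, h]
        have h3 := mul_le_mul_of_nonneg_right (min_le_left (1 / ν₀) (1 / κ₀))
          (hpos (-(2 * s))).le
        rw [this] at *; linarith
      · have : b = 2 * s := by rw [← hmax, h]
        have h3 := mul_le_mul_of_nonneg_right (min_le_right (1 / ν₀) (1 / κ₀))
          (hpos (-(2 * s))).le
        rw [this] at *; linarith)
    (by
      rw [e2, hL2]
      refine le_trans ?_ (mul_le_mul_of_nonneg_right k4 (hpos (-(2 * s))).le)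
      have p1 : 0 ≤ 1 / ν₀ := by positivity
      have p2 : 0 ≤ 1 / κ₀ := by positivity
      have h1 := mul_le_mul_of_nonneg_left (hle (show -(2 * s) ≤ -a by linarith)) p1
      have h2 := mul_le_mul_of_nonneg_left (hle (show -(2 * s) ≤ -b by linarith)) p2
      linarith)
    hεz
    (by
      refine le_trans ?_ hKK'
      rw [mul_assoc, ← Real.rpow_natCast, ← Real.rpow_add hε]
      exact mul_le_of_le_one_right hK0.le (hone _ (by push_cast; linarith)))
  refine ⟨F, hF, N, fun ω k m h _ => ?_⟩
  obtain ⟨hex, hall⟩ := hN ω k m (h.mono hK0 hKK' le_rfl)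
  refine ⟨hex, fun l hl => ?_⟩
  obtain ⟨c, ⟨r0, n0⟩, ⟨r1, n1⟩, ⟨r2, n2⟩, hdet, hamp⟩ := hall l hl
  have hi : (C * (1 + κ₀ / ν₀))⁻¹ ≤ C⁻¹ := by
    gcongr; exact le_mul_of_one_le_right hC.le hD
  have hCD : C ≤ C * (1 + κ₀ / ν₀) := le_mul_of_one_le_right hC.le hD
  have key : ∀ (w : ℂ) (x : ℝ), C⁻¹ * ε ^ x ≤ w.re → ‖w‖ ≤ C * ε ^ x →
      ((C * (1 + κ₀ / ν₀))⁻¹ * ε ^ x ≤ w.re ∧ w.re ≤ C * (1 + κ₀ / ν₀) * ε ^ x) ∧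
      ((C * (1 + κ₀ / ν₀))⁻¹ * ε ^ x ≤ ‖w‖ ∧ ‖w‖ ≤ C * (1 + κ₀ / ν₀) * ε ^ x) := by
    intro w x h1 h2
    have h3 := mul_le_mul_of_nonneg_right hi (hpos x).le
    have h4 := mul_le_mul_of_nonneg_right hCD (hpos x).le
    have h5 := Complex.re_le_norm w
    exact ⟨⟨by linarith, by linarith⟩, by linarith, by linarith⟩
  refine ⟨c, ?_, ?_, hdet, ?_⟩
  · intro j; fin_cases j
    exacts [(key _ _ r0 n0).1, (key _ _ r1 n1).1, (key _ _ r2 n2).1]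
  · intro j; fin_cases j
    exacts [(key _ _ r0 n0).2, (key _ _ r1 n1).2, (key _ _ r2 n2).2]
  intro A hA j
  obtain ⟨b0, b1, b2⟩ := hamp A hA
  fin_cases j
  · exact b0.trans (mul_le_mul_of_nonneg_right hCD (hpos _).le)
  · exact b1.trans (mul_le_mul_of_nonneg_right hCD (hpos _).le)
  · show ‖A 2‖ ≤ C * (1 + κ₀ / ν₀) * ε ^ α
    refine b2.trans ?_
    rw [mul_assoc]
    refine mul_le_mul_of_nonneg_left ?_ hC.le
    have p0 := hpos (-t)
    have p1 : 0 < ν₀ * ε ^ a / (κ₀ * ε ^ b) * ε ^ (-s) := by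
      have := hpos a; have := hpos b; have := hpos (-s); positivity
    rcases hα with h | h
    · calc (ε ^ (-t)) ^ 2 / (ν₀ * ε ^ a / (κ₀ * ε ^ b) * ε ^ (-s) + ε ^ (-t))
          ≤ (ε ^ (-t)) ^ 2 / ε ^ (-t) := by gcongr; linarith
        _ = ε ^ (-t) := by field_simp
        _ ≤ ε ^ α := hle h
        _ ≤ _ := le_mul_of_one_le_left (hpos _).le hD
    · calc (ε ^ (-t)) ^ 2 / (ν₀ * ε ^ a / (κ₀ * ε ^ b) * ε ^ (-s) + ε ^ (-t))
          ≤ (ε ^ (-t)) ^ 2 / (ν₀ * ε ^ a / (κ₀ * ε ^ b) * ε ^ (-s)) := by gcongr; linarith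
        _ = κ₀ / ν₀ * ε ^ (s + b - a - 2 * t) := by
          rw [show s + b - a - 2 * t = s + b + (-a) + (-t) + (-t) by ring, Real.rpow_add hε,
            Real.rpow_add hε, Real.rpow_add hε, Real.rpow_add hε, Real.rpow_neg hε.le s,
            Real.rpow_neg hε.le a]
          have := hpos s
          have := hpos a
          have := hpos b
          field_simp
        _ ≤ κ₀ / ν₀ * ε ^ α := mul_le_mul_of_nonneg_left (hle h) (by positivity)
        _ ≤ _ := by
          refine mul_le_mul_of_nonneg_right ?_ (hpos _).le
          linarith

theorem exists_roots_of_equal_power {γ K ν₀ κ₀ β : ℝ} (hs : 0 < Real.sin γ)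
    (hc : 0 < Real.cos γ) (hK : 1 ≤ K) (hν₀ : 0 < ν₀) (hκ₀ : 0 < κ₀) (hβ : 6 < β) :
    ∃ C > 0, ∃ ε₁ > 0, ∀ ε : ℝ, 0 < ε → ε < ε₁ →
      RootsSelectable γ (ν₀ * ε ^ β) (κ₀ * ε ^ β) C K (K * ε ^ 2)
        (fun ω => K⁻¹ * ε ^ 2 ≤ |ω ^ 2 - Real.sin γ ^ 2|)
        (fun j => ε ^ (![β - 8, 1 - β / 2, -(β / 2)] : Fin 3 → ℝ) j)
        (fun j => ε ^ (![-2, 1 - β / 2, -(β / 2)] : Fin 3 → ℝ) j)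
        (fun j => ε ^ (![-2, -2, -1] : Fin 3 → ℝ) j) := by
  set σ := ν₀ + κ₀ with hσ
  have hσ0 : 0 < σ := by positivity
  obtain ⟨K', hKK', k1, k3, k4⟩ : ∃ K', K ≤ K' ∧ ((1 / ν₀ + 1 / κ₀) * σ)⁻¹ ≤ K' ∧
      (1 / ν₀ + 1 / κ₀) * σ ≤ K' ∧ (ν₀ / κ₀)⁻¹ + ν₀ / κ₀ ≤ K' := by
    have p1 : 0 < ((1 / ν₀ + 1 / κ₀) * σ)⁻¹ := by positivity
    have p2 : 0 < (1 / ν₀ + 1 / κ₀) * σ := by positivity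
    have p3 : 0 < (ν₀ / κ₀)⁻¹ + ν₀ / κ₀ := by positivity
    refine ⟨K + ((1 / ν₀ + 1 / κ₀) * σ)⁻¹ + (1 / ν₀ + 1 / κ₀) * σ + ((ν₀ / κ₀)⁻¹ + ν₀ / κ₀),
      ?_, ?_, ?_, ?_⟩ <;> linarith
  have hK' : 1 ≤ K' := hK.trans hKK'
  have hK0 : 0 < K := by linarith
  have hK'0 : 0 < K' := by linarith
  obtain ⟨C, hC, τ, hτ, H⟩ := exists_roots_of_separated hs hc hK'
  obtain ⟨D, hD, d1, d2, d3, d4, d5⟩ : ∃ D, 1 ≤ D ∧ σ ≤ D ∧ σ⁻¹ ≤ D ∧ (Real.sqrt σ) ≤ D ∧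
      (Real.sqrt σ)⁻¹ ≤ D ∧ 0 < D := by
    have p1 : 0 < σ⁻¹ := by positivity
    have p2 : 0 < Real.sqrt σ := by positivity
    have p3 : 0 < (Real.sqrt σ)⁻¹ := by positivity
    refine ⟨1 + σ + σ⁻¹ + Real.sqrt σ + (Real.sqrt σ)⁻¹, ?_, ?_, ?_, ?_, ?_, ?_⟩ <;> linarith
  refine ⟨C * D, by positivity,
    min 1 (min τ ((τ ^ 2 / σ) ^ (1 / (β - 6)))), by positivity, fun ε hε hεε => ?_⟩
  have hε1 : ε ≤ 1 := (hεε.le.trans (min_le_left _ _))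
  have hετ : ε ≤ τ := hεε.le.trans ((min_le_right _ _).trans (min_le_left _ _))
  have hpos : ∀ x : ℝ, 0 < ε ^ x := fun x => Real.rpow_pos_of_pos hε x
  have hβ6 : 0 < β - 6 := by linarith
  have hsmall : σ * ε ^ β ≤ τ ^ 2 * ε ^ 6 := by
    have h1 : ε ≤ (τ ^ 2 / σ) ^ (1 / (β - 6)) :=
      hεε.le.trans ((min_le_right _ _).trans (min_le_right _ _))
    have h2 : ε ^ (β - 6) ≤ τ ^ 2 / σ := by
      calc ε ^ (β - 6) ≤ ((τ ^ 2 / σ) ^ (1 / (β - 6))) ^ (β - 6) :=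
            Real.rpow_le_rpow hε.le h1 hβ6.le
        _ = τ ^ 2 / σ := by
            rw [← Real.rpow_mul (by positivity), one_div_mul_cancel hβ6.ne', Real.rpow_one]
    calc σ * ε ^ β = σ * (ε ^ (β - 6) * ε ^ (6 : ℝ)) := by
          rw [← Real.rpow_add hε]; congr 2; ring
      _ ≤ σ * (τ ^ 2 / σ * ε ^ (6 : ℝ)) := by
          have := hpos 6
          gcongr
      _ = τ ^ 2 * ε ^ (6 : ℝ) := by field_simp
      _ = τ ^ 2 * ε ^ 6 := by norm_cast
  have hsum : ν₀ * ε ^ β + κ₀ * ε ^ β = σ * ε ^ β := by rw [hσ]; ring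
  have hhalf : (ε ^ (-(β / 2))) ^ 2 = (ε ^ β)⁻¹ := by
    rw [← Real.rpow_natCast, ← Real.rpow_mul hε.le, ← Real.rpow_neg hε.le]
    congr 1; push_cast; ring
  have hsq : Real.sqrt σ ^ 2 = σ := Real.sq_sqrt hσ0.le
  have hsq0 : 0 < Real.sqrt σ := Real.sqrt_pos.2 hσ0
  have pβ := hpos β
  have pβ2 := hpos (-(β / 2))
  have hL2 : ((Real.sqrt σ)⁻¹ * ε ^ (-(β / 2))) ^ 2 = (σ * ε ^ β)⁻¹ := by
    rw [mul_pow, hhalf, inv_pow, hsq, mul_inv]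
  have e2 : 1 / (ν₀ * ε ^ β) + 1 / (κ₀ * ε ^ β)
      = (1 / ν₀ + 1 / κ₀) * σ * (σ * ε ^ β)⁻¹ := by field_simp
  have e3 : ν₀ * ε ^ β / (κ₀ * ε ^ β) = ν₀ / κ₀ := by field_simp
  have hS : ε * ((Real.sqrt σ)⁻¹ * ε ^ (-(β / 2))) = (Real.sqrt σ)⁻¹ * ε ^ (1 - β / 2) := by
    rw [sub_eq_add_neg, Real.rpow_add hε, Real.rpow_one]; ring
  obtain ⟨F, hF, N, hN⟩ := H (ν₀ * ε ^ β) (κ₀ * ε ^ β) ε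
    (ε * ((Real.sqrt σ)⁻¹ * ε ^ (-(β / 2)))) ((Real.sqrt σ)⁻¹ * ε ^ (-(β / 2)))
    (by positivity) (by positivity) hε hετ (by positivity) (by positivity)
    (by rw [hsum, mul_pow, hL2]; field_simp) (by rw [hsum, hL2]; field_simp)
    (by rw [hsum]; exact hsmall)
    (by
      rw [hL2, e2]
      exact mul_le_mul_of_nonneg_right ((inv_le_comm₀ (by positivity) hK'0).1 k1) (by positivity))
    (by
      rw [hL2, e2]
      exact mul_le_mul_of_nonneg_right k3 (by positivity))
    (by
      rw [e3]
      refine (inv_le_comm₀ (by positivity) hK'0).1 (le_trans ?_ k4)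
      have : 0 < ν₀ / κ₀ := by positivity
      linarith)
    (by
      rw [e3]
      refine le_trans ?_ k4
      have : 0 < (ν₀ / κ₀)⁻¹ := by positivity
      linarith)
  refine ⟨F, hF, N, fun ω k m h hz => ?_⟩
  have hε2 : 0 < ε ^ 2 := by positivity
  obtain ⟨hex, hall⟩ := hN ω k m (h.mono hK0 hKK' (by gcongr)) (le_trans (by gcongr) hz)
  refine ⟨hex, fun l hl => ?_⟩
  obtain ⟨c, ⟨r0, r0'⟩, ⟨n0, n0'⟩, ⟨r1, n1⟩, ⟨r2, n2⟩, hdet, hamp⟩ := hall l hl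
  have key : ∀ x y : ℝ, 0 < x → y ≤ D → D⁻¹ ≤ y →
      (C * D)⁻¹ * x ≤ C⁻¹ * (y * x) ∧ C * (y * x) ≤ C * D * x := by
    intro x y hx h1 h2
    constructor
    · calc (C * D)⁻¹ * x = C⁻¹ * (D⁻¹ * x) := by rw [mul_inv]; ring
        _ ≤ _ := by gcongr
    · calc C * (y * x) ≤ C * (D * x) := by gcongr
        _ = _ := by ring
  have hDi : D⁻¹ ≤ 1 := inv_le_one_of_one_le₀ hD
  have hDσ : D⁻¹ ≤ σ := (inv_le_comm₀ hσ0 d5).1 d2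
  have hDq : D⁻¹ ≤ (Real.sqrt σ)⁻¹ := by gcongr
  have hm2 : ε ^ (-2 : ℝ) = (ε ^ 2)⁻¹ := by
    rw [Real.rpow_neg hε.le]; norm_cast
  have hm1 : ε ^ (-1 : ℝ) = ε⁻¹ := by rw [Real.rpow_neg_one]
  have hm8 : (ν₀ * ε ^ β + κ₀ * ε ^ β) / ε ^ 8 = σ * ε ^ (β - 8) := by
    rw [hsum, Real.rpow_sub hε, mul_div_assoc]; norm_cast
  rw [hm8] at r0 r0'
  rw [hS] at r1 n1
  rw [← hm2] at n0 n0' hamp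
  rw [← hm1] at hamp
  have k0 := key _ σ (hpos (β - 8)) d1 hDσ
  have k0' := key _ 1 (hpos (-2)) hD hDi
  have k1' := key _ 1 (hpos (-1)) hD hDi
  have k1 := key _ _ (hpos (1 - β / 2)) d4 hDq
  have k2 := key _ _ (hpos (-(β / 2))) d4 hDq
  rw [one_mul] at k0' k1'
  have q0 := Complex.re_le_norm (l 0)
  have q1 := Complex.re_le_norm (l 1)
  have q2 := Complex.re_le_norm (l 2)
  refine ⟨c, ?_, ?_, hdet, ?_⟩
  · intro j; fin_cases j
    · exact ⟨k0.1.trans r0, r0'.trans k0.2⟩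
    · exact ⟨k1.1.trans r1, (q1.trans n1).trans k1.2⟩
    · exact ⟨k2.1.trans r2, (q2.trans n2).trans k2.2⟩
  · intro j; fin_cases j
    · exact ⟨k0'.1.trans n0, n0'.trans k0'.2⟩
    · exact ⟨(k1.1.trans r1).trans q1, n1.trans k1.2⟩
    · exact ⟨(k2.1.trans r2).trans q2, n2.trans k2.2⟩
  · intro A hA j
    obtain ⟨b0, b1, b2⟩ := hamp A hA
    fin_cases j
    exacts [b0.trans k0'.2, b1.trans k0'.2, b2.trans k1'.2]

/-- The roots and amplitudes in the five regimes. -/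
theorem Regime.exists_roots (R : Regime) {γ K ν₀ κ₀ β : ℝ} (hs : 0 < Real.sin γ)
    (hc : 0 < Real.cos γ) (hK : 1 ≤ K) (hν₀ : 0 < ν₀) (hκ₀ : 0 < κ₀) (hβ : R.Admissible β) :
    ∃ C > 0, ∃ ε₁ > 0, ∀ ε : ℝ, 0 < ε → ε < ε₁ →
      RootsSelectable γ (R.visc ν₀ ε β) (R.diff κ₀ ε β) C K (K * ε ^ 2)
        (fun ω => R = case5 → K⁻¹ * ε ^ 2 ≤ |ω ^ 2 - Real.sin γ ^ 2|)
        (fun j => ε ^ R.decayExp β j) (fun j => ε ^ R.sizeExp β j)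
        (fun j => ε ^ R.ampExp β j) := by
  have h6 : ∀ x : ℝ, x ^ 6 = x ^ (6 : ℝ) := fun x => by norm_cast
  have weaken : ∀ {ν κ C z : ℝ} {P : ℝ → Prop} {r s α : Fin 3 → ℝ},
      RootsSelectable γ ν κ C K z (fun _ => True) r s α → RootsSelectable γ ν κ C K z P r s α := by
    rintro ν κ C z P r s α ⟨F, hF, N, h⟩
    exact ⟨F, hF, N, fun ω k m hd _ => h ω k m hd trivial⟩
  cases R with
  | case1 =>
    obtain ⟨h1, h2⟩ := hβ
    obtain ⟨C, hC, ε₁, hε₁, H⟩ := exists_roots_of_power_law (K := K) (a := 6) (b := β)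
      (t := β / 3) (s := 3) (α := if 9 / 2 < β then β / 3 - 3 else -(β / 3)) hs hc hK hν₀ hκ₀
      (by linarith) (by linarith) (by rw [min_eq_right h2.le]; ring)
      (by rw [max_eq_left h2.le]; norm_num) (by
        split_ifs with h
        · right; linarith
        · left; exact le_rfl)
    refine ⟨C, hC, ε₁, hε₁, fun ε h0 h1 => weaken ?_⟩
    have := H ε h0 h1
    simp only [Regime.visc, Regime.diff, Regime.decayExp, Regime.sizeExp, Regime.ampExp, h6]
    exact this
  | case2 =>
    have h2 : 6 < β := hβ
    obtain ⟨C, hC, ε₁, hε₁, H⟩ := exists_roots_of_power_law (K := K) (a := 6) (b := β)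
      (t := 2) (s := β / 2) (α := 3 * β / 2 - 10) hs hc hK hν₀ hκ₀
      (by linarith) (by linarith) (by rw [min_eq_left h2.le]; norm_num)
      (by rw [max_eq_right h2.le]; ring) (by right; linarith)
    refine ⟨C, hC, ε₁, hε₁, fun ε h0 h1 => weaken ?_⟩
    have := H ε h0 h1
    simp only [Regime.visc, Regime.diff, Regime.decayExp, Regime.sizeExp, Regime.ampExp, h6]
    exact this
  | case3 =>
    obtain ⟨h1, h2⟩ := hβ
    obtain ⟨C, hC, ε₁, hε₁, H⟩ := exists_roots_of_power_law (K := K) (a := β) (b := 6)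
      (t := β / 3) (s := 3) (α := 9 - 5 * β / 3) hs hc hK hν₀ hκ₀
      (by linarith) (by linarith) (by rw [min_eq_left h2.le]; ring)
      (by rw [max_eq_right h2.le]; norm_num) (by right; linarith)
    refine ⟨C, hC, ε₁, hε₁, fun ε h0 h1 => weaken ?_⟩
    have := H ε h0 h1
    simp only [Regime.visc, Regime.diff, Regime.decayExp, Regime.sizeExp, Regime.ampExp, h6]
    exact this
  | case4 =>
    have h2 : 6 < β := hβ
    obtain ⟨C, hC, ε₁, hε₁, H⟩ := exists_roots_of_power_law (K := K) (a := β) (b := 6)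
      (t := 2) (s := β / 2) (α := if β < 8 then 2 - β / 2 else -2) hs hc hK hν₀ hκ₀
      (by linarith) (by linarith) (by rw [min_eq_right h2.le]; norm_num)
      (by rw [max_eq_left h2.le]; ring) (by
        split_ifs with h
        · right; linarith
        · left; exact le_rfl)
    refine ⟨C, hC, ε₁, hε₁, fun ε h0 h1 => weaken ?_⟩
    have := H ε h0 h1
    simp only [Regime.visc, Regime.diff, Regime.decayExp, Regime.sizeExp, Regime.ampExp, h6]
    exact this
  | case5 =>
    obtain ⟨C, hC, ε₁, hε₁, H⟩ := exists_roots_of_equal_power (K := K) hs hc hK hν₀ hκ₀ hβ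
    refine ⟨C, hC, ε₁, hε₁, fun ε h0 h1 => ?_⟩
    obtain ⟨F, hF, N, h⟩ := H ε h0 h1
    exact ⟨F, hF, N, fun ω k m hd hP => h ω k m hd (hP rfl)⟩

theorem hasDerivAt_omegaPlus {γ k m : ℝ} (hk : k ≠ 0) :
    HasDerivAt (fun m => omegaPlus γ k m)
      (-(k * (k * Real.sin γ + m * Real.cos γ)) / (Real.sqrt (k ^ 2 + m ^ 2)) ^ 3) m := by
  have hr : 0 < k ^ 2 + m ^ 2 := by positivity
  have hr0 := Real.sqrt_pos.2 hr
  have h1 : HasDerivAt (fun m : ℝ => k * Real.cos γ - m * Real.sin γ) (-Real.sin γ) m := by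
    simpa using ((hasDerivAt_id m).mul_const (Real.sin γ)).const_sub (k * Real.cos γ)
  have h2 : HasDerivAt (fun m : ℝ => k ^ 2 + m ^ 2) (2 * m) m := by
    simpa using (hasDerivAt_pow 2 m).const_add (k ^ 2)
  have h3 := h1.div (h2.sqrt hr.ne') hr0.ne'
  refine h3.congr_deriv ?_
  have hsq : Real.sqrt (k ^ 2 + m ^ 2) ^ 2 = k ^ 2 + m ^ 2 := Real.sq_sqrt hr.le
  generalize Real.sqrt (k ^ 2 + m ^ 2) = r at *
  field_simp
  rw [hsq]
  ring

theorem sq_omegaPlus_mul {γ k m : ℝ} (hk : k ≠ 0) :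
    omegaPlus γ k m ^ 2 * (k ^ 2 + m ^ 2) = (k * Real.cos γ - m * Real.sin γ) ^ 2 := by
  have hr : 0 < k ^ 2 + m ^ 2 := by positivity
  rw [omegaPlus, div_pow, Real.sq_sqrt hr.le]
  field_simp

theorem sq_omega (γ : ℝ) (q : ℝ × ℝ) : omega γ q ^ 2 = omegaPlus γ q.1 q.2 ^ 2 := by
  unfold omega
  split_ifs
  · rfl
  · exact neg_sq _

theorem criticality_mul {γ : ℝ} {q : ℝ × ℝ} (hk : q.1 ≠ 0) :
    criticality γ q * (q.1 ^ 2 + q.2 ^ 2) = q.1 * (q.1 * (Real.cos γ ^ 2 - Real.sin γ ^ 2)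
      - 2 * q.2 * Real.sin γ * Real.cos γ) := by
  rw [criticality, sq_omega, sub_mul, sq_omegaPlus_mul hk]
  ring

theorem abs_omegaPlus_le_one (γ k m : ℝ) : |omegaPlus γ k m| ≤ 1 := by
  by_cases hk : k = 0 ∧ m = 0
  · simp [omegaPlus, hk.1, hk.2]
  have hr : 0 < k ^ 2 + m ^ 2 := by
    by_contra h
    refine hk ⟨?_, ?_⟩ <;> nlinarith [sq_nonneg k, sq_nonneg m]
  rw [omegaPlus, abs_div, abs_of_nonneg (Real.sqrt_nonneg _), div_le_one (Real.sqrt_pos.2 hr)]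
  refine Real.le_sqrt_of_sq_le ?_
  rw [sq_abs]
  nlinarith [sq_nonneg (k * Real.sin γ + m * Real.cos γ), Real.sin_sq_add_cos_sq γ]

/-- The geometry of near-critical frequencies. -/
theorem near_critical_geometry {γ c e k m : ℝ} (hs : 0 < Real.sin γ) (hc : 0 < Real.cos γ)
    (hc0 : 0 < c) (hk : c ≤ |k|) (hk' : |k| ≤ c⁻¹) (hm : |m| ≤ c⁻¹)
    (hζ : |criticality γ (k, m)| ≤ e)
    (he : e ≤ c ^ 4 / 4 * |Real.cos γ ^ 2 - Real.sin γ ^ 2|) :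
    omega γ (k, m) = omegaPlus γ k m ∧ c ^ 3 / 8 ≤ k * omegaPlus γ k m ∧
      c / 2 * |Real.cos γ ^ 2 - Real.sin γ ^ 2| ≤ |m| := by
  have hk0 : k ≠ 0 := abs_pos.1 (hc0.trans_le hk)
  have hr : 0 < k ^ 2 + m ^ 2 := by positivity
  have hsc := Real.sin_sq_add_cos_sq γ
  have hD : |Real.cos γ ^ 2 - Real.sin γ ^ 2| ≤ 1 := by
    rw [abs_le]; constructor <;> nlinarith [sq_nonneg (Real.sin γ), sq_nonneg (Real.cos γ)]
  have hc1 : c * c⁻¹ = 1 := mul_inv_cancel₀ hc0.ne'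
  have hr2 : k ^ 2 + m ^ 2 ≤ 2 * (c⁻¹) ^ 2 := by
    have h1 : k ^ 2 ≤ c⁻¹ ^ 2 := by rw [← sq_abs]; gcongr
    have h2 : m ^ 2 ≤ c⁻¹ ^ 2 := by rw [← sq_abs m]; gcongr
    linarith
  set d := k * (Real.cos γ ^ 2 - Real.sin γ ^ 2) - 2 * m * Real.sin γ * Real.cos γ with hd
  have hζd : criticality γ (k, m) * (k ^ 2 + m ^ 2) = k * d := criticality_mul hk0
  have hdle : |d| ≤ c / 2 * |Real.cos γ ^ 2 - Real.sin γ ^ 2| := by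
    have h1 : |k| * |d| ≤ e * (2 * c⁻¹ ^ 2) := by
      rw [← abs_mul, ← hζd, abs_mul, abs_of_pos hr]
      exact mul_le_mul hζ hr2 hr.le ((abs_nonneg _).trans hζ)
    have h2 : c * |d| ≤ c * (c / 2 * |Real.cos γ ^ 2 - Real.sin γ ^ 2|) := by
      calc c * |d| ≤ |k| * |d| := by gcongr
        _ ≤ e * (2 * c⁻¹ ^ 2) := h1
        _ ≤ c ^ 4 / 4 * |Real.cos γ ^ 2 - Real.sin γ ^ 2| * (2 * c⁻¹ ^ 2) := by gcongr
        _ = _ := by field_simp; ring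
    exact le_of_mul_le_mul_left h2 hc0
  have hdk : |d| ≤ |k| / 2 := by
    have : c / 2 * |Real.cos γ ^ 2 - Real.sin γ ^ 2| ≤ c / 2 * 1 := by gcongr
    linarith
  have hkd : |k * d| ≤ k ^ 2 / 2 := by
    rw [abs_mul, ← sq_abs k]
    calc |k| * |d| ≤ |k| * (|k| / 2) := by gcongr
      _ = _ := by ring
  obtain ⟨hkd1, hkd2⟩ := abs_le.1 hkd
  have hk2 : 0 < k ^ 2 := by positivity
  have hr0 := Real.sqrt_pos.2 hr
  refine ⟨?_, ?_, ?_⟩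
  · have h1 : 0 < k * (k * Real.sin γ + m * Real.cos γ) := by
      have : 2 * Real.sin γ * (k * (k * Real.sin γ + m * Real.cos γ)) = k ^ 2 - k * d := by
        rw [hd]; linear_combination k ^ 2 * hsc
      have h2 : 0 < 2 * Real.sin γ * (k * (k * Real.sin γ + m * Real.cos γ)) := by
        rw [this]; linarith
      exact (mul_pos_iff_of_pos_left (by positivity)).1 h2
    unfold omega
    rw [if_pos]
    rw [(hasDerivAt_omegaPlus hk0).deriv]
    exact div_neg_of_neg_of_pos (by linarith) (by positivity)
  · have h1 : 2 * Real.cos γ * (k * (k * Real.cos γ - m * Real.sin γ)) = k ^ 2 + k * d := by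
      rw [hd]; linear_combination k ^ 2 * hsc
    have h2 : k ^ 2 / 4 ≤ k * (k * Real.cos γ - m * Real.sin γ) := by
      have h3 : 0 ≤ k * (k * Real.cos γ - m * Real.sin γ) := by
        have : 0 ≤ 2 * Real.cos γ * (k * (k * Real.cos γ - m * Real.sin γ)) := by
          rw [h1]; linarith
        exact (mul_nonneg_iff_of_pos_left (by positivity)).1 this
      have h4 := mul_le_mul_of_nonneg_right (Real.cos_le_one γ) h3
      linarith
    have hrt : Real.sqrt (k ^ 2 + m ^ 2) ≤ 2 * c⁻¹ := by
      refine Real.sqrt_le_iff.2 ⟨by positivity, hr2.trans ?_⟩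
      have : 0 < c⁻¹ ^ 2 := by positivity
      calc 2 * c⁻¹ ^ 2 ≤ 4 * c⁻¹ ^ 2 := by linarith
        _ = _ := by ring
    rw [omegaPlus, ← mul_div_assoc, le_div_iff₀ hr0]
    have hc2 : c ^ 2 ≤ k ^ 2 := by rw [← sq_abs k]; gcongr
    calc c ^ 3 / 8 * Real.sqrt (k ^ 2 + m ^ 2) ≤ c ^ 3 / 8 * (2 * c⁻¹) := by gcongr
      _ = c ^ 2 / 4 := by field_simp; norm_num
      _ ≤ k ^ 2 / 4 := by gcongr
      _ ≤ _ := h2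
  · have h1 : |k * (Real.cos γ ^ 2 - Real.sin γ ^ 2)| ≤ |2 * m * Real.sin γ * Real.cos γ| + |d| := by
      have : k * (Real.cos γ ^ 2 - Real.sin γ ^ 2) = 2 * m * Real.sin γ * Real.cos γ + d := by
        rw [hd]; ring
      rw [this]; exact abs_add_le _ _
    have h2 : |2 * m * Real.sin γ * Real.cos γ| ≤ |m| := by
      rw [show 2 * m * Real.sin γ * Real.cos γ = m * (2 * Real.sin γ * Real.cos γ) by ring, abs_mul]
      refine mul_le_of_le_one_right (abs_nonneg _) ?_
      rw [abs_of_pos (by positivity)]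
      nlinarith [sq_nonneg (Real.sin γ - Real.cos γ)]
    rw [abs_mul] at h1
    have h3 : c * |Real.cos γ ^ 2 - Real.sin γ ^ 2| ≤ |k| * |Real.cos γ ^ 2 - Real.sin γ ^ 2| := by
      gcongr
    linarith

/-- The frequencies carried by the density. -/
theorem support_density {χ : ℝ → ℂ} (hχc : HasCompactSupport χ) :
    ∃ ρ > 0, ∀ (ε k₀ m₀ : ℝ) (q : ℝ × ℝ), 0 < ε → density χ ε k₀ m₀ q ≠ 0 →
      (|q.1 + k₀| ≤ ρ * ε ^ 2 ∧ |q.2 + m₀| ≤ ρ * ε ^ 2) ∨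
        (|q.1 - k₀| ≤ ρ * ε ^ 2 ∧ |q.2 - m₀| ≤ ρ * ε ^ 2) := by
  obtain ⟨ρ, hρ, h⟩ := hχc.isCompact.isBounded.exists_pos_norm_le
  refine ⟨ρ, hρ, fun ε k₀ m₀ q hε hq => ?_⟩
  have key : ∀ x : ℝ, χ (x / ε ^ 2) ≠ 0 → |x| ≤ ρ * ε ^ 2 := by
    intro x hx
    have h1 := h _ (subset_tsupport _ (Function.mem_support.2 hx))
    rw [Real.norm_eq_abs, abs_div, abs_of_pos (show 0 < ε ^ 2 by positivity),
      div_le_iff₀ (by positivity)] at h1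
    exact h1
  by_contra hcon
  rw [not_or] at hcon
  refine hq ?_
  have h1 : χ ((q.1 + k₀) / ε ^ 2) * χ ((q.2 + m₀) / ε ^ 2) = 0 := by
    by_contra h0
    exact hcon.1 ⟨key _ (left_ne_zero_of_mul h0), key _ (right_ne_zero_of_mul h0)⟩
  have h2 : χ ((q.1 - k₀) / ε ^ 2) * χ ((q.2 - m₀) / ε ^ 2) = 0 := by
    by_contra h0
    exact hcon.2 ⟨key _ (left_ne_zero_of_mul h0), key _ (right_ne_zero_of_mul h0)⟩
  rw [density, h1, h2, add_zero, mul_zero]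

theorem cos_sq_sub_sin_sq_ne_zero {γ : ℝ} (hγ : 0 < γ) (hγ' : γ < Real.pi / 2)
    (hγ4 : γ ≠ Real.pi / 4) : Real.cos γ ^ 2 - Real.sin γ ^ 2 ≠ 0 := by
  rw [← Real.cos_two_mul']
  intro h
  have h1 : 2 * γ = Real.pi / 2 := by
    refine Real.injOn_cos ⟨by linarith, by linarith⟩ ⟨by linarith, by linarith⟩ ?_
    rw [h, Real.cos_pi_div_two]
  exact hγ4 (by linarith)

/-- On the support of the density the frequencies have the properties `NearData`. -/
theorem Regime.NearCritical.nearData {γ c : ℝ} {χ : ℝ → ℂ} (hγ : 0 < γ) (hγ' : γ < Real.pi / 2)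
    (hγ4 : γ ≠ Real.pi / 4) (hχc : HasCompactSupport χ) (hc : 0 < c) :
    ∃ K, 1 ≤ K ∧ ∃ ε₂ > 0, ∀ (R : Regime) (ε k₀ m₀ : ℝ), 0 < ε → ε < ε₂ →
      R.NearCritical γ χ c ε k₀ m₀ → ∀ q, density χ ε k₀ m₀ q ≠ 0 →
        NearData γ K (K * ε ^ 2) (omega γ q) q.1 q.2 ∧ omega γ q = omegaPlus γ q.1 q.2 ∧
        (R = case5 → K⁻¹ * ε ^ 2 ≤ |omega γ q ^ 2 - Real.sin γ ^ 2|) := by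
  have hs : 0 < Real.sin γ := Real.sin_pos_of_pos_of_lt_pi hγ (by linarith)
  have hcos : 0 < Real.cos γ := Real.cos_pos_of_mem_Ioo ⟨by linarith, hγ'⟩
  obtain ⟨ρ, hρ, hsupp⟩ := support_density hχc
  set D := |Real.cos γ ^ 2 - Real.sin γ ^ 2| with hD
  have hD0 : 0 < D := abs_pos.2 (cos_sq_sub_sin_sq_ne_zero hγ hγ' hγ4)
  set b := c / 2 with hb
  have hb0 : 0 < b := by positivity
  obtain ⟨K, K1, K2, K3, K4, K5, K6⟩ : ∃ K, 1 ≤ K ∧ b⁻¹ ≤ K ∧ (b ^ 3 / 8)⁻¹ ≤ K ∧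
      (b ^ 4 / 8)⁻¹ ≤ K ∧ (b / 2 * D)⁻¹ ≤ K ∧ c⁻¹ ≤ K := by
    have p1 : 0 < b⁻¹ := by positivity
    have p2 : 0 < (b ^ 3 / 8)⁻¹ := by positivity
    have p3 : 0 < (b ^ 4 / 8)⁻¹ := by positivity
    have p4 : 0 < (b / 2 * D)⁻¹ := by positivity
    have p5 : 0 < c⁻¹ := by positivity
    refine ⟨1 + b⁻¹ + (b ^ 3 / 8)⁻¹ + (b ^ 4 / 8)⁻¹ + (b / 2 * D)⁻¹ + c⁻¹, ?_, ?_, ?_, ?_, ?_, ?_⟩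
      <;> linarith
  have hK0 : 0 < K := by linarith
  refine ⟨K, K1, min (Real.sqrt (b / ρ)) (Real.sqrt (c * (b ^ 4 / 4 * D))), by positivity, ?_⟩
  rintro R ε k₀ m₀ hε hεε ⟨hk, hk', hm, hζ⟩ q hq
  have hε1 : ρ * ε ^ 2 ≤ b := by
    have : ε ^ 2 ≤ b / ρ := by
      rw [← Real.sq_sqrt (show 0 ≤ b / ρ by positivity)]
      have := hεε.le.trans (min_le_left _ _)
      gcongr
    rw [le_div_iff₀ hρ] at this; linarith
  have hε2 : c⁻¹ * ε ^ 2 ≤ b ^ 4 / 4 * D := by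
    have : ε ^ 2 ≤ c * (b ^ 4 / 4 * D) := by
      rw [← Real.sq_sqrt (show 0 ≤ c * (b ^ 4 / 4 * D) by positivity)]
      have := hεε.le.trans (min_le_right _ _)
      gcongr
    rw [inv_mul_le_iff₀ hc]; exact this
  have hcc : c ≤ c⁻¹ := hk.trans hk'
  have hbc : b⁻¹ = 2 * c⁻¹ := by rw [hb]; field_simp
  obtain ⟨q1, q2, q3⟩ : b ≤ |q.1| ∧ |q.1| ≤ b⁻¹ ∧ |q.2| ≤ b⁻¹ := by
    have hci : 0 < c⁻¹ := by positivity
    rcases hsupp ε k₀ m₀ q hε hq with ⟨h1, h2⟩ | ⟨h1, h2⟩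
    · have t1 := abs_sub (q.1 + k₀) q.1
      have t2 := abs_sub (q.1 + k₀) k₀
      have t3 := abs_sub (q.2 + m₀) m₀
      rw [add_sub_cancel_left] at t1
      rw [add_sub_cancel_right] at t2 t3
      rw [hbc]
      refine ⟨?_, ?_, ?_⟩ <;> linarith
    · have t1 := abs_sub q.1 (q.1 - k₀)
      have t2 := abs_add_le (q.1 - k₀) k₀
      have t3 := abs_add_le (q.2 - m₀) m₀
      rw [sub_sub_cancel] at t1
      rw [sub_add_cancel] at t2 t3
      rw [hbc]
      refine ⟨?_, ?_, ?_⟩ <;> linarith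
  obtain ⟨hz, hz5⟩ := hζ q hq
  obtain ⟨g1, g2, g3⟩ := near_critical_geometry (k := q.1) (m := q.2) hs hcos hb0 q1 q2 q3 hz hε2
  have hinv : ∀ x : ℝ, 0 < x → x⁻¹ ≤ K → K⁻¹ ≤ x := fun x hx h => (inv_le_comm₀ hx hK0).1 h
  rw [← g1] at g2
  refine ⟨⟨q2.trans K2, ?_, ?_, (hinv _ (by positivity) K3).trans g2,
    (hinv _ (by positivity) K5).trans g3, q3.trans K2, hz.trans (by gcongr)⟩, g1, fun h5 => ?_⟩
  · rw [g1]; exact abs_omegaPlus_le_one _ _ _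
  · refine (hinv _ (by positivity) K4).trans ?_
    have h1 : b ^ 3 / 8 ≤ b⁻¹ * |omega γ q| := by
      refine (g2.trans (le_abs_self _)).trans ?_
      rw [abs_mul]
      gcongr
    calc b ^ 4 / 8 = b * (b ^ 3 / 8) := by ring
      _ ≤ b * (b⁻¹ * |omega γ q|) := by gcongr
      _ = _ := by field_simp
  · refine le_trans ?_ (hz5 h5)
    have := hinv c hc K6
    gcongr

theorem measurableSet_exists_le {α : Type*} [MeasurableSpace α] {F : α → ℂ → ℝ} {K : Set ℂ}
    (hK : IsCompact K) (hF : ∀ w, Measurable fun a => F a w) (hc : ∀ a, Continuous (F a)) :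
    MeasurableSet {a | ∃ w ∈ K, F a w ≤ 0} := by
  obtain ⟨s, hs, hd⟩ := TopologicalSpace.exists_countable_dense K
  have h : {a | ∃ w ∈ K, F a w ≤ 0} = ⋂ n : ℕ, ⋃ w ∈ s, {a | F a w < 1 / ((n : ℝ) + 1)} := by
    ext a
    simp only [Set.mem_ofPred_eq, Set.mem_iInter, Set.mem_iUnion, exists_prop]
    constructor
    · rintro ⟨w, hw, hle⟩ n
      have hpos : (0 : ℝ) < 1 / ((n : ℝ) + 1) := by positivity
      have hopen : IsOpen {v : K | F a v < 1 / ((n : ℝ) + 1)} :=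
        isOpen_lt ((hc a).comp continuous_subtype_val) continuous_const
      obtain ⟨v, hv, hvs⟩ := hd.exists_mem_open hopen ⟨⟨w, hw⟩, lt_of_le_of_lt hle hpos⟩
      exact ⟨v, hv, hvs⟩
    · intro hn
      have hne : K.Nonempty := by
        obtain ⟨v, -, -⟩ := hn 0
        exact ⟨v, v.2⟩
      obtain ⟨w, hw, hmin⟩ := hK.exists_isMinOn hne (hc a).continuousOn
      refine ⟨w, hw, le_of_forall_pos_lt_add fun δ hδ => ?_⟩
      obtain ⟨n, hn'⟩ := exists_nat_one_div_lt hδ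
      obtain ⟨v, -, hv⟩ := hn n
      have := isMinOn_iff.1 hmin v v.2
      linarith
  rw [h]
  exact MeasurableSet.iInter fun n => MeasurableSet.biUnion hs fun w _ =>
    measurableSet_lt (hF w) measurable_const

/-- The minimum of a continuous function over the zero set depends measurably on parameters. -/
theorem exists_measurable_min {α : Type*} [MeasurableSpace α] {F : α → ℂ → ℝ} {K : Set ℂ}
    (hK : IsCompact K) (hF : ∀ w, Measurable fun a => F a w) (hc : ∀ a, Continuous (F a))
    {φ : ℂ → ℝ} (hφ : Continuous φ) :
    ∃ g : α → ℝ, Measurable g ∧ ∀ a, (∃ w ∈ K, F a w ≤ 0) → ∃ w ∈ K, F a w ≤ 0 ∧ φ w = g a := by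
  classical
  set S := {a | ∃ w ∈ K, F a w ≤ 0} with hSd
  have hS : MeasurableSet S := measurableSet_exists_le hK hF hc
  have hex : ∀ a ∈ S, ∃ w, (w ∈ K ∧ F a w ≤ 0) ∧ ∀ v ∈ K, F a v ≤ 0 → φ w ≤ φ v := by
    rintro a ⟨w, hw, hle⟩
    have hcomp : IsCompact (K ∩ {v | F a v ≤ 0}) :=
      hK.inter_right (isClosed_le (hc a) continuous_const)
    obtain ⟨v, hv, hmin⟩ := hcomp.exists_isMinOn ⟨w, hw, hle⟩ hφ.continuousOn
    exact ⟨v, hv, fun u hu hu' => isMinOn_iff.1 hmin u ⟨hu, hu'⟩⟩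
  choose! p hp hmin using hex
  refine ⟨fun a => if a ∈ S then φ (p a) else 0, ?_, fun a ha => ⟨p a, (hp a ha).1, (hp a ha).2,
    (if_pos (show a ∈ S from ha)).symm⟩⟩
  refine measurable_of_Iic fun r => ?_
  have h : (fun a => if a ∈ S then φ (p a) else 0) ⁻¹' Set.Iic r
      = {a | ∃ w ∈ K, max (F a w) (φ w - r) ≤ 0} ∪ (Sᶜ ∩ {_a | 0 ≤ r}) := by
    ext a
    simp only [Set.mem_preimage, Set.mem_Iic, Set.mem_union, Set.mem_ofPred_eq, Set.mem_inter_iff,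
      Set.mem_compl_iff, max_le_iff, sub_nonpos]
    by_cases ha : a ∈ S
    · simp only [ha, if_true, not_true_eq_false, false_and, or_false]
      constructor
      · exact fun h => ⟨p a, (hp a ha).1, (hp a ha).2, h⟩
      · rintro ⟨w, hw, h1, h2⟩
        exact (hmin a ha w hw h1).trans h2
    · simp only [ha, if_false, not_false_eq_true, true_and]
      constructor
      · exact fun h => Or.inr h
      · rintro (⟨w, hw, h1, -⟩ | h)
        · exact absurd ⟨w, hw, h1⟩ ha
        · exact h
  rw [h]
  exact (measurableSet_exists_le hK (fun w => (hF w).max measurable_const)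
    (fun a => (hc a).max (hφ.sub continuous_const))).union (hS.compl.inter (by simp))

/-- Measurable selection from the compact zero sets of a function that is measurable in the
parameter and continuous in the unknown. -/
theorem exists_measurable_selection {α : Type*} [MeasurableSpace α] {F : α → ℂ → ℝ} {K : Set ℂ}
    (hK : IsCompact K) (hF : ∀ w, Measurable fun a => F a w) (hc : ∀ a, Continuous (F a)) :
    ∃ g : α → ℂ, Measurable g ∧ ∀ a, (∃ w ∈ K, F a w ≤ 0) → g a ∈ K ∧ F a (g a) ≤ 0 := by
  obtain ⟨x, hx, hxw⟩ := exists_measurable_min hK hF hc Complex.continuous_re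
  have hF' : ∀ w, Measurable fun a => max (F a w) |w.re - x a| := fun w =>
    (hF w).max (measurable_const.sub hx).abs
  obtain ⟨y, hy, hyw⟩ := exists_measurable_min (F := fun a w => max (F a w) |w.re - x a|) hK hF'
    (fun a => (hc a).max (Complex.continuous_re.sub continuous_const).abs) Complex.continuous_im
  refine ⟨fun a => x a + y a * I, by fun_prop, fun a ha => ?_⟩
  obtain ⟨w, hw, h1, h2⟩ := hxw a ha
  obtain ⟨v, hv, h3, h4⟩ := hyw a ⟨w, hw, max_le h1 (by rw [h2, sub_self, abs_zero])⟩
  rw [max_le_iff] at h3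
  have h5 : v.re = x a := sub_eq_zero.1 (abs_nonpos_iff.1 h3.2)
  have h6 : (x a + y a * I : ℂ) = v := by
    apply Complex.ext <;> simp [h4, h5]
  simp only [h6]
  exact ⟨hv, h3.1⟩

theorem add_diffusion_ne_zero {γ ν κ ω k : ℝ} {l : ℂ} (hs : 0 < Real.sin γ) (hl : 0 < l.re)
    (h : charPoly γ ν κ ω k l = 0) : I * ω - κ * (k ^ 2 - l ^ 2) ≠ (0 : ℂ) := by
  intro h0
  rw [charPoly_eq, show I * ω + κ * (l ^ 2 - k ^ 2) = I * ω - κ * (k ^ 2 - l ^ 2) by ring, h0] at h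
  have h1 : (l * Real.sin γ + I * k * Real.cos γ) ^ 2 = 0 := by linear_combination -h
  have h2 := congrArg Complex.re (pow_eq_zero_iff two_ne_zero |>.1 h1)
  have h3 : (l * Real.sin γ + I * k * Real.cos γ).re = l.re * Real.sin γ := by
    simp [Complex.mul_re, -Complex.ofReal_cos, -Complex.ofReal_sin]
  rw [h3, Complex.zero_re] at h2
  exact (mul_pos hl hs).ne' h2

theorem symbolMatrix_mulVec_layerVec {γ ν κ ω k : ℝ} {l : ℂ} (hs : 0 < Real.sin γ)
    (hk : k ≠ 0) (hl : 0 < l.re) (h : charPoly γ ν κ ω k l = 0) :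
    (symbolMatrix γ ν κ ω k l).mulVec (layerVec γ ν κ ω k l) = 0 := by
  have hl0 : l ≠ 0 := by rintro rfl; simp at hl
  have hkC : (k : ℂ) ≠ 0 := by exact_mod_cast hk
  have hb := add_diffusion_ne_zero hs hl h
  have hB : layerB γ κ ω k l * (I * ω - κ * (k ^ 2 - l ^ 2)) * l =
      Real.sin γ * l + I * k * Real.cos γ := by
    unfold layerB; field_simp
  have hP : I * k * layerP γ ν κ ω k l =
      I * ω + ν * (l ^ 2 - k ^ 2) + Real.sin γ * layerB γ κ ω k l := by
    unfold layerP; field_simp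
  have hW : layerW k l * l = I * k := by unfold layerW; field_simp
  have h1 := layerB_mul_eq hl0 hb h
  generalize hBe : layerB γ κ ω k l = B at *
  generalize hPe : layerP γ ν κ ω k l = P at *
  generalize hWe : layerW k l = W at *
  ext i
  fin_cases i
  · simp [symbolMatrix, layerVec, Matrix.mulVec, dotProduct, Fin.sum_univ_four, hBe, hPe, hWe,
      -Complex.ofReal_cos, -Complex.ofReal_sin]
    linear_combination hP
  · simp [symbolMatrix, layerVec, Matrix.mulVec, dotProduct, Fin.sum_univ_four, hBe, hPe, hWe,
      -Complex.ofReal_cos, -Complex.ofReal_sin]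
    refine mul_left_cancel₀ (mul_ne_zero (mul_ne_zero I_ne_zero hkC) hl0) ?_
    linear_combination (I * k * (-I * ω + ν * (k ^ 2 - l ^ 2))) * hW - l ^ 2 * hP - h1
      + (-I * ω - ν * (l ^ 2 - k ^ 2)) * k ^ 2 * Complex.I_sq
  · simp [symbolMatrix, layerVec, Matrix.mulVec, dotProduct, Fin.sum_univ_four, hBe, hPe, hWe,
      -Complex.ofReal_cos, -Complex.ofReal_sin]
    refine mul_right_cancel₀ hl0 ?_
    linear_combination (Real.cos γ : ℂ) * hW - hB
  · simp [symbolMatrix, layerVec, Matrix.mulVec, dotProduct, Fin.sum_univ_four, hBe, hPe, hWe,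
      -Complex.ofReal_cos, -Complex.ofReal_sin]
    linear_combination -hW

theorem norm_layerVec_le {γ ν κ K N ρ : ℝ} (hs : 0 < Real.sin γ) (hK : 0 < K) (hρ : 0 < ρ) :
    ∃ C, ∀ (ω k : ℝ) (l : ℂ), |ω| ≤ 1 → K⁻¹ ≤ |k| → |k| ≤ K → ρ ≤ l.re → ‖l‖ ≤ N →
      charPoly γ ν κ ω k l = 0 → ∀ i, ‖layerVec γ ν κ ω k l i‖ ≤ C := by
  set E := N ^ 2 + K ^ 2 with hE
  set B := (1 + |ν| * E) * E / (ρ * (ρ * Real.sin γ)) with hB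
  set P := K * (1 + |ν| * E + B) with hP
  refine ⟨max (max 1 (K / ρ)) (max B P), fun ω k l hω hk hk' hl hN h i => ?_⟩
  have hl0 : 0 < l.re := hρ.trans_le hl
  have hln : ρ ≤ ‖l‖ := hl.trans (Complex.re_le_norm l)
  have hlz : l ≠ 0 := norm_pos_iff.1 (hρ.trans_le hln)
  have hN0 : 0 ≤ N := (norm_nonneg l).trans hN
  have hkz : (k : ℂ) ≠ 0 := by
    have : k ≠ 0 := abs_pos.1 (lt_of_lt_of_le (by positivity) hk)
    exact_mod_cast this
  have hE0 : 0 ≤ E := by positivity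
  have hD : ‖(l ^ 2 - k ^ 2 : ℂ)‖ ≤ E := by
    refine (norm_sub_le _ _).trans ?_
    rw [norm_pow, norm_pow, Complex.norm_real, Real.norm_eq_abs, hE]
    gcongr
  have hnD : ‖(I * ω + ν * (l ^ 2 - k ^ 2) : ℂ)‖ ≤ 1 + |ν| * E := by
    refine (norm_add_le _ _).trans ?_
    rw [norm_mul, norm_mul, Complex.norm_I, Complex.norm_real, Complex.norm_real,
      Real.norm_eq_abs, Real.norm_eq_abs, one_mul]
    gcongr
  have hlow : ρ * Real.sin γ ≤ ‖l * Real.sin γ + I * k * Real.cos γ‖ := by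
    have h3 : (l * Real.sin γ + I * k * Real.cos γ).re = l.re * Real.sin γ := by
      simp [Complex.mul_re, -Complex.ofReal_cos, -Complex.ofReal_sin]
    refine le_trans ?_ (Complex.re_le_norm _)
    rw [h3]; gcongr
  have hBl : ‖layerB γ κ ω k l‖ ≤ B := by
    have h1 := congrArg norm (layerB_mul_eq hlz (add_diffusion_ne_zero hs hl0 h) h)
    rw [norm_mul, norm_mul, norm_neg, norm_mul] at h1
    rw [hB, le_div_iff₀ (by positivity)]
    calc ‖layerB γ κ ω k l‖ * (ρ * (ρ * Real.sin γ))
        ≤ ‖layerB γ κ ω k l‖ * (‖l‖ * ‖l * Real.sin γ + I * k * Real.cos γ‖) := by gcongr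
      _ = ‖(I * ω + ν * (l ^ 2 - k ^ 2) : ℂ)‖ * ‖(l ^ 2 - k ^ 2 : ℂ)‖ := by rw [← h1]; ring
      _ ≤ _ := by gcongr
  have hBP : ‖layerP γ ν κ ω k l‖ ≤ P := by
    unfold layerP
    rw [norm_mul, norm_div, norm_one, norm_mul, Complex.norm_I, one_mul, Complex.norm_real,
      Real.norm_eq_abs, hP]
    have h1 : 1 / |k| ≤ K := by
      rw [one_div]
      exact (inv_le_comm₀ hK (lt_of_lt_of_le (by positivity) hk)).1 hk
    have h2 : ‖(Real.sin γ : ℂ) * layerB γ κ ω k l‖ ≤ B := by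
      rw [norm_mul, Complex.norm_real, Real.norm_eq_abs, abs_of_pos hs]
      exact (mul_le_of_le_one_left (norm_nonneg _) (Real.sin_le_one γ)).trans hBl
    have h3 := (norm_add_le (I * ω + ν * (l ^ 2 - k ^ 2) : ℂ)
      ((Real.sin γ : ℂ) * layerB γ κ ω k l)).trans (add_le_add hnD h2)
    gcongr
  have hW : ‖layerW k l‖ ≤ K / ρ := by
    unfold layerW
    rw [norm_div, norm_mul, Complex.norm_I, one_mul, Complex.norm_real, Real.norm_eq_abs]
    gcongr
  fin_cases i
  · simp [layerVec]
  · exact hW.trans ((le_max_right _ _).trans (le_max_left _ _))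
  · exact hBl.trans ((le_max_left _ _).trans (le_max_right _ _))
  · exact hBP.trans ((le_max_right _ _).trans (le_max_right _ _))

/-- Superposition of the exponentials `exp (α t + β x + μ y)` with density `F`. -/
def superposition (F α β μ : ℝ × ℝ → ℂ) (t x y : ℝ) : ℂ :=
  ∫ q, F q * exp (α q * t + β q * x + μ q * y)

/-- Measurable phases with a uniform bound. -/
structure BoundedPhases (α β μ : ℝ × ℝ → ℂ) (M : ℝ) : Prop where
  meas₁ : Measurable α
  meas₂ : Measurable β
  meas₃ : Measurable μ
  le₁ : ∀ q, ‖α q‖ ≤ M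
  le₂ : ∀ q, ‖β q‖ ≤ M
  le₃ : ∀ q, ‖μ q‖ ≤ M

section Superposition

variable {F G α β μ : ℝ × ℝ → ℂ} {M : ℝ}

theorem integrable_mul_of_bounded (hF : Integrable F) (hα : Measurable α)
    (hM : ∀ q, ‖α q‖ ≤ M) : Integrable fun q => F q * α q :=
  hF.mul_bdd hα.aestronglyMeasurable (Filter.Eventually.of_forall hM)

theorem BoundedPhases.norm_exp_le (h : BoundedPhases α β μ M) (t x y : ℝ) (q : ℝ × ℝ) :
    ‖exp (α q * t + β q * x + μ q * y)‖ ≤ Real.exp (M * |t| + M * |x| + M * |y|) := by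
  refine (Complex.norm_exp_le_exp_norm _).trans (Real.exp_le_exp.2 ?_)
  refine (norm_add₃_le).trans ?_
  simp only [norm_mul, Complex.norm_real, Real.norm_eq_abs]
  have := h.le₁ q
  have := h.le₂ q
  have := h.le₃ q
  gcongr

theorem BoundedPhases.integrable (h : BoundedPhases α β μ M) (hF : Integrable F) (t x y : ℝ) :
    Integrable fun q => F q * exp (α q * t + β q * x + μ q * y) := by
  have := h.meas₁
  have := h.meas₂
  have := h.meas₃
  exact integrable_mul_of_bounded hF (by fun_prop) (h.norm_exp_le t x y)

/-- The three coordinates as complex valued functionals. -/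
def coordT : ℝ × ℝ × ℝ →L[ℝ] ℂ := Complex.ofRealCLM.comp (ContinuousLinearMap.fst ℝ ℝ (ℝ × ℝ))

def coordX : ℝ × ℝ × ℝ →L[ℝ] ℂ := Complex.ofRealCLM.comp
  ((ContinuousLinearMap.fst ℝ ℝ ℝ).comp (ContinuousLinearMap.snd ℝ ℝ (ℝ × ℝ)))

def coordY : ℝ × ℝ × ℝ →L[ℝ] ℂ := Complex.ofRealCLM.comp
  ((ContinuousLinearMap.snd ℝ ℝ ℝ).comp (ContinuousLinearMap.snd ℝ ℝ (ℝ × ℝ)))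

theorem BoundedPhases.hasFDerivAt (h : BoundedPhases α β μ M) (hF : Integrable F)
    (z : ℝ × ℝ × ℝ) :
    HasFDerivAt (fun z : ℝ × ℝ × ℝ => superposition F α β μ z.1 z.2.1 z.2.2)
      (superposition (fun q => F q * α q) α β μ z.1 z.2.1 z.2.2 • coordT
        + superposition (fun q => F q * β q) α β μ z.1 z.2.1 z.2.2 • coordX
        + superposition (fun q => F q * μ q) α β μ z.1 z.2.1 z.2.2 • coordY) z := by
  have m1 := h.meas₁
  have m2 := h.meas₂
  have m3 := h.meas₃
  have i1 := h.integrable (integrable_mul_of_bounded hF m1 h.le₁) z.1 z.2.1 z.2.2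
  have i2 := h.integrable (integrable_mul_of_bounded hF m2 h.le₂) z.1 z.2.1 z.2.2
  have i3 := h.integrable (integrable_mul_of_bounded hF m3 h.le₃) z.1 z.2.1 z.2.2
  have hM : 0 ≤ M := (norm_nonneg _).trans (h.le₁ 0)
  set E : ℝ × ℝ × ℝ → ℝ × ℝ → ℂ := fun z q => exp (α q * z.1 + β q * z.2.1 + μ q * z.2.2) with hE
  have hint : (∫ q, ((F q * α q * E z q) • coordT + (F q * β q * E z q) • coordX
        + (F q * μ q * E z q) • coordY))
      = superposition (fun q => F q * α q) α β μ z.1 z.2.1 z.2.2 • coordT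
        + superposition (fun q => F q * β q) α β μ z.1 z.2.1 z.2.2 • coordX
        + superposition (fun q => F q * μ q) α β μ z.1 z.2.1 z.2.2 • coordY := by
    rw [integral_add, integral_add, integral_smul_const, integral_smul_const,
      integral_smul_const]
    · rfl
    · exact i1.smul_const _
    · exact i2.smul_const _
    · exact (i1.smul_const _).add (i2.smul_const _)
    · exact i3.smul_const _
  rw [← hint]
  set R := Real.exp (M * (|z.1| + 1) + M * (|z.2.1| + 1) + M * (|z.2.2| + 1)) with hR
  refine hasFDerivAt_integral_of_dominated_of_fderiv_le (Metric.ball_mem_nhds z one_pos)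
    (bound := fun q => ‖F q‖ * (M * R * (‖coordT‖ + ‖coordX‖ + ‖coordY‖)))
    (Filter.Eventually.of_forall fun w =>
      (h.integrable hF w.1 w.2.1 w.2.2).aestronglyMeasurable)
    (h.integrable hF z.1 z.2.1 z.2.2)
    (((i1.smul_const coordT).add (i2.smul_const coordX)).add
      (i3.smul_const coordY)).aestronglyMeasurable
    (Filter.Eventually.of_forall fun q w hw => ?_) (hF.norm.mul_const _)
    (F' := fun z q => (F q * α q * E z q) • coordT + (F q * β q * E z q) • coordX
        + (F q * μ q * E z q) • coordY)
    (Filter.Eventually.of_forall fun q w _ => ?_)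
  · have hw' : ‖w - z‖ < 1 := by rwa [← dist_eq_norm]
    have b1 : |w.1| ≤ |z.1| + 1 := by
      have h1 : |w.1 - z.1| ≤ 1 := ((norm_fst_le (w - z)).trans hw'.le)
      have := abs_add_le (w.1 - z.1) z.1
      rw [sub_add_cancel] at this; linarith
    have hw2 : ‖(w - z).2‖ ≤ 1 := (norm_snd_le (w - z)).trans hw'.le
    have b2 : |w.2.1| ≤ |z.2.1| + 1 := by
      have h1 : |w.2.1 - z.2.1| ≤ 1 := (norm_fst_le (w - z).2).trans hw2
      have := abs_add_le (w.2.1 - z.2.1) z.2.1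
      rw [sub_add_cancel] at this; linarith
    have b3 : |w.2.2| ≤ |z.2.2| + 1 := by
      have h1 : |w.2.2 - z.2.2| ≤ 1 := (norm_snd_le (w - z).2).trans hw2
      have := abs_add_le (w.2.2 - z.2.2) z.2.2
      rw [sub_add_cancel] at this; linarith
    have hER : ‖E w q‖ ≤ R := by
      refine (h.norm_exp_le w.1 w.2.1 w.2.2 q).trans (Real.exp_le_exp.2 ?_)
      gcongr
    have key : ∀ (c : ℂ) (L : ℝ × ℝ × ℝ →L[ℝ] ℂ), ‖c‖ ≤ M →
        ‖(F q * c * E w q) • L‖ ≤ ‖F q‖ * (M * R) * ‖L‖ := by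
      intro c L hc
      rw [norm_smul, norm_mul, norm_mul, mul_assoc ‖F q‖]
      gcongr
    refine norm_add₃_le.trans ?_
    refine (add_le_add (add_le_add (key _ _ (h.le₁ q)) (key _ _ (h.le₂ q)))
      (key _ _ (h.le₃ q))).trans (le_of_eq ?_)
    ring
  · have hL : HasFDerivAt (fun z : ℝ × ℝ × ℝ => α q * z.1 + β q * z.2.1 + μ q * z.2.2)
        (α q • coordT + β q • coordX + μ q • coordY) w :=
      ((coordT.hasFDerivAt.const_mul (α q)).add (coordX.hasFDerivAt.const_mul (β q))).add
        (coordY.hasFDerivAt.const_mul (μ q))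
    refine (hL.cexp.const_mul (F q)).congr_fderiv ?_
    ext <;> simp [hE] <;> ring

theorem BoundedPhases.contDiff (h : BoundedPhases α β μ M) (hF : Integrable F) (n : ℕ) :
    ContDiff ℝ n (fun z : ℝ × ℝ × ℝ => superposition F α β μ z.1 z.2.1 z.2.2) := by
  induction n generalizing F with
  | zero =>
    exact contDiff_zero.2 (continuous_iff_continuousAt.2 fun z => (h.hasFDerivAt hF z).continuousAt)
  | succ n ih =>
    push_cast
    rw [contDiff_succ_iff_hasFDerivAt]
    refine ⟨_, ?_, fun z => h.hasFDerivAt hF z⟩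
    exact (((ih (integrable_mul_of_bounded hF h.meas₁ h.le₁)).smul contDiff_const).add
      ((ih (integrable_mul_of_bounded hF h.meas₂ h.le₂)).smul contDiff_const)).add
      ((ih (integrable_mul_of_bounded hF h.meas₃ h.le₃)).smul contDiff_const)

theorem BoundedPhases.dt_eq (h : BoundedPhases α β μ M) (hF : Integrable F) :
    dt (superposition F α β μ) = superposition (fun q => F q * α q) α β μ := by
  funext t x y
  have h1 : HasDerivAt (fun s : ℝ => ((s, x, y) : ℝ × ℝ × ℝ)) (1, 0, 0) t :=
    (hasDerivAt_id t).prodMk ((hasDerivAt_const t x).prodMk (hasDerivAt_const t y))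
  have h2 := (h.hasFDerivAt hF (t, x, y)).comp_hasDerivAt t h1
  refine h2.deriv.trans ?_
  simp [coordT, coordX, coordY]

theorem BoundedPhases.dx_eq (h : BoundedPhases α β μ M) (hF : Integrable F) :
    dx (superposition F α β μ) = superposition (fun q => F q * β q) α β μ := by
  funext t x y
  have h1 : HasDerivAt (fun s : ℝ => ((t, s, y) : ℝ × ℝ × ℝ)) (0, 1, 0) x :=
    (hasDerivAt_const x t).prodMk ((hasDerivAt_id x).prodMk (hasDerivAt_const x y))
  have h2 := (h.hasFDerivAt hF (t, x, y)).comp_hasDerivAt x h1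
  refine h2.deriv.trans ?_
  simp [coordT, coordX, coordY]

theorem BoundedPhases.dy_eq (h : BoundedPhases α β μ M) (hF : Integrable F) :
    dy (superposition F α β μ) = superposition (fun q => F q * μ q) α β μ := by
  funext t x y
  have h1 : HasDerivAt (fun s : ℝ => ((t, x, s) : ℝ × ℝ × ℝ)) (0, 0, 1) y :=
    (hasDerivAt_const y t).prodMk ((hasDerivAt_const y x).prodMk (hasDerivAt_id y))
  have h2 := (h.hasFDerivAt hF (t, x, y)).comp_hasDerivAt y h1
  refine h2.deriv.trans ?_
  simp [coordT, coordX, coordY]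

theorem BoundedPhases.lap_eq (h : BoundedPhases α β μ M) (hF : Integrable F) :
    lap (superposition F α β μ) = superposition (fun q => F q * (β q ^ 2 + μ q ^ 2)) α β μ := by
  have i2 := integrable_mul_of_bounded hF h.meas₂ h.le₂
  have i3 := integrable_mul_of_bounded hF h.meas₃ h.le₃
  funext t x y
  rw [lap, h.dx_eq hF, h.dx_eq i2, h.dy_eq hF, h.dy_eq i3]
  unfold superposition
  rw [← integral_add (h.integrable (integrable_mul_of_bounded i2 h.meas₂ h.le₂) t x y)
    (h.integrable (integrable_mul_of_bounded i3 h.meas₃ h.le₃) t x y)]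
  congr 1
  funext q
  ring

theorem BoundedPhases.superposition_add (h : BoundedPhases α β μ M) (hF : Integrable F)
    (hG : Integrable G) (t x y : ℝ) : superposition (fun q => F q + G q) α β μ t x y
      = superposition F α β μ t x y + superposition G α β μ t x y := by
  unfold superposition
  rw [← integral_add (h.integrable hF t x y) (h.integrable hG t x y)]
  simp only [add_mul]

theorem BoundedPhases.superposition_linear (h : BoundedPhases α β μ M)
    {f₁ f₂ f₃ f₄ : ℝ × ℝ → ℂ} (h₁ : Integrable f₁) (h₂ : Integrable f₂) (h₃ : Integrable f₃)
    (h₄ : Integrable f₄) (c₁ c₂ c₃ c₄ : ℂ) (t x y : ℝ) :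
    superposition (fun q => c₁ * f₁ q + c₂ * f₂ q + c₃ * f₃ q + c₄ * f₄ q) α β μ t x y
      = c₁ * superposition f₁ α β μ t x y + c₂ * superposition f₂ α β μ t x y
        + c₃ * superposition f₃ α β μ t x y + c₄ * superposition f₄ α β μ t x y := by
  have i₁ := (h.integrable h₁ t x y).const_mul c₁
  have i₂ := (h.integrable h₂ t x y).const_mul c₂
  have i₃ := (h.integrable h₃ t x y).const_mul c₃
  have i₄ := (h.integrable h₄ t x y).const_mul c₄
  unfold superposition
  rw [← integral_const_mul, ← integral_const_mul, ← integral_const_mul, ← integral_const_mul,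
    ← integral_add' i₁ i₂, ← integral_add' (i₁.add i₂) i₃, ← integral_add' ((i₁.add i₂).add i₃) i₄]
  congr 1
  funext q
  simp only [Pi.add_apply]
  ring

end Superposition

/-- The fields obtained by superposition with densities `F₀, …, F₃`. -/
def waveFields (F : Fin 4 → ℝ × ℝ → ℂ) (α β μ : ℝ × ℝ → ℂ) : Fields where
  u := superposition (F 0) α β μ
  w := superposition (F 1) α β μ
  b := superposition (F 2) α β μ
  p := superposition (F 3) α β μ

theorem solvesWithSource_waveFields {γ ν κ M : ℝ} {F : Fin 4 → ℝ × ℝ → ℂ} {G₀ G₁ G₂ : ℝ × ℝ → ℂ}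
    {α β μ : ℝ × ℝ → ℂ} (h : BoundedPhases α β μ M) (hF : ∀ i, Integrable (F i))
    (h₀ : ∀ q, F 0 q * α q - F 2 q * Real.sin γ + F 3 q * β q
      = ν * (F 0 q * (β q ^ 2 + μ q ^ 2)) + G₀ q)
    (h₁ : ∀ q, F 1 q * α q - F 2 q * Real.cos γ + F 3 q * μ q
      = ν * (F 1 q * (β q ^ 2 + μ q ^ 2)) + G₁ q)
    (h₂ : ∀ q, F 2 q * α q + F 0 q * Real.sin γ + F 1 q * Real.cos γ
      = κ * (F 2 q * (β q ^ 2 + μ q ^ 2)) + G₂ q)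
    (h₃ : ∀ q, F 0 q * β q + F 1 q * μ q = 0) :
    SolvesWithSource γ ν κ (waveFields F α β μ) (superposition G₀ α β μ) (superposition G₁ α β μ)
      (superposition G₂ α β μ) := by
  have j1 : ∀ i, Integrable fun q => F i q * α q := fun i =>
    integrable_mul_of_bounded (hF i) h.meas₁ h.le₁
  have j2 : ∀ i, Integrable fun q => F i q * β q := fun i =>
    integrable_mul_of_bounded (hF i) h.meas₂ h.le₂
  have j3 : ∀ i, Integrable fun q => F i q * μ q := fun i =>
    integrable_mul_of_bounded (hF i) h.meas₃ h.le₃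
  have j4 : ∀ i, Integrable fun q => F i q * (β q ^ 2 + μ q ^ 2) := fun i => by
    have := (integrable_mul_of_bounded (j2 i) h.meas₂ h.le₂).add
      (integrable_mul_of_bounded (j3 i) h.meas₃ h.le₃)
    refine this.congr (Filter.Eventually.of_forall fun q => ?_)
    simp only [Pi.add_apply]; ring
  have e0 : G₀ = fun q => 1 * (F 0 q * α q) + (-(Real.sin γ : ℂ)) * F 2 q + 1 * (F 3 q * β q)
      + (-(ν : ℂ)) * (F 0 q * (β q ^ 2 + μ q ^ 2)) := by
    funext q; linear_combination -h₀ q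
  have e1 : G₁ = fun q => 1 * (F 1 q * α q) + (-(Real.cos γ : ℂ)) * F 2 q + 1 * (F 3 q * μ q)
      + (-(ν : ℂ)) * (F 1 q * (β q ^ 2 + μ q ^ 2)) := by
    funext q; linear_combination -h₁ q
  have e2 : G₂ = fun q => 1 * (F 2 q * α q) + (Real.sin γ : ℂ) * F 0 q + (Real.cos γ : ℂ) * F 1 q
      + (-(κ : ℂ)) * (F 2 q * (β q ^ 2 + μ q ^ 2)) := by
    funext q; linear_combination -h₂ q
  refine ⟨by exact_mod_cast h.contDiff (hF 0) 2, by exact_mod_cast h.contDiff (hF 1) 2,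
    by exact_mod_cast h.contDiff (hF 2) 2, by exact_mod_cast h.contDiff (hF 3) 1, ?_, ?_, ?_, ?_⟩
  · intro t x y _
    simp only [waveFields]
    rw [h.dt_eq (hF 0), h.dx_eq (hF 3), h.lap_eq (hF 0), e0,
      h.superposition_linear (j1 0) (hF 2) (j2 3) (j4 0)]
    ring
  · intro t x y _
    simp only [waveFields]
    rw [h.dt_eq (hF 1), h.dy_eq (hF 3), h.lap_eq (hF 1), e1,
      h.superposition_linear (j1 1) (hF 2) (j3 3) (j4 1)]
    ring
  · intro t x y _
    simp only [waveFields]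
    rw [h.dt_eq (hF 2), h.lap_eq (hF 2), e2,
      h.superposition_linear (j1 2) (hF 0) (hF 1) (j4 2)]
    ring
  · intro t x y _
    simp only [waveFields]
    rw [h.dx_eq (hF 0), h.dy_eq (hF 1), ← h.superposition_add (j2 0) (j3 1)]
    simp only [h₃, superposition, zero_mul, integral_zero]

section Derivatives

variable {f g : ℝ → ℝ → ℝ → ℂ} {n : WithTop ℕ∞}

theorem dt_add (hf : ContDiff ℝ n (fun z : ℝ × ℝ × ℝ => f z.1 z.2.1 z.2.2))
    (hg : ContDiff ℝ n (fun z : ℝ × ℝ × ℝ => g z.1 z.2.1 z.2.2)) (hn : n ≠ 0) :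
    dt (f + g) = dt f + dt g := by
  funext t x y
  have h : ContDiff ℝ n (fun s : ℝ => ((s, x, y) : ℝ × ℝ × ℝ)) := by fun_prop
  exact deriv_add ((hf.comp h).differentiable hn t) ((hg.comp h).differentiable hn t)

theorem dx_add (hf : ContDiff ℝ n (fun z : ℝ × ℝ × ℝ => f z.1 z.2.1 z.2.2))
    (hg : ContDiff ℝ n (fun z : ℝ × ℝ × ℝ => g z.1 z.2.1 z.2.2)) (hn : n ≠ 0) :
    dx (f + g) = dx f + dx g := by
  funext t x y
  have h : ContDiff ℝ n (fun s : ℝ => ((t, s, y) : ℝ × ℝ × ℝ)) := by fun_prop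
  exact deriv_add ((hf.comp h).differentiable hn x) ((hg.comp h).differentiable hn x)

theorem dy_add (hf : ContDiff ℝ n (fun z : ℝ × ℝ × ℝ => f z.1 z.2.1 z.2.2))
    (hg : ContDiff ℝ n (fun z : ℝ × ℝ × ℝ => g z.1 z.2.1 z.2.2)) (hn : n ≠ 0) :
    dy (f + g) = dy f + dy g := by
  funext t x y
  have h : ContDiff ℝ n (fun s : ℝ => ((t, x, s) : ℝ × ℝ × ℝ)) := by fun_prop
  exact deriv_add ((hf.comp h).differentiable hn y) ((hg.comp h).differentiable hn y)

theorem contDiff_dx (hf : ContDiff ℝ 2 (fun z : ℝ × ℝ × ℝ => f z.1 z.2.1 z.2.2)) :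
    ContDiff ℝ 1 (fun z : ℝ × ℝ × ℝ => dx f z.1 z.2.1 z.2.2) := by
  have h : (fun z : ℝ × ℝ × ℝ => dx f z.1 z.2.1 z.2.2) =
      fun z => fderiv ℝ (fun z : ℝ × ℝ × ℝ => f z.1 z.2.1 z.2.2) z (0, 1, 0) := by
    funext z
    have h1 : HasDerivAt (fun s : ℝ => ((z.1, s, z.2.2) : ℝ × ℝ × ℝ)) (0, 1, 0) z.2.1 :=
      (hasDerivAt_const z.2.1 z.1).prodMk ((hasDerivAt_id z.2.1).prodMk
        (hasDerivAt_const z.2.1 z.2.2))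
    exact ((hf.differentiable two_ne_zero z).hasFDerivAt.comp_hasDerivAt z.2.1 h1).deriv
  rw [h]
  exact (hf.fderiv_right (by norm_num)).clm_apply contDiff_const

theorem contDiff_dy (hf : ContDiff ℝ 2 (fun z : ℝ × ℝ × ℝ => f z.1 z.2.1 z.2.2)) :
    ContDiff ℝ 1 (fun z : ℝ × ℝ × ℝ => dy f z.1 z.2.1 z.2.2) := by
  have h : (fun z : ℝ × ℝ × ℝ => dy f z.1 z.2.1 z.2.2) =
      fun z => fderiv ℝ (fun z : ℝ × ℝ × ℝ => f z.1 z.2.1 z.2.2) z (0, 0, 1) := by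
    funext z
    have h1 : HasDerivAt (fun s : ℝ => ((z.1, z.2.1, s) : ℝ × ℝ × ℝ)) (0, 0, 1) z.2.2 :=
      (hasDerivAt_const z.2.2 z.1).prodMk ((hasDerivAt_const z.2.2 z.2.1).prodMk
        (hasDerivAt_id z.2.2))
    exact ((hf.differentiable two_ne_zero z).hasFDerivAt.comp_hasDerivAt z.2.2 h1).deriv
  rw [h]
  exact (hf.fderiv_right (by norm_num)).clm_apply contDiff_const

theorem lap_add (hf : ContDiff ℝ 2 (fun z : ℝ × ℝ × ℝ => f z.1 z.2.1 z.2.2))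
    (hg : ContDiff ℝ 2 (fun z : ℝ × ℝ × ℝ => g z.1 z.2.1 z.2.2)) :
    lap (f + g) = lap f + lap g := by
  funext t x y
  simp only [lap, Pi.add_apply]
  rw [dx_add hf hg two_ne_zero, dy_add hf hg two_ne_zero,
    dx_add (contDiff_dx hf) (contDiff_dx hg) one_ne_zero,
    dy_add (contDiff_dy hf) (contDiff_dy hg) one_ne_zero]
  simp only [Pi.add_apply]
  ring

end Derivatives

theorem SolvesWithSource.add {γ ν κ : ℝ} {V W : Fields} {Ru Rw Rb Su Sw Sb : ℝ → ℝ → ℝ → ℂ}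
    (hV : SolvesWithSource γ ν κ V Ru Rw Rb) (hW : SolvesWithSource γ ν κ W Su Sw Sb) :
    SolvesWithSource γ ν κ (V + W) (Ru + Su) (Rw + Sw) (Rb + Sb) := by
  have eu : (V + W).u = V.u + W.u := rfl
  have ew : (V + W).w = V.w + W.w := rfl
  have eb : (V + W).b = V.b + W.b := rfl
  have ep : (V + W).p = V.p + W.p := rfl
  refine ⟨hV.smooth_u.add hW.smooth_u, hV.smooth_w.add hW.smooth_w, hV.smooth_b.add hW.smooth_b,
    hV.smooth_p.add hW.smooth_p, ?_, ?_, ?_, ?_⟩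
  · intro t x y hy
    rw [eu, eb, ep, dt_add hV.smooth_u hW.smooth_u two_ne_zero,
      dx_add hV.smooth_p hW.smooth_p one_ne_zero, lap_add hV.smooth_u hW.smooth_u]
    simp only [Pi.add_apply]
    linear_combination hV.momentum_x t x y hy + hW.momentum_x t x y hy
  · intro t x y hy
    rw [ew, eb, ep, dt_add hV.smooth_w hW.smooth_w two_ne_zero,
      dy_add hV.smooth_p hW.smooth_p one_ne_zero, lap_add hV.smooth_w hW.smooth_w]
    simp only [Pi.add_apply]
    linear_combination hV.momentum_y t x y hy + hW.momentum_y t x y hy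
  · intro t x y hy
    rw [eu, ew, eb, dt_add hV.smooth_b hW.smooth_b two_ne_zero, lap_add hV.smooth_b hW.smooth_b]
    simp only [Pi.add_apply]
    linear_combination hV.buoyancy t x y hy + hW.buoyancy t x y hy
  · intro t x y hy
    rw [eu, ew, dx_add hV.smooth_u hW.smooth_u two_ne_zero,
      dy_add hV.smooth_w hW.smooth_w two_ne_zero]
    simp only [Pi.add_apply]
    linear_combination hV.divergence_free t x y hy + hW.divergence_free t x y hy

theorem Solves.add {γ ν κ : ℝ} {V W : Fields} (hV : Solves γ ν κ V) (hW : Solves γ ν κ W) :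
    Solves γ ν κ (V + W) := by
  have := SolvesWithSource.add hV hW
  rwa [add_zero] at this

/-- A packet is a superposition of exponentials, whatever the values of the phases off the support
of the density. -/
theorem packet_eq_superposition {γ : ℝ} {A X μ F α β η : ℝ × ℝ → ℂ}
    (hF : ∀ q, A q ≠ 0 → F q = A q * X q) (hF0 : ∀ q, A q = 0 → F q = 0)
    (hα : ∀ q, A q ≠ 0 → α q = -I * omega γ q) (hβ : ∀ q, A q ≠ 0 → β q = I * q.1)
    (hη : ∀ q, A q ≠ 0 → η q = -μ q) : packet γ A X μ = superposition F α β η := by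
  funext t x y
  unfold packet superposition
  congr 1
  funext q
  by_cases hA : A q = 0
  · rw [hA, hF0 q hA, zero_mul, zero_mul, zero_mul]
  · rw [hF q hA, hα q hA, hβ q hA, hη q hA]
    congr 2
    ring

open scoped FourierTransform ENNReal

section Plancherel

variable {E : Type*} [NormedAddCommGroup E] [InnerProductSpace ℝ E] [FiniteDimensional ℝ E]
  [MeasurableSpace E] [BorelSpace E]

theorem continuous_fourier {f : E → ℂ} (hf : Integrable f) : Continuous (𝓕 f) :=
  VectorFourier.fourierIntegral_continuous Real.continuous_fourierChar
    (show Continuous fun p : E × E => innerₗ E p.1 p.2 from continuous_inner) hf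

theorem integral_mul_fourier {f g : E → ℂ} (hf : Integrable f) (hg : Integrable g) :
    ∫ x, 𝓕 f x • g x = ∫ x, f x • 𝓕 g x := by
  have h := VectorFourier.integral_fourierIntegral_smul_eq_flip (μ := volume) (ν := volume)
    (L := innerₗ E) Real.continuous_fourierChar
    (show Continuous fun p : E × E => innerₗ E p.1 p.2 from continuous_inner) hf hg
  rw [flip_innerₗ] at h
  exact h

/-- Plancherel's identity for integrable and square integrable functions. -/
theorem eLpNorm_fourier {f : E → ℂ} (hf : Integrable f) (hf2 : MemLp f 2) :
    eLpNorm (𝓕 f) 2 volume = eLpNorm f 2 volume := by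
  obtain ⟨g, hg⟩ : ∃ g : Lp (α := E) ℂ 2 volume, g = hf2.toLp f := ⟨_, rfl⟩
  have hgf : g =ᵐ[volume] f := hg ▸ hf2.coeFn_toLp
  have key : ∀ φ : SchwartzMap E ℂ, ∫ x, φ x • (𝓕 g : Lp (α := E) ℂ 2 volume) x = ∫ x, φ x • 𝓕 f x := by
    intro φ
    have h1 := congrArg (fun T => T φ) (Lp.fourier_toTemperedDistribution_eq g)
    simp only [TemperedDistribution.fourier_apply, Lp.toTemperedDistribution_apply] at h1
    rw [← h1, ← integral_mul_fourier φ.integrable hf]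
    refine integral_congr_ae ?_
    filter_upwards [hgf] with x hx
    rw [hx]
    rfl
  have hae : ∀ᵐ x, (𝓕 g : Lp (α := E) ℂ 2 volume) x = 𝓕 f x := by
    refine ae_eq_of_integral_contDiff_smul_eq
      ((Lp.memLp _).locallyIntegrable (by norm_num))
      (continuous_fourier hf).locallyIntegrable fun φ hφ hφc => ?_
    have hc : HasCompactSupport fun x => (φ x : ℂ) :=
      hφc.comp_left (g := fun x : ℝ => (x : ℂ)) Complex.ofReal_zero
    have hs : ContDiff ℝ (⊤ : ℕ∞) fun x => (φ x : ℂ) := Complex.ofRealCLM.contDiff.comp hφ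
    have e : ∀ x, hc.toSchwartzMap hs x = (φ x : ℂ) := fun x => rfl
    have := key (hc.toSchwartzMap hs)
    simpa [e] using this
  rw [← eLpNorm_congr_ae hae, ← eLpNorm_congr_ae hgf]
  have h2 := congrArg ENNReal.ofReal (Lp.norm_fourier_eq g)
  rwa [Lp.norm_def, Lp.norm_def, ENNReal.ofReal_toReal (Lp.eLpNorm_ne_top _),
    ENNReal.ofReal_toReal (Lp.eLpNorm_ne_top _)] at h2

theorem eLpNorm_comp_smul {f : E → ℂ} (hf : Continuous f) {r : ℝ} (hr : r ≠ 0) :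
    eLpNorm (fun x => f (r • x)) 2 volume =
      ENNReal.ofReal (|r ^ Module.finrank ℝ E|⁻¹) ^ (1 / 2 : ℝ) * eLpNorm f 2 volume := by
  have h := eLpNorm_map_measure (p := 2) (μ := (volume : Measure E)) (f := fun x : E => r • x)
    (g := f) hf.aestronglyMeasurable (continuous_const_smul r).measurable.aemeasurable
  rw [Measure.map_addHaar_smul volume hr, eLpNorm_smul_measure_of_ne_top (by norm_num)] at h
  rw [abs_inv] at h
  simpa [Function.comp_def] using h.symm

end Plancherel

theorem eLpNorm_superposition {G : ℝ × ℝ → ℂ} (hG : Integrable G) (hG2 : MemLp G 2) :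
    eLpNorm (fun z : ℝ × ℝ => ∫ q, G q * exp (I * q.1 * z.1 + I * q.2 * z.2)) 2 volume
      = ENNReal.ofReal (2 * Real.pi) * eLpNorm G 2 volume := by
  have hpo := WithLp.volume_preserving_ofLp ℝ ℝ
  have hpt := WithLp.volume_preserving_toLp ℝ ℝ
  set f : WithLp 2 (ℝ × ℝ) → ℂ := G ∘ WithLp.ofLp with hf
  have hfi : Integrable f := hpo.integrable_comp_of_integrable hG
  have hf2 : MemLp f 2 := hG2.comp_measurePreserving hpo
  have hr : -(2 * Real.pi)⁻¹ ≠ 0 := by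
    have := Real.pi_pos
    exact neg_ne_zero.2 (by positivity)
  have hU : (fun z : ℝ × ℝ => ∫ q, G q * exp (I * q.1 * z.1 + I * q.2 * z.2))
      = (fun w => 𝓕 f (-(2 * Real.pi)⁻¹ • w)) ∘ WithLp.toLp 2 := by
    funext z
    have hpi : (Real.pi : ℂ) ≠ 0 := by exact_mod_cast Real.pi_ne_zero
    rw [Function.comp_apply, Real.fourier_eq',
      ← hpt.integral_comp (MeasurableEquiv.toLp 2 (ℝ × ℝ)).measurableEmbedding]
    congr 1
    funext q
    rw [smul_eq_mul, mul_comm, hf]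
    congr 2
    simp [WithLp.prod_inner_apply]
    field_simp
    ring
  have hc := continuous_fourier hfi
  have hc' : Continuous fun w => 𝓕 f (-(2 * Real.pi)⁻¹ • w) := hc.comp (continuous_const_smul _)
  rw [hU, eLpNorm_comp_measurePreserving hc'.aestronglyMeasurable hpt,
    eLpNorm_comp_smul hc hr, eLpNorm_fourier hfi hf2, hf,
    eLpNorm_comp_measurePreserving hG2.aestronglyMeasurable hpo]
  have hfin : Module.finrank ℝ (WithLp 2 (ℝ × ℝ)) = 2 := by
    rw [(WithLp.linearEquiv 2 ℝ (ℝ × ℝ)).finrank_eq]; simp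
  have h2π : 0 < 2 * Real.pi := by positivity
  rw [hfin, neg_sq, abs_of_pos (by positivity), inv_pow, inv_inv,
    ENNReal.ofReal_rpow_of_pos (by positivity), ← Real.sqrt_eq_rpow, Real.sqrt_sq h2π.le]

theorem continuous_density {χ : ℝ → ℂ} (hχ : Continuous χ) (ε k₀ m₀ : ℝ) :
    Continuous (density χ ε k₀ m₀) := by
  unfold density
  fun_prop

theorem measurableSet_support_density {χ : ℝ → ℂ} (hχ : Continuous χ) (ε k₀ m₀ : ℝ) :
    MeasurableSet {q | density χ ε k₀ m₀ q ≠ 0} :=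
  (isOpen_ne_fun (continuous_density hχ ε k₀ m₀) continuous_const).measurableSet

theorem measurable_omegaPlus (γ : ℝ) : Measurable fun q : ℝ × ℝ => omegaPlus γ q.1 q.2 := by
  unfold omegaPlus
  fun_prop

/-- Functions dominated by the density are integrable, and their `L²` norm is bounded uniformly
in `ε`. -/
theorem density_domination {χ : ℝ → ℂ} (hχ : Continuous χ) (hχc : HasCompactSupport χ) :
    ∃ C > 0, ∀ (ε k₀ m₀ B : ℝ) (F : ℝ × ℝ → ℂ), 0 < ε → Measurable F →
      (∀ q, ‖F q‖ ≤ B * ‖density χ ε k₀ m₀ q‖) → 0 ≤ B →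
      Integrable F ∧ MemLp F 2 ∧ eLpNorm F 2 volume ≤ ENNReal.ofReal (C * B) := by
  obtain ⟨ρ, hρ, hsupp⟩ := support_density hχc
  obtain ⟨D, hD⟩ := hχc.exists_bound_of_continuous hχ
  have hD0 : 0 ≤ D := (norm_nonneg _).trans (hD 0)
  refine ⟨Real.sqrt (8 * ρ ^ 2) * (2 * D ^ 2) + 1, by positivity, ?_⟩
  intro ε k₀ m₀ B F hε hF hFB hB
  have hdens : ∀ q, ‖density χ ε k₀ m₀ q‖ ≤ 2 * D ^ 2 / ε ^ 2 := by
    intro q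
    rw [density, norm_mul, norm_div, norm_one, norm_pow, Complex.norm_real, Real.norm_eq_abs,
      sq_abs]
    have h1 : ∀ x y : ℝ, ‖χ x * χ y‖ ≤ D ^ 2 := fun x y => by
      rw [norm_mul, sq]; exact mul_le_mul (hD x) (hD y) (norm_nonneg _) hD0
    have h2 := (norm_add_le (χ ((q.1 + k₀) / ε ^ 2) * χ ((q.2 + m₀) / ε ^ 2))
      (χ ((q.1 - k₀) / ε ^ 2) * χ ((q.2 - m₀) / ε ^ 2))).trans (add_le_add (h1 _ _) (h1 _ _))
    calc _ ≤ 1 / ε ^ 2 * (D ^ 2 + D ^ 2) := by gcongr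
      _ = _ := by ring
  set T : Set (ℝ × ℝ) := (Metric.closedBall (-k₀) (ρ * ε ^ 2) ×ˢ Metric.closedBall (-m₀) (ρ * ε ^ 2))
    ∪ (Metric.closedBall k₀ (ρ * ε ^ 2) ×ˢ Metric.closedBall m₀ (ρ * ε ^ 2)) with hT
  have hTm : MeasurableSet T :=
    (measurableSet_closedBall.prod measurableSet_closedBall).union
      (measurableSet_closedBall.prod measurableSet_closedBall)
  have hTvol : volume T ≤ ENNReal.ofReal (8 * ρ ^ 2 * ε ^ 4) := by
    have h1 : ∀ x y : ℝ, volume (Metric.closedBall x (ρ * ε ^ 2) ×ˢ Metric.closedBall y (ρ * ε ^ 2))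
        = ENNReal.ofReal (4 * ρ ^ 2 * ε ^ 4) := fun x y => by
      rw [Measure.volume_eq_prod, Measure.prod_prod, Real.volume_closedBall, Real.volume_closedBall,
        ← ENNReal.ofReal_mul (by positivity)]
      congr 1; ring
    refine (measure_union_le _ _).trans ?_
    rw [h1, h1, ← ENNReal.ofReal_add (by positivity) (by positivity)]
    exact ENNReal.ofReal_le_ofReal (by linarith)
  have hsub : Function.support F ⊆ T := by
    intro q hq
    have hd : density χ ε k₀ m₀ q ≠ 0 := by
      intro h0
      have := hFB q
      rw [h0, norm_zero, mul_zero] at this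
      exact hq (norm_le_zero_iff.1 this)
    rcases hsupp ε k₀ m₀ q hε hd with ⟨h1, h2⟩ | ⟨h1, h2⟩
    · left
      simp only [Set.mem_prod, Metric.mem_closedBall, Real.dist_eq, sub_neg_eq_add]
      exact ⟨h1, h2⟩
    · right
      simp only [Set.mem_prod, Metric.mem_closedBall, Real.dist_eq]
      exact ⟨h1, h2⟩
  have hbd : ∀ q, ‖F q‖ ≤ B * (2 * D ^ 2 / ε ^ 2) := fun q =>
    (hFB q).trans (mul_le_mul_of_nonneg_left (hdens q) hB)
  have hTfin : volume T < ∞ := hTvol.trans_lt ENNReal.ofReal_lt_top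
  have : IsFiniteMeasure (volume.restrict T) := ⟨by rwa [Measure.restrict_apply_univ]⟩
  have hmem : ∀ p : ℝ≥0∞, MemLp F p := fun p => by
    have h1 : MemLp F p (volume.restrict T) :=
      MemLp.of_bound hF.aestronglyMeasurable _ (Filter.Eventually.of_forall hbd)
    refine ⟨hF.aestronglyMeasurable, ?_⟩
    rw [← eLpNorm_restrict_eq_of_support_subset hsub]
    exact h1.2
  refine ⟨memLp_one_iff_integrable.1 (hmem 1), hmem 2, ?_⟩
  rw [← eLpNorm_restrict_eq_of_support_subset hsub]
  refine (eLpNorm_le_of_ae_bound (Filter.Eventually.of_forall hbd)).trans ?_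
  rw [Measure.restrict_apply_univ]
  have h8 : (volume T) ^ ((2 : ℝ≥0∞).toReal⁻¹) ≤ ENNReal.ofReal (Real.sqrt (8 * ρ ^ 2) * ε ^ 2) := by
    calc (volume T) ^ ((2 : ℝ≥0∞).toReal⁻¹)
        ≤ (ENNReal.ofReal (8 * ρ ^ 2 * ε ^ 4)) ^ ((2 : ℝ≥0∞).toReal⁻¹) := by gcongr
      _ = ENNReal.ofReal (Real.sqrt (8 * ρ ^ 2 * ε ^ 4)) := by
        rw [ENNReal.ofReal_rpow_of_pos (by positivity), Real.sqrt_eq_rpow]; norm_num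
      _ = _ := by
        rw [Real.sqrt_mul (by positivity), show ε ^ 4 = (ε ^ 2) ^ 2 by ring,
          Real.sqrt_sq (by positivity)]
  calc _ ≤ ENNReal.ofReal (Real.sqrt (8 * ρ ^ 2) * ε ^ 2)
        * ENNReal.ofReal (B * (2 * D ^ 2 / ε ^ 2)) := by gcongr
    _ = ENNReal.ofReal (Real.sqrt (8 * ρ ^ 2) * (2 * D ^ 2) * B) := by
      rw [← ENNReal.ofReal_mul (by positivity)]
      congr 1; field_simp
    _ ≤ _ := ENNReal.ofReal_le_ofReal (by gcongr; linarith)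

/-- A phase that is cut off outside the support of the density. -/
def cutoff (χ : ℝ → ℂ) (ε k₀ m₀ : ℝ) (f : ℝ × ℝ → ℂ) : ℝ × ℝ → ℂ :=
  Set.indicator {q | density χ ε k₀ m₀ q ≠ 0} f

section Cutoff

variable {χ : ℝ → ℂ} {ε k₀ m₀ : ℝ} {f : ℝ × ℝ → ℂ} {q : ℝ × ℝ}

theorem cutoff_of_ne (h : density χ ε k₀ m₀ q ≠ 0) : cutoff χ ε k₀ m₀ f q = f q :=
  Set.indicator_of_mem (s := {q | density χ ε k₀ m₀ q ≠ 0}) h f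

theorem cutoff_of_eq (h : density χ ε k₀ m₀ q = 0) : cutoff χ ε k₀ m₀ f q = 0 :=
  Set.indicator_of_notMem (s := {q | density χ ε k₀ m₀ q ≠ 0}) (fun hn => hn h) f

theorem measurable_cutoff (hχ : Continuous χ) (hf : Measurable f) :
    Measurable (cutoff χ ε k₀ m₀ f) :=
  hf.indicator (measurableSet_support_density hχ ε k₀ m₀)

theorem norm_cutoff_le {M : ℝ} (hM : 0 ≤ M) (h : ∀ q, density χ ε k₀ m₀ q ≠ 0 → ‖f q‖ ≤ M)
    (q : ℝ × ℝ) : ‖cutoff χ ε k₀ m₀ f q‖ ≤ M := by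
  by_cases hq : density χ ε k₀ m₀ q = 0
  · rwa [cutoff_of_eq hq, norm_zero]
  · rw [cutoff_of_ne hq]; exact h q hq

end Cutoff

/-- The time phase of the packets. -/
def phaseT (γ : ℝ) (χ : ℝ → ℂ) (ε k₀ m₀ : ℝ) : ℝ × ℝ → ℂ :=
  cutoff χ ε k₀ m₀ fun q => -I * omegaPlus γ q.1 q.2

/-- The phase of the packets in the direction of the slope. -/
def phaseX (χ : ℝ → ℂ) (ε k₀ m₀ : ℝ) : ℝ × ℝ → ℂ := cutoff χ ε k₀ m₀ fun q => I * q.1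

theorem boundedPhases_cutoff {γ K N ε k₀ m₀ : ℝ} {χ : ℝ → ℂ} (hχ : Continuous χ) {f : ℝ × ℝ → ℂ}
    (hf : Measurable f) (hk : ∀ q : ℝ × ℝ, density χ ε k₀ m₀ q ≠ 0 → |q.1| ≤ K)
    (hfN : ∀ q, density χ ε k₀ m₀ q ≠ 0 → ‖f q‖ ≤ N) :
    BoundedPhases (phaseT γ χ ε k₀ m₀) (phaseX χ ε k₀ m₀) (cutoff χ ε k₀ m₀ f)
      (max 1 (max K N)) := by
  have h0 : 0 ≤ max 1 (max K N) := zero_le_one.trans (le_max_left _ _)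
  have hω := measurable_omegaPlus γ
  refine ⟨measurable_cutoff hχ (by fun_prop), measurable_cutoff hχ (by fun_prop),
    measurable_cutoff hχ hf, norm_cutoff_le h0 fun q _ => ?_, norm_cutoff_le h0 fun q hq => ?_,
    norm_cutoff_le h0 fun q hq => (hfN q hq).trans ((le_max_right _ _).trans (le_max_right _ _))⟩
  · rw [norm_mul, norm_neg, Complex.norm_I, one_mul, Complex.norm_real, Real.norm_eq_abs]
    exact (abs_omegaPlus_le_one γ q.1 q.2).trans (le_max_left _ _)
  · rw [norm_mul, Complex.norm_I, one_mul, Complex.norm_real, Real.norm_eq_abs]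
    exact (hk q hq).trans ((le_max_left _ _).trans (le_max_right _ _))

/-- The eigenvector of the incident waves for the branch `ω⁺`. -/
def incVec (γ : ℝ) (q : ℝ × ℝ) : Fin 4 → ℂ :=
  ![1, -(q.1 : ℂ) / q.2,
    I * (q.1 * Real.cos γ - q.2 * Real.sin γ) / (q.2 * omegaPlus γ q.1 q.2),
    1 / q.1 * (omegaPlus γ q.1 q.2
      + Real.sin γ * (q.1 * Real.cos γ - q.2 * Real.sin γ) / (q.2 * omegaPlus γ q.1 q.2))]

theorem measurable_incVec (γ : ℝ) (i : Fin 4) : Measurable fun q => incVec γ q i := by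
  have hω := measurable_omegaPlus γ
  fin_cases i <;> simp only [incVec, Fin.zero_eta, Fin.mk_one, Fin.reduceFinMk, Matrix.cons_val] <;>
    fun_prop

theorem norm_incVec_le {γ K z : ℝ} {q : ℝ × ℝ} (hK : 1 ≤ K)
    (h : NearData γ K z (omegaPlus γ q.1 q.2) q.1 q.2) :
    ‖incVec γ q 0‖ ≤ 2 * K ^ 3 ∧ ‖incVec γ q 1‖ ≤ 2 * K ^ 3 ∧ ‖incVec γ q 2‖ ≤ 2 * K ^ 3 ∧
      ‖incVec γ q 3‖ ≤ K * K * (1 + 2 * K ^ 3) := by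
  have hK0 : 0 < K := by linarith
  have hω := h.le_ω
  have hm := h.le_m
  have hk := h.k_le
  have hm' := h.m_le
  have hω' := h.ω_le
  have hkω := h.kω
  obtain ⟨k, m⟩ := q
  simp only [incVec, Matrix.cons_val] at *
  generalize omegaPlus γ k m = ω at *
  have hω0 : 0 < |ω| := lt_of_lt_of_le (by positivity) hω
  have hm0 : 0 < |m| := lt_of_lt_of_le (by positivity) hm
  have hk0 : K⁻¹ ≤ |k| := by
    calc K⁻¹ ≤ |k * ω| := hkω.trans (le_abs_self _)
      _ = |k| * |ω| := abs_mul _ _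
      _ ≤ |k| * 1 := by gcongr
      _ = |k| := mul_one _
  have hk0' : 0 < |k| := lt_of_lt_of_le (by positivity) hk0
  have hK3 : 1 ≤ K ^ 3 := one_le_pow₀ hK
  have hK2 : K ^ 2 ≤ K ^ 3 := pow_le_pow_right₀ hK (by norm_num)
  have hnum : |k * Real.cos γ - m * Real.sin γ| ≤ 2 * K := by
    refine (abs_sub _ _).trans ?_
    rw [abs_mul, abs_mul]
    have h1 : |k| * |Real.cos γ| ≤ K * 1 := by
      gcongr; exact Real.abs_cos_le_one γ
    have h2 : |m| * |Real.sin γ| ≤ K * 1 := by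
      gcongr; exact Real.abs_sin_le_one γ
    linarith
  have hdiv : |k * Real.cos γ - m * Real.sin γ| / (|m| * |ω|) ≤ 2 * K ^ 3 := by
    rw [div_le_iff₀ (by positivity)]
    calc _ ≤ 2 * K ^ 3 * (K⁻¹ * K⁻¹) := hnum.trans (le_of_eq (by field_simp))
      _ ≤ _ := by gcongr
  have hcast : (k * Real.cos γ - m * Real.sin γ : ℂ) = ((k * Real.cos γ - m * Real.sin γ : ℝ) : ℂ) := by
    push_cast; ring
  refine ⟨?_, ?_, ?_, ?_⟩
  · rw [norm_one]
    linarith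
  · simp only [norm_div, norm_neg, Complex.norm_real, Real.norm_eq_abs]
    rw [div_le_iff₀ hm0]
    calc |k| ≤ K ^ 2 * K⁻¹ := hk.trans (le_of_eq (by field_simp))
      _ ≤ 2 * K ^ 3 * |m| := by gcongr; linarith
  · rw [hcast, norm_div, norm_mul, norm_mul, Complex.norm_I, one_mul, Complex.norm_real,
      Complex.norm_real, Complex.norm_real, Real.norm_eq_abs, Real.norm_eq_abs, Real.norm_eq_abs]
    exact hdiv
  · rw [hcast, norm_mul, norm_div, norm_one, Complex.norm_real, Real.norm_eq_abs]
    have h1 : 1 / |k| ≤ K * K := by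
      rw [one_div]
      have : |k|⁻¹ ≤ K := (inv_le_comm₀ hK0 hk0').1 hk0
      exact this.trans (le_mul_of_one_le_right hK0.le hK)
    have h2 : ‖(ω + Real.sin γ * ((k * Real.cos γ - m * Real.sin γ : ℝ) : ℂ) / (m * ω) : ℂ)‖
        ≤ 1 + 2 * K ^ 3 := by
      refine (norm_add_le _ _).trans ?_
      rw [norm_div, norm_mul, norm_mul, Complex.norm_real, Complex.norm_real, Complex.norm_real,
        Complex.norm_real, Real.norm_eq_abs, Real.norm_eq_abs, Real.norm_eq_abs, Real.norm_eq_abs,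
        mul_div_assoc]
      have h3 : |Real.sin γ| * (|k * Real.cos γ - m * Real.sin γ| / (|m| * |ω|)) ≤ 1 * (2 * K ^ 3) := by
        gcongr; exact Real.abs_sin_le_one γ
      linarith
    gcongr

section Incident

variable {γ K z ε k₀ m₀ ν κ : ℝ} {χ : ℝ → ℂ}

/-- The density of the incident packet with its eigenvector. -/
def incDensity (γ : ℝ) (χ : ℝ → ℂ) (ε k₀ m₀ : ℝ) (i : Fin 4) (q : ℝ × ℝ) : ℂ :=
  density χ ε k₀ m₀ q * incVec γ q i

/-- The normal phase of the incident packet. -/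
def incPhase (χ : ℝ → ℂ) (ε k₀ m₀ : ℝ) : ℝ × ℝ → ℂ := cutoff χ ε k₀ m₀ fun q => I * q.2

theorem incident_eq_waveFields
    (hω : ∀ q, density χ ε k₀ m₀ q ≠ 0 → omega γ q = omegaPlus γ q.1 q.2) :
    incident γ χ ε k₀ m₀ = waveFields (incDensity γ χ ε k₀ m₀) (phaseT γ χ ε k₀ m₀)
      (phaseX χ ε k₀ m₀) (incPhase χ ε k₀ m₀) := by
  have key : ∀ (X : ℝ × ℝ → ℂ) (i : Fin 4), (∀ q, density χ ε k₀ m₀ q ≠ 0 → X q = incVec γ q i) →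
      packet γ (density χ ε k₀ m₀) X (fun q => -I * q.2)
        = superposition (incDensity γ χ ε k₀ m₀ i) (phaseT γ χ ε k₀ m₀)
          (phaseX χ ε k₀ m₀) (incPhase χ ε k₀ m₀) := by
    intro X i hX
    refine packet_eq_superposition (fun q hq => ?_) (fun q hq => ?_) (fun q hq => ?_)
      (fun q hq => ?_) (fun q hq => ?_)
    · rw [incDensity, hX q hq]
    · rw [incDensity, hq, zero_mul]
    · rw [phaseT, cutoff_of_ne hq, hω q hq]
    · rw [phaseX, cutoff_of_ne hq]
    · rw [incPhase, cutoff_of_ne hq]; ring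
  unfold incident waveFields
  rw [key (fun _ => 1) 0 fun q hq => rfl, key (fun q => -(q.1 : ℂ) / q.2) 1 fun q hq => rfl,
    key (incB γ) 2 fun q hq => by rw [incB, hω q hq]; rfl,
    key (incP γ) 3 fun q hq => by rw [incP, hω q hq]; rfl]

theorem incident_boundedPhases (hχ : Continuous χ)
    (hnd : ∀ q, density χ ε k₀ m₀ q ≠ 0 → NearData γ K z (omegaPlus γ q.1 q.2) q.1 q.2) :
    BoundedPhases (phaseT γ χ ε k₀ m₀) (phaseX χ ε k₀ m₀) (incPhase χ ε k₀ m₀)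
      (max 1 (max K K)) :=
  boundedPhases_cutoff hχ (by fun_prop) (fun q hq => (hnd q hq).k_le) fun q hq => by
    rw [norm_mul, Complex.norm_I, one_mul, Complex.norm_real, Real.norm_eq_abs]
    exact (hnd q hq).m_le

theorem measurable_incDensity (hχ : Continuous χ) (i : Fin 4) :
    Measurable (incDensity γ χ ε k₀ m₀ i) :=
  (continuous_density hχ ε k₀ m₀).measurable.mul (measurable_incVec γ i)

theorem norm_incDensity_le (hK : 1 ≤ K)
    (hnd : ∀ q, density χ ε k₀ m₀ q ≠ 0 → NearData γ K z (omegaPlus γ q.1 q.2) q.1 q.2)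
    (i : Fin 4) (hi : i ≠ 3) (q : ℝ × ℝ) :
    ‖incDensity γ χ ε k₀ m₀ i q‖ ≤ 2 * K ^ 3 * ‖density χ ε k₀ m₀ q‖ := by
  rw [incDensity, norm_mul, mul_comm]
  by_cases hq : density χ ε k₀ m₀ q = 0
  · rw [hq, norm_zero, mul_zero, mul_zero]
  · obtain ⟨h0, h1, h2, -⟩ := norm_incVec_le hK (hnd q hq)
    refine mul_le_mul_of_nonneg_right ?_ (norm_nonneg _)
    fin_cases i
    exacts [h0, h1, h2, absurd rfl hi]

theorem integrable_incDensity (hχ : Continuous χ) (hχc : HasCompactSupport χ) (hε : 0 < ε)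
    (hK : 1 ≤ K)
    (hnd : ∀ q, density χ ε k₀ m₀ q ≠ 0 → NearData γ K z (omegaPlus γ q.1 q.2) q.1 q.2)
    (i : Fin 4) : Integrable (incDensity γ χ ε k₀ m₀ i) := by
  have hK0 : 0 < K := by linarith
  obtain ⟨C, -, H⟩ := density_domination hχ hχc
  refine (H ε k₀ m₀ (max (2 * K ^ 3) (K * K * (1 + 2 * K ^ 3))) _ hε (measurable_incDensity hχ i)
    (fun q => ?_) (by positivity)).1
  rw [incDensity, norm_mul, mul_comm]
  by_cases hq : density χ ε k₀ m₀ q = 0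
  · rw [hq, norm_zero, mul_zero, mul_zero]
  · obtain ⟨h0, h1, h2, h3⟩ := norm_incVec_le hK (hnd q hq)
    refine mul_le_mul_of_nonneg_right ?_ (norm_nonneg _)
    fin_cases i
    exacts [h0.trans (le_max_left _ _), h1.trans (le_max_left _ _), h2.trans (le_max_left _ _),
      h3.trans (le_max_right _ _)]

/-- The density of the dissipation of a component of the incident packet. -/
def incSource (γ : ℝ) (χ : ℝ → ℂ) (ε k₀ m₀ c : ℝ) (i : Fin 4) (q : ℝ × ℝ) : ℂ :=
  -(c * (incDensity γ χ ε k₀ m₀ i q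
    * (phaseX χ ε k₀ m₀ q ^ 2 + incPhase χ ε k₀ m₀ q ^ 2)))

theorem incident_solvesWithSource (hχ : Continuous χ) (hχc : HasCompactSupport χ) (hε : 0 < ε)
    (hK : 1 ≤ K)
    (hnd : ∀ q, density χ ε k₀ m₀ q ≠ 0 → NearData γ K z (omegaPlus γ q.1 q.2) q.1 q.2)
    (hω : ∀ q, density χ ε k₀ m₀ q ≠ 0 → omega γ q = omegaPlus γ q.1 q.2) :
    SolvesWithSource γ ν κ (incident γ χ ε k₀ m₀)
      (superposition (incSource γ χ ε k₀ m₀ ν 0) (phaseT γ χ ε k₀ m₀) (phaseX χ ε k₀ m₀)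
        (incPhase χ ε k₀ m₀))
      (superposition (incSource γ χ ε k₀ m₀ ν 1) (phaseT γ χ ε k₀ m₀) (phaseX χ ε k₀ m₀)
        (incPhase χ ε k₀ m₀))
      (superposition (incSource γ χ ε k₀ m₀ κ 2) (phaseT γ χ ε k₀ m₀) (phaseX χ ε k₀ m₀)
        (incPhase χ ε k₀ m₀)) := by
  have hK0 : 0 < K := by linarith
  rw [incident_eq_waveFields hω]
  have hne : ∀ q, density χ ε k₀ m₀ q ≠ 0 → (q.1 : ℂ) ≠ 0 ∧ (q.2 : ℂ) ≠ 0 ∧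
      (omegaPlus γ q.1 q.2 : ℂ) ≠ 0 ∧ (omegaPlus γ q.1 q.2 : ℂ) ^ 2 * (q.1 ^ 2 + q.2 ^ 2)
        = (q.1 * Real.cos γ - q.2 * Real.sin γ) ^ 2 := by
    intro q hq
    have h := hnd q hq
    have hk : q.1 ≠ 0 := by
      intro h0
      have := h.kω
      rw [h0, zero_mul] at this
      exact absurd this (not_le.2 (by positivity))
    have hm : q.2 ≠ 0 := abs_pos.1 (lt_of_lt_of_le (by positivity) h.le_m)
    have hw : omegaPlus γ q.1 q.2 ≠ 0 := abs_pos.1 (lt_of_lt_of_le (by positivity) h.le_ω)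
    refine ⟨by exact_mod_cast hk, by exact_mod_cast hm, by exact_mod_cast hw, ?_⟩
    have := sq_omegaPlus_mul (γ := γ) (m := q.2) hk
    rw [← Complex.ofReal_mul, ← Complex.ofReal_mul, ← Complex.ofReal_sub, ← Complex.ofReal_pow,
      ← Complex.ofReal_pow, ← Complex.ofReal_pow, ← Complex.ofReal_add, ← Complex.ofReal_mul,
      ← Complex.ofReal_pow, this]
  refine solvesWithSource_waveFields (incident_boundedPhases hχ hnd)
    (integrable_incDensity hχ hχc hε hK hnd) (fun q => ?_) (fun q => ?_) (fun q => ?_) fun q => ?_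
  all_goals
    by_cases hq : density χ ε k₀ m₀ q = 0
    · simp [incSource, incDensity, hq]
    obtain ⟨hk, hm, hw, hdisp⟩ := hne q hq
    simp only [incSource, incDensity, incVec, Matrix.cons_val, phaseT, phaseX, incPhase,
      cutoff_of_ne hq]
    generalize (omegaPlus γ q.1 q.2 : ℂ) = w at *
    generalize density χ ε k₀ m₀ q = d at *
    generalize (Real.cos γ : ℂ) = c at *
    generalize (Real.sin γ : ℂ) = s at *
    generalize (q.1 : ℂ) = k at *
    generalize (q.2 : ℂ) = m at *
  · field_simp
    ring
  · field_simp
    linear_combination hdisp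
  · field_simp
    linear_combination -w * (k * c - m * s) * Complex.I_sq
  · field_simp
    ring

end Incident

theorem superposition_incSource_eq {γ ε k₀ m₀ c : ℝ} {χ : ℝ → ℂ} (i : Fin 4) (t x y : ℝ) :
    superposition (incSource γ χ ε k₀ m₀ c i) (phaseT γ χ ε k₀ m₀) (phaseX χ ε k₀ m₀)
      (incPhase χ ε k₀ m₀) t x y = ∫ q : ℝ × ℝ, incSource γ χ ε k₀ m₀ c i q
        * exp (phaseT γ χ ε k₀ m₀ q * t) * exp (I * q.1 * x + I * q.2 * y) := by
  unfold superposition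
  congr 1
  funext q
  by_cases hq : density χ ε k₀ m₀ q = 0
  · simp [incSource, incDensity, hq]
  · rw [phaseX, incPhase, cutoff_of_ne hq, cutoff_of_ne hq, add_assoc, Complex.exp_add]
    ring

/-- The dissipation of the incident packet is bounded in `L²`, uniformly in `ε`. -/
theorem normL2_incSource_le {χ : ℝ → ℂ} (hχ : Continuous χ) (hχc : HasCompactSupport χ) {K : ℝ}
    (hK : 1 ≤ K) :
    ∃ C > 0, ∀ (γ ε k₀ m₀ z c t : ℝ) (i : Fin 4), 0 < ε → 0 ≤ c → i ≠ 3 →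
      (∀ q, density χ ε k₀ m₀ q ≠ 0 → NearData γ K z (omegaPlus γ q.1 q.2) q.1 q.2) →
      normL2 (superposition (incSource γ χ ε k₀ m₀ c i) (phaseT γ χ ε k₀ m₀) (phaseX χ ε k₀ m₀)
        (incPhase χ ε k₀ m₀)) t ≤ ENNReal.ofReal (C * c) := by
  have hK0 : 0 < K := by linarith
  obtain ⟨C, hC, H⟩ := density_domination hχ hχc
  refine ⟨2 * Real.pi * (C * (4 * K ^ 5)), by positivity, ?_⟩
  intro γ ε k₀ m₀ z c t i hε hc hi hnd
  set G : ℝ × ℝ → ℂ := fun q => incSource γ χ ε k₀ m₀ c i q * exp (phaseT γ χ ε k₀ m₀ q * t)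
    with hG
  have hph := incident_boundedPhases hχ hnd
  have m1 := hph.meas₁
  have m2 := hph.meas₂
  have m3 := hph.meas₃
  have m4 := measurable_incDensity (γ := γ) (ε := ε) (k₀ := k₀) (m₀ := m₀) hχ i
  have hGm : Measurable G := by
    unfold G incSource
    fun_prop
  have hGb : ∀ q, ‖G q‖ ≤ (4 * K ^ 5 * c) * ‖density χ ε k₀ m₀ q‖ := by
    intro q
    by_cases hq : density χ ε k₀ m₀ q = 0
    · simp [hG, incSource, incDensity, hq]
    have h := hnd q hq
    have hexp : ‖exp (phaseT γ χ ε k₀ m₀ q * t)‖ = 1 := by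
      rw [phaseT, cutoff_of_ne hq, Complex.norm_exp]
      simp
    have hsym : ‖phaseX χ ε k₀ m₀ q ^ 2 + incPhase χ ε k₀ m₀ q ^ 2‖ ≤ 2 * K ^ 2 := by
      rw [phaseX, incPhase, cutoff_of_ne hq, cutoff_of_ne hq]
      refine (norm_add_le _ _).trans ?_
      rw [norm_pow, norm_pow, norm_mul, norm_mul, Complex.norm_I, one_mul, one_mul,
        Complex.norm_real, Complex.norm_real, Real.norm_eq_abs, Real.norm_eq_abs]
      have h1 : |q.1| ^ 2 ≤ K ^ 2 := by gcongr; exact h.k_le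
      have h2 : |q.2| ^ 2 ≤ K ^ 2 := by gcongr; exact h.m_le
      linarith
    have hd := norm_incDensity_le hK hnd i hi q
    rw [hG]
    simp only
    rw [norm_mul, hexp, mul_one, incSource, norm_neg, norm_mul, norm_mul, Complex.norm_real,
      Real.norm_eq_abs, abs_of_nonneg hc]
    calc _ ≤ c * (2 * K ^ 3 * ‖density χ ε k₀ m₀ q‖ * (2 * K ^ 2)) := by gcongr
      _ = _ := by ring
  obtain ⟨hi1, hi2, hi3⟩ := H ε k₀ m₀ (4 * K ^ 5 * c) G hε hGm hGb (by positivity)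
  have hfun : (fun p : ℝ × ℝ => superposition (incSource γ χ ε k₀ m₀ c i) (phaseT γ χ ε k₀ m₀)
      (phaseX χ ε k₀ m₀) (incPhase χ ε k₀ m₀) t p.1 p.2)
      = fun p : ℝ × ℝ => ∫ q, G q * exp (I * q.1 * p.1 + I * q.2 * p.2) := by
    funext p
    exact superposition_incSource_eq i t p.1 p.2
  unfold normL2
  rw [hfun]
  refine (eLpNorm_mono_measure _ Measure.restrict_le_self).trans ?_
  rw [eLpNorm_superposition hi1 hi2]
  calc _ ≤ ENNReal.ofReal (2 * Real.pi) * ENNReal.ofReal (C * (4 * K ^ 5 * c)) := by gcongr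
    _ = ENNReal.ofReal (2 * Real.pi * (C * (4 * K ^ 5)) * c) := by
      rw [← ENNReal.ofReal_mul (by positivity)]
      congr 1; ring

theorem normL2_vector_le {f g h : ℝ → ℝ → ℝ → ℂ} {t : ℝ}
    (hf : Continuous fun z : ℝ × ℝ => f t z.1 z.2) (hg : Continuous fun z : ℝ × ℝ => g t z.1 z.2)
    (hh : Continuous fun z : ℝ × ℝ => h t z.1 z.2) :
    normL2 (fun t x y => !₂[f t x y, g t x y, h t x y]) t ≤ normL2 f t + normL2 g t + normL2 h t := by
  unfold normL2
  set μ := (volume : Measure (ℝ × ℝ)).restrict halfPlane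
  have h1 : eLpNorm (fun z : ℝ × ℝ => !₂[f t z.1 z.2, g t z.1 z.2, h t z.1 z.2]) 2 μ
      ≤ eLpNorm ((fun z : ℝ × ℝ => ‖f t z.1 z.2‖) + (fun z : ℝ × ℝ => ‖g t z.1 z.2‖)
        + fun z : ℝ × ℝ => ‖h t z.1 z.2‖) 2 μ := by
    refine eLpNorm_mono_real fun z => ?_
    rw [EuclideanSpace.norm_eq, Real.sqrt_le_iff]
    simp only [Fin.sum_univ_three, Pi.add_apply]
    have a1 := norm_nonneg (f t z.1 z.2)
    have a2 := norm_nonneg (g t z.1 z.2)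
    have a3 := norm_nonneg (h t z.1 z.2)
    refine ⟨by positivity, ?_⟩
    simp only [Matrix.cons_val]
    nlinarith [mul_nonneg a1 a2, mul_nonneg a1 a3, mul_nonneg a2 a3]
  refine h1.trans ((eLpNorm_add_le (hf.norm.add hg.norm).aestronglyMeasurable
    hh.norm.aestronglyMeasurable (by norm_num)).trans ?_)
  refine (add_le_add_left (eLpNorm_add_le hf.norm.aestronglyMeasurable
    hg.norm.aestronglyMeasurable (by norm_num)) _).trans ?_
  rw [eLpNorm_norm, eLpNorm_norm, eLpNorm_norm]

/-- Superpositions whose densities add up to zero cancel at `y = 0`, whatever the normal phases. -/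
theorem superposition_boundary_eq {α β μ₁ μ₂ μ₃ μ₀ f₁ f₂ f₃ f₀ : ℝ × ℝ → ℂ} {M : ℝ}
    (h : BoundedPhases α β μ₀ M) (h₁ : Integrable f₁) (h₂ : Integrable f₂) (h₃ : Integrable f₃)
    (h₀ : Integrable f₀) (hsum : ∀ q, f₁ q + f₂ q + f₃ q + f₀ q = 0) (t x : ℝ) :
    superposition f₁ α β μ₁ t x 0 + superposition f₂ α β μ₂ t x 0 + superposition f₃ α β μ₃ t x 0
      = -superposition f₀ α β μ₀ t x 0 := by
  have e : ∀ f μ : ℝ × ℝ → ℂ, superposition f α β μ t x 0 = superposition f α β μ₀ t x 0 := by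
    intro f μ
    simp [superposition]
  have hl := h.superposition_linear h₁ h₂ h₃ h₀ 1 1 1 1 t x 0
  simp only [one_mul, hsum] at hl
  rw [e f₁ μ₁, e f₂ μ₂, e f₃ μ₃]
  have h0 : superposition (fun _ => 0) α β μ₀ t x 0 = 0 := by simp [superposition]
  rw [h0] at hl
  linear_combination -hl

section Layer

variable {γ K z N ρ ν κ ε k₀ m₀ : ℝ} {χ : ℝ → ℂ} {l a : ℝ × ℝ → ℂ}

/-- The density of a boundary layer packet with its eigenvector, for the branch `ω⁺`. -/
def layerDensity (γ ν κ : ℝ) (χ : ℝ → ℂ) (ε k₀ m₀ : ℝ) (l a : ℝ × ℝ → ℂ) (i : Fin 4)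
    (q : ℝ × ℝ) : ℂ :=
  density χ ε k₀ m₀ q * a q * layerVec γ ν κ (omegaPlus γ q.1 q.2) q.1 (l q) i

/-- The normal phase of a boundary layer packet. -/
def layerPhase (χ : ℝ → ℂ) (ε k₀ m₀ : ℝ) (l : ℝ × ℝ → ℂ) : ℝ × ℝ → ℂ :=
  cutoff χ ε k₀ m₀ fun q => -l q

theorem layerDensity_of_eq {q : ℝ × ℝ} (hq : density χ ε k₀ m₀ q = 0) (i : Fin 4) :
    layerDensity γ ν κ χ ε k₀ m₀ l a i q = 0 := by
  rw [layerDensity, hq, zero_mul, zero_mul]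

theorem layer_packet_eq
    (hω : ∀ q, density χ ε k₀ m₀ q ≠ 0 → omega γ q = omegaPlus γ q.1 q.2) (i : Fin 4) :
    packet γ (fun q => density χ ε k₀ m₀ q * a q)
      (fun q => layerVec γ ν κ (omega γ q) q.1 (l q) i) l
      = superposition (layerDensity γ ν κ χ ε k₀ m₀ l a i) (phaseT γ χ ε k₀ m₀)
        (phaseX χ ε k₀ m₀) (layerPhase χ ε k₀ m₀ l) := by
  refine packet_eq_superposition (fun q hq => ?_) (fun q hq => ?_) (fun q hq => ?_)
    (fun q hq => ?_) (fun q hq => ?_)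
  · rw [layerDensity, hω q (left_ne_zero_of_mul hq)]
  · rw [layerDensity, hq, zero_mul]
  · rw [phaseT, cutoff_of_ne (left_ne_zero_of_mul hq), hω q (left_ne_zero_of_mul hq)]
  · rw [phaseX, cutoff_of_ne (left_ne_zero_of_mul hq)]
  · rw [layerPhase, cutoff_of_ne (left_ne_zero_of_mul hq)]

theorem layer_eq_waveFields
    (hω : ∀ q, density χ ε k₀ m₀ q ≠ 0 → omega γ q = omegaPlus γ q.1 q.2) :
    layer γ ν κ χ ε k₀ m₀ l a = waveFields (layerDensity γ ν κ χ ε k₀ m₀ l a)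
      (phaseT γ χ ε k₀ m₀) (phaseX χ ε k₀ m₀) (layerPhase χ ε k₀ m₀ l) := by
  unfold layer waveFields
  rw [layer_packet_eq hω, layer_packet_eq hω, layer_packet_eq hω, layer_packet_eq hω]

theorem measurable_layerVec (hl : Measurable l) (i : Fin 4) :
    Measurable fun q : ℝ × ℝ => layerVec γ ν κ (omegaPlus γ q.1 q.2) q.1 (l q) i := by
  have hω := measurable_omegaPlus γ
  fin_cases i <;> simp only [layerVec, layerW, layerB, layerP, Fin.zero_eta, Fin.mk_one,
    Fin.reduceFinMk, Matrix.cons_val] <;> fun_prop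

theorem layer_boundedPhases (hχ : Continuous χ) (hl : Measurable l)
    (hnd : ∀ q, density χ ε k₀ m₀ q ≠ 0 → NearData γ K z (omegaPlus γ q.1 q.2) q.1 q.2)
    (hlN : ∀ q, density χ ε k₀ m₀ q ≠ 0 → ‖l q‖ ≤ N) :
    BoundedPhases (phaseT γ χ ε k₀ m₀) (phaseX χ ε k₀ m₀) (layerPhase χ ε k₀ m₀ l)
      (max 1 (max K N)) :=
  boundedPhases_cutoff hχ hl.neg (fun q hq => (hnd q hq).k_le) fun q hq => by
    rw [norm_neg]; exact hlN q hq

theorem NearData.le_k {ω k m : ℝ} (h : NearData γ K z ω k m) : K⁻¹ ≤ |k| := by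
  calc K⁻¹ ≤ |k * ω| := h.kω.trans (le_abs_self _)
    _ = |k| * |ω| := abs_mul _ _
    _ ≤ |k| * 1 := mul_le_mul_of_nonneg_left h.ω_le (abs_nonneg _)
    _ = |k| := mul_one _

theorem integrable_layerDensity (hχ : Continuous χ) (hχc : HasCompactSupport χ) (hε : 0 < ε)
    (hs : 0 < Real.sin γ) (hK : 0 < K) (hl : Measurable l) (ha : Measurable a) (hρ : 0 < ρ)
    {A : ℝ}
    (hnd : ∀ q, density χ ε k₀ m₀ q ≠ 0 → NearData γ K z (omegaPlus γ q.1 q.2) q.1 q.2)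
    (hlN : ∀ q, density χ ε k₀ m₀ q ≠ 0 → ‖l q‖ ≤ N)
    (hlρ : ∀ q, density χ ε k₀ m₀ q ≠ 0 → ρ ≤ (l q).re)
    (hla : ∀ q, density χ ε k₀ m₀ q ≠ 0 → ‖a q‖ ≤ A)
    (hroot : ∀ q, density χ ε k₀ m₀ q ≠ 0 →
      charPoly γ ν κ (omegaPlus γ q.1 q.2) q.1 (l q) = 0) (i : Fin 4) :
    Integrable (layerDensity γ ν κ χ ε k₀ m₀ l a i) := by
  obtain ⟨C, -, H⟩ := density_domination hχ hχc
  obtain ⟨D, hD⟩ := norm_layerVec_le (ν := ν) (κ := κ) (N := N) hs hK hρ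
  refine (H ε k₀ m₀ (|A| * |D|) _ hε ?_ (fun q => ?_) (by positivity)).1
  · exact ((continuous_density hχ ε k₀ m₀).measurable.mul ha).mul (measurable_layerVec hl i)
  · by_cases hq : density χ ε k₀ m₀ q = 0
    · rw [layerDensity_of_eq hq, norm_zero]; positivity
    have h := hnd q hq
    have h1 := hD _ _ (l q) h.ω_le h.le_k h.k_le (hlρ q hq) (hlN q hq) (hroot q hq) i
    have h2 := hla q hq
    rw [layerDensity, norm_mul, norm_mul]
    calc _ ≤ ‖density χ ε k₀ m₀ q‖ * |A| * |D| := by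
          gcongr
          · exact h2.trans (le_abs_self A)
          · exact h1.trans (le_abs_self D)
      _ = _ := by ring

theorem layer_solves (hs : 0 < Real.sin γ) (hK : 0 < K)
    {M : ℝ} (hb : BoundedPhases (phaseT γ χ ε k₀ m₀) (phaseX χ ε k₀ m₀)
      (layerPhase χ ε k₀ m₀ l) M)
    (hi : ∀ i, Integrable (layerDensity γ ν κ χ ε k₀ m₀ l a i))
    (hnd : ∀ q, density χ ε k₀ m₀ q ≠ 0 → NearData γ K z (omegaPlus γ q.1 q.2) q.1 q.2)
    (hω : ∀ q, density χ ε k₀ m₀ q ≠ 0 → omega γ q = omegaPlus γ q.1 q.2)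
    (hre : ∀ q, density χ ε k₀ m₀ q ≠ 0 → 0 < (l q).re)
    (hroot : ∀ q, density χ ε k₀ m₀ q ≠ 0 →
      charPoly γ ν κ (omegaPlus γ q.1 q.2) q.1 (l q) = 0) :
    Solves γ ν κ (layer γ ν κ χ ε k₀ m₀ l a) := by
  have hzero : superposition (fun _ => 0) (phaseT γ χ ε k₀ m₀) (phaseX χ ε k₀ m₀)
      (layerPhase χ ε k₀ m₀ l) = 0 := by
    funext t x y; simp [superposition]
  unfold Solves
  rw [layer_eq_waveFields hω, ← hzero]
  have hker : ∀ q, density χ ε k₀ m₀ q ≠ 0 → ∀ i,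
      (symbolMatrix γ ν κ (omegaPlus γ q.1 q.2) q.1 (l q)).mulVec
        (layerVec γ ν κ (omegaPlus γ q.1 q.2) q.1 (l q)) i = 0 := by
    intro q hq i
    have hk : q.1 ≠ 0 := abs_pos.1 (lt_of_lt_of_le (by positivity) (hnd q hq).le_k)
    rw [symbolMatrix_mulVec_layerVec hs hk (hre q hq) (hroot q hq)]
    rfl
  refine solvesWithSource_waveFields hb hi (fun q => ?_) (fun q => ?_) (fun q => ?_) fun q => ?_
  all_goals
    by_cases hq : density χ ε k₀ m₀ q = 0
    · simp [layerDensity_of_eq hq]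
    have h0 := hker q hq 0
    have h1 := hker q hq 1
    have h2 := hker q hq 2
    have h3 := hker q hq 3
    simp only [symbolMatrix, Matrix.mulVec, dotProduct, Fin.sum_univ_four, Matrix.of_apply,
      Matrix.cons_val] at h0 h1 h2 h3
    simp only [layerDensity, phaseT, phaseX, layerPhase, cutoff_of_ne hq]
    generalize layerVec γ ν κ (omegaPlus γ q.1 q.2) q.1 (l q) = X at *
    generalize density χ ε k₀ m₀ q * a q = d at *
  · linear_combination d * h0 - d * X 0 * ν * q.1 ^ 2 * Complex.I_sq
  · linear_combination d * h1 - d * X 1 * ν * q.1 ^ 2 * Complex.I_sq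
  · linear_combination d * h2 - d * X 2 * κ * q.1 ^ 2 * Complex.I_sq
  · linear_combination d * h3

theorem isLayer_of_bounds (hs : 0 < Real.sin γ) (hK : 0 < K)
    {M C r s α : ℝ} (hb : BoundedPhases (phaseT γ χ ε k₀ m₀) (phaseX χ ε k₀ m₀)
      (layerPhase χ ε k₀ m₀ l) M)
    (hi : ∀ i, Integrable (layerDensity γ ν κ χ ε k₀ m₀ l a i))
    (hnd : ∀ q, density χ ε k₀ m₀ q ≠ 0 → NearData γ K z (omegaPlus γ q.1 q.2) q.1 q.2)
    (hω : ∀ q, density χ ε k₀ m₀ q ≠ 0 → omega γ q = omegaPlus γ q.1 q.2)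
    (hre : ∀ q, density χ ε k₀ m₀ q ≠ 0 → 0 < (l q).re)
    (hroot : ∀ q, density χ ε k₀ m₀ q ≠ 0 →
      charPoly γ ν κ (omegaPlus γ q.1 q.2) q.1 (l q) = 0)
    (hdec : ∀ q, density χ ε k₀ m₀ q ≠ 0 → C⁻¹ * ε ^ r ≤ (l q).re ∧ (l q).re ≤ C * ε ^ r)
    (hsize : ∀ q, density χ ε k₀ m₀ q ≠ 0 → C⁻¹ * ε ^ s ≤ ‖l q‖ ∧ ‖l q‖ ≤ C * ε ^ s)
    (hamp : ∀ q, density χ ε k₀ m₀ q ≠ 0 → ‖a q‖ ≤ C * ε ^ α) :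
    IsLayer γ ν κ χ ε k₀ m₀ l a C r s α := by
  refine ⟨fun i t x y _ => ?_, hre, fun q hq => by rw [hω q hq]; exact hroot q hq, fun q hq => ?_,
    hdec, hsize, hamp⟩
  · refine (hb.integrable (hi i) t x y).congr (Filter.Eventually.of_forall fun q => ?_)
    by_cases hq : density χ ε k₀ m₀ q = 0
    · simp [layerDensity_of_eq hq, hq]
    · simp only [layerDensity, phaseT, phaseX, layerPhase, cutoff_of_ne hq, hω q hq]
      congr 2
      ring
  · have hk : q.1 ≠ 0 := abs_pos.1 (lt_of_lt_of_le (by positivity) (hnd q hq).le_k)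
    rw [hω q hq]
    exact symbolMatrix_mulVec_layerVec hs hk (hre q hq) (hroot q hq)

end Layer

theorem measurable_det {α : Type*} [MeasurableSpace α] {n : ℕ}
    {M : α → Matrix (Fin n) (Fin n) ℂ} (h : ∀ i j, Measurable fun q => M q i j) :
    Measurable fun q => (M q).det := by
  simp only [Matrix.det_apply]
  exact Finset.measurable_sum _ fun σ _ =>
    (Finset.measurable_prod _ fun i _ => h (σ i) i).const_smul (Equiv.Perm.sign σ)

/-- Measurable solution of linear systems by Cramer's rule. -/
theorem exists_measurable_solution {α : Type*} [MeasurableSpace α] {n : ℕ}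
    {M : α → Matrix (Fin n) (Fin n) ℂ} {b : α → Fin n → ℂ}
    (hM : ∀ i j, Measurable fun q => M q i j) (hb : ∀ i, Measurable fun q => b q i) :
    ∃ a : α → Fin n → ℂ, (∀ i, Measurable fun q => a q i) ∧
      ∀ q, (M q).det ≠ 0 → (M q).mulVec (a q) = b q := by
  refine ⟨fun q => (M q).det⁻¹ • (M q).cramer (b q), fun i => ?_, fun q hq => ?_⟩
  · simp only [Pi.smul_apply, smul_eq_mul, Matrix.cramer_apply]
    refine (measurable_det hM).inv.mul (measurable_det fun r s => ?_)
    simp only [Matrix.updateCol_apply]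
    split_ifs
    exacts [hb r, hM r s]
  · rw [Matrix.mulVec_smul, Matrix.mulVec_cramer, smul_smul, inv_mul_cancel₀ hq, one_smul]

/-- Measurable choice of the roots and of the amplitudes on the support of the density. -/
theorem RootsSelectable.exists_layers {γ ν κ C K z ε k₀ m₀ : ℝ} {P : ℝ → Prop}
    {r s α : Fin 3 → ℝ} {χ : ℝ → ℂ} (h : RootsSelectable γ ν κ C K z P r s α)
    (hnd : ∀ q, density χ ε k₀ m₀ q ≠ 0 → NearData γ K z (omegaPlus γ q.1 q.2) q.1 q.2)
    (hP : ∀ q, density χ ε k₀ m₀ q ≠ 0 → P (omegaPlus γ q.1 q.2)) :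
    ∃ (N : ℝ) (l a : Fin 3 → ℝ × ℝ → ℂ), (∀ j, Measurable (l j)) ∧ (∀ j, Measurable (a j)) ∧
      ∀ q, density χ ε k₀ m₀ q ≠ 0 → (∀ j, ‖l j q‖ ≤ N) ∧
        LayerBounds γ ν κ C r s α (omegaPlus γ q.1 q.2) q.1 q.2 (fun j => l j q) ∧
        (amplitudeMatrix γ κ (omegaPlus γ q.1 q.2) q.1 (fun j => l j q)).mulVec (fun j => a j q)
          = ![-1, -(-(q.1 : ℂ) / q.2), -(I * q.2 * incVec γ q 2)] := by
  obtain ⟨F, hF, N, H⟩ := h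
  have hω := measurable_omegaPlus γ
  have hsel : ∀ j, ∃ g : ℝ × ℝ → ℂ, Measurable g ∧
      ∀ q : ℝ × ℝ, (∃ w ∈ Metric.closedBall (0 : ℂ) N, F j (omegaPlus γ q.1 q.2, q.1, w) ≤ 0) →
        g q ∈ Metric.closedBall (0 : ℂ) N ∧ F j (omegaPlus γ q.1 q.2, q.1, g q) ≤ 0 := by
    intro j
    refine exists_measurable_selection (F := fun (q : ℝ × ℝ) w => F j (omegaPlus γ q.1 q.2, q.1, w))
      (isCompact_closedBall 0 N) (fun w => (hF j).measurable.comp (by fun_prop))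
      fun q => (hF j).comp (by fun_prop)
  choose l hl hlsel using hsel
  have hWm : ∀ j, Measurable fun q : ℝ × ℝ => layerW q.1 (l j q) := fun j => by
    have := hl j
    unfold layerW; fun_prop
  have hBm : ∀ j, Measurable fun q : ℝ × ℝ => layerB γ κ (omegaPlus γ q.1 q.2) q.1 (l j q) :=
    fun j => by
      have := hl j
      unfold layerB; fun_prop
  obtain ⟨a, ha, hsol⟩ := exists_measurable_solution
    (M := fun q : ℝ × ℝ => amplitudeMatrix γ κ (omegaPlus γ q.1 q.2) q.1 (fun j => l j q))
    (b := fun q : ℝ × ℝ => ![-1, -(-(q.1 : ℂ) / q.2), -(I * q.2 * incVec γ q 2)])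
    (fun i j => by
      have h1 := hl j
      have h2 := hWm j
      have h3 := (hl j).neg.mul (hBm j)
      fin_cases i
      · fin_cases j <;> exact measurable_const
      · fin_cases j <;> exact h2
      · fin_cases j <;> exact h3)
    (fun i => by
      have h1 := measurable_incVec γ 2
      fin_cases i <;> simp only [Fin.zero_eta, Fin.mk_one, Fin.reduceFinMk, Matrix.cons_val] <;>
        fun_prop)
  refine ⟨N, l, fun j q => a q j, hl, ha, fun q hq => ?_⟩
  obtain ⟨hex, hall⟩ := H _ _ _ (hnd q hq) (hP q hq)
  have hl' : ∀ j, l j q ∈ Metric.closedBall (0 : ℂ) N ∧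
      F j (omegaPlus γ q.1 q.2, q.1, l j q) ≤ 0 := fun j => hlsel j q (by
    obtain ⟨w, hw, hle⟩ := hex j
    exact ⟨w, mem_closedBall_zero_iff.2 hw, hle⟩)
  have hb := hall (fun j => l j q) fun j => (hl' j).2
  exact ⟨fun j => mem_closedBall_zero_iff.1 (hl' j).1, hb, hsol q hb.det_ne⟩

theorem continuous_superposition {F α β μ : ℝ × ℝ → ℂ} {M : ℝ} (h : BoundedPhases α β μ M)
    (hF : Integrable F) (t : ℝ) :
    Continuous fun z : ℝ × ℝ => superposition F α β μ t z.1 z.2 :=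
  (h.contDiff hF 0).continuous.comp (f := fun z : ℝ × ℝ => ((t, z.1, z.2) : ℝ × ℝ × ℝ))
    (by fun_prop)

theorem Regime.visc_pos (R : Regime) {ν₀ ε β : ℝ} (hν₀ : 0 < ν₀) (hε : 0 < ε) :
    0 < R.visc ν₀ ε β := by
  have := Real.rpow_pos_of_pos hε β
  cases R <;> simp only [Regime.visc] <;> positivity

theorem Regime.diff_pos (R : Regime) {κ₀ ε β : ℝ} (hκ₀ : 0 < κ₀) (hε : 0 < ε) :
    0 < R.diff κ₀ ε β := by
  have := Real.rpow_pos_of_pos hε β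
  cases R <;> simp only [Regime.diff] <;> positivity

theorem Regime.visc_add_diff_le (R : Regime) {ν₀ κ₀ ε β : ℝ} (hν₀ : 0 < ν₀) (hκ₀ : 0 < κ₀)
    (hε : 0 < ε) (hε1 : ε ≤ 1) (hβ : R.Admissible β) :
    R.visc ν₀ ε β + R.diff κ₀ ε β ≤ (ν₀ + κ₀) * ε ^ R.remainderExp β := by
  have h6 : ε ^ 6 = ε ^ (6 : ℝ) := by norm_cast
  have hle : ∀ {x y : ℝ}, x ≤ y → ε ^ y ≤ ε ^ x := fun h =>
    Real.rpow_le_rpow_of_exponent_ge hε hε1 h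
  have key : ∀ x y e : ℝ, e ≤ x → e ≤ y → ν₀ * ε ^ x + κ₀ * ε ^ y ≤ (ν₀ + κ₀) * ε ^ e := by
    intro x y e hx hy
    have h1 := mul_le_mul_of_nonneg_left (hle hx) hν₀.le
    have h2 := mul_le_mul_of_nonneg_left (hle hy) hκ₀.le
    linarith
  cases R <;> simp only [Regime.visc, Regime.diff, Regime.remainderExp, Regime.Admissible] at hβ ⊢
  · rw [h6]; exact key _ _ _ hβ.2.le le_rfl
  · rw [h6]; exact key _ _ _ le_rfl hβ.le
  · rw [h6]; exact key _ _ _ le_rfl hβ.2.le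
  · rw [h6]; exact key _ _ _ hβ.le le_rfl
  · exact key _ _ _ le_rfl le_rfl

/-- The boundary layers cancel the boundary values of the incident packet. -/
theorem boundary_values {γ ν κ ε k₀ m₀ M N : ℝ} {χ : ℝ → ℂ} {l a : Fin 3 → ℝ × ℝ → ℂ}
    (hω : ∀ q, density χ ε k₀ m₀ q ≠ 0 → omega γ q = omegaPlus γ q.1 q.2)
    (hinc : BoundedPhases (phaseT γ χ ε k₀ m₀) (phaseX χ ε k₀ m₀) (incPhase χ ε k₀ m₀) M)
    (hb : ∀ j, BoundedPhases (phaseT γ χ ε k₀ m₀) (phaseX χ ε k₀ m₀)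
      (layerPhase χ ε k₀ m₀ (l j)) N)
    (h0 : ∀ i, Integrable (incDensity γ χ ε k₀ m₀ i))
    (hi : ∀ j i, Integrable (layerDensity γ ν κ χ ε k₀ m₀ (l j) (a j) i))
    (hM : ∀ q, density χ ε k₀ m₀ q ≠ 0 →
      (amplitudeMatrix γ κ (omegaPlus γ q.1 q.2) q.1 (fun j => l j q)).mulVec (fun j => a j q)
        = ![-1, -(-(q.1 : ℂ) / q.2), -(I * q.2 * incVec γ q 2)])
    (t x : ℝ) :
    let W := layer γ ν κ χ ε k₀ m₀ (l 0) (a 0) + layer γ ν κ χ ε k₀ m₀ (l 1) (a 1)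
      + layer γ ν κ χ ε k₀ m₀ (l 2) (a 2)
    W.u t x 0 = -(incident γ χ ε k₀ m₀).u t x 0 ∧ W.w t x 0 = -(incident γ χ ε k₀ m₀).w t x 0 ∧
      dy W.b t x 0 = -dy (incident γ χ ε k₀ m₀).b t x 0 := by
  intro W
  have hrow : ∀ q, density χ ε k₀ m₀ q ≠ 0 → ∀ i,
      (amplitudeMatrix γ κ (omegaPlus γ q.1 q.2) q.1 (fun j => l j q)).mulVec (fun j => a j q) i
        = ![-1, -(-(q.1 : ℂ) / q.2), -(I * q.2 * incVec γ q 2)] i := fun q hq i => by rw [hM q hq]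
  have eW : W = waveFields (layerDensity γ ν κ χ ε k₀ m₀ (l 0) (a 0)) (phaseT γ χ ε k₀ m₀)
        (phaseX χ ε k₀ m₀) (layerPhase χ ε k₀ m₀ (l 0))
      + waveFields (layerDensity γ ν κ χ ε k₀ m₀ (l 1) (a 1)) (phaseT γ χ ε k₀ m₀)
        (phaseX χ ε k₀ m₀) (layerPhase χ ε k₀ m₀ (l 1))
      + waveFields (layerDensity γ ν κ χ ε k₀ m₀ (l 2) (a 2)) (phaseT γ χ ε k₀ m₀)
        (phaseX χ ε k₀ m₀) (layerPhase χ ε k₀ m₀ (l 2)) := by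
    rw [← layer_eq_waveFields hω, ← layer_eq_waveFields hω, ← layer_eq_waveFields hω]
  rw [eW, incident_eq_waveFields hω]
  refine ⟨?_, ?_, ?_⟩
  · refine superposition_boundary_eq hinc (hi 0 0) (hi 1 0) (hi 2 0) (h0 0) (fun q => ?_) t x
    by_cases hq : density χ ε k₀ m₀ q = 0
    · simp [layerDensity, incDensity, hq]
    have h := hrow q hq 0
    simp only [amplitudeMatrix, Matrix.mulVec, dotProduct, Fin.sum_univ_three, Matrix.of_apply,
      Matrix.cons_val] at h
    simp only [layerDensity, incDensity, layerVec, incVec, Matrix.cons_val]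
    linear_combination density χ ε k₀ m₀ q * h
  · refine superposition_boundary_eq hinc (hi 0 1) (hi 1 1) (hi 2 1) (h0 1) (fun q => ?_) t x
    by_cases hq : density χ ε k₀ m₀ q = 0
    · simp [layerDensity, incDensity, hq]
    have h := hrow q hq 1
    simp only [amplitudeMatrix, Matrix.mulVec, dotProduct, Fin.sum_univ_three, Matrix.of_apply,
      Matrix.cons_val] at h
    simp only [layerDensity, incDensity, layerVec, incVec, Matrix.cons_val]
    linear_combination density χ ε k₀ m₀ q * h
  · have c : ∀ j, ContDiff ℝ ((2 : ℕ) : WithTop ℕ∞) fun z : ℝ × ℝ × ℝ =>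
        superposition (layerDensity γ ν κ χ ε k₀ m₀ (l j) (a j) 2) (phaseT γ χ ε k₀ m₀)
          (phaseX χ ε k₀ m₀) (layerPhase χ ε k₀ m₀ (l j)) z.1 z.2.1 z.2.2 :=
      fun j => (hb j).contDiff (hi j 2) 2
    have e : ∀ f g h : ℝ → ℝ → ℝ → ℂ,
        ContDiff ℝ ((2 : ℕ) : WithTop ℕ∞) (fun z : ℝ × ℝ × ℝ => f z.1 z.2.1 z.2.2) →
        ContDiff ℝ ((2 : ℕ) : WithTop ℕ∞) (fun z : ℝ × ℝ × ℝ => g z.1 z.2.1 z.2.2) →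
        ContDiff ℝ ((2 : ℕ) : WithTop ℕ∞) (fun z : ℝ × ℝ × ℝ => h z.1 z.2.1 z.2.2) →
        dy (f + g + h) t x 0 = dy f t x 0 + dy g t x 0 + dy h t x 0 := by
      intro f g h hf hg hh
      rw [dy_add (hf.add hg) hh (by norm_num), dy_add hf hg (by norm_num)]
      rfl
    refine (e _ _ _ (c 0) (c 1) (c 2)).trans ?_
    simp only [waveFields]
    rw [(hb 0).dy_eq (hi 0 2), (hb 1).dy_eq (hi 1 2), (hb 2).dy_eq (hi 2 2), hinc.dy_eq (h0 2)]
    have hj := fun j => integrable_mul_of_bounded (hi j 2) (hb j).meas₃ (hb j).le₃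
    refine superposition_boundary_eq hinc (hj 0) (hj 1) (hj 2)
      (integrable_mul_of_bounded (h0 2) hinc.meas₃ hinc.le₃) (fun q => ?_) t x
    by_cases hq : density χ ε k₀ m₀ q = 0
    · simp [layerDensity, incDensity, hq]
    have h := hrow q hq 2
    simp only [amplitudeMatrix, Matrix.mulVec, dotProduct, Fin.sum_univ_three, Matrix.of_apply,
      Matrix.cons_val] at h
    simp only [layerDensity, incDensity, layerVec, Matrix.cons_val, layerPhase, incPhase,
      cutoff_of_ne hq]
    linear_combination density χ ε k₀ m₀ q * h

theorem integrable_incSource {γ K z ε k₀ m₀ c : ℝ} {χ : ℝ → ℂ} (hχ : Continuous χ)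
    (hχc : HasCompactSupport χ) (hε : 0 < ε) (hK : 1 ≤ K)
    (hnd : ∀ q, density χ ε k₀ m₀ q ≠ 0 → NearData γ K z (omegaPlus γ q.1 q.2) q.1 q.2)
    (i : Fin 4) : Integrable (incSource γ χ ε k₀ m₀ c i) := by
  have hinc := incident_boundedPhases hχ hnd
  have hi := integrable_incDensity hχ hχc hε hK hnd i
  have h := (((integrable_mul_of_bounded (integrable_mul_of_bounded hi hinc.meas₂ hinc.le₂)
    hinc.meas₂ hinc.le₂).add (integrable_mul_of_bounded (integrable_mul_of_bounded hi hinc.meas₃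
      hinc.le₃) hinc.meas₃ hinc.le₃)).const_mul (c : ℂ)).neg
  refine h.congr (Filter.Eventually.of_forall fun q => ?_)
  simp only [incSource, Pi.neg_apply, Pi.add_apply]
  ring

end Boussinesq

end

open Boussinesq in
theorem proposition3p1
    (R : Regime) (γ : ℝ) (hγ : 0 < γ) (hγ' : γ < Real.pi / 2) (hγ4 : γ ≠ Real.pi / 4)
    (χ : ℝ → ℂ) (hχ : ContDiff ℝ (⊤ : ℕ∞) χ) (hχc : HasCompactSupport χ)
    (ν₀ κ₀ β c : ℝ) (hν₀ : 0 < ν₀) (hκ₀ : 0 < κ₀) (hβ : R.Admissible β) (hc : 0 < c) :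
    ∃ C > 0, ∃ ε₀ > 0, ∀ ε k₀ m₀ ν κ : ℝ, 0 < ε → ε < ε₀ →
      ν = R.visc ν₀ ε β → κ = R.diff κ₀ ε β → R.NearCritical γ χ c ε k₀ m₀ →
      ∃ l a : Fin 3 → ℝ × ℝ → ℂ, ∃ Winc WBL Wapp : Fields,
        Winc = incident γ χ ε k₀ m₀ ∧
        WBL = layer γ ν κ χ ε k₀ m₀ (l 0) (a 0) + layer γ ν κ χ ε k₀ m₀ (l 1) (a 1)
          + layer γ ν κ χ ε k₀ m₀ (l 2) (a 2) ∧
        Wapp = Winc + WBL ∧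
        -- the boundary layers: roots, eigenvectors, decay rates and sizes of the amplitudes
        (∀ j, IsLayer γ ν κ χ ε k₀ m₀ (l j) (a j) C
          (R.decayExp β j) (R.sizeExp β j) (R.ampExp β j)) ∧
        -- the amplitudes are obtained by inverting the amplitude matrix
        (∀ q : ℝ × ℝ, density χ ε k₀ m₀ q ≠ 0 →
          (amplitudeMatrix γ κ (omega γ q) q.1 (fun j => l j q)).det ≠ 0 ∧
          (amplitudeMatrix γ κ (omega γ q) q.1 (fun j => l j q)).mulVec (fun j => a j q)
            = ![-1, -(-(q.1 : ℂ) / q.2), -(Complex.I * q.2 * incB γ q)]) ∧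
        -- the boundary layer part solves the system exactly
        Solves γ ν κ WBL ∧
        -- and it cancels the boundary values of the incident packet
        (∀ t x : ℝ, WBL.u t x 0 = -Winc.u t x 0 ∧ WBL.w t x 0 = -Winc.w t x 0 ∧
          dy WBL.b t x 0 = -dy Winc.b t x 0) ∧
        -- so that the approximate solution satisfies the boundary conditions exactly
        (∀ t x : ℝ, Wapp.u t x 0 = 0 ∧ Wapp.w t x 0 = 0 ∧ dy Wapp.b t x 0 = 0) ∧
        -- consistency
        ∃ Ru Rw Rb : ℝ → ℝ → ℝ → ℂ,
          SolvesWithSource γ ν κ Wapp Ru Rw Rb ∧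
          ∀ t : ℝ,
            normL2 Ru t ≤ ENNReal.ofReal (C * ν) ∧
            normL2 Rw t ≤ ENNReal.ofReal (C * ν) ∧
            normL2 Rb t ≤ ENNReal.ofReal (C * κ) ∧
            normL2 (fun t x y => !₂[Ru t x y, Rw t x y, Rb t x y]) t
              ≤ normL2 Ru t + normL2 Rw t + normL2 Rb t ∧
            normL2 Ru t + normL2 Rw t + normL2 Rb t ≤ ENNReal.ofReal (C * (ν + κ)) ∧
            normL2 (fun t x y => !₂[Ru t x y, Rw t x y, Rb t x y]) t
              ≤ ENNReal.ofReal (C * ε ^ R.remainderExp β) := by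
  have hs : 0 < Real.sin γ := Real.sin_pos_of_pos_of_lt_pi hγ (by linarith [Real.pi_pos])
  have hcos : 0 < Real.cos γ := Real.cos_pos_of_mem_Ioo ⟨by linarith [Real.pi_pos], hγ'⟩
  obtain ⟨K, hK, ε₂, hε₂, hnear⟩ := Regime.NearCritical.nearData hγ hγ' hγ4 hχc hc
  have hK0 : 0 < K := by linarith
  obtain ⟨C₁, hC₁, ε₁, hε₁, hroots⟩ := R.exists_roots hs hcos hK hν₀ hκ₀ hβ
  obtain ⟨C₂, hC₂, hsrc⟩ := normL2_incSource_le hχ.continuous hχc hK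
  obtain ⟨C, hCC₁, hCC₂, hCC₃⟩ : ∃ C, C₁ ≤ C ∧ 2 * C₂ ≤ C ∧ 2 * C₂ * (ν₀ + κ₀) ≤ C := by
    have : 0 < 2 * C₂ * (ν₀ + κ₀) := by positivity
    refine ⟨C₁ + 2 * C₂ + 2 * C₂ * (ν₀ + κ₀), ?_, ?_, ?_⟩ <;> linarith
  have hC : 0 < C := by linarith
  refine ⟨C, hC, min 1 (min ε₁ ε₂), by positivity, ?_⟩
  intro ε k₀ m₀ ν κ hε hεε hν hκ hcrit
  have hε1 : ε ≤ 1 := hεε.le.trans (min_le_left _ _)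
  have hν0 : 0 < ν := hν ▸ R.visc_pos hν₀ hε
  have hκ0 : 0 < κ := hκ ▸ R.diff_pos hκ₀ hε
  have hpow : ∀ x : ℝ, 0 < ε ^ x := fun x => Real.rpow_pos_of_pos hε x
  have hn := hnear R ε k₀ m₀ hε (hεε.trans_le ((min_le_right _ _).trans (min_le_right _ _))) hcrit
  have hω : ∀ q, density χ ε k₀ m₀ q ≠ 0 → omega γ q = omegaPlus γ q.1 q.2 :=
    fun q hq => (hn q hq).2.1
  have hnd : ∀ q, density χ ε k₀ m₀ q ≠ 0 →
      NearData γ K (K * ε ^ 2) (omegaPlus γ q.1 q.2) q.1 q.2 := fun q hq => by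
    rw [← hω q hq]; exact (hn q hq).1
  have hsel := hroots ε hε (hεε.trans_le ((min_le_right _ _).trans (min_le_left _ _)))
  rw [← hν, ← hκ] at hsel
  obtain ⟨N, l, a, hl, ha, hla⟩ := hsel.exists_layers hnd fun q hq => by
    rw [← hω q hq]; exact (hn q hq).2.2
  have hbounds : ∀ q, density χ ε k₀ m₀ q ≠ 0 →
      LayerBounds γ ν κ C (fun j => ε ^ R.decayExp β j) (fun j => ε ^ R.sizeExp β j)
        (fun j => ε ^ R.ampExp β j) (omegaPlus γ q.1 q.2) q.1 q.2 (fun j => l j q) :=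
    fun q hq => (hla q hq).2.1.mono hC₁ hCC₁ (fun j => (hpow _).le) (fun j => (hpow _).le)
      fun j => (hpow _).le
  have hamp : ∀ j q, density χ ε k₀ m₀ q ≠ 0 → ‖a j q‖ ≤ C * ε ^ R.ampExp β j := fun j q hq =>
    (hbounds q hq).amplitude (fun j => a j q) (hla q hq).2.2 j
  have hdec : ∀ j q, density χ ε k₀ m₀ q ≠ 0 → C⁻¹ * ε ^ R.decayExp β j ≤ (l j q).re :=
    fun j q hq => ((hbounds q hq).decay j).1
  have hρ : ∀ j, 0 < C⁻¹ * ε ^ R.decayExp β j := fun j => mul_pos (inv_pos.2 hC) (hpow _)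
  have hre : ∀ j q, density χ ε k₀ m₀ q ≠ 0 → 0 < (l j q).re := fun j q hq =>
    (hρ j).trans_le (hdec j q hq)
  have hroot : ∀ j q, density χ ε k₀ m₀ q ≠ 0 →
      charPoly γ ν κ (omegaPlus γ q.1 q.2) q.1 (l j q) = 0 := fun j q hq => (hbounds q hq).root j
  have hinc := incident_boundedPhases hχ.continuous hnd
  have hb := fun j => layer_boundedPhases hχ.continuous (hl j) hnd fun q hq => (hla q hq).1 j
  have hi0 := integrable_incDensity hχ.continuous hχc hε hK hnd
  have hi := fun j => integrable_layerDensity hχ.continuous hχc hε hs hK0 (hl j) (ha j) (hρ j) hnd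
    (fun q hq => (hla q hq).1 j) (hdec j) (hamp j) (hroot j)
  have hsolves := fun j => layer_solves hs hK0 (hb j) (hi j) hnd hω (hre j) (hroot j)
  have hWBL := ((hsolves 0).add (hsolves 1)).add (hsolves 2)
  have hWinc := incident_solvesWithSource (ν := ν) (κ := κ) hχ.continuous hχc hε hK hnd hω
  have hbdry := boundary_values hω hinc hb hi0 hi fun q hq => (hla q hq).2.2
  have happ := hWinc.add hWBL
  rw [add_zero, add_zero, add_zero] at happ
  refine ⟨l, a, _, _, _, rfl, rfl, rfl, fun j => ?_, fun q hq => ?_, hWBL, hbdry, fun t x => ?_,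
    _, _, _, happ, fun t => ?_⟩
  · exact isLayer_of_bounds hs hK0 (hb j) (hi j) hnd hω (hre j) (hroot j)
      (fun q hq => (hbounds q hq).decay j) (fun q hq => (hbounds q hq).size j) (hamp j)
  · have hB : incB γ q = incVec γ q 2 := by
      rw [incB, hω q hq]; rfl
    rw [hω q hq, hB]
    exact ⟨(hbounds q hq).det_ne, (hla q hq).2.2⟩
  · obtain ⟨h1, h2, h3⟩ := hbdry t x
    refine ⟨?_, ?_, ?_⟩
    · refine (congrArg (_ + ·) h1).trans (add_neg_cancel _)
    · refine (congrArg (_ + ·) h2).trans (add_neg_cancel _)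
    · have hd := dy_add hWinc.smooth_b hWBL.smooth_b two_ne_zero
      refine (congrFun (congrFun (congrFun hd t) x) 0).trans ?_
      exact (congrArg (_ + ·) h3).trans (add_neg_cancel _)
  · have n0 := hsrc γ ε k₀ m₀ _ ν t 0 hε hν0.le (by decide) hnd
    have n1 := hsrc γ ε k₀ m₀ _ ν t 1 hε hν0.le (by decide) hnd
    have n2 := hsrc γ ε k₀ m₀ _ κ t 2 hε hκ0.le (by decide) hnd
    have weaken : ∀ c : ℝ, 0 ≤ c → ENNReal.ofReal (C₂ * c) ≤ ENNReal.ofReal (C * c) :=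
      fun c hc => ENNReal.ofReal_le_ofReal (mul_le_mul_of_nonneg_right (by linarith) hc)
    have hcont := fun (c : ℝ) (i : Fin 4) => continuous_superposition hinc
      (integrable_incSource (γ := γ) (c := c) hχ.continuous hχc hε hK hnd i) t
    have hvec := normL2_vector_le (t := t) (hcont ν 0) (hcont ν 1) (hcont κ 2)
    have hsum := (add_le_add (add_le_add n0 n1) n2)
    rw [← ENNReal.ofReal_add (by positivity) (by positivity),
      ← ENNReal.ofReal_add (by positivity) (by positivity)] at hsum
    have hle : C₂ * ν + C₂ * ν + C₂ * κ ≤ 2 * C₂ * (ν + κ) := by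
      have := mul_pos hC₂ hκ0
      linarith
    have hrem : 2 * C₂ * (ν + κ) ≤ C * ε ^ R.remainderExp β := by
      have h1 := R.visc_add_diff_le hν₀ hκ₀ hε hε1 hβ
      rw [← hν, ← hκ] at h1
      calc 2 * C₂ * (ν + κ) ≤ 2 * C₂ * ((ν₀ + κ₀) * ε ^ R.remainderExp β) := by gcongr
        _ = 2 * C₂ * (ν₀ + κ₀) * ε ^ R.remainderExp β := by ring
        _ ≤ _ := mul_le_mul_of_nonneg_right hCC₃ (hpow _).le
    refine ⟨n0.trans (weaken ν hν0.le), n1.trans (weaken ν hν0.le), n2.trans (weaken κ hκ0.le),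
      hvec, hsum.trans (ENNReal.ofReal_le_ofReal (hle.trans ?_)),
      hvec.trans (hsum.trans (ENNReal.ofReal_le_ofReal (hle.trans hrem)))⟩
    exact mul_le_mul_of_nonneg_right hCC₂ (by positivity)
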